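/- An instance of the boundary labeling problem with sliding ports and obstacles consists of an axis-aligned rectangle $R$ with nonempty interior, a set of $n$ sites (points in the interior of $R$), $n$ labels, and a finite set of orthogonal polygons (obstacles) contained in $R$. Each label is given by a closed interval, possibly a single point (a fixed port), on one side of $R$; intervals on the same side do not overlap (they may share an endpoint). The distribution of the labels over the four sides is arbitrary; in particular all adjacent ($1$-, $2$-, $3$-, $4$-sided) models and the opposite $2$-sided model are included. A leader from a site to a label is an axis-aligned polyline from the site to a point $q$ (the port) of the label's interval that, except for $q$, lies in the interior of $R$ and that meets no obstacle (obstacles are closed regions). In the $po$-model every leader has at most one bend, in the $opo$-model every leader has at most two bends. A feasible labeling connects the sites to pairwise distinct labels by pairwise disjoint leaders. Theorem. For each of the two leader types, $po$ and $opo$, there is an algorithm that, for every such instance, decides whether a feasible labeling exists and, if so, computes a feasible labeling with the minimum total number of bends. Its running time is polynomial in the total number of sites and obstacle vertices. Here an algorithm is a program for a random access machine with unit-cost steps whose memory consists of arrays of natural numbers and arrays of real numbers with indirect addressing, and whose arithmetic operations are addition, (truncated) subtraction and comparison of natural numbers, and addition, subtraction, halving and comparison of real numbers, as well as constants. -/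

import Mathlib

noncomputable section

namespace BoundaryLabeling

/-! ### Random access machine

The memory consists of arrays of natural numbers and arrays of real numbers, with indirect
addressing.  Natural numbers can be added, subtracted (truncated at zero) and compared; real
numbers can be added, subtracted, halved and compared.  There is no multiplication and no
conversion of a real number to a natural number, so that a computation of `T` steps on rational
data only meets numbers whose encoding length is polynomial in `T` and in the encoding length of
the data. -/

/-- A memory: `nat a i` and `real a i` are the `i`-th cells of the `a`-th arrays. -/
structure State where
  nat : ℕ → ℕ → ℕ
  real : ℕ → ℕ → ℝ

/-- `s.setNat a i v` is `s` after the assignment `nat a i := v`. -/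
def State.setNat (s : State) (a i v : ℕ) : State :=
  { s with nat := Function.update s.nat a (Function.update (s.nat a) i v) }

/-- `s.setReal a i v` is `s` after the assignment `real a i := v`. -/
def State.setReal (s : State) (a i : ℕ) (v : ℝ) : State :=
  { s with real := Function.update s.real a (Function.update (s.real a) i v) }

/-- Expressions of type natural number; `read a e` is the cell of the `a`-th array with index
`e`. -/
inductive NatExpr where
  | const (k : ℕ)
  | read (a : ℕ) (e : NatExpr)
  | add (e f : NatExpr)
  | sub (e f : NatExpr)

def NatExpr.eval (s : State) : NatExpr → ℕ
  | const k => k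
  | read a e => s.nat a (e.eval s)
  | add e f => e.eval s + f.eval s
  | sub e f => e.eval s - f.eval s

/-- The number of operations in an expression. -/
def NatExpr.cost : NatExpr → ℕ
  | const _ => 1
  | read _ e => e.cost + 1
  | add e f => e.cost + f.cost + 1
  | sub e f => e.cost + f.cost + 1

/-- Expressions of type real number. -/
inductive RealExpr where
  | const (q : ℚ)
  | read (a : ℕ) (e : NatExpr)
  | add (e f : RealExpr)
  | sub (e f : RealExpr)
  | half (e : RealExpr)

def RealExpr.eval (s : State) : RealExpr → ℝ
  | const q => (q : ℝ)
  | read a e => s.real a (e.eval s)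
  | add e f => e.eval s + f.eval s
  | sub e f => e.eval s - f.eval s
  | half e => e.eval s / 2

/-- The number of operations in an expression. -/
def RealExpr.cost : RealExpr → ℕ
  | const _ => 1
  | read _ e => e.cost + 1
  | add e f => e.cost + f.cost + 1
  | sub e f => e.cost + f.cost + 1
  | half e => e.cost + 1

/-- Tests, by which programs branch. -/
inductive Test where
  | natLe (e f : NatExpr)
  | realLe (e f : RealExpr)
  | neg (b : Test)
  | and (b c : Test)

def Test.Holds (s : State) : Test → Prop
  | natLe e f => e.eval s ≤ f.eval s
  | realLe e f => e.eval s ≤ f.eval s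
  | neg b => ¬ b.Holds s
  | and b c => b.Holds s ∧ c.Holds s

/-- The number of operations in a test. -/
def Test.cost : Test → ℕ
  | natLe e f => e.cost + f.cost + 1
  | realLe e f => e.cost + f.cost + 1
  | neg b => b.cost + 1
  | and b c => b.cost + c.cost + 1

/-- Programs.  `setNat a i e` is the assignment `nat a i := e`, and `setReal a i e` is the
assignment `real a i := e`. -/
inductive Program where
  | skip
  | setNat (a : ℕ) (i e : NatExpr)
  | setReal (a : ℕ) (i : NatExpr) (e : RealExpr)
  | seq (c d : Program)
  | ite (b : Test) (c d : Program)
  | while (b : Test) (c : Program)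

/-- `Exec c s T s'`: the program `c`, started in the memory `s`, halts after exactly `T` steps
with the memory `s'`. -/
inductive Exec : Program → State → ℕ → State → Prop
  | skip (s : State) : Exec .skip s 1 s
  | setNat (s : State) (a : ℕ) (i e : NatExpr) :
      Exec (.setNat a i e) s (i.cost + e.cost + 1) (s.setNat a (i.eval s) (e.eval s))
  | setReal (s : State) (a : ℕ) (i : NatExpr) (e : RealExpr) :
      Exec (.setReal a i e) s (i.cost + e.cost + 1) (s.setReal a (i.eval s) (e.eval s))
  | seq (c d : Program) (s s' s'' : State) (T T' : ℕ) :
      Exec c s T s' → Exec d s' T' s'' → Exec (.seq c d) s (T + T') s''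
  | ite_true (b : Test) (c d : Program) (s s' : State) (T : ℕ) :
      b.Holds s → Exec c s T s' → Exec (.ite b c d) s (b.cost + T + 1) s'
  | ite_false (b : Test) (c d : Program) (s s' : State) (T : ℕ) :
      ¬ b.Holds s → Exec d s T s' → Exec (.ite b c d) s (b.cost + T + 1) s'
  | while_true (b : Test) (c : Program) (s s' s'' : State) (T T' : ℕ) :
      b.Holds s → Exec c s T s' → Exec (.while b c) s' T' s'' →
      Exec (.while b c) s (b.cost + T + T' + 1) s''
  | while_false (b : Test) (c : Program) (s : State) :
      ¬ b.Holds s → Exec (.while b c) s (b.cost + 1) s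

/-! ### Polygonal chains and orthogonal polygons -/

/-- Points of the plane. -/
abbrev Point : Type := ℝ × ℝ

/-- The point set of the polygonal chain with the given vertices. -/
def trace : List Point → Set Point
  | [] => ∅
  | [p] => {p}
  | p :: q :: l => segment ℝ p q ∪ trace (q :: l)

/-- `p` and `q` are the ends of a nondegenerate horizontal segment. -/
def Horizontal (p q : Point) : Prop := p.2 = q.2 ∧ p.1 ≠ q.1

/-- `p` and `q` are the ends of a nondegenerate vertical segment. -/
def Vertical (p q : Point) : Prop := p.1 = q.1 ∧ p.2 ≠ q.2

/-- The chain has at least one segment, its segments are nondegenerate and axis-aligned, and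
consecutive segments are perpendicular: all inner vertices are bends. -/
def IsOrthogonalPath : List Point → Prop
  | [] => False
  | [_] => False
  | [p, q] => Horizontal p q ∨ Vertical p q
  | p :: q :: r :: l =>
      ((Horizontal p q ∧ Vertical q r) ∨ (Vertical p q ∧ Horizontal q r)) ∧
        IsOrthogonalPath (q :: r :: l)

/-- The number of bends of an orthogonal path: the number of its inner vertices. -/
def bends (l : List Point) : ℕ := l.length - 2

/-- The closed chain of vertices that runs around the polygon with vertex list `P`. -/
def closedChain (P : List Point) : List Point := P ++ P.take 1

/-- A polygon, given by the cyclic list of its vertices, all of whose edges are axis-aligned.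
Simplicity is not demanded. -/
def IsOrthogonalPolygon (P : List Point) : Prop :=
  4 ≤ P.length ∧ (closedChain P).IsChain fun p q => p.1 = q.1 ∨ p.2 = q.2

/-- The closed region of the plane bounded by a polygon: its boundary together with all bounded
connected components of the complement of the boundary. -/
def region (P : List Point) : Set Point :=
  {p | Bornology.IsBounded (connectedComponentIn (trace (closedChain P))ᶜ p)}

/-! ### The boundary labeling problem -/

/-- Axis-aligned rectangles. -/
structure Rect where
  xmin : ℝ
  xmax : ℝ
  ymin : ℝ
  ymax : ℝ
  x_lt : xmin < xmax
  y_lt : ymin < ymax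

/-- The sides of a rectangle. -/
inductive Side where
  | bottom
  | top
  | left
  | right

/-- The code of a side in the input of a program. -/
def Side.code : Side → ℕ
  | bottom => 0
  | top => 1
  | left => 2
  | right => 3

namespace Rect

/-- The closed rectangle. -/
def closed (R : Rect) : Set Point := Set.Icc R.xmin R.xmax ×ˢ Set.Icc R.ymin R.ymax

/-- The open rectangle. -/
def inside (R : Rect) : Set Point := Set.Ioo R.xmin R.xmax ×ˢ Set.Ioo R.ymin R.ymax

/-- The point with parameter `u` (its free coordinate) on the line through a side. -/
def sidePoint (R : Rect) : Side → ℝ → Point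
  | .bottom, u => (u, R.ymin)
  | .top, u => (u, R.ymax)
  | .left, u => (R.xmin, u)
  | .right, u => (R.xmax, u)

/-- The parameters of the points of a side. -/
def sideRange (R : Rect) : Side → Set ℝ
  | .bottom => Set.Icc R.xmin R.xmax
  | .top => Set.Icc R.xmin R.xmax
  | .left => Set.Icc R.ymin R.ymax
  | .right => Set.Icc R.ymin R.ymax

end Rect

/-- An instance of the boundary labeling problem with sliding ports and obstacles: `n` sites inside
a rectangle, `n` labels whose ports range over intervals `[lo j, hi j]` on the sides of the
rectangle, and orthogonal polygons inside the rectangle.  The sides are chosen freely (adjacent,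
opposite, or any other distribution).  An interval may be a single point (a fixed port); two
intervals on the same side do not overlap, but may share an end. -/
structure Problem where
  rect : Rect
  n : ℕ
  site : Fin n → Point
  side : Fin n → Side
  lo : Fin n → ℝ
  hi : Fin n → ℝ
  obstacles : List (List Point)
  site_mem : ∀ i, site i ∈ rect.inside
  site_injective : Function.Injective site
  lo_le_hi : ∀ j, lo j ≤ hi j
  lo_mem : ∀ j, lo j ∈ rect.sideRange (side j)
  hi_mem : ∀ j, hi j ∈ rect.sideRange (side j)
  intervals_disjoint : ∀ j k, j ≠ k → side j = side k → hi j ≤ lo k ∨ hi k ≤ lo j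
  obstacle_polygon : ∀ P ∈ obstacles, IsOrthogonalPolygon P
  obstacle_mem : ∀ P ∈ obstacles, ∀ p ∈ P, p ∈ rect.closed

/-- The two kinds of leaders. -/
inductive LeaderStyle where
  | po
  | opo

/-- The number of bends that a leader may have. -/
def LeaderStyle.maxBends : LeaderStyle → ℕ
  | po => 1
  | opo => 2

namespace Problem

/-- The size of an instance: the total number of sites and of obstacle vertices. -/
def size (I : Problem) : ℕ := I.n + I.obstacles.flatten.length

/-- `l` is the vertex list of a leader of the given style from site `i` to a port `q` of label `j`:
an orthogonal path with at most `t.maxBends` bends that, except for its end `q`, lies in the open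
rectangle, and that meets no obstacle.  (The last segment of such a path is orthogonal to the side
that contains `q`.) -/
def IsLeader (I : Problem) (t : LeaderStyle) (i j : Fin I.n) (l : List Point) : Prop :=
  IsOrthogonalPath l ∧ bends l ≤ t.maxBends ∧ l.head? = some (I.site i) ∧
  (∃ u ∈ Set.Icc (I.lo j) (I.hi j), l.getLast? = some (I.rect.sidePoint (I.side j) u) ∧
    ∀ p ∈ trace l, p ≠ I.rect.sidePoint (I.side j) u → p ∈ I.rect.inside) ∧
  ∀ P ∈ I.obstacles, Disjoint (trace l) (region P)

/-- A choice of a label and of a vertex list for each site. -/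
structure Labeling (I : Problem) where
  label : Fin I.n → Fin I.n
  leader : Fin I.n → List Point

/-- Feasible labelings: the sites are connected to distinct labels by disjoint leaders. -/
def IsFeasible (I : Problem) (t : LeaderStyle) (L : I.Labeling) : Prop :=
  Function.Injective L.label ∧ (∀ i, I.IsLeader t i (L.label i) (L.leader i)) ∧
  ∀ i j, i ≠ j → Disjoint (trace (L.leader i)) (trace (L.leader j))

/-- The total number of bends of a labeling. -/
def totalBends (I : Problem) (L : I.Labeling) : ℕ := ∑ i, bends (L.leader i)

/-- Feasible labelings with the minimum total number of bends. -/
def IsOptimal (I : Problem) (t : LeaderStyle) (L : I.Labeling) : Prop :=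
  I.IsFeasible t L ∧ ∀ L' : I.Labeling, I.IsFeasible t L' → I.totalBends L ≤ I.totalBends L'

/-- The memory that holds the instance `I`.  The arrays of natural numbers are: `0`, the number of
sites and the number of obstacles; `1`, the sides of the labels; `2`, the numbers of vertices of
the obstacles.  The arrays of real numbers are: `0`, the rectangle; `1` and `2`, the coordinates of
the sites; `3` and `4`, the ends of the intervals of the labels; `5` and `6`, the coordinates of
the vertices of all obstacles, one obstacle after the other.  All other cells are zero. -/
def input (I : Problem) : State where
  nat a i :=
    match a with
    | 0 => [I.n, I.obstacles.length].getD i 0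
    | 1 => if h : i < I.n then (I.side ⟨i, h⟩).code else 0
    | 2 => (I.obstacles.map List.length).getD i 0
    | _ => 0
  real a i :=
    match a with
    | 0 => [I.rect.xmin, I.rect.xmax, I.rect.ymin, I.rect.ymax].getD i 0
    | 1 => if h : i < I.n then (I.site ⟨i, h⟩).1 else 0
    | 2 => if h : i < I.n then (I.site ⟨i, h⟩).2 else 0
    | 3 => if h : i < I.n then I.lo ⟨i, h⟩ else 0
    | 4 => if h : i < I.n then I.hi ⟨i, h⟩ else 0
    | 5 => (I.obstacles.flatten.map Prod.fst).getD i 0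
    | 6 => (I.obstacles.flatten.map Prod.snd).getD i 0
    | _ => 0

/-- The output cell that reports whether a labeling has been found (`1`) or not (`0`). -/
def answer (s : State) : ℕ := s.nat 3 0

/-- The memory `s` holds the labeling `L`: for each site `i`, the index of its label is
`s.nat 4 i`, the number of vertices of its leader is `s.nat 5 i`, and the vertex number `k` of its
leader has the coordinates `s.real 7 (4 * i + k)` and `s.real 8 (4 * i + k)` (a leader has at most
four vertices). -/
def Holds (I : Problem) (s : State) (L : I.Labeling) : Prop :=
  ∀ i : Fin I.n, s.nat 4 i = L.label i ∧ s.nat 5 i = (L.leader i).length ∧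
    ∀ (k : ℕ) (h : k < (L.leader i).length),
      (L.leader i)[k] = (s.real 7 (4 * i + k), s.real 8 (4 * i + k))

end Problem

end BoundaryLabeling

end

/-! The algorithm is a dynamic program over a planar decomposition of the set of leaders.

Discretization. Whether a leader is legal, and whether two leaders meet, depends only on comparisons
of coordinates. The region of an obstacle can be replaced by its boundary, because a leader ends on
the rim of the rectangle, from where a ray escapes to infinity (`disjoint_region_iff`). A leader has
two free coordinates, its port and a middle coordinate. Those of a feasible labeling that are not
input numbers can be moved, keeping the order, to numbers `lo + (up - lo) / 2 ^ k`, where `lo < up`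
are consecutive input numbers (`exists_bisection`). So polynomially many candidate routes suffice,
and ranks turn their coordinates into natural numbers (`Frame.valid_map`, `Frame.legsMeet_map`).

Decomposition. Every route is continued outside the rectangle down to a common bottom row, without
new intersections (`Coding.not_touch`). A feasible labeling becomes a set `S` of disjoint connected
lattice sets ("strings"), each with one foot on the bottom row. Let every lattice point fall until
it hits a string or the bottom row: this gives it an owner and a stem, which joins it to the foot of
its owner. A lattice edge `z z'` bounds a subproblem: the candidates with feet between the two
owners that avoid both stems. If a string of `S` lies between the owners, Sperner's lemma yields a
triangle whose third owner `d` lies strictly between them (`exists_split`), and the subproblem falls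
apart into `d` and the subproblems of two sides of the triangle. The discrete separation theorem
`Conn.inter_nonempty` shows that candidates of the two parts never conflict with each other or leave
the given subproblem (`between_disjoint`, `between_mono_left`, `between_mono_right`). Apart from the
owner's string, a stem is a vertical segment and a piece of the bottom row (`exists_barrier`), so
boundedly many numbers describe a subproblem.

Dynamic program. Transitions are tested exhaustively for compatibility (`Coding.Trans`), so every
selection in the table is compatible by construction (`sound_table`). Geometry enters only to show
that the table is at least as good as any feasible labeling (`weight_le_total`). A route weighs `2 *
n + 1` minus its number of bends; maximal weight therefore means as many routes as possible if all
sites can be connected, and then as few bends as possible.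

Machine. Expressions with sums up to a bound compile to programs that take a number of steps
polynomial in the bound (`compile_correct`), and everything above is expressible in this way. -/

namespace BoundaryLabeling

/-! ### Connected sets of the triangular lattice -/

namespace Lattice

open Relation

/-- Adjacency in the triangular lattice: the edges of the square grid and one diagonal of each
square. -/
def Adj (u v : ℕ × ℕ) : Prop :=
  (v.1 = u.1 + 1 ∧ v.2 = u.2) ∨ (v.1 = u.1 ∧ v.2 = u.2 + 1) ∨ (v.1 = u.1 + 1 ∧ v.2 = u.2 + 1) ∨
  (u.1 = v.1 + 1 ∧ u.2 = v.2) ∨ (u.1 = v.1 ∧ u.2 = v.2 + 1) ∨ (u.1 = v.1 + 1 ∧ u.2 = v.2 + 1)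

theorem Adj.symm {u v : ℕ × ℕ} (h : Adj u v) : Adj v u := by
  unfold Adj at *; tauto

/-- A step of a lattice walk inside `X`. -/
def Step (X : Set (ℕ × ℕ)) (u v : ℕ × ℕ) : Prop := Adj u v ∧ u ∈ X ∧ v ∈ X

/-- `u` and `v` are joined by a lattice walk inside `X`. -/
abbrev Joined (X : Set (ℕ × ℕ)) (u v : ℕ × ℕ) : Prop := ReflTransGen (Step X) u v

theorem Joined.mono {X Y : Set (ℕ × ℕ)} (h : X ⊆ Y) {u v : ℕ × ℕ} (w : Joined X u v) :
    Joined Y u v := by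
  induction w with
  | refl => exact ReflTransGen.refl
  | tail _ s ih => exact ih.tail ⟨s.1, h s.2.1, h s.2.2⟩

theorem Joined.symm {X : Set (ℕ × ℕ)} {u v : ℕ × ℕ} (w : Joined X u v) : Joined X v u := by
  induction w with
  | refl => exact ReflTransGen.refl
  | tail _ s ih => exact ReflTransGen.head ⟨s.1.symm, s.2.2, s.2.1⟩ ih

/-- Any two points of `X` are joined inside `X`. -/
def Conn (X : Set (ℕ × ℕ)) : Prop := ∀ u ∈ X, ∀ v ∈ X, Joined X u v

theorem conn_of_base {X : Set (ℕ × ℕ)} (b : ℕ × ℕ) (h : ∀ u ∈ X, Joined X b u) : Conn X :=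
  fun u hu v hv => (h u hu).symm.trans (h v hv)

theorem Conn.union {X Y : Set (ℕ × ℕ)} (hX : Conn X) (hY : Conn Y) {x y : ℕ × ℕ} (hx : x ∈ X)
    (hy : y ∈ Y) (h : Adj x y ∨ x = y) : Conn (X ∪ Y) := by
  have hxy : Joined (X ∪ Y) x y := by
    rcases h with h | rfl
    · exact ReflTransGen.single ⟨h, Or.inl hx, Or.inr hy⟩
    · exact ReflTransGen.refl
  refine conn_of_base x fun u hu => ?_
  rcases hu with hu | hu
  · exact (hX x hx u hu).mono Set.subset_union_left
  · exact hxy.trans ((hY y hy u hu).mono Set.subset_union_right)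

/-! ### Crossing numbers -/

/-- The signed crossing of the step from `u` to `v` with the ray that leaves `z` to the right,
half a unit above `z`. -/
def crossing (z u v : ℕ × ℕ) : ℤ :=
  (if u.2 = z.2 ∧ v.2 = z.2 + 1 ∧ z.1 < u.1 then 1 else 0) -
    (if v.2 = z.2 ∧ u.2 = z.2 + 1 ∧ z.1 < v.1 then 1 else 0)

/-- Indicator of the points to the right of `z` in its row. -/
def rightOf (z w : ℕ × ℕ) : ℤ := if w.2 = z.2 ∧ z.1 < w.1 then 1 else 0

/-- The two rays differ only at the point to the right of `z`, so only a step with an end at this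
point can be counted differently. -/
theorem crossing_right {z u v : ℕ × ℕ} (h : Adj u v) (h1 : (z.1 + 1, z.2) ≠ u)
    (h2 : (z.1 + 1, z.2) ≠ v) : crossing z u v = crossing (z.1 + 1, z.2) u v := by
  obtain ⟨a, b⟩ := z
  obtain ⟨x, y⟩ := u
  obtain ⟨x', y'⟩ := v
  simp only [Adj, crossing, ne_eq, Prod.mk.injEq] at *
  split_ifs <;> first | rfl | omega

/-- What crosses the lower ray but not the upper one stays in the row of `z'`, to the right of `z'`.
The difference of the crossings is thus the change of an indicator function and telescopes along a
walk. The upward moves of `z` are exactly the upward edges of the lattice. -/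
theorem crossing_up {z z' u v : ℕ × ℕ} (h : Adj u v)
    (hz : z' = (z.1, z.2 + 1) ∨ z' = (z.1 + 1, z.2 + 1)) (h1 : z' ≠ u) (h2 : z' ≠ v)
    (h3 : z ≠ u) (h4 : z ≠ v) :
    crossing z u v - crossing z' u v = rightOf z' v - rightOf z' u := by
  obtain ⟨a, b⟩ := z
  obtain ⟨x, y⟩ := u
  obtain ⟨x', y'⟩ := v
  obtain ⟨c, d⟩ := z'
  simp only [Adj, crossing, rightOf, ne_eq, Prod.mk.injEq] at *
  rcases hz with ⟨rfl, rfl⟩ | ⟨rfl, rfl⟩ <;>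
  rcases h with ⟨rfl, rfl⟩ | ⟨rfl, rfl⟩ | ⟨rfl, rfl⟩ | ⟨rfl, rfl⟩ | ⟨rfl, rfl⟩ | ⟨rfl, rfl⟩ <;>
  split_ifs <;> omega

/-- There is nothing below row 0, so crossing the ray is the same as leaving or entering the part of
row 0 to the right of `(t, 0)`. -/
theorem crossing_bottom {t : ℕ} {u v : ℕ × ℕ} (h : Adj u v) (h1 : (t, 0) ≠ u) (h2 : (t, 0) ≠ v) :
    crossing (t, 0) u v = rightOf (t, 0) u - rightOf (t, 0) v := by
  obtain ⟨x, y⟩ := u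
  obtain ⟨x', y'⟩ := v
  simp only [Adj, crossing, rightOf, ne_eq, Prod.mk.injEq] at *
  split_ifs <;> first | rfl | omega

/-- `θ z` is the sum of the signed crossings of the walk with the ray of `z`. It plays the role of a
winding number: it changes along lattice edges off `X` only through terms at the ends of the walk.
-/
theorem exists_crossing_number {X : Set (ℕ × ℕ)} {u v : ℕ × ℕ} (w : Joined X u v) :
    ∃ θ : ℕ × ℕ → ℤ,
      (∀ z, z ∉ X → (z.1 + 1, z.2) ∉ X → θ z = θ (z.1 + 1, z.2)) ∧
      (∀ z z', z ∉ X → z' ∉ X → (z' = (z.1, z.2 + 1) ∨ z' = (z.1 + 1, z.2 + 1)) →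
        θ z - θ z' = rightOf z' v - rightOf z' u) ∧
      ∀ t, (t, 0) ∉ X → θ (t, 0) = rightOf (t, 0) u - rightOf (t, 0) v := by
  induction w with
  | refl => exact ⟨fun _ => 0, by simp, by simp, by simp⟩
  | @tail v v' _ s ih =>
    obtain ⟨θ, h1, h2, h3⟩ := ih
    obtain ⟨hs, hv, hv'⟩ := s
    have ne : ∀ {z x : ℕ × ℕ}, z ∉ X → x ∈ X → z ≠ x := fun hz hx e => hz (e ▸ hx)
    refine ⟨fun z => θ z + crossing z v v', fun z hz hz' => ?_, fun z z' hz hz' e => ?_,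
      fun t ht => ?_⟩
    · have := crossing_right hs (ne hz' hv) (ne hz' hv')
      simp only [h1 z hz hz', this]
    · have := crossing_up hs e (ne hz' hv) (ne hz' hv') (ne hz hv) (ne hz hv')
      have := h2 z z' hz hz' e
      simp only; omega
    · have := crossing_bottom hs (ne ht hv) (ne ht hv')
      have := h3 t ht
      simp only; omega

/-- Two connected sets in the upper half plane whose points on the bottom row interleave
intersect. -/
theorem Conn.inter_nonempty {X Y : Set (ℕ × ℕ)} (hX : Conn X) (hY : Conn Y) {a b c d : ℕ}
    (ha : (a, 0) ∈ X) (hb : (b, 0) ∈ Y) (hc : (c, 0) ∈ X) (hd : (d, 0) ∈ Y) (hab : a < b)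
    (hbc : b < c) (hcd : c < d) : ∃ z, z ∈ X ∧ z ∈ Y := by
  by_contra hne
  push Not at hne
  have hYX : ∀ z ∈ Y, z ∉ X := fun z hz hz' => hne z hz' hz
  obtain ⟨θ, h1, h2, h3⟩ := exists_crossing_number (hX _ ha _ hc)
  -- The walk starts and ends in row 0 and `z'` lies above row 0, so both boundary terms vanish and
  -- `θ` is constant on `Y`.
  have key : ∀ z z', z ∈ Y → z' ∈ Y →
      (z' = (z.1, z.2 + 1) ∨ z' = (z.1 + 1, z.2 + 1)) → θ z = θ z' := by
    intro z z' hz hz' e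
    have := h2 z z' (hYX z hz) (hYX z' hz') e
    have h0 : z'.2 ≠ 0 := by rcases e with e | e <;> simp [e]
    simp only [rightOf] at this
    rw [if_neg (by simpa using fun h => absurd h.symm h0),
      if_neg (by simpa using fun h => absurd h.symm h0)] at this
    omega
  have step : ∀ z z', Step Y z z' → θ z = θ z' := by
    rintro ⟨x, y⟩ ⟨x', y'⟩ ⟨h, hz, hz'⟩
    simp only [Adj] at h
    rcases h with ⟨rfl, rfl⟩ | ⟨rfl, rfl⟩ | ⟨rfl, rfl⟩ | ⟨rfl, rfl⟩ | ⟨rfl, rfl⟩ | ⟨rfl, rfl⟩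
    · exact h1 _ (hYX _ hz) (hYX _ hz')
    · exact key _ _ hz hz' (Or.inl rfl)
    · exact key _ _ hz hz' (Or.inr rfl)
    · exact (h1 _ (hYX _ hz') (hYX _ hz)).symm
    · exact (key _ _ hz' hz (Or.inl rfl)).symm
    · exact (key _ _ hz' hz (Or.inr rfl)).symm
  have const : ∀ z z', Joined Y z z' → θ z = θ z' := by
    intro z z' w
    induction w with
    | refl => rfl
    | tail _ s ih => exact ih.trans (step _ _ s)
  -- The formula for the bottom row gives -1 at `b`, which lies between the ends of the walk, and 0
  -- at `d`, which lies to the right of both.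
  have e := const _ _ (hY _ hb _ hd)
  have e1 := h3 b (hYX _ hb)
  have e2 := h3 d (hYX _ hd)
  simp only [rightOf, true_and] at e1 e2
  rw [if_neg (by omega), if_pos (by omega)] at e1
  rw [if_neg (by omega), if_neg (by omega)] at e2
  omega

/-! ### A discrete form of Sperner's lemma -/

/-- If no triangle of the rectangle sees a nonzero circulation of `c`, the boundary does not. -/
theorem boundary_circulation (c : ℕ × ℕ → ℕ × ℕ → ℤ) (m n : ℕ)
    (h1 : ∀ x < m, ∀ y < n,
      c (x, y) (x + 1, y) + c (x + 1, y) (x + 1, y + 1) + c (x + 1, y + 1) (x, y) = 0)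
    (h2 : ∀ x < m, ∀ y < n,
      c (x, y) (x, y + 1) + c (x, y + 1) (x + 1, y + 1) + c (x + 1, y + 1) (x, y) = 0) :
    (∑ x ∈ Finset.range m, c (x, 0) (x + 1, 0)) + ∑ y ∈ Finset.range n, c (m, y) (m, y + 1) =
      (∑ x ∈ Finset.range m, c (x, n) (x + 1, n)) +
        ∑ y ∈ Finset.range n, c (0, y) (0, y + 1) := by
  have sq : ∀ x < m, ∀ y < n, c (x, y) (x + 1, y) + c (x + 1, y) (x + 1, y + 1) =
      c (x, y) (x, y + 1) + c (x, y + 1) (x + 1, y + 1) := by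
    intro x hx y hy
    have := h1 x hx y hy
    have := h2 x hx y hy
    omega
  -- This is a discrete Stokes formula: the circulations of all unit squares vanish, and their sum
  -- telescopes in both directions to the boundary.
  have s : ∑ x ∈ Finset.range m, ∑ y ∈ Finset.range n,
      ((c (x + 1, y) (x + 1, y + 1) - c (x, y) (x, y + 1)) -
        (c (x, y + 1) (x + 1, y + 1) - c (x, y) (x + 1, y))) = 0 := by
    refine Finset.sum_eq_zero fun x hx => Finset.sum_eq_zero fun y hy => ?_
    have := sq x (Finset.mem_range.1 hx) y (Finset.mem_range.1 hy)
    omega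
  simp only [Finset.sum_sub_distrib] at s
  have s1 : ∑ x ∈ Finset.range m, ((∑ y ∈ Finset.range n, c (x, y + 1) (x + 1, y + 1)) -
      ∑ y ∈ Finset.range n, c (x, y) (x + 1, y)) =
      ∑ x ∈ Finset.range m, (c (x, n) (x + 1, n) - c (x, 0) (x + 1, 0)) := by
    refine Finset.sum_congr rfl fun x _ => ?_
    rw [← Finset.sum_sub_distrib]
    exact Finset.sum_range_sub (fun y => c (x, y) (x + 1, y)) n
  have s2 : ∑ x ∈ Finset.range m, ((∑ y ∈ Finset.range n, c (x + 1, y) (x + 1, y + 1)) -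
      ∑ y ∈ Finset.range n, c (x, y) (x, y + 1)) =
      (∑ y ∈ Finset.range n, c (m, y) (m, y + 1)) - ∑ y ∈ Finset.range n, c (0, y) (0, y + 1) :=
    Finset.sum_range_sub (fun x => ∑ y ∈ Finset.range n, c (x, y) (x, y + 1)) m
  simp only [Finset.sum_sub_distrib] at s1 s2
  linarith

/-- Three pairwise adjacent points of the rectangle `[0, m] × [0, n]`. -/
def IsTriangle (m n : ℕ) (u v w : ℕ × ℕ) : Prop :=
  (u.1 ≤ m ∧ u.2 ≤ n) ∧ (v.1 ≤ m ∧ v.2 ≤ n) ∧ (w.1 ≤ m ∧ w.2 ≤ n) ∧ Adj u v ∧ Adj v w ∧ Adj u w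

/-- If the boundary of a rectangle has a nonzero number of changes between `E` and `M`, then
there is a triangle with one vertex in `E`, one in `M` and one in neither. -/
theorem exists_triangle (E M : Set (ℕ × ℕ)) (hEM : Disjoint E M) (m n : ℕ)
    (htop : ∀ x ≤ m, (x, n) ∉ M) (hleft : ∀ y ≤ n, (0, y) ∉ M) (hright : ∀ y ≤ n, (m, y) ∉ M)
    (hbot : ∀ x < m, ¬ ((x, 0) ∈ M ∧ (x + 1, 0) ∈ E))
    (hex : ∃ x < m, (x, 0) ∈ E ∧ (x + 1, 0) ∈ M) :
    ∃ u v w, IsTriangle m n u v w ∧ u ∈ E ∧ v ∈ M ∧ w ∉ E ∧ w ∉ M := by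
  classical
  by_contra hno
  push Not at hno
  have hdis : ∀ {z}, z ∈ E → z ∉ M := fun h h' => Set.disjoint_left.1 hEM h h'
  -- `c` counts changes from `E` to `M` with sign. Around a triangle its sum can be nonzero only if
  -- the three vertices show `E`, `M` and neither.
  let c : ℕ × ℕ → ℕ × ℕ → ℤ := fun u v =>
    (if u ∈ E ∧ v ∈ M then 1 else 0) - (if v ∈ E ∧ u ∈ M then 1 else 0)
  have rot : ∀ {u v w}, IsTriangle m n u v w → IsTriangle m n v w u := by
    rintro u v w ⟨a, b, d, e, f, g⟩; exact ⟨b, d, a, f, g.symm, e.symm⟩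
  have flip : ∀ {u v w}, IsTriangle m n u v w → IsTriangle m n v u w := by
    rintro u v w ⟨a, b, d, e, f, g⟩; exact ⟨b, a, d, e.symm, g, f⟩
  have tri : ∀ u v w, IsTriangle m n u v w → c u v + c v w + c w u = 0 := by
    intro u v w h
    have h1 := hno u v w h
    have h2 := hno v w u (rot h)
    have h3 := hno w u v (rot (rot h))
    have h4 := hno v u w (flip h)
    have h5 := hno w v u (flip (rot h))
    have h6 := hno u w v (flip (rot (rot h)))
    simp only [c]
    by_cases uE : u ∈ E <;> by_cases vE : v ∈ E <;> by_cases wE : w ∈ E <;>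
    by_cases uM : u ∈ M <;> by_cases vM : v ∈ M <;> by_cases wM : w ∈ M <;>
    first
      | exact absurd uM (hdis uE)
      | exact absurd vM (hdis vE)
      | exact absurd wM (hdis wE)
      | simp_all
  have hz : ∀ u v, u ∉ M → v ∉ M → c u v = 0 := fun u v hu hv => by simp [c, hu, hv]
  have B := boundary_circulation c m n
    (fun x hx y hy => tri _ _ _ ⟨⟨hx.le, hy.le⟩, ⟨hx, hy.le⟩, ⟨hx, hy⟩, Or.inl ⟨rfl, rfl⟩,
      Or.inr (Or.inl ⟨rfl, rfl⟩), Or.inr (Or.inr (Or.inl ⟨rfl, rfl⟩))⟩)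
    (fun x hx y hy => tri _ _ _ ⟨⟨hx.le, hy.le⟩, ⟨hx.le, hy⟩, ⟨hx, hy⟩, Or.inr (Or.inl ⟨rfl, rfl⟩),
      Or.inl ⟨rfl, rfl⟩, Or.inr (Or.inr (Or.inl ⟨rfl, rfl⟩))⟩)
  rw [Finset.sum_eq_zero (s := Finset.range n) (f := fun y => c (m, y) (m, y + 1)),
    Finset.sum_eq_zero (s := Finset.range n) (f := fun y => c (0, y) (0, y + 1)),
    Finset.sum_eq_zero (s := Finset.range m) (f := fun x => c (x, n) (x + 1, n))] at B
  -- Only the bottom row can contribute, all changes there have the same sign, and one of them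
  -- occurs; so the boundary sum is not zero.
  · obtain ⟨x, hx, h1, h2⟩ := hex
    have nonneg : ∀ x ∈ Finset.range m, 0 ≤ c (x, 0) (x + 1, 0) := by
      intro x hx
      have := hbot x (Finset.mem_range.1 hx)
      simp only [c]
      rw [if_neg (c := _ ∈ E ∧ (x, 0) ∈ M) (fun h => this ⟨h.2, h.1⟩)]
      split_ifs <;> simp
    have one := Finset.single_le_sum nonneg (Finset.mem_range.2 hx)
    have : c (x, 0) (x + 1, 0) = 1 := by
      simp only [c]
      rw [if_pos ⟨h1, h2⟩, if_neg (fun h => hbot x hx ⟨h.2, h.1⟩)]; rfl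
    omega
  · intro x hx
    have := Finset.mem_range.1 hx
    exact hz _ _ (htop _ (by omega)) (htop _ (by omega))
  · intro y hy
    have := Finset.mem_range.1 hy
    exact hz _ _ (hleft _ (by omega)) (hleft _ (by omega))
  · intro y hy
    have := Finset.mem_range.1 hy
    exact hz _ _ (hright _ (by omega)) (hright _ (by omega))

end Lattice

end BoundaryLabeling

noncomputable section

namespace BoundaryLabeling

namespace Lattice

open Relation

/-! ### The forest of vertical drops -/

/-- The strings `str c`, `c ∈ V`, are connected sets in the interior of the rectangle
`[0, m] × [0, n]` except for one point `(pos c, 0)` on its bottom side. -/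
structure IsStringSystem (m n : ℕ) (str : ℕ → Set (ℕ × ℕ)) (pos : ℕ → ℕ) (V : Set ℕ) : Prop where
  conn : ∀ c ∈ V, Conn (str c)
  pos_mem : ∀ c ∈ V, (pos c, 0) ∈ str c
  pos_eq : ∀ c ∈ V, ∀ x, (x, 0) ∈ str c → x = pos c
  inside : ∀ c ∈ V, ∀ v ∈ str c, 0 < v.1 ∧ v.1 < m ∧ v.2 < n

open Classical in
/-- The parent of a lattice point: points of `T` are roots; the top row and the bottom row point
to the left, all other points point downwards. -/
def parent (T : Set (ℕ × ℕ)) (m n : ℕ) (v : ℕ × ℕ) : ℕ × ℕ :=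
  if v ∈ T then v
  else if v.2 = 0 then (if v.1 = m then v else (v.1 - 1, 0))
  else if v.2 = n ∧ v.1 ≠ 0 then (v.1 - 1, n) else (v.1, v.2 - 1)

section Forest

variable (T : Set (ℕ × ℕ)) (m n : ℕ)

theorem adj_parent (v : ℕ × ℕ) : parent T m n v = v ∨ Adj v (parent T m n v) := by
  obtain ⟨x, y⟩ := v
  unfold parent Adj
  split_ifs <;> simp_all <;> omega

/-- The sum of the coordinates is a potential, which is why `v.1 + v.2` iterations reach the root in
`rootOf`. -/
theorem parent_decreases (v : ℕ × ℕ) : parent T m n v = v ∨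
    (parent T m n v).1 + (parent T m n v).2 + 1 ≤ v.1 + v.2 := by
  obtain ⟨x, y⟩ := v
  unfold parent
  split_ifs <;> simp_all <;> omega

theorem parent_iterate_fixed (k : ℕ) (v : ℕ × ℕ) (h : v.1 + v.2 ≤ k) :
    parent T m n ((parent T m n)^[k] v) = (parent T m n)^[k] v := by
  induction k generalizing v with
  | zero =>
    rcases parent_decreases T m n v with h' | h'
    · exact h'
    · omega
  | succ k ih =>
    rcases parent_decreases T m n v with h' | h'
    · rw [Function.iterate_fixed h', h']
    · exact ih _ (by omega)

/-- The root of the tree of `v`. -/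
def rootOf (v : ℕ × ℕ) : ℕ × ℕ := (parent T m n)^[v.1 + v.2] v

theorem parent_rootOf (v : ℕ × ℕ) : parent T m n (rootOf T m n v) = rootOf T m n v :=
  parent_iterate_fixed T m n _ v le_rfl

theorem rootOf_eq {v : ℕ × ℕ} {k : ℕ}
    (h : parent T m n ((parent T m n)^[k] v) = (parent T m n)^[k] v) :
    rootOf T m n v = (parent T m n)^[k] v := by
  have key : ∀ i j, i ≤ j → parent T m n ((parent T m n)^[i] v) = (parent T m n)^[i] v →
      (parent T m n)^[j] v = (parent T m n)^[i] v := by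
    intro i j hij hi
    obtain ⟨d, rfl⟩ := Nat.exists_eq_add_of_le hij
    rw [Nat.add_comm, Function.iterate_add_apply, Function.iterate_fixed hi]
  rcases le_total k (v.1 + v.2) with hk | hk
  · exact key _ _ hk h
  · exact (key _ _ hk (parent_rootOf T m n v)).symm

theorem rootOf_iterate (v : ℕ × ℕ) (k : ℕ) :
    rootOf T m n ((parent T m n)^[k] v) = rootOf T m n v := by
  set w := (parent T m n)^[k] v with hw
  have h := parent_rootOf T m n w
  have e : rootOf T m n w = (parent T m n)^[(w.1 + w.2) + k] v := by
    rw [Function.iterate_add_apply]; rfl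
  rw [e] at h
  rw [rootOf_eq T m n h, e]

theorem rootOf_of_fixed {v : ℕ × ℕ} (h : parent T m n v = v) : rootOf T m n v = v :=
  rootOf_eq T m n (k := 0) h

theorem rootOf_parent (v : ℕ × ℕ) : rootOf T m n (parent T m n v) = rootOf T m n v :=
  rootOf_iterate T m n v 1

/-- The path of `v` to its root. -/
def path (v : ℕ × ℕ) : Set (ℕ × ℕ) := {w | ∃ k, w = (parent T m n)^[k] v}

theorem mem_path_self (v : ℕ × ℕ) : v ∈ path T m n v := ⟨0, rfl⟩

theorem rootOf_mem_path (v : ℕ × ℕ) : rootOf T m n v ∈ path T m n v := ⟨_, rfl⟩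

theorem rootOf_of_mem_path {v w : ℕ × ℕ} (h : w ∈ path T m n v) :
    rootOf T m n w = rootOf T m n v := by
  obtain ⟨k, rfl⟩ := h; exact rootOf_iterate T m n v k

theorem joined_iterate (v : ℕ × ℕ) (k : ℕ) :
    Joined {w | ∃ j ≤ k, w = (parent T m n)^[j] v} v ((parent T m n)^[k] v) := by
  induction k with
  | zero => exact ReflTransGen.refl
  | succ k ih =>
    have ih' := ih.mono (Y := {w | ∃ j ≤ k + 1, w = (parent T m n)^[j] v})
      (by rintro w ⟨j, hj, e⟩; exact ⟨j, by omega, e⟩)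
    rw [Function.iterate_succ_apply']
    rcases adj_parent T m n ((parent T m n)^[k] v) with h | h
    · rw [h]; exact ih'
    · refine ih'.tail ⟨h, ⟨k, by omega, rfl⟩, ⟨k + 1, le_rfl, ?_⟩⟩
      rw [Function.iterate_succ_apply']

theorem conn_prefix (v : ℕ × ℕ) (k : ℕ) : Conn {w | ∃ j ≤ k, w = (parent T m n)^[j] v} := by
  refine conn_of_base v ?_
  rintro w ⟨j, hj, rfl⟩
  exact (joined_iterate T m n v j).mono (by rintro w ⟨i, hi, e⟩; exact ⟨i, by omega, e⟩)

theorem conn_path (v : ℕ × ℕ) : Conn (path T m n v) := by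
  refine conn_of_base v ?_
  rintro w ⟨j, rfl⟩
  exact (joined_iterate T m n v j).mono (by rintro w ⟨i, _, e⟩; exact ⟨i, e⟩)

end Forest

/-! ### Owners and stems -/

section Stems

variable (m n : ℕ) (str : ℕ → Set (ℕ × ℕ)) (pos : ℕ → ℕ) (S : Set ℕ)

/-- The union of the strings in `S`. -/
def support : Set (ℕ × ℕ) := {v | ∃ c ∈ S, v ∈ str c}

open Classical in
/-- The position of the owner of a lattice point. -/
def owner (v : ℕ × ℕ) : ℕ :=
  if h : ∃ c ∈ S, rootOf (support str S) m n v ∈ str c then pos h.choose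
  else (rootOf (support str S) m n v).1

/-- The string of the owner of `v` and the path of `v` to it. -/
def stem (v : ℕ × ℕ) : Set (ℕ × ℕ) :=
  {w | ∃ c ∈ S, rootOf (support str S) m n v ∈ str c ∧ w ∈ str c} ∪ path (support str S) m n v

variable {m n str pos S} {V : Set ℕ} (hV : IsStringSystem m n str pos V) (hS : S ⊆ V)
  (hd : ∀ c ∈ S, ∀ c' ∈ S, c ≠ c' → Disjoint (str c) (str c'))

theorem parent_of_mem_support {v : ℕ × ℕ} (h : v ∈ support str S) :
    parent (support str S) m n v = v := by simp [parent, h]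

include hd in
theorem owner_eq_pos {v : ℕ × ℕ} {c : ℕ} (hc : c ∈ S)
    (h : rootOf (support str S) m n v ∈ str c) : owner m n str pos S v = pos c := by
  have hex : ∃ c ∈ S, rootOf (support str S) m n v ∈ str c := ⟨c, hc, h⟩
  rw [owner, dif_pos hex]
  by_contra hne
  exact Set.disjoint_left.1 (hd _ hex.choose_spec.1 _ hc (fun e => hne (by rw [e])))
    hex.choose_spec.2 h

include hd in
theorem owner_of_mem {v : ℕ × ℕ} {c : ℕ} (hc : c ∈ S) (h : v ∈ str c) :
    owner m n str pos S v = pos c := by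
  refine owner_eq_pos hd hc ?_
  rwa [rootOf_of_fixed _ _ _ (parent_of_mem_support ⟨c, hc, h⟩)]

theorem owner_congr {v w : ℕ × ℕ}
    (h : rootOf (support str S) m n v = rootOf (support str S) m n w) :
    owner m n str pos S v = owner m n str pos S w := by
  unfold owner; rw [h]

-- The owner depends only on the root, and a string is its own set of roots; so an owner is constant
-- on a stem, and stems of different owners are disjoint.
include hd in
theorem owner_of_mem_stem {v w : ℕ × ℕ} (h : w ∈ stem m n str S v) :
    owner m n str pos S w = owner m n str pos S v := by
  rcases h with ⟨c, hc, h1, h2⟩ | h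
  · rw [owner_of_mem hd hc h2, owner_eq_pos hd hc h1]
  · exact owner_congr (rootOf_of_mem_path _ _ _ h)

theorem mem_stem_self (v : ℕ × ℕ) : v ∈ stem m n str S v := Or.inr (mem_path_self _ _ _ v)

/-- Off the strings the only fixed points of `parent` are the two bottom corners. Their abscissas 0
and `m` serve as artificial owners to the left and right of all feet. -/
theorem root_cases (v : ℕ × ℕ) :
    rootOf (support str S) m n v ∈ support str S ∨
      rootOf (support str S) m n v = (0, 0) ∨ rootOf (support str S) m n v = (m, 0) := by
  have h := parent_rootOf (support str S) m n v
  set r := rootOf (support str S) m n v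
  obtain ⟨x, y⟩ := r
  unfold parent at h
  split_ifs at h <;> simp_all <;> omega

include hV hS hd in
theorem owner_mem_stem (v : ℕ × ℕ) :
    (owner m n str pos S v, 0) ∈ stem m n str S v := by
  by_cases hs : rootOf (support str S) m n v ∈ support str S
  · obtain ⟨c, hc, h⟩ := hs
    rw [owner_eq_pos hd hc h]
    exact Or.inl ⟨c, hc, h, hV.pos_mem c (hS hc)⟩
  · have hne : ¬ ∃ c ∈ S, rootOf (support str S) m n v ∈ str c := hs
    have : (owner m n str pos S v, 0) = rootOf (support str S) m n v := by
      rw [owner, dif_neg hne]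
      rcases root_cases (n := n) (str := str) (S := S) v with h | h | h
      · exact absurd h hs
      · rw [h]
      · rw [h]
    rw [this]
    exact Or.inr (rootOf_mem_path _ _ _ v)

include hV hS hd in
theorem conn_stem (v : ℕ × ℕ) : Conn (stem m n str S v) := by
  by_cases hs : rootOf (support str S) m n v ∈ support str S
  · obtain ⟨c, hc, h⟩ := hs
    have e : {w | ∃ c ∈ S, rootOf (support str S) m n v ∈ str c ∧ w ∈ str c} = str c := by
      ext w
      refine ⟨fun ⟨c', hc', h1, h2⟩ => ?_, fun hw => ⟨c, hc, h, hw⟩⟩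
      by_contra hw
      have : c' ≠ c := fun e => hw (e ▸ h2)
      exact Set.disjoint_left.1 (hd _ hc' _ hc this) h1 h
    rw [stem, e]
    exact (hV.conn c (hS hc)).union (conn_path _ _ _ v) h (rootOf_mem_path _ _ _ v) (Or.inr rfl)
  · have e : {w | ∃ c ∈ S, rootOf (support str S) m n v ∈ str c ∧ w ∈ str c} = ∅ := by
      ext w
      simp only [Set.mem_ofPred_eq, Set.mem_empty_iff_false, iff_false]
      exact fun ⟨c, hc, h, _⟩ => hs ⟨c, hc, h⟩
    rw [stem, e, Set.empty_union]
    exact conn_path _ _ _ v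

include hV hS hd in
theorem pos_injOn : Set.InjOn pos S := by
  intro c hc c' hc' h
  by_contra hne
  exact Set.disjoint_left.1 (hd _ hc _ hc' hne) (hV.pos_mem c (hS hc))
    (h ▸ hV.pos_mem c' (hS hc'))

include hV hS in
theorem pos_bounds {c : ℕ} (hc : c ∈ S) : 0 < pos c ∧ pos c < m := by
  have := hV.inside c (hS hc) _ (hV.pos_mem c (hS hc))
  exact ⟨this.1, this.2.1⟩

include hV hS hd in
/-- Points with the same owner have stems that agree off their paths. -/
theorem mem_stem_or_mem_path {u v w : ℕ × ℕ}
    (h : owner m n str pos S u = owner m n str pos S v) (hw : w ∈ stem m n str S u) :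
    w ∈ stem m n str S v ∨ w ∈ path (support str S) m n u := by
  rcases hw with ⟨c, hc, h1, h2⟩ | hw
  · left
    have e := owner_eq_pos (pos := pos) hd hc h1
    have b := pos_bounds hV hS hc
    by_cases hs : rootOf (support str S) m n v ∈ support str S
    · obtain ⟨c', hc', h'⟩ := hs
      have e' := owner_eq_pos (pos := pos) hd hc' h'
      have : c = c' := pos_injOn hV hS hd hc hc' (by rw [← e, ← e', h])
      subst this
      exact Or.inl ⟨c, hc, h', h2⟩
    -- Here the owner of `v` would be an artificial owner, 0 or `m`, whereas the owner of `u` is a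
    -- foot strictly between them.
    · have hne : ¬ ∃ c ∈ S, rootOf (support str S) m n v ∈ str c := hs
      have e' : owner m n str pos S v = (rootOf (support str S) m n v).1 := by
        rw [owner, dif_neg hne]
      rcases root_cases (n := n) (str := str) (S := S) v with h' | h' | h'
      · exact absurd h' hs
      · rw [h'] at e'; simp only at e'; omega
      · rw [h'] at e'; simp only at e'; omega
  · exact Or.inr hw

/-- A path that has entered a stem never leaves it again. This is what keeps an initial piece of a
path off a stem, once its last point is off that stem. -/
theorem stem_parent_closed {v w : ℕ × ℕ} (h : w ∈ stem m n str S v) :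
    parent (support str S) m n w ∈ stem m n str S v := by
  rcases h with ⟨c, hc, h1, h2⟩ | ⟨k, rfl⟩
  · rw [parent_of_mem_support ⟨c, hc, h2⟩]; exact Or.inl ⟨c, hc, h1, h2⟩
  · exact Or.inr ⟨k + 1, by rw [Function.iterate_succ_apply']⟩

theorem stem_iterate_closed {v w : ℕ × ℕ} (h : w ∈ stem m n str S v) (k : ℕ) :
    (parent (support str S) m n)^[k] w ∈ stem m n str S v := by
  induction k with
  | zero => exact h
  | succ k ih => rw [Function.iterate_succ_apply']; exact stem_parent_closed ih

/-- The strings of `V` that lie between the owners of `z` and `z'` and avoid their stems. -/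
def between (m n : ℕ) (str : ℕ → Set (ℕ × ℕ)) (pos : ℕ → ℕ) (S V : Set ℕ) (z z' : ℕ × ℕ) :
    Set ℕ :=
  {c | c ∈ V ∧ owner m n str pos S z < pos c ∧ pos c < owner m n str pos S z' ∧
    Disjoint (str c) (stem m n str S z) ∧ Disjoint (str c) (stem m n str S z')}

include hV hS hd in
/-- A string between `z` and `z'` meets no connected set that avoids the stems of `z` and `z'`
and reaches the bottom row outside. -/
theorem not_meet {z z' : ℕ × ℕ} (ha : Adj z z') {c : ℕ}
    (hc : c ∈ between m n str pos S V z z') {W : Set (ℕ × ℕ)} (hW : Conn W) {d : ℕ}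
    (hdW : (d, 0) ∈ W)
    (hdd : d < owner m n str pos S z ∨ owner m n str pos S z' < d)
    (h1 : Disjoint W (stem m n str S z)) (h2 : Disjoint W (stem m n str S z')) :
    Disjoint (str c) W := by
  obtain ⟨hcV, p1, p2, q1, q2⟩ := hc
  rw [Set.disjoint_left]
  intro v hv hvW
  -- The two stems, joined by the edge `z z'`, form a connected set that reaches the bottom row on
  -- both sides of the foot of `c`. If `W` met the string of `c`, their union would reach the bottom
  -- row in interleaving points while avoiding the stems.
  have hX : Conn (stem m n str S z ∪ stem m n str S z') :=
    (conn_stem hV hS hd z).union (conn_stem hV hS hd z') (mem_stem_self z) (mem_stem_self z')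
      (Or.inl ha)
  have hY : Conn (str c ∪ W) := (hV.conn c hcV).union hW hv hvW (Or.inr rfl)
  have hXY : ∀ x, x ∈ stem m n str S z ∪ stem m n str S z' → x ∈ str c ∪ W → False := by
    rintro x (hx | hx) (hx' | hx')
    · exact Set.disjoint_left.1 q1 hx' hx
    · exact Set.disjoint_left.1 h1 hx' hx
    · exact Set.disjoint_left.1 q2 hx' hx
    · exact Set.disjoint_left.1 h2 hx' hx
  have m1 : (owner m n str pos S z, 0) ∈ stem m n str S z ∪ stem m n str S z' :=
    Or.inl (owner_mem_stem hV hS hd _)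
  have m2 : (owner m n str pos S z', 0) ∈ stem m n str S z ∪ stem m n str S z' :=
    Or.inr (owner_mem_stem hV hS hd _)
  have m3 : (pos c, 0) ∈ str c ∪ W := Or.inl (hV.pos_mem c hcV)
  have m4 : (d, 0) ∈ str c ∪ W := Or.inr hdW
  rcases hdd with h | h
  · obtain ⟨x, hx, hx'⟩ := hY.inter_nonempty hX m4 m1 m3 m2 h p1 p2
    exact hXY x hx' hx
  · obtain ⟨x, hx, hx'⟩ := hX.inter_nonempty hY m1 m3 m2 m4 p1 p2 h
    exact hXY x hx hx'

include hd in
theorem disjoint_stem {z z' : ℕ × ℕ}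
    (h : owner m n str pos S z ≠ owner m n str pos S z') :
    Disjoint (stem m n str S z) (stem m n str S z') := by
  rw [Set.disjoint_left]
  intro v hv hv'
  exact h ((owner_of_mem_stem hd hv).symm.trans (owner_of_mem_stem hd hv'))

include hV hS hd in
/-- A point of the stem of `u` off the stem of `v`, where `u` and `v` have the same owner, is
connected to any neighbour `w` of `u` off the stem of `v`. -/
theorem exists_conn_off_stem {u v w x : ℕ × ℕ}
    (h : owner m n str pos S u = owner m n str pos S v) (ha : Adj u w)
    (hne : owner m n str pos S w ≠ owner m n str pos S u)
    (hx : x ∈ stem m n str S u) (hx' : x ∉ stem m n str S v) :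
    ∃ W, Conn W ∧ x ∈ W ∧ stem m n str S w ⊆ W ∧ Disjoint W (stem m n str S v) ∧
      ∀ y ∈ W, owner m n str pos S y = owner m n str pos S u ∨
        owner m n str pos S y = owner m n str pos S w := by
  rcases mem_stem_or_mem_path hV hS hd h hx with hx'' | ⟨k, rfl⟩
  · exact absurd hx'' hx'
  refine ⟨{y | ∃ j ≤ k, y = (parent (support str S) m n)^[j] u} ∪ stem m n str S w,
    (conn_prefix _ _ _ u k).union (conn_stem hV hS hd w) ⟨0, by omega, rfl⟩ (mem_stem_self w)
      (Or.inl ha), Or.inl ⟨k, le_rfl, rfl⟩, Set.subset_union_right, ?_, ?_⟩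
  · rw [Set.disjoint_left]
    rintro y (⟨j, hj, rfl⟩ | hy) hy'
    -- If the path met the stem of `v` before `x`, it would stay in it, and `x` would belong to that
    -- stem.
    · refine hx' ?_
      have := stem_iterate_closed hy' (k - j)
      rwa [← Function.iterate_add_apply, Nat.sub_add_cancel hj] at this
    · exact hne (by rw [h, ← owner_of_mem_stem hd hy, ← owner_of_mem_stem hd hy'])
  · rintro y (⟨j, hj, rfl⟩ | hy)
    · exact Or.inl (owner_congr (rootOf_iterate _ _ _ u j))
    · exact Or.inr (owner_of_mem_stem hd hy)

-- The points `a` and `z` have the same owner, but their paths to it may differ. If the string of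
-- `c` met the stem of `z` off the stem of `a`, then this piece of the path, continued across the
-- edge `z z'` and down the stem of `z'`, would reach the bottom row outside the interval of `a` and
-- `b` without touching their stems. This contradicts `not_meet`.
include hV hS hd in
theorem between_mono_left {z z' a b : ℕ × ℕ} (hzz : Adj z z') (hab : Adj a b)
    (h1 : owner m n str pos S a = owner m n str pos S z)
    (h2 : owner m n str pos S a < owner m n str pos S b)
    (h3 : owner m n str pos S b < owner m n str pos S z') :
    between m n str pos S V a b ⊆ between m n str pos S V z z' := by
  intro c hc
  have hc' := hc
  obtain ⟨hcV, p1, p2, q1, q2⟩ := hc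
  refine ⟨hcV, by omega, by omega, ?_, ?_⟩
  · rw [Set.disjoint_left]
    intro x hx hxz
    obtain ⟨W, w1, w2, w3, w4, w5⟩ := exists_conn_off_stem hV hS hd h1.symm hzz (by omega)
      hxz (Set.disjoint_left.1 q1 hx)
    refine Set.disjoint_left.1 (not_meet hV hS hd hab hc' w1
      (w3 (owner_mem_stem hV hS hd _)) (Or.inr h3) w4 ?_) hx w2
    rw [Set.disjoint_left]
    intro y hy hyb
    have := owner_of_mem_stem (pos := pos) hd hyb
    rcases w5 y hy with e | e <;> omega
  · exact not_meet hV hS hd hab hc' (conn_stem hV hS hd z')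
      (owner_mem_stem hV hS hd _) (Or.inr h3) (disjoint_stem (pos := pos) hd (by omega))
      (disjoint_stem (pos := pos) hd (by omega))

-- Mirror image of `between_mono_left`.
include hV hS hd in
theorem between_mono_right {z z' a b : ℕ × ℕ} (hzz : Adj z z') (hab : Adj a b)
    (h1 : owner m n str pos S b = owner m n str pos S z')
    (h2 : owner m n str pos S a < owner m n str pos S b)
    (h3 : owner m n str pos S z < owner m n str pos S a) :
    between m n str pos S V a b ⊆ between m n str pos S V z z' := by
  intro c hc
  have hc' := hc
  obtain ⟨hcV, p1, p2, q1, q2⟩ := hc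
  refine ⟨hcV, by omega, by omega, ?_, ?_⟩
  · exact not_meet hV hS hd hab hc' (conn_stem hV hS hd z)
      (owner_mem_stem hV hS hd _) (Or.inl h3) (disjoint_stem (pos := pos) hd (by omega))
      (disjoint_stem (pos := pos) hd (by omega))
  · rw [Set.disjoint_left]
    intro x hx hxz
    obtain ⟨W, w1, w2, w3, w4, w5⟩ := exists_conn_off_stem hV hS hd h1.symm hzz.symm
      (by omega) hxz (Set.disjoint_left.1 q2 hx)
    refine Set.disjoint_left.1 (not_meet hV hS hd hab hc' w1
      (w3 (owner_mem_stem hV hS hd _)) (Or.inl h3) ?_ w4) hx w2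
    rw [Set.disjoint_left]
    intro y hy hya
    have := owner_of_mem_stem (pos := pos) hd hya
    rcases w5 y hy with e | e <;> omega

-- The string of `c'` has its foot beyond the owner of `b`, avoids the stem of `b` by definition,
-- and avoids the stem of `a` by `not_meet` for the edge `b d`. So `not_meet` for the edge `a b`
-- applies to it.
include hV hS hd in
theorem between_disjoint {a b d : ℕ × ℕ} (hab : Adj a b) (hbd : Adj b d)
    (h1 : owner m n str pos S a < owner m n str pos S b)
    (h2 : owner m n str pos S b < owner m n str pos S d) {c c' : ℕ}
    (hc : c ∈ between m n str pos S V a b) (hc' : c' ∈ between m n str pos S V b d) :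
    Disjoint (str c) (str c') := by
  refine not_meet hV hS hd hab hc (hV.conn c' hc'.1) (hV.pos_mem c' hc'.1)
    (Or.inr hc'.2.1) ?_ hc'.2.2.2.1
  exact not_meet hV hS hd hbd hc' (conn_stem hV hS hd a) (owner_mem_stem hV hS hd _)
    (Or.inl h1) (disjoint_stem (pos := pos) hd (by omega))
    (disjoint_stem (pos := pos) hd (by omega))

include hV hS hd in
/-- Edges with interleaving owners do not exist. -/
theorem not_interleaved {u v w x : ℕ × ℕ} (huw : Adj u w) (hvx : Adj v x)
    (h1 : owner m n str pos S u < owner m n str pos S v)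
    (h2 : owner m n str pos S v < owner m n str pos S w)
    (h3 : owner m n str pos S w < owner m n str pos S x) : False := by
  -- Each edge joins two stems to a connected set. A common point of the two sets would have the
  -- same owner as one of `u`, `w` and as one of `v`, `x`.
  have hX : Conn (stem m n str S u ∪ stem m n str S w) :=
    (conn_stem hV hS hd u).union (conn_stem hV hS hd w) (mem_stem_self u) (mem_stem_self w)
      (Or.inl huw)
  have hY : Conn (stem m n str S v ∪ stem m n str S x) :=
    (conn_stem hV hS hd v).union (conn_stem hV hS hd x) (mem_stem_self v) (mem_stem_self x)
      (Or.inl hvx)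
  obtain ⟨y, hy, hy'⟩ := hX.inter_nonempty hY (Or.inl (owner_mem_stem hV hS hd _))
    (Or.inl (owner_mem_stem hV hS hd _)) (Or.inr (owner_mem_stem hV hS hd _))
    (Or.inr (owner_mem_stem hV hS hd _)) h1 h2 h3
  rcases hy with hy | hy <;> rcases hy' with hy' | hy' <;>
  · have e1 := owner_of_mem_stem (pos := pos) hd hy
    have e2 := owner_of_mem_stem (pos := pos) hd hy'
    omega

/-! ### Owners on the boundary -/

include hV hS in
theorem not_mem_support {v : ℕ × ℕ} (h : v.1 = 0 ∨ m ≤ v.1 ∨ n ≤ v.2) : v ∉ support str S := by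
  rintro ⟨c, hc, hv⟩
  have := hV.inside c (hS hc) v hv
  omega

include hV hS in
theorem owner_left (y : ℕ) : owner m n str pos S (0, y) = 0 := by
  have r : rootOf (support str S) m n (0, y) = (0, 0) := by
    induction y with
    | zero =>
      refine rootOf_of_fixed _ _ _ ?_
      have := not_mem_support hV hS (v := (0, 0)) (Or.inl rfl)
      simp [parent, this]
    | succ y ih =>
      rw [← ih, ← rootOf_parent]
      have := not_mem_support hV hS (v := (0, y + 1)) (Or.inl rfl)
      simp [parent, this]
  have : ¬ ∃ c ∈ S, rootOf (support str S) m n (0, y) ∈ str c := by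
    rw [r]; exact not_mem_support hV hS (Or.inl rfl)
  rw [owner, dif_neg this, r]

-- Points of the top row run left to the corner and then down the left column. Hence the owner jumps
-- from 0 to `m` across the topmost edge of the right column, which is where the whole problem
-- starts.
include hV hS in
theorem owner_top (hn : 0 < n) (x : ℕ) : owner m n str pos S (x, n) = 0 := by
  induction x with
  | zero => exact owner_left hV hS n
  | succ x ih =>
    rw [← ih]
    refine owner_congr ?_
    rw [← rootOf_parent]
    have := not_mem_support hV hS (v := (x + 1, n)) (Or.inr (Or.inr le_rfl))
    simp [parent, this, hn.ne']

include hV hS in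
theorem owner_right {y : ℕ} (hy : y < n) : owner m n str pos S (m, y) = m := by
  have r : rootOf (support str S) m n (m, y) = (m, 0) := by
    induction y with
    | zero =>
      refine rootOf_of_fixed _ _ _ ?_
      simp [parent]
    | succ y ih =>
      rw [← ih (by omega), ← rootOf_parent]
      have := not_mem_support hV hS (v := (m, y + 1)) (Or.inr (Or.inl le_rfl))
      simp [parent, this, hy.ne]
  have : ¬ ∃ c ∈ S, rootOf (support str S) m n (m, y) ∈ str c := by
    rw [r]; exact not_mem_support hV hS (Or.inr (Or.inl le_rfl))
  rw [owner, dif_neg this, r]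

include hV hS hd in
/-- The owners along the bottom row. -/
theorem owner_bottom {x : ℕ} (hx : x < m) :
    (owner m n str pos S (x, 0) = 0 ∨ ∃ c ∈ S, owner m n str pos S (x, 0) = pos c) ∧
    owner m n str pos S (x, 0) ≤ x ∧ ∀ c ∈ S, pos c ≤ x → pos c ≤ owner m n str pos S (x, 0) := by
  induction x with
  | zero =>
    rw [owner_left hV hS]
    refine ⟨Or.inl rfl, le_rfl, fun c hc h => h⟩
  | succ x ih =>
    by_cases hs : (x + 1, 0) ∈ support str S
    · obtain ⟨c, hc, h⟩ := hs
      have e := hV.pos_eq c (hS hc) _ h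
      rw [owner_of_mem hd hc h]
      exact ⟨Or.inr ⟨c, hc, rfl⟩, e.ge, fun c' _ h' => e ▸ h'⟩
    · have : owner m n str pos S (x + 1, 0) = owner m n str pos S (x, 0) := by
        refine owner_congr ?_
        rw [← rootOf_parent]
        simp [parent, hs, hx.ne]
      rw [this]
      obtain ⟨i1, i2, i3⟩ := ih (by omega)
      refine ⟨i1, by omega, fun c hc h => i3 c hc ?_⟩
      rcases Nat.lt_or_ge (pos c) (x + 1) with h' | h'
      · omega
      · refine absurd ⟨c, hc, ?_⟩ hs
        have : pos c = x + 1 := by omega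
        exact this ▸ hV.pos_mem c (hS hc)

include hV hS hd in
/-- If a string of `S` lies between the owners of two adjacent points, then some triangle has
the same two owners and a third owner between them. -/
theorem exists_split (hn : 0 < n) {z z' : ℕ × ℕ} (hzz : Adj z z')
    (hez : owner m n str pos S z = 0 ∨ ∃ c ∈ S, owner m n str pos S z = pos c)
    (hfm : owner m n str pos S z' ≤ m) {c : ℕ} (hc : c ∈ S)
    (h1 : owner m n str pos S z < pos c) (h2 : pos c < owner m n str pos S z') :
    ∃ d ∈ S, ∃ u v w, IsTriangle m n u v w ∧ owner m n str pos S u = owner m n str pos S z ∧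
      owner m n str pos S v = pos d ∧ owner m n str pos S w = owner m n str pos S z' ∧
      owner m n str pos S z < pos d ∧ pos d < owner m n str pos S z' := by
  set e := owner m n str pos S z with he
  set f := owner m n str pos S z' with hf
  -- Sperner's lemma with `E`, the points owned by `e`, and `M`, the points with owner strictly
  -- between `e` and `f`. On the left, top and right sides all owners are 0 or `m`, so `M` does not
  -- occur there. Along the bottom row the owners increase, so there is no change back from `M` to
  -- `E`.
  have T := exists_triangle {v | owner m n str pos S v = e}
    {v | e < owner m n str pos S v ∧ owner m n str pos S v < f}
    (by rw [Set.disjoint_left]; intro v hv hv'; simp only [Set.mem_ofPred_eq] at hv hv'; omega)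
    m n
    (by intro x _; simp only [Set.mem_ofPred_eq, owner_top hV hS hn]; omega)
    (by intro y _; simp only [Set.mem_ofPred_eq, owner_left hV hS]; omega)
    (by
      intro y hy
      simp only [Set.mem_ofPred_eq]
      rcases hy.lt_or_eq with h | rfl
      · rw [owner_right hV hS h]; omega
      · rw [owner_top hV hS hn]; omega)
    (by
      rintro x hx ⟨⟨h3, h4⟩, h5⟩
      simp only [Set.mem_ofPred_eq] at h5
      have b := owner_bottom (pos := pos) hV hS hd hx
      rcases Nat.lt_or_ge (x + 1) m with h | h
      · have b' := owner_bottom (pos := pos) hV hS hd h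
        rcases b.1 with h0 | ⟨c', hc', h0⟩
        · omega
        · have := b'.2.2 c' hc' (by omega); omega
      · have : x + 1 = m := by omega
        rw [this, owner_right hV hS hn] at h5; omega)
    (by
      classical
      -- Let `p` be the first foot beyond `e`. The point just left of it is still owned by `e`, and
      -- `(p, 0)` owns itself and lies in `M`.
      have hP : ∃ p, ∃ d ∈ S, pos d = p ∧ e < p := ⟨pos c, c, hc, rfl, h1⟩
      obtain ⟨d, hd', hp, hep⟩ := Nat.find_spec hP
      set p := Nat.find hP
      have hpc : p ≤ pos c := Nat.find_min' hP ⟨c, hc, rfl, h1⟩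
      have hb := pos_bounds hV hS hd'
      refine ⟨p - 1, by omega, ?_, ?_⟩
      · simp only [Set.mem_ofPred_eq]
        obtain ⟨b1, b2, b3⟩ := owner_bottom (pos := pos) hV hS hd (x := p - 1) (by omega)
        have ge : e ≤ owner m n str pos S (p - 1, 0) := by
          rcases hez with h0 | ⟨c', hc', h0⟩
          · omega
          · rw [h0]; exact b3 c' hc' (by omega)
        by_contra hne
        rcases b1 with h0 | ⟨c', hc', h0⟩
        · omega
        · exact Nat.find_min hP (m := pos c') (by omega) ⟨c', hc', rfl, by omega⟩
      · have e1 : p - 1 + 1 = pos d := by omega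
        rw [e1]
        simp only [Set.mem_ofPred_eq]
        rw [owner_of_mem hd hd' (hV.pos_mem d (hS hd'))]
        omega)
  obtain ⟨u, v, w, ht, hu, hv, hw1, hw2⟩ := T
  have ht' := ht
  obtain ⟨⟨u1, u2⟩, ⟨v1, v2⟩, ⟨w1, w2⟩, huv, hvw, huw⟩ := ht
  simp only [Set.mem_ofPred_eq] at hu hv hw1 hw2
  have hvS : ∃ d ∈ S, owner m n str pos S v = pos d := by
    by_cases hs : rootOf (support str S) m n v ∈ support str S
    · obtain ⟨d, hd', h⟩ := hs
      exact ⟨d, hd', owner_eq_pos hd hd' h⟩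
    · have hne : ¬ ∃ c ∈ S, rootOf (support str S) m n v ∈ str c := hs
      have e' : owner m n str pos S v = (rootOf (support str S) m n v).1 := by
        rw [owner, dif_neg hne]
      rcases root_cases (n := n) (str := str) (S := S) v with h' | h' | h'
      · exact absurd h' hs
      · rw [h'] at e'; simp only at e'; omega
      · rw [h'] at e'; simp only at e'; omega
  obtain ⟨d, hd', hvd⟩ := hvS
  refine ⟨d, hd', u, v, w, ht', hu, hvd, ?_, by omega, by omega⟩
  -- If the owner of `w` is not `f`, it lies below `e` or above `f`; then the edges `v w` and `z z'`
  -- interleave.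
  by_contra hne
  have hcases : owner m n str pos S w < e ∨ f < owner m n str pos S w := by omega
  rcases hcases with h | h
  · exact not_interleaved hV hS hd hvw.symm hzz h (by omega) (by omega)
  · exact not_interleaved hV hS hd hzz hvw (by omega) (by omega) h

/-! ### Barriers -/

theorem path_of_fixed {T : Set (ℕ × ℕ)} {v : ℕ × ℕ} (h : parent T m n v = v) :
    path T m n v = {v} := by
  ext w
  constructor
  · rintro ⟨k, rfl⟩
    exact Function.iterate_fixed h k
  · rintro rfl
    exact mem_path_self _ _ _ _

theorem mem_path_iff {T : Set (ℕ × ℕ)} {v w : ℕ × ℕ} :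
    w ∈ path T m n v ↔ w = v ∨ w ∈ path T m n (parent T m n v) := by
  constructor
  · rintro ⟨_ | k, rfl⟩
    · exact Or.inl rfl
    · exact Or.inr ⟨k, rfl⟩
  · rintro (rfl | ⟨k, rfl⟩)
    · exact mem_path_self _ _ _ _
    · exact ⟨k + 1, rfl⟩

theorem owner_parent (v : ℕ × ℕ) :
    owner m n str pos S (parent (support str S) m n v) = owner m n str pos S v :=
  owner_congr (rootOf_parent _ _ _ v)

-- On the bottom row a path runs left and stops at the first foot of a string of `S` or at the
-- corner; this is its owner.
include hV hS hd in
theorem mem_path_bottom {x : ℕ} (hx : x < m) (w : ℕ × ℕ) :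
    w ∈ path (support str S) m n (x, 0) ↔
      w.2 = 0 ∧ owner m n str pos S (x, 0) ≤ w.1 ∧ w.1 ≤ x := by
  induction x with
  | zero =>
    have := not_mem_support hV hS (v := (0, 0)) (Or.inl rfl)
    rw [path_of_fixed (by simp [parent, this]), owner_left hV hS]
    obtain ⟨a, b⟩ := w
    simp only [Set.mem_singleton_iff, Prod.mk.injEq]
    omega
  | succ x ih =>
    by_cases hs : (x + 1, 0) ∈ support str S
    · rw [path_of_fixed (parent_of_mem_support hs)]
      obtain ⟨c, hc, h⟩ := hs
      have e := hV.pos_eq c (hS hc) _ h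
      rw [owner_of_mem hd hc h]
      obtain ⟨a, b⟩ := w
      simp only [Set.mem_singleton_iff, Prod.mk.injEq]
      omega
    · have e : parent (support str S) m n (x + 1, 0) = (x, 0) := by simp [parent, hs, hx.ne]
      have b := owner_bottom (pos := pos) hV hS hd (x := x) (by omega)
      rw [mem_path_iff, ← owner_parent, e, ih (by omega)]
      obtain ⟨a, b⟩ := w
      simp only [Prod.mk.injEq]
      omega

include hV hS hd in
/-- Off its owner, a string meets the path of `z` in a vertical segment or in its bottom row
point. -/
theorem exists_barrier (hn : 0 < n) {z : ℕ × ℕ} (hz : z.1 ≤ m) (hz' : z.2 ≤ n) :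
    ∃ x y₀ y p, x ≤ m ∧ y₀ ≤ y ∧ y ≤ n ∧ p ≤ m ∧ owner m n str pos S z ≤ p ∧
      ∀ c ∈ V, pos c ≠ owner m n str pos S z →
        (Disjoint (str c) (path (support str S) m n z) ↔
          (∀ t, y₀ ≤ t → t ≤ y → (x, t) ∉ str c) ∧
            ¬ (owner m n str pos S z < pos c ∧ pos c ≤ p)) := by
  obtain ⟨x, y⟩ := z
  simp only at hz hz'
  by_cases hc : x = 0 ∨ y = n
  -- From the left column or the top row the whole path stays on these two sides, where no string
  -- has a point; any degenerate barrier in the left column does.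
  · have h0 : owner m n str pos S (x, y) = 0 := by
      rcases hc with rfl | rfl
      · exact owner_left hV hS y
      · exact owner_top hV hS hn x
    refine ⟨0, 0, 0, 0, by omega, by omega, by omega, by omega, by omega, fun c hcV _ => ?_⟩
    have hp : ∀ w ∈ path (support str S) m n (x, y), w.1 = 0 ∨ w.2 = n := by
      rintro w ⟨k, rfl⟩
      induction k with
      | zero => exact hc
      | succ k ih =>
        rw [Function.iterate_succ_apply']
        have := not_mem_support hV hS (v := (parent (support str S) m n)^[k] (x, y)) (by omega)
        generalize (parent (support str S) m n)^[k] (x, y) = v at ih this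
        unfold parent
        rw [if_neg this]
        clear hd h0 hcV
        split_ifs <;> simp_all <;> omega
    refine iff_of_true ?_ ⟨fun t _ _ ht => ?_, by omega⟩
    · rw [Set.disjoint_left]
      intro w hw hw'
      have := hV.inside c hcV w hw
      have := hp w hw'
      omega
    · have := hV.inside c hcV _ ht
      simp only at this
      omega
  push Not at hc
  obtain ⟨hx0, hyn⟩ := hc
  -- Otherwise the path falls vertically until it enters a string of `S` or reaches row 0, where it
  -- runs left to its owner. A string of `V` has only its foot in row 0, so there the condition is
  -- that the foot does not lie under the path. The owner itself is exempt because `pos c` is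
  -- assumed to differ from it.
  have main : ∃ y₀ p, y₀ ≤ y ∧ p ≤ m ∧ owner m n str pos S (x, y) ≤ p ∧
      ∀ c ∈ V, pos c ≠ owner m n str pos S (x, y) →
        (Disjoint (str c) (path (support str S) m n (x, y)) ↔
          (∀ t, y₀ ≤ t → t ≤ y → (x, t) ∉ str c) ∧
            ¬ (owner m n str pos S (x, y) < pos c ∧ pos c ≤ p)) := by
    have hlt' : y < n := by omega
    clear hz' hyn
    induction y with
    | zero =>
      rcases hz.lt_or_eq with hlt | rfl
      · have b := owner_bottom (pos := pos) hV hS hd hlt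
        refine ⟨0, x, le_rfl, hz, b.2.1, fun c hcV hne => ?_⟩
        rw [Set.disjoint_left]
        constructor
        · intro h
          refine ⟨fun t h1 h2 ht => ?_, fun hp => ?_⟩
          · refine h ht ?_
            rw [mem_path_bottom (pos := pos) hV hS hd hlt]
            simp only; omega
          · refine h (hV.pos_mem c hcV) ?_
            rw [mem_path_bottom (pos := pos) hV hS hd hlt]
            exact ⟨rfl, hp.1.le, hp.2⟩
        · rintro ⟨-, h⟩ w hw hw'
          rw [mem_path_bottom (pos := pos) hV hS hd hlt] at hw'
          obtain ⟨a, b'⟩ := w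
          simp only at hw'
          obtain ⟨rfl, h1, h2⟩ := hw'
          have := hV.pos_eq c hcV _ hw
          omega
      · have o := owner_right hV hS (y := 0) hn
        refine ⟨0, x, le_rfl, le_rfl, o.le, fun c hcV _ => ?_⟩
        have hs := fun y => hV.inside c hcV (x, y)
        refine iff_of_true ?_ ⟨fun t _ _ ht => ?_, fun h => by rw [o] at h; omega⟩
        · rw [path_of_fixed (by simp [parent]), Set.disjoint_singleton_right]
          intro h; have := hs 0 h; simp only at this; omega
        · have := hs t ht; simp only at this; omega
    | succ y ih =>
      by_cases hs : (x, y + 1) ∈ support str S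
      · have e := path_of_fixed (parent_of_mem_support (m := m) (n := n) hs)
        have o : owner m n str pos S (x, y + 1) ≤ m := by
          obtain ⟨c, hc, h⟩ := hs
          rw [owner_of_mem hd hc h]
          exact (pos_bounds hV hS hc).2.le
        refine ⟨y + 1, _, le_rfl, o, le_rfl, fun c hcV hne => ?_⟩
        rw [e, Set.disjoint_singleton_right]
        constructor
        · intro h
          refine ⟨fun t h1 h2 => ?_, by omega⟩
          have : t = y + 1 := by omega
          rwa [this]
        · intro h; exact h.1 _ le_rfl le_rfl
      · have e : parent (support str S) m n (x, y + 1) = (x, y) := by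
          simp [parent, hs, hlt'.ne]
        have o := owner_parent (m := m) (n := n) (str := str) (pos := pos) (S := S) (x, y + 1)
        rw [e] at o
        obtain ⟨y₀, p, h1, h2, h3, h4⟩ := ih (by omega)
        refine ⟨y₀, p, by omega, h2, o ▸ h3, fun c hcV hne => ?_⟩
        have := h4 c hcV (by rwa [o])
        rw [← o]
        have hd' : Disjoint (str c) (path (support str S) m n (x, y + 1)) ↔
            Disjoint (str c) (path (support str S) m n (x, y)) ∧ (x, y + 1) ∉ str c := by
          simp only [Set.disjoint_left, mem_path_iff (v := (x, y + 1)), e]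
          constructor
          · intro h
            exact ⟨fun w hw hw' => h hw (Or.inr hw'), fun hw => h hw (Or.inl rfl)⟩
          · rintro ⟨h, h'⟩ w hw (rfl | hw')
            · exact h' hw
            · exact h hw hw'
        rw [hd', this]
        constructor
        · rintro ⟨⟨h5, h6⟩, h7⟩
          refine ⟨fun t ht ht' => ?_, h6⟩
          rcases Nat.lt_or_ge t (y + 1) with h | h
          · exact h5 t ht (by omega)
          · have : t = y + 1 := by omega
            rwa [this]
        · rintro ⟨h5, h6⟩
          exact ⟨⟨fun t ht ht' => h5 t ht (by omega), h6⟩, h5 _ (by omega) le_rfl⟩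
  obtain ⟨y₀, p, h1, h2, h3, h4⟩ := main
  exact ⟨x, y₀, y, p, hz, h1, hz', h2, h3, h4⟩

end Stems

end Lattice

end BoundaryLabeling

end

noncomputable section

namespace BoundaryLabeling

/-! ### Expressions with bounded sums and their evaluation on the machine -/

namespace Machine

/-- The array of the local variables of compiled expressions. -/
abbrev scratch : ℕ := 9

/-- The array whose cell `0` holds the bound of all loops. -/
abbrev params : ℕ := 10

/-- The bound of all loops. -/
abbrev bound (s : State) : ℕ := s.nat params 0

/-- Environments extended by a new variable `0`. -/
def push (i : ℕ) (ρ : ℕ → ℕ) : ℕ → ℕ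
  | 0 => i
  | k + 1 => ρ k

/-- Expressions over the memory, with variables as de Bruijn indices. -/
inductive BoundedExpr where
  | const (k : ℕ)
  | var (k : ℕ)
  | cell (a : ℕ) (e : BoundedExpr)
  | add (e f : BoundedExpr)
  | sub (e f : BoundedExpr)
  | le (e f : BoundedExpr)
  | realLe (a : ℕ) (e : BoundedExpr) (b : ℕ) (f : BoundedExpr)
  | ite (c e f : BoundedExpr)
  | sum (e : BoundedExpr)
  | bind (e f : BoundedExpr)

namespace BoundedExpr

/-- The value of an expression. -/
def eval (s : State) : BoundedExpr → (ℕ → ℕ) → ℕ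
  | const k, _ => k
  | var k, ρ => ρ k
  -- Reading the array of local variables is declared to give 0, so that values do not depend on
  -- what compiled code leaves there.
  | cell a e, ρ => if a = scratch then 0 else s.nat a (e.eval s ρ)
  | add e f, ρ => e.eval s ρ + f.eval s ρ
  | sub e f, ρ => e.eval s ρ - f.eval s ρ
  | le e f, ρ => if e.eval s ρ ≤ f.eval s ρ then 1 else 0
  | realLe a e b f, ρ => open Classical in
      if s.real a (e.eval s ρ) ≤ s.real b (f.eval s ρ) then 1 else 0
  | ite c e f, ρ => if c.eval s ρ ≤ 0 then f.eval s ρ else e.eval s ρ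
  | sum e, ρ => ∑ i ∈ Finset.range (bound s), e.eval s (push i ρ)
  | bind e f, ρ => f.eval s (push (e.eval s ρ) ρ)

/-- Renaming of variables. -/
def rename : (ℕ → ℕ) → BoundedExpr → BoundedExpr
  | _, const k => const k
  | r, var k => var (r k)
  | r, cell a e => cell a (e.rename r)
  | r, add e f => add (e.rename r) (f.rename r)
  | r, sub e f => sub (e.rename r) (f.rename r)
  | r, le e f => le (e.rename r) (f.rename r)
  | r, realLe a e b f => realLe a (e.rename r) b (f.rename r)
  | r, ite c e f => ite (c.rename r) (e.rename r) (f.rename r)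
  | r, sum e => sum (e.rename (push 0 fun k => r k + 1))
  | r, bind e f => bind (e.rename r) (f.rename (push 0 fun k => r k + 1))

theorem eval_rename (s : State) (e : BoundedExpr) (r ρ : ℕ → ℕ) :
    (e.rename r).eval s ρ = e.eval s fun k => ρ (r k) := by
  have lift : ∀ (r ρ : ℕ → ℕ) (i : ℕ), (fun k => push i ρ (push 0 (fun k => r k + 1) k)) =
      push i fun k => ρ (r k) := by
    intro r ρ i
    funext k
    cases k <;> rfl
  induction e generalizing r ρ with
  | const k => rfl
  | var k => rfl
  | cell a e ih => simp only [rename, eval, ih]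
  | add e f ih ih' => simp only [rename, eval, ih, ih']
  | sub e f ih ih' => simp only [rename, eval, ih, ih']
  | le e f ih ih' => simp only [rename, eval, ih, ih']
  | realLe a e b f ih ih' => simp only [rename, eval, ih, ih']
  | ite c e f ih ih' ih'' => simp only [rename, eval, ih, ih', ih'']
  | sum e ih => simp only [rename, eval, ih, lift]
  | bind e f ih ih' => simp only [rename, eval, ih, ih', lift]

end BoundedExpr

/-- The states `s` and `s'` agree except on the local variables. -/
def Agree (s s' : State) : Prop := s'.real = s.real ∧ ∀ a ≠ scratch, s'.nat a = s.nat a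

theorem Agree.trans {s s' s'' : State} (h : Agree s s') (h' : Agree s' s'') : Agree s s'' :=
  ⟨h'.1.trans h.1, fun a ha => (h'.2 a ha).trans (h.2 a ha)⟩

theorem Agree.bound {s s' : State} (h : Agree s s') : bound s' = bound s := by
  simp only [Machine.bound, h.2 params (by decide)]

theorem BoundedExpr.eval_congr {s s' : State} (h : Agree s s') (e : BoundedExpr) (ρ : ℕ → ℕ) :
    e.eval s' ρ = e.eval s ρ := by
  induction e generalizing ρ with
  | const k => rfl
  | var k => rfl
  | cell a e ih =>
    simp only [eval, ih]
    split_ifs with ha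
    · rfl
    · rw [h.2 a ha]
  | add e f ih ih' => simp only [eval, ih, ih']
  | sub e f ih ih' => simp only [eval, ih, ih']
  | le e f ih ih' => simp only [eval, ih, ih']
  | realLe a e b f ih ih' => simp only [eval, ih, ih', h.1]
  | ite c e f ih ih' ih'' => simp only [eval, ih, ih', ih'']
  | sum e ih => simp only [eval, ih, h.bound]
  | bind e f ih ih' => simp only [eval, ih, ih']

/-- `c` started in `s` halts in `s'` after at most `B` steps. -/
def Runs (c : Program) (s : State) (B : ℕ) (s' : State) : Prop := ∃ T ≤ B, Exec c s T s'

theorem Runs.mono {c : Program} {s s' : State} {B B' : ℕ} (h : Runs c s B s') (hB : B ≤ B') :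
    Runs c s B' s' := by
  obtain ⟨T, hT, h⟩ := h
  exact ⟨T, hT.trans hB, h⟩

theorem Runs.seq {c d : Program} {s s' s'' : State} {B B' : ℕ} (h : Runs c s B s')
    (h' : Runs d s' B' s'') : Runs (.seq c d) s (B + B') s'' := by
  obtain ⟨T, hT, h⟩ := h
  obtain ⟨T', hT', h'⟩ := h'
  exact ⟨T + T', by omega, .seq _ _ _ _ _ _ _ h h'⟩

theorem runs_setNat (s : State) (a : ℕ) (i e : NatExpr) :
    Runs (.setNat a i e) s (i.cost + e.cost + 1) (s.setNat a (i.eval s) (e.eval s)) :=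
  ⟨_, le_rfl, .setNat _ _ _ _⟩

theorem runs_setReal (s : State) (a : ℕ) (i : NatExpr) (e : RealExpr) :
    Runs (.setReal a i e) s (i.cost + e.cost + 1) (s.setReal a (i.eval s) (e.eval s)) :=
  ⟨_, le_rfl, .setReal _ _ _ _⟩

theorem runs_ite {b : Test} {c d : Program} {s s' : State} {B : ℕ}
    (h : b.Holds s → Runs c s B s') (h' : ¬ b.Holds s → Runs d s B s') :
    Runs (.ite b c d) s (b.cost + B + 1) s' := by
  by_cases hb : b.Holds s
  · obtain ⟨T, hT, h⟩ := h hb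
    exact ⟨_, by omega, .ite_true _ _ _ _ _ _ hb h⟩
  · obtain ⟨T, hT, h⟩ := h' hb
    exact ⟨_, by omega, .ite_false _ _ _ _ _ _ hb h⟩

/-- The loop that runs `c` with the counter `nat a k` from `0` up to the bound. -/
def loop (a k : ℕ) (c : Program) : Program :=
  .seq (.setNat a (.const k) (.const 0))
    (.while (.natLe (.add (.read a (.const k)) (.const 1)) (.read params (.const 0)))
      (.seq c (.setNat a (.const k) (.add (.read a (.const k)) (.const 1)))))

/-- The Hoare rule for `loop`. The invariant for `i + 1` is required after the increment of the
counter, because the counter is a memory cell like any other; the body has to preserve the counter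
and the bound. -/
theorem runs_loop {a k : ℕ} {c : Program} {N B : ℕ} (P : ℕ → State → Prop) (ha : a ≠ params)
    (step : ∀ i < N, ∀ s, P i s → s.nat a k = i → bound s = N →
      ∃ s', Runs c s B s' ∧ s'.nat a k = i ∧ bound s' = N ∧ P (i + 1) (s'.setNat a k (i + 1)))
    {s : State} (hs : bound s = N) (h0 : P 0 (s.setNat a k 0)) :
    ∃ s', Runs (loop a k c) s (N * (B + 20) + 20) s' ∧ P N s' ∧ bound s' = N := by
  have hset : ∀ (s : State) v, bound (s.setNat a k v) = bound s := by
    intro s v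
    simp only [bound, State.setNat]
    rw [Function.update_of_ne ha.symm]
  have hget : ∀ (s : State) v, (s.setNat a k v).nat a k = v := by
    intro s v; simp [State.setNat]
  have main : ∀ j i, i + j = N → ∀ s, P i s → s.nat a k = i → bound s = N →
      ∃ s', Runs (.while (.natLe (.add (.read a (.const k)) (.const 1)) (.read params (.const 0)))
        (.seq c (.setNat a (.const k) (.add (.read a (.const k)) (.const 1))))) s
        (j * (B + 20) + 10) s' ∧ P N s' ∧ bound s' = N := by
    intro j
    induction j with
    | zero =>
      intro i hi s hP hk hN
      refine ⟨s, ⟨_, ?_, .while_false _ _ _ ?_⟩, ?_, hN⟩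
      · simp [Test.cost, NatExpr.cost]
      · simp only [Test.Holds, NatExpr.eval]
        have : s.nat params 0 = N := hN
        omega
      · have : i = N := by omega
        exact this ▸ hP
    | succ j ih =>
      intro i hi s hP hk hN
      obtain ⟨s1, ⟨T1, hT1, e1⟩, k1, N1, P1⟩ := step i (by omega) s hP hk hN
      obtain ⟨s2, ⟨T2, hT2, e2⟩, P2, N2⟩ := ih (i + 1) (by omega) _ P1 (hget _ _)
        ((hset _ _).trans N1)
      have e3 := Exec.setNat s1 a (.const k) (.add (.read a (.const k)) (.const 1))
      simp only [NatExpr.eval, k1] at e3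
      refine ⟨s2, ⟨_, ?_, .while_true _ _ _ _ _ _ _ ?_ (.seq _ _ _ _ _ _ _ e1 e3) e2⟩, P2, N2⟩
      · simp only [Test.cost, NatExpr.cost]
        rw [Nat.add_mul]
        omega
      · simp only [Test.Holds, NatExpr.eval]
        have : s.nat params 0 = N := hN
        omega
  obtain ⟨s', h1, h2, h3⟩ := main N 0 (by omega) _ h0 (hget _ _) ((hset _ _).trans hs)
  refine ⟨s', ?_, h2, h3⟩
  refine ((runs_setNat s a (.const k) (.const 0)).seq h1).mono ?_
  simp only [NatExpr.cost]
  omega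

namespace BoundedExpr

/-- The local variable with index `n`. -/
def loc (n : ℕ) : NatExpr := .read scratch (.const n)

/-- Assignment to the local variable with index `n`. -/
def setLoc (n : ℕ) (e : NatExpr) : Program := .setNat scratch (.const n) e

/-- The program that writes the value of an expression into the local variable with index `n`;
the variables of the expression are in the local variables with the indices `env`. -/
def compile : BoundedExpr → (ℕ → ℕ) → ℕ → Program
  | const k, _, n => setLoc n (.const k)
  | var k, env, n => setLoc n (loc (env k))
  | cell a e, env, n =>
      .seq (e.compile env n) (setLoc n (if a = scratch then .const 0 else .read a (loc n)))
  | add e f, env, n =>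
      .seq (e.compile env n) (.seq (f.compile env (n + 1)) (setLoc n (.add (loc n) (loc (n + 1)))))
  | sub e f, env, n =>
      .seq (e.compile env n) (.seq (f.compile env (n + 1)) (setLoc n (.sub (loc n) (loc (n + 1)))))
  | le e f, env, n =>
      .seq (e.compile env n) (.seq (f.compile env (n + 1))
        (.ite (.natLe (loc n) (loc (n + 1))) (setLoc n (.const 1)) (setLoc n (.const 0))))
  | realLe a e b f, env, n =>
      .seq (e.compile env n) (.seq (f.compile env (n + 1))
        (.ite (.realLe (.read a (loc n)) (.read b (loc (n + 1)))) (setLoc n (.const 1))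
          (setLoc n (.const 0))))
  | ite c e f, env, n =>
      .seq (c.compile env n) (.ite (.natLe (loc n) (.const 0)) (f.compile env n) (e.compile env n))
  | sum e, env, n =>
      -- Cell `n` accumulates the sum, cell `n + 1` is the counter and the new variable, and the
      -- summand is computed from cell `n + 2` on.
      .seq (setLoc n (.const 0)) (loop scratch (n + 1)
        (.seq (e.compile (push (n + 1) env) (n + 2)) (setLoc n (.add (loc n) (loc (n + 2))))))
  | bind e f, env, n =>
      .seq (e.compile env n) (.seq (f.compile (push n env) (n + 1)) (setLoc n (loc (n + 1))))

/-- A bound for the number of steps of the compiled expression, in terms of the bound of all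
loops. -/
def steps : BoundedExpr → Polynomial ℕ
  | const _ => 20
  | var _ => 20
  | cell _ e => e.steps + 20
  | add e f => e.steps + f.steps + 20
  | sub e f => e.steps + f.steps + 20
  | le e f => e.steps + f.steps + 20
  | realLe _ e _ f => e.steps + f.steps + 20
  | ite c e f => c.steps + e.steps + f.steps + 20
  | sum e => Polynomial.X * (e.steps + 40) + 40
  | bind e f => e.steps + f.steps + 20

/-- The states agree except on the local variables with index at least `n`. -/
def AgreeBelow (n : ℕ) (s s' : State) : Prop :=
  Agree s s' ∧ ∀ k < n, s'.nat scratch k = s.nat scratch k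

theorem AgreeBelow.trans {n n' : ℕ} {s s' s'' : State} (h : AgreeBelow n s s')
    (h' : AgreeBelow n' s' s'') (hn : n ≤ n') : AgreeBelow n s s'' :=
  ⟨h.1.trans h'.1, fun k hk => (h'.2 k (by omega)).trans (h.2 k hk)⟩

theorem agreeBelow_set (n v : ℕ) (s : State) : AgreeBelow n s (s.setNat scratch n v) := by
  refine ⟨⟨rfl, fun a ha => ?_⟩, fun k hk => ?_⟩
  · simp [State.setNat, Function.update_of_ne ha]
  · simp [State.setNat, Function.update_of_ne hk.ne]

theorem set_get (s : State) (n v : ℕ) : (s.setNat scratch n v).nat scratch n = v := by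
  simp [State.setNat]

/-- The variables `env` hold the values `ρ`. -/
def EnvHolds (s : State) (env ρ : ℕ → ℕ) (n : ℕ) : Prop :=
  ∀ k, env k < n ∧ s.nat scratch (env k) = ρ k

theorem EnvHolds.mono {s s' : State} {env ρ : ℕ → ℕ} {n n' : ℕ} (h : EnvHolds s env ρ n)
    (hs : AgreeBelow n s s') (hn : n ≤ n') : EnvHolds s' env ρ n' :=
  fun k => ⟨(h k).1.trans_le hn, (hs.2 _ (h k).1).trans (h k).2⟩

theorem EnvHolds.push {s : State} {env ρ : ℕ → ℕ} {n : ℕ} (h : EnvHolds s env ρ n) {k : ℕ}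
    (hk : n ≤ k) : EnvHolds s (push k env) (push (s.nat scratch k) ρ) (k + 1) := by
  rintro (_ | j)
  · exact ⟨by simp [Machine.push], rfl⟩
  · exact ⟨(h j).1.trans_le (by omega), (h j).2⟩

/-- The pair of runs for a binary operation. -/
theorem runs_two {n : ℕ} {s : State} {p q : Program} {B B' : ℕ}
    {x y : ℕ}
    (h1 : ∃ s', Runs p s B s' ∧ AgreeBelow n s s' ∧ s'.nat scratch n = x)
    (h2 : ∀ s', AgreeBelow n s s' →
      ∃ s'', Runs q s' B' s'' ∧ AgreeBelow (n + 1) s' s'' ∧ s''.nat scratch (n + 1) = y)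
    {r : Program} {C v : ℕ}
    (h3 : ∀ s', s'.real = s.real → s'.nat scratch n = x → s'.nat scratch (n + 1) = y →
      Runs r s' C (s'.setNat scratch n v)) :
    ∃ s', Runs (.seq p (.seq q r)) s (B + B' + C) s' ∧ AgreeBelow n s s' ∧
      s'.nat scratch n = v := by
  obtain ⟨s1, r1, a1, v1⟩ := h1
  obtain ⟨s2, r2, a2, v2⟩ := h2 s1 a1
  have a12 : AgreeBelow n s s2 := a1.trans a2 (by omega)
  refine ⟨_, (r1.seq (r2.seq (h3 s2 a12.1.1 ?_ v2))).mono (by omega),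
    a12.trans (agreeBelow_set n v s2) le_rfl, set_get _ _ _⟩
  rw [a2.2 n (by omega), v1]

/-- The local variables form a stack: code for cell `n` changes only cells from `n` on, and its
variables lie below `n`. So values computed earlier survive the evaluation of later subexpressions.
-/
theorem compile_correct (e : BoundedExpr) (env ρ : ℕ → ℕ) (n : ℕ) (s : State)
    (h : EnvHolds s env ρ n) :
    ∃ s', Runs (e.compile env n) s (e.steps.eval (bound s)) s' ∧ AgreeBelow n s s' ∧
      s'.nat scratch n = e.eval s ρ := by
  induction e generalizing env ρ n s with
  | const k =>
    refine ⟨_, (runs_setNat _ _ _ _).mono ?_, agreeBelow_set _ _ _, set_get _ _ _⟩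
    simp [steps, NatExpr.cost]
  | var k =>
    refine ⟨_, (runs_setNat _ _ _ _).mono ?_, agreeBelow_set _ _ _, ?_⟩
    · simp [steps, NatExpr.cost, loc]
    · rw [NatExpr.eval, set_get]
      exact (h k).2
  | cell a e ih =>
    obtain ⟨s1, r1, a1, v1⟩ := ih env ρ n s h
    have r2 := runs_setNat s1 scratch (.const n)
      (if a = scratch then .const 0 else .read a (loc n))
    refine ⟨_, (r1.seq r2).mono ?_, a1.trans (agreeBelow_set _ _ _) le_rfl, ?_⟩
    · simp only [steps, Polynomial.eval_add, Polynomial.eval_ofNat]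
      split_ifs <;> simp [NatExpr.cost, loc]
    · simp only [NatExpr.eval]
      rw [set_get, eval]
      split_ifs with ha
      · rfl
      · simp only [NatExpr.eval, loc, v1, a1.1.2 a ha]
  | add e f ih ih' =>
    obtain ⟨s', r, a, v⟩ := runs_two (n := n)
      (r := setLoc n (.add (loc n) (loc (n + 1)))) (C := 20) (v := (add e f).eval s ρ)
      (ih env ρ n s h)
      (y := f.eval s ρ) (fun s' ha => by
        have := ih' env ρ (n + 1) s' (h.mono ha (by omega))
        rwa [ha.1.bound, eval_congr ha.1] at this)
      (fun s' _ hx hy => by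
        refine cast ?_ ((runs_setNat s' scratch (.const n) (.add (loc n) (loc (n + 1)))).mono
          (B' := 20) (by simp [NatExpr.cost, loc]))
        simp only [NatExpr.eval, loc, hx, hy, eval, setLoc])
    exact ⟨s', r.mono (by simp [steps]), a, v⟩
  | sub e f ih ih' =>
    obtain ⟨s', r, a, v⟩ := runs_two (n := n)
      (r := setLoc n (.sub (loc n) (loc (n + 1)))) (C := 20) (v := (sub e f).eval s ρ)
      (ih env ρ n s h)
      (y := f.eval s ρ) (fun s' ha => by
        have := ih' env ρ (n + 1) s' (h.mono ha (by omega))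
        rwa [ha.1.bound, eval_congr ha.1] at this)
      (fun s' _ hx hy => by
        refine cast ?_ ((runs_setNat s' scratch (.const n) (.sub (loc n) (loc (n + 1)))).mono
          (B' := 20) (by simp [NatExpr.cost, loc]))
        simp only [NatExpr.eval, loc, hx, hy, eval, setLoc])
    exact ⟨s', r.mono (by simp [steps]), a, v⟩
  | le e f ih ih' =>
    obtain ⟨s', r, a, v⟩ := runs_two (n := n)
      (r := .ite (.natLe (loc n) (loc (n + 1))) (setLoc n (.const 1)) (setLoc n (.const 0)))
      (C := 20) (v := (le e f).eval s ρ) (ih env ρ n s h)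
      (y := f.eval s ρ) (fun s' ha => by
        have := ih' env ρ (n + 1) s' (h.mono ha (by omega))
        rwa [ha.1.bound, eval_congr ha.1] at this)
      (fun s' _ hx hy => by
        refine (runs_ite (B := 10) (fun hb => ?_) (fun hb => ?_)).mono
          (by simp [NatExpr.cost, Test.cost, loc])
        all_goals simp only [Test.Holds, NatExpr.eval, loc, hx, hy] at hb
        · rw [eval, if_pos hb]
          exact (runs_setNat s' scratch (.const n) (.const 1)).mono (by simp [NatExpr.cost])
        · rw [eval, if_neg hb]
          exact (runs_setNat s' scratch (.const n) (.const 0)).mono (by simp [NatExpr.cost]))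
    exact ⟨s', r.mono (by simp [steps]), a, v⟩
  | realLe p e q f ih ih' =>
    obtain ⟨s', r, a, v⟩ := runs_two (n := n)
      (r := .ite (.realLe (.read p (loc n)) (.read q (loc (n + 1)))) (setLoc n (.const 1))
        (setLoc n (.const 0)))
      (C := 20) (v := (realLe p e q f).eval s ρ) (ih env ρ n s h)
      (y := f.eval s ρ) (fun s' ha => by
        have := ih' env ρ (n + 1) s' (h.mono ha (by omega))
        rwa [ha.1.bound, eval_congr ha.1] at this)
      (fun s' hr hx hy => by
        refine (runs_ite (B := 10) (fun hb => ?_) (fun hb => ?_)).mono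
          (by simp [NatExpr.cost, Test.cost, RealExpr.cost, loc])
        all_goals simp only [Test.Holds, NatExpr.eval, RealExpr.eval, loc, hx, hy, hr] at hb
        · rw [eval, if_pos hb]
          exact (runs_setNat s' scratch (.const n) (.const 1)).mono (by simp [NatExpr.cost])
        · rw [eval, if_neg hb]
          exact (runs_setNat s' scratch (.const n) (.const 0)).mono (by simp [NatExpr.cost]))
    exact ⟨s', r.mono (by simp [steps]), a, v⟩
  | ite c e f ih ih' ih'' =>
    obtain ⟨s1, r1, a1, v1⟩ := ih env ρ n s h
    by_cases hc : c.eval s ρ ≤ 0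
    · obtain ⟨s2, r2, a2, v2⟩ := ih'' env ρ n s1 (h.mono a1 le_rfl)
      refine ⟨s2, (r1.seq (runs_ite (fun _ => r2) (fun hb => absurd ?_ hb))).mono ?_,
        a1.trans a2 le_rfl, ?_⟩
      · simpa only [Test.Holds, NatExpr.eval, loc, v1] using hc
      · simp only [Test.cost, NatExpr.cost, loc, a1.1.bound, steps, Polynomial.eval_add,
          Polynomial.eval_ofNat]
        omega
      · rw [v2, eval_congr a1.1, eval, if_pos hc]
    · obtain ⟨s2, r2, a2, v2⟩ := ih' env ρ n s1 (h.mono a1 le_rfl)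
      refine ⟨s2, (r1.seq (runs_ite (fun hb => absurd hb ?_) (fun _ => r2))).mono ?_,
        a1.trans a2 le_rfl, ?_⟩
      · simpa only [Test.Holds, NatExpr.eval, loc, v1] using hc
      · simp only [Test.cost, NatExpr.cost, loc, a1.1.bound, steps, Polynomial.eval_add,
          Polynomial.eval_ofNat]
        omega
      · rw [v2, eval_congr a1.1, eval, if_neg hc]
  | sum e ih =>
    have r0 := runs_setNat s scratch (.const n) (.const 0)
    simp only [NatExpr.eval] at r0
    have a0 := agreeBelow_set n 0 s
    have inc : ∀ (s' : State) v, AgreeBelow (n + 1) s' (s'.setNat scratch (n + 1) v) :=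
      fun s' v => agreeBelow_set _ _ _
    obtain ⟨s2, r2, ⟨a2, v2⟩, -⟩ := runs_loop (a := scratch) (k := n + 1)
      (c := .seq (e.compile (push (n + 1) env) (n + 2)) (setLoc n (.add (loc n) (loc (n + 2)))))
      (N := bound s) (B := e.steps.eval (bound s) + 10)
      (fun i s' => AgreeBelow n s s' ∧
        s'.nat scratch n = ∑ j ∈ Finset.range i, e.eval s (push j ρ)) (by decide)
      (by
        rintro i hi s1 ⟨a1, v1⟩ hk hb
        have h1 : EnvHolds s1 (push (n + 1) env) (push i ρ) (n + 2) := by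
          have := (h.mono a1 le_rfl).push (k := n + 1) (by omega)
          rwa [hk] at this
        obtain ⟨s3, r3, a3, v3⟩ := ih _ _ _ _ h1
        have r4 := runs_setNat s3 scratch (.const n) (.add (loc n) (loc (n + 2)))
        have hn : s3.nat scratch n = s1.nat scratch n := a3.2 n (by omega)
        simp only [NatExpr.eval, loc] at r4
        rw [hn, v1, v3, eval_congr a1.1, ← Finset.sum_range_succ (fun j => e.eval s (push j ρ))] at r4
        refine ⟨_, (r3.seq r4).mono ?_, ?_, ?_, ?_, ?_⟩
        · rw [hb]; simp [NatExpr.cost]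
        · simp only [State.setNat, Function.update_self]
          rw [Function.update_of_ne (by omega), a3.2 (n + 1) (by omega), hk]
        · rw [(agreeBelow_set n _ s3).1.bound, a3.1.bound, hb]
        · exact ((a1.trans a3 (by omega)).trans (agreeBelow_set n _ s3) le_rfl).trans
            (inc _ _) (by omega)
        · rw [(inc _ _).2 n (by omega), set_get])
      (s := s.setNat scratch n 0) a0.1.bound
      ⟨a0.trans (inc _ _) (by omega), by rw [(inc _ _).2 n (by omega), set_get]; simp⟩
    refine ⟨s2, (r0.seq r2).mono ?_, a2, v2⟩
    simp only [NatExpr.cost, steps, Polynomial.eval_add, Polynomial.eval_mul, Polynomial.eval_X,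
      Polynomial.eval_ofNat]
    have : bound s * (Polynomial.eval (bound s) e.steps + 10 + 20) ≤
      bound s * (Polynomial.eval (bound s) e.steps + 40) := Nat.mul_le_mul_left _ (by omega)
    omega
  | bind e f ih ih' =>
    obtain ⟨s1, r1, a1, v1⟩ := ih env ρ n s h
    have h1 := (h.mono a1 le_rfl).push (k := n) le_rfl
    rw [v1] at h1
    obtain ⟨s2, r2, a2, v2⟩ := ih' _ _ _ _ h1
    have r3 := runs_setNat s2 scratch (.const n) (loc (n + 1))
    simp only [NatExpr.eval, loc] at r3
    rw [v2, eval_congr a1.1] at r3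
    refine ⟨_, (r1.seq (r2.seq r3)).mono ?_,
      (a1.trans a2 (by omega)).trans (agreeBelow_set _ _ _) le_rfl, ?_⟩
    · simp only [a1.1.bound, NatExpr.cost, steps, Polynomial.eval_add, Polynomial.eval_ofNat]
      omega
    · rw [set_get, eval]

end BoundedExpr

end Machine

end BoundaryLabeling

end

noncomputable section

namespace BoundaryLabeling

namespace Machine

/-! ### Definable functions -/

open Classical in
/-- `if p then a else b`, for an arbitrary proposition. -/
def pick {α : Type*} (p : Prop) (a b : α) : α := if p then a else b

theorem pick_pos {α : Type*} {p : Prop} (h : p) (a b : α) : pick p a b = a := if_pos h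

theorem pick_neg {α : Type*} {p : Prop} (h : ¬ p) (a b : α) : pick p a b = b := if_neg h

/-- A function of the memory and of numerical arguments that is computed by an expression. -/
def Definable (f : State → (ℕ → ℕ) → ℕ) : Prop :=
  ∃ e : BoundedExpr, ∀ s ρ, e.eval s ρ = f s ρ

/-- A relation that is decided by an expression. -/
def DefinableRel (p : State → (ℕ → ℕ) → Prop) : Prop := Definable fun s ρ => pick (p s ρ) 1 0

namespace Definable

variable {f g h : State → (ℕ → ℕ) → ℕ} {p q : State → (ℕ → ℕ) → Prop}

theorem const (k : ℕ) : Definable fun _ _ => k := ⟨.const k, fun _ _ => rfl⟩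

theorem var (k : ℕ) : Definable fun _ ρ => ρ k := ⟨.var k, fun _ _ => rfl⟩

theorem cell {a : ℕ} (ha : a ≠ scratch) (hf : Definable f) :
    Definable fun s ρ => s.nat a (f s ρ) := by
  obtain ⟨e, he⟩ := hf
  exact ⟨.cell a e, fun s ρ => by simp only [BoundedExpr.eval, if_neg ha, he]⟩

theorem add (hf : Definable f) (hg : Definable g) : Definable fun s ρ => f s ρ + g s ρ := by
  obtain ⟨e, he⟩ := hf
  obtain ⟨e', he'⟩ := hg
  exact ⟨.add e e', fun s ρ => by simp only [BoundedExpr.eval, he, he']⟩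

theorem sub (hf : Definable f) (hg : Definable g) : Definable fun s ρ => f s ρ - g s ρ := by
  obtain ⟨e, he⟩ := hf
  obtain ⟨e', he'⟩ := hg
  exact ⟨.sub e e', fun s ρ => by simp only [BoundedExpr.eval, he, he']⟩

theorem pick (hp : DefinableRel p) (hf : Definable f) (hg : Definable g) :
    Definable fun s ρ => Machine.pick (p s ρ) (f s ρ) (g s ρ) := by
  obtain ⟨c, hc⟩ := hp
  obtain ⟨e, he⟩ := hf
  obtain ⟨e', he'⟩ := hg
  refine ⟨.ite c e e', fun s ρ => ?_⟩
  simp only [BoundedExpr.eval, hc, he, he']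
  by_cases h : p s ρ
  · simp [pick_pos h]
  · simp [pick_neg h]

theorem sum {f : State → (ℕ → ℕ) → ℕ → ℕ}
    (hf : Definable fun s ρ => f s (fun k => ρ (k + 1)) (ρ 0)) :
    Definable fun s ρ => ∑ i ∈ Finset.range (Machine.bound s), f s ρ i := by
  obtain ⟨e, he⟩ := hf
  refine ⟨.sum e, fun s ρ => ?_⟩
  simp only [BoundedExpr.eval, he]
  rfl

theorem app₁ {F : State → ℕ → ℕ} (hF : Definable fun s ρ => F s (ρ 0)) (hf : Definable f) :
    Definable fun s ρ => F s (f s ρ) := by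
  obtain ⟨E, hE⟩ := hF
  obtain ⟨e, he⟩ := hf
  refine ⟨.bind e E, fun s ρ => ?_⟩
  simp only [BoundedExpr.eval, hE, he]
  rfl

theorem app₂ {F : State → ℕ → ℕ → ℕ} (hF : Definable fun s ρ => F s (ρ 0) (ρ 1))
    (hf : Definable f) (hg : Definable g) : Definable fun s ρ => F s (f s ρ) (g s ρ) := by
  obtain ⟨E, hE⟩ := hF
  obtain ⟨e, he⟩ := hf
  obtain ⟨e', he'⟩ := hg
  -- The last argument is bound first, so that the first one becomes variable 0. Each later argument
  -- is evaluated under the binders already introduced and must be shifted past them.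
  refine ⟨.bind e' (.bind (e.rename (· + 1)) E), fun s ρ => ?_⟩
  simp only [BoundedExpr.eval, BoundedExpr.eval_rename, hE, he, he']
  rfl

theorem app₃ {F : State → ℕ → ℕ → ℕ → ℕ} (hF : Definable fun s ρ => F s (ρ 0) (ρ 1) (ρ 2))
    (hf : Definable f) (hg : Definable g) (hh : Definable h) :
    Definable fun s ρ => F s (f s ρ) (g s ρ) (h s ρ) := by
  obtain ⟨E, hE⟩ := hF
  obtain ⟨e, he⟩ := hf
  obtain ⟨e', he'⟩ := hg
  obtain ⟨e'', he''⟩ := hh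
  refine ⟨.bind e'' (.bind (e'.rename (· + 1)) (.bind (e.rename (· + 2)) E)), fun s ρ => ?_⟩
  simp only [BoundedExpr.eval, BoundedExpr.eval_rename, hE, he, he', he'']
  rfl

end Definable

namespace DefinableRel

variable {f g h : State → (ℕ → ℕ) → ℕ} {p q : State → (ℕ → ℕ) → Prop}

theorem le (hf : Definable f) (hg : Definable g) : DefinableRel fun s ρ => f s ρ ≤ g s ρ := by
  obtain ⟨e, he⟩ := hf
  obtain ⟨e', he'⟩ := hg
  refine ⟨.le e e', fun s ρ => ?_⟩
  simp only [BoundedExpr.eval, he, he']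
  split_ifs with h
  · rw [pick_pos h]
  · rw [pick_neg h]

theorem realLe (a b : ℕ) (hf : Definable f) (hg : Definable g) :
    DefinableRel fun s ρ => s.real a (f s ρ) ≤ s.real b (g s ρ) := by
  obtain ⟨e, he⟩ := hf
  obtain ⟨e', he'⟩ := hg
  refine ⟨.realLe a e b e', fun s ρ => ?_⟩
  simp only [BoundedExpr.eval, he, he']
  split_ifs with h
  · rw [pick_pos h]
  · rw [pick_neg h]

theorem congr (hp : DefinableRel p) (hpq : ∀ s ρ, p s ρ ↔ q s ρ) : DefinableRel q := by
  have : p = q := by funext s ρ; exact propext (hpq s ρ)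
  exact this ▸ hp

theorem and (hp : DefinableRel p) (hq : DefinableRel q) :
    DefinableRel fun s ρ => p s ρ ∧ q s ρ := by
  obtain ⟨e, he⟩ := Definable.pick hp hq (Definable.const 0)
  refine ⟨e, fun s ρ => ?_⟩
  rw [he]
  by_cases h : p s ρ <;> by_cases h' : q s ρ <;> simp [pick, h, h']

theorem not (hp : DefinableRel p) : DefinableRel fun s ρ => ¬ p s ρ := by
  obtain ⟨e, he⟩ := Definable.pick hp (Definable.const 0) (Definable.const 1)
  refine ⟨e, fun s ρ => ?_⟩
  rw [he]
  by_cases h : p s ρ <;> simp [pick, h]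

theorem or (hp : DefinableRel p) (hq : DefinableRel q) :
    DefinableRel fun s ρ => p s ρ ∨ q s ρ :=
  (hp.not.and hq.not).not.congr fun _ _ => by tauto

theorem imp (hp : DefinableRel p) (hq : DefinableRel q) :
    DefinableRel fun s ρ => p s ρ → q s ρ :=
  (hp.and hq.not).not.congr fun _ _ => by tauto

theorem lt (hf : Definable f) (hg : Definable g) : DefinableRel fun s ρ => f s ρ < g s ρ :=
  (le hg hf).not.congr fun _ _ => not_le

theorem eq (hf : Definable f) (hg : Definable g) : DefinableRel fun s ρ => f s ρ = g s ρ :=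
  ((le hf hg).and (le hg hf)).congr fun _ _ => le_antisymm_iff.symm

theorem realLt (a b : ℕ) (hf : Definable f) (hg : Definable g) :
    DefinableRel fun s ρ => s.real a (f s ρ) < s.real b (g s ρ) :=
  (realLe b a hg hf).not.congr fun _ _ => not_le

/-- A bounded existential quantifier is the statement that the sum of an indicator is at least 1. -/
theorem ex {p : State → (ℕ → ℕ) → ℕ → Prop}
    (hp : DefinableRel fun s ρ => p s (fun k => ρ (k + 1)) (ρ 0)) :
    DefinableRel fun s ρ => ∃ i < bound s, p s ρ i := by
  refine (le (Definable.const 1) (Definable.sum (f := fun s ρ i => pick (p s ρ i) 1 0) hp)).congr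
    fun s ρ => ?_
  constructor
  · intro h
    by_contra hne
    push Not at hne
    rw [Finset.sum_eq_zero fun i hi => pick_neg (hne i (Finset.mem_range.1 hi)) _ _] at h
    omega
  · rintro ⟨i, hi, h⟩
    have := Finset.single_le_sum (f := fun i => pick (p s ρ i) 1 0) (fun _ _ => Nat.zero_le _)
      (Finset.mem_range.2 hi)
    simpa only [pick_pos h] using this

theorem all {p : State → (ℕ → ℕ) → ℕ → Prop}
    (hp : DefinableRel fun s ρ => p s (fun k => ρ (k + 1)) (ρ 0)) :
    DefinableRel fun s ρ => ∀ i < bound s, p s ρ i :=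
  (ex (p := fun s ρ i => ¬ p s ρ i) hp.not).not.congr fun _ _ => by push Not; rfl

theorem pick_const (p : Prop) : DefinableRel fun _ _ => p := Definable.const _

theorem app₁ {F : State → ℕ → Prop} (hF : DefinableRel fun s ρ => F s (ρ 0))
    (hf : Definable f) : DefinableRel fun s ρ => F s (f s ρ) :=
  Definable.app₁ (F := fun s a => pick (F s a) 1 0) hF hf

/-- For a range that is a fixed number and not the bound of the loops, the quantifier is unrolled
into a disjunction. -/
theorem exConst {p : State → (ℕ → ℕ) → ℕ → Prop} (c : ℕ)
    (hp : DefinableRel fun s ρ => p s (fun k => ρ (k + 1)) (ρ 0)) :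
    DefinableRel fun s ρ => ∃ i < c, p s ρ i := by
  induction c with
  | zero => exact (pick_const False).congr fun _ _ => by simp
  | succ c ih =>
    have hc : DefinableRel fun s ρ => p s ρ c := by
      obtain ⟨e, he⟩ := hp
      refine ⟨.bind (.const c) e, fun s ρ => ?_⟩
      simp only [BoundedExpr.eval, he]
      rfl
    refine (ih.or hc).congr fun s ρ => ⟨?_, ?_⟩
    · rintro (⟨i, hi, h⟩ | h)
      exacts [⟨i, by omega, h⟩, ⟨c, by omega, h⟩]
    · rintro ⟨i, hi, h⟩
      rcases (by omega : i < c ∨ i = c) with h' | rfl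
      exacts [Or.inl ⟨i, h', h⟩, Or.inr h]

theorem app₂ {F : State → ℕ → ℕ → Prop} (hF : DefinableRel fun s ρ => F s (ρ 0) (ρ 1))
    (hf : Definable f) (hg : Definable g) : DefinableRel fun s ρ => F s (f s ρ) (g s ρ) :=
  Definable.app₂ (F := fun s a b => pick (F s a b) 1 0) hF hf hg

theorem app₃ {F : State → ℕ → ℕ → ℕ → Prop} (hF : DefinableRel fun s ρ => F s (ρ 0) (ρ 1) (ρ 2))
    (hf : Definable f) (hg : Definable g) (hh : Definable h) :
    DefinableRel fun s ρ => F s (f s ρ) (g s ρ) (h s ρ) :=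
  Definable.app₃ (F := fun s a b c => pick (F s a b c) 1 0) hF hf hg hh

end DefinableRel

/-! ### Programs that fill arrays -/

open BoundedExpr

/-- `nat a k := e`. -/
def assign (a k : ℕ) (e : BoundedExpr) : Program :=
  .seq (e.compile (fun _ => 0) 1) (.setNat a (.const k) (loc 1))

/-- The states agree except on the local variables and on the array `a` of natural numbers. -/
def AgreeOff (a : ℕ) (s s' : State) : Prop :=
  s'.real = s.real ∧ ∀ b, b ≠ scratch → b ≠ a → s'.nat b = s.nat b

theorem envHolds_zero (s : State) {i n : ℕ} (hi : s.nat scratch 0 = i) (hn : 0 < n) :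
    EnvHolds s (fun _ => 0) (fun _ => i) n := fun _ => ⟨hn, hi⟩

theorem runs_assign {a : ℕ} (k : ℕ) (e : BoundedExpr) (s : State) (ha : a ≠ scratch) :
    ∃ s', Runs (assign a k e) s (e.steps.eval (bound s) + 10) s' ∧ AgreeOff a s s' ∧
      s'.nat a = Function.update (s.nat a) k (e.eval s fun _ => s.nat scratch 0) := by
  obtain ⟨s1, r1, a1, v1⟩ := compile_correct e _ _ 1 s (envHolds_zero s rfl one_pos)
  have r2 := runs_setNat s1 a (.const k) (loc 1)
  refine ⟨_, (r1.seq r2).mono (by simp [NatExpr.cost, loc]), ⟨a1.1.1, fun b hb hb' => ?_⟩, ?_⟩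
  · simp only [State.setNat]
    rw [Function.update_of_ne hb', a1.1.2 b hb]
  · simp only [State.setNat, Function.update_self, NatExpr.eval, loc, v1]
    rw [a1.1.2 a ha]

/-- `nat a i := e` for all `i` below the bound; `i` is the variable of `e`. -/
def fillNat (a : ℕ) (e : BoundedExpr) : Program :=
  loop scratch 0 (.seq (e.compile (fun _ => 0) 1) (.setNat a (loc 0) (loc 1)))

/-- The loop changes the array `a` while it runs, so `e` has to have the same value in all memories
that agree off `a`. -/
theorem runs_fillNat {a : ℕ} (e : BoundedExpr) (s : State) (ha : a ≠ scratch) (ha' : a ≠ params)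
    (v : ℕ → ℕ)
    (hv : ∀ s', AgreeOff a s s' → ∀ i < bound s, e.eval s' (fun _ => i) = v i) :
    ∃ s', Runs (fillNat a e) s ((Polynomial.X * (e.steps + 30) + 20 : Polynomial ℕ).eval (bound s))
      s' ∧ AgreeOff a s s' ∧ ∀ i, s'.nat a i = if i < bound s then v i else s.nat a i := by
  have hb : ∀ {s'}, AgreeOff a s s' → bound s' = bound s := by
    intro s' h; simp only [bound, h.2 params (by decide) ha'.symm]
  obtain ⟨s', r, ⟨h1, h2⟩, -⟩ := runs_loop (a := scratch) (k := 0)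
    (c := .seq (e.compile (fun _ => 0) 1) (.setNat a (loc 0) (loc 1))) (N := bound s)
    (B := e.steps.eval (bound s) + 10)
    (fun j s' => AgreeOff a s s' ∧ ∀ i, s'.nat a i = if i < j then v i else s.nat a i)
    (by decide)
    (by
      rintro i hi s1 ⟨a1, v1⟩ hk hN
      obtain ⟨s2, r2, a2, v2⟩ := compile_correct e _ _ 1 s1 (envHolds_zero s1 hk one_pos)
      have r3 := runs_setNat s2 a (loc 0) (loc 1)
      simp only [NatExpr.eval, loc] at r3
      rw [v2, a2.2 0 one_pos, hk, hv s1 a1 i hi] at r3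
      refine ⟨_, (r2.seq r3).mono ?_, ?_, ?_, ⟨a1.1 ▸ a2.1.1, fun b hb hb' => ?_⟩, fun j => ?_⟩
      · rw [hN]; simp [NatExpr.cost]
      · simp only [State.setNat]
        rw [Function.update_of_ne ha.symm, a2.2 0 one_pos, hk]
      · simp only [bound, State.setNat]
        rw [Function.update_of_ne ha'.symm, a2.1.2 params (by decide)]
        exact hN
      · simp only [State.setNat]
        rw [Function.update_of_ne hb, Function.update_of_ne hb', a2.1.2 b hb, a1.2 b hb hb']
      · simp only [State.setNat]
        rw [Function.update_of_ne ha, Function.update_self, a2.1.2 a ha]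
        rcases eq_or_ne j i with rfl | hj
        · rw [Function.update_self, if_pos (by omega)]
        · rw [Function.update_of_ne hj, v1]
          by_cases hji : j < i
          · rw [if_pos hji, if_pos (by omega)]
          · rw [if_neg hji, if_neg (by omega)])
    (s := s) rfl ⟨⟨rfl, fun b hb _ => by simp [State.setNat, Function.update_of_ne hb]⟩,
      fun i => by simp [State.setNat, Function.update_of_ne ha]⟩
  refine ⟨s', r.mono ?_, h1, h2⟩
  simp only [Polynomial.eval_add, Polynomial.eval_mul, Polynomial.eval_X, Polynomial.eval_ofNat]
  exact le_rfl

/-- For all `i` below the bound, if the guard `g` is not zero, `real a d` is set to the mean of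
`real b e` and `real c f`. -/
def fillReal (a b c : ℕ) (g d e f : BoundedExpr) : Program :=
  loop scratch 0 (.seq (g.compile (fun _ => 0) 1) (.ite (.natLe (loc 1) (.const 0)) .skip
    (.seq (d.compile (fun _ => 0) 1) (.seq (e.compile (fun _ => 0) 2)
      (.seq (f.compile (fun _ => 0) 3)
        (.setReal a (loc 1) (.half (.add (.read b (loc 2)) (.read c (loc 3))))))))))

/-- The contents of the arrays of real numbers after `i` rounds of `fillReal`. -/
def realFill (a b c : ℕ) (g d e f : ℕ → ℕ) (r : ℕ → ℕ → ℝ) : ℕ → ℕ → ℕ → ℝ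
  | 0 => r
  | i + 1 =>
    let r' := realFill a b c g d e f r i
    if g i ≤ 0 then r'
    else Function.update r' a (Function.update (r' a) (d i) ((r' b (e i) + r' c (f i)) / 2))

/-- The states have the same natural numbers except for the local variables. -/
def AgreeNat (s s' : State) : Prop := ∀ a ≠ scratch, s'.nat a = s.nat a

/-- Guard and indices are required to depend only on the natural numbers in the memory, which the
loop does not touch. The real numbers may feed back into the loop, hence the recursive description
by `realFill`. With equal sources the mean is a copy. -/
theorem runs_fillReal (a b c : ℕ) (g d e f : BoundedExpr) (s : State) (vg vd ve vf : ℕ → ℕ)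
    (hg : ∀ s', AgreeNat s s' → ∀ i < bound s, g.eval s' (fun _ => i) = vg i)
    (hd : ∀ s', AgreeNat s s' → ∀ i < bound s, d.eval s' (fun _ => i) = vd i)
    (he : ∀ s', AgreeNat s s' → ∀ i < bound s, e.eval s' (fun _ => i) = ve i)
    (hf : ∀ s', AgreeNat s s' → ∀ i < bound s, f.eval s' (fun _ => i) = vf i) :
    ∃ s', Runs (fillReal a b c g d e f) s
      ((Polynomial.X * (g.steps + d.steps + e.steps + f.steps + 60) + 20 : Polynomial ℕ).eval
        (bound s)) s' ∧
      AgreeNat s s' ∧ s'.real = realFill a b c vg vd ve vf s.real (bound s) := by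
  obtain ⟨s', r, ⟨h1, h2⟩, -⟩ := runs_loop (a := scratch) (k := 0)
    (c := .seq (g.compile (fun _ => 0) 1) (.ite (.natLe (loc 1) (.const 0)) .skip
    (.seq (d.compile (fun _ => 0) 1) (.seq (e.compile (fun _ => 0) 2)
      (.seq (f.compile (fun _ => 0) 3)
        (.setReal a (loc 1) (.half (.add (.read b (loc 2)) (.read c (loc 3))))))))))
    (N := bound s)
    (B := (g.steps + d.steps + e.steps + f.steps + 40).eval (bound s))
    (fun j s' => AgreeNat s s' ∧ s'.real = realFill a b c vg vd ve vf s.real j)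
    (by decide)
    (by
      rintro i hi s1 ⟨a1, v1⟩ hk hN
      have key : ∀ s', AgreeBelow 1 s1 s' → AgreeNat s s' ∧ s'.nat scratch 0 = i ∧
          bound s' = bound s ∧ s'.real = realFill a b c vg vd ve vf s.real i := fun s' h =>
        ⟨fun b hb => (h.1.2 b hb).trans (a1 b hb), (h.2 0 one_pos).trans hk,
          h.1.bound.trans hN, h.1.1.trans v1⟩
      obtain ⟨s2, r2, a2, v2⟩ := compile_correct g _ _ 1 s1 (envHolds_zero s1 hk one_pos)
      obtain ⟨k21, k22, k23, k24⟩ := key s2 a2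
      rw [hg s1 a1 i hi] at v2
      obtain ⟨s3, r3, a3, v3⟩ := compile_correct d _ _ 1 s2 (envHolds_zero s2 k22 (by omega))
      obtain ⟨k31, k32, k33, k34⟩ := key s3 (a2.trans a3 le_rfl)
      rw [hd s2 k21 i hi] at v3
      obtain ⟨s4, r4, a4, v4⟩ := compile_correct e _ _ 2 s3 (envHolds_zero s3 k32 (by omega))
      obtain ⟨k41, k42, k43, k44⟩ := key s4 ((a2.trans a3 le_rfl).trans a4 (by omega))
      rw [he s3 k31 i hi] at v4
      obtain ⟨s5, r5, a5, v5⟩ := compile_correct f _ _ 3 s4 (envHolds_zero s4 k42 (by omega))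
      obtain ⟨k51, k52, k53, k54⟩ := key s5
        (((a2.trans a3 le_rfl).trans a4 (by omega)).trans a5 (by omega))
      rw [hf s4 k41 i hi] at v5
      have r6 := runs_setReal s5 a (loc 1) (.half (.add (.read b (loc 2)) (.read c (loc 3))))
      have e1 : s5.nat scratch 1 = vd i := by
        rw [a5.2 1 (by omega), a4.2 1 (by omega), v3]
      have e2 : s5.nat scratch 2 = ve i := by rw [a5.2 2 (by omega), v4]
      simp only [NatExpr.eval, RealExpr.eval, loc, e1, e2, v5, NatExpr.cost, RealExpr.cost] at r6
      rw [hN] at r2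
      rw [k23] at r3
      rw [k33] at r4
      rw [k43] at r5
      have fin : ∀ s' : State, s'.nat = s2.nat ∨ s'.nat = s5.nat → s'.nat scratch 0 = i ∧
          bound s' = bound s ∧ AgreeNat s (s'.setNat scratch 0 (i + 1)) := by
        intro s' hs'
        have hs : s'.nat scratch 0 = i ∧ bound s' = bound s ∧ AgreeNat s s' := by
          rcases hs' with h | h
          · exact ⟨by rw [h, k22], by rw [bound, h]; exact k23, fun b hb => by rw [h, k21 b hb]⟩
          · exact ⟨by rw [h, k52], by rw [bound, h]; exact k53, fun b hb => by rw [h, k51 b hb]⟩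
        refine ⟨hs.1, hs.2.1, fun b hb => ?_⟩
        rw [← hs.2.2 b hb]
        simp only [State.setNat]
        rw [Function.update_of_ne hb]
      by_cases h0 : vg i ≤ 0
      · obtain ⟨f1, f2, f3⟩ := fin s2 (Or.inl rfl)
        refine ⟨s2, (r2.seq (runs_ite (B := 1) (fun _ => ⟨1, le_rfl, .skip _⟩)
          (fun hb => absurd ?_ hb))).mono ?_, f1, f2, f3, ?_⟩
        · simpa only [Test.Holds, NatExpr.eval, loc, v2] using h0
        · simp only [Test.cost, NatExpr.cost, loc, Polynomial.eval_add, Polynomial.eval_ofNat]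
          omega
        · simp only [realFill, if_pos h0]
          exact k24
      · obtain ⟨f1, f2, f3⟩ := fin (s5.setReal a (vd i) ((s5.real b (ve i) + s5.real c (vf i)) / 2))
          (Or.inr rfl)
        refine ⟨_, (r2.seq (runs_ite (fun hb => absurd hb ?_)
          (fun _ => r3.seq (r4.seq (r5.seq r6))))).mono ?_, f1, f2, f3, ?_⟩
        · simpa only [Test.Holds, NatExpr.eval, loc, v2] using h0
        · simp only [Test.cost, NatExpr.cost, loc, Polynomial.eval_add, Polynomial.eval_ofNat]
          omega
        · simp only [realFill, if_neg h0, State.setReal, State.setNat, k54])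
    (s := s) rfl ⟨fun b hb => by simp [State.setNat, Function.update_of_ne hb], rfl⟩
  refine ⟨s', r.mono ?_, h1, h2⟩
  simp only [Polynomial.eval_add, Polynomial.eval_mul, Polynomial.eval_X, Polynomial.eval_ofNat]
  exact le_rfl

end Machine

end BoundaryLabeling

end

noncomputable section

namespace BoundaryLabeling

open Machine (pick pick_pos pick_neg)

/-! ### Routes in a frame -/

/-- The intervals spanned by `a`, `b` and by `c`, `d` intersect. -/
def Meets {α : Type*} [LinearOrder α] (a b c d : α) : Prop :=
  (a ≤ c ∨ a ≤ d ∨ b ≤ c ∨ b ≤ d) ∧ (c ≤ a ∨ c ≤ b ∨ d ≤ a ∨ d ≤ b)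

theorem meets_iff {α : Type*} [LinearOrder α] {a b c d : α} :
    Meets a b c d ↔ ∃ x, x ∈ Set.uIcc a b ∧ x ∈ Set.uIcc c d := by
  unfold Meets
  constructor
  · rintro ⟨h1, h2⟩
    -- Two intervals that intersect contain the larger of their lower ends.
    refine ⟨max (min a b) (min c d), ?_, ?_⟩ <;>
    · simp only [Set.uIcc, Set.mem_Icc, le_max_iff, max_le_iff, min_le_iff, le_min_iff]
      grind
  · rintro ⟨x, h1, h2⟩
    simp only [Set.mem_uIcc] at h1 h2
    grind

theorem Meets.symm {α : Type*} [LinearOrder α] {a b c d : α} (h : Meets a b c d) :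
    Meets c d a b := by
  unfold Meets at *; tauto

/-- The coordinates of an instance, in an arbitrary linear order. -/
structure Frame (α : Type*) where
  n : ℕ
  nobs : ℕ
  N : ℕ
  side : ℕ → ℕ
  len : ℕ → ℕ
  rim : ℕ → α
  sx : ℕ → α
  sy : ℕ → α
  lo : ℕ → α
  hi : ℕ → α
  ox : ℕ → α
  oy : ℕ → α

namespace Frame

variable {α β : Type*}

/-- The image of a frame. -/
def map (φ : α → β) (F : Frame α) : Frame β where
  n := F.n
  nobs := F.nobs
  N := F.N
  side := F.side
  len := F.len
  rim i := φ (F.rim i)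
  sx i := φ (F.sx i)
  sy i := φ (F.sy i)
  lo i := φ (F.lo i)
  hi i := φ (F.hi i)
  ox i := φ (F.ox i)
  oy i := φ (F.oy i)

variable (F : Frame α)

/-- The label `j` is on the bottom or on the top side. -/
def Upright (j : ℕ) : Prop := F.side j ≤ 1

/-- The coordinate of the line through the side of the label `j`. -/
def goal (j : ℕ) : α :=
  pick (F.side j = 0) (F.rim 2) (pick (F.side j = 1) (F.rim 3)
    (pick (F.side j = 2) (F.rim 0) (F.rim 1)))

/-- The coordinate of the site `i` along the side of the label `j`. -/
def along (i j : ℕ) : α := pick (F.Upright j) (F.sx i) (F.sy i)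

/-- The coordinate of the site `i` across the side of the label `j`. -/
def across (i j : ℕ) : α := pick (F.Upright j) (F.sy i) (F.sx i)

/-- The route of the site `i` to the port `u` of the label `j` with middle coordinate `w` has three
legs, numbered `0`, `1`, `2`; these are their ends along the side of the label. -/
def fromAlong (k i j : ℕ) (u : α) : α := pick (k ≤ 1) (F.along i j) u

def toAlong (k i j : ℕ) (u : α) : α := pick (k = 0) (F.along i j) u

def fromAcross (k i j : ℕ) (w : α) : α := pick (k = 0) (F.across i j) w

def toAcross (k j : ℕ) (w : α) : α := pick (k ≤ 1) w (F.goal j)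

def fromX (k i j : ℕ) (u w : α) : α :=
  pick (F.Upright j) (F.fromAlong k i j u) (F.fromAcross k i j w)

def toX (k i j : ℕ) (u w : α) : α :=
  pick (F.Upright j) (F.toAlong k i j u) (F.toAcross k j w)

def fromY (k i j : ℕ) (u w : α) : α :=
  pick (F.Upright j) (F.fromAcross k i j w) (F.fromAlong k i j u)

def toY (k i j : ℕ) (u w : α) : α :=
  pick (F.Upright j) (F.toAcross k j w) (F.toAlong k i j u)

/-- The number of the first vertex of the obstacle `o`. -/
def start (o : ℕ) : ℕ := ∑ o' ∈ Finset.range F.N, pick (o' < o) (F.len o') 0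

/-- The number of the vertex of the obstacle `o` that follows its vertex `k`. -/
def next (o k : ℕ) : ℕ := F.start o + pick (k + 1 = F.len o) 0 (k + 1)

theorem map_pick (φ : α → β) (p : Prop) (a b : α) : pick p (φ a) (φ b) = φ (pick p a b) := by
  by_cases h : p
  · rw [pick_pos h, pick_pos h]
  · rw [pick_neg h, pick_neg h]

theorem pick_mem {S : Set α} {p : Prop} {a b : α} (ha : p → a ∈ S) (hb : ¬ p → b ∈ S) :
    pick p a b ∈ S := by
  by_cases h : p
  · rw [pick_pos h]; exact ha h
  · rw [pick_neg h]; exact hb h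

variable [LinearOrder α] [LinearOrder β]

/-- The leg `m` of the route meets the edge `k` of the obstacle `o`. -/
def Hits (m i j : ℕ) (u w : α) (o k : ℕ) : Prop :=
  Meets (F.fromX m i j u w) (F.toX m i j u w) (F.ox (F.start o + k)) (F.ox (F.next o k)) ∧
  Meets (F.fromY m i j u w) (F.toY m i j u w) (F.oy (F.start o + k)) (F.oy (F.next o k))

/-- The route lies inside the frame and ends in the interval of its label; it has at most one bend
if `po` holds, and at most two bends otherwise. -/
def Fits (po : Prop) (i j : ℕ) (u w : α) : Prop :=
  i < F.n ∧ j < F.n ∧ F.lo j ≤ u ∧ u ≤ F.hi j ∧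
  pick (F.Upright j) (F.rim 0) (F.rim 2) < u ∧ u < pick (F.Upright j) (F.rim 1) (F.rim 3) ∧
  pick (F.Upright j) (F.rim 2) (F.rim 0) < w ∧ w < pick (F.Upright j) (F.rim 3) (F.rim 1) ∧
  (u = F.along i j → w = F.across i j) ∧ (po → w = F.across i j)

/-- The route meets no edge of an obstacle. -/
def Clear (i j : ℕ) (u w : α) : Prop :=
  ∀ o < F.N, ∀ k < F.N, o < F.nobs → k < F.len o →
    ¬ F.Hits 0 i j u w o k ∧ ¬ F.Hits 1 i j u w o k ∧ ¬ F.Hits 2 i j u w o k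

/-- The routes are legal. -/
def Valid (po : Prop) (i j : ℕ) (u w : α) : Prop := F.Fits po i j u w ∧ F.Clear i j u w

/-- The leg `m` of a route meets the leg `m'` of another route. -/
def LegsMeet (m i j : ℕ) (u w : α) (m' i' j' : ℕ) (u' w' : α) : Prop :=
  Meets (F.fromX m i j u w) (F.toX m i j u w) (F.fromX m' i' j' u' w') (F.toX m' i' j' u' w') ∧
  Meets (F.fromY m i j u w) (F.toY m i j u w) (F.fromY m' i' j' u' w') (F.toY m' i' j' u' w')

/-- The number of bends of a route. -/
def bends (i j : ℕ) (u w : α) : ℕ := pick (u = F.along i j) 0 (pick (w = F.across i j) 1 2)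

/-! ### Transport along monotone maps -/

/-- The coordinates of the frame lie in `S`. -/
structure Within (S : Set α) : Prop where
  rim : ∀ i < 4, F.rim i ∈ S
  sx : ∀ i < F.n, F.sx i ∈ S
  sy : ∀ i < F.n, F.sy i ∈ S
  lo : ∀ i < F.n, F.lo i ∈ S
  hi : ∀ i < F.n, F.hi i ∈ S
  ox : ∀ o < F.nobs, ∀ k < F.len o, F.ox (F.start o + k) ∈ S
  oy : ∀ o < F.nobs, ∀ k < F.len o, F.oy (F.start o + k) ∈ S

set_option linter.unusedSectionVars false

section Map

variable {F} {S : Set α} (hF : F.Within S) {φ : α → β} (hφ : ∀ a ∈ S, ∀ b ∈ S, φ a ≤ φ b ↔ a ≤ b)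

include hφ

/-- `Meets` is a boolean combination of comparisons, so it survives every map that preserves and
reflects the order on `S`. All of the transport rests on this. -/
theorem meets_map {a b c d : α} (ha : a ∈ S) (hb : b ∈ S) (hc : c ∈ S) (hd : d ∈ S) :
    Meets (φ a) (φ b) (φ c) (φ d) ↔ Meets a b c d := by
  simp only [Meets, hφ a ha c hc, hφ a ha d hd, hφ b hb c hc, hφ b hb d hd, hφ c hc a ha,
    hφ c hc b hb, hφ d hd a ha, hφ d hd b hb]

theorem lt_map {a b : α} (ha : a ∈ S) (hb : b ∈ S) : φ a < φ b ↔ a < b := by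
  rw [← not_le, ← not_le, hφ b hb a ha]

theorem eq_map {a b : α} (ha : a ∈ S) (hb : b ∈ S) : φ a = φ b ↔ a = b := by
  rw [le_antisymm_iff, le_antisymm_iff, hφ b hb a ha, hφ a ha b hb]

omit hφ

theorem start_map (o : ℕ) : (F.map φ).start o = F.start o := rfl

theorem next_map (o k : ℕ) : (F.map φ).next o k = F.next o k := rfl

theorem along_map (i j : ℕ) : (F.map φ).along i j = φ (F.along i j) := map_pick φ _ _ _

theorem across_map (i j : ℕ) : (F.map φ).across i j = φ (F.across i j) := map_pick φ _ _ _

theorem goal_map (j : ℕ) : (F.map φ).goal j = φ (F.goal j) := by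
  simp only [goal, map, map_pick]

theorem fromX_map (k i j : ℕ) (u w : α) :
    (F.map φ).fromX k i j (φ u) (φ w) = φ (F.fromX k i j u w) := by
  simp only [fromX, fromAlong, fromAcross, along_map, across_map, map_pick]; rfl

theorem fromY_map (k i j : ℕ) (u w : α) :
    (F.map φ).fromY k i j (φ u) (φ w) = φ (F.fromY k i j u w) := by
  simp only [fromY, fromAlong, fromAcross, along_map, across_map, map_pick]; rfl

theorem toX_map (k i j : ℕ) (u w : α) :
    (F.map φ).toX k i j (φ u) (φ w) = φ (F.toX k i j u w) := by
  simp only [toX, toAlong, toAcross, along_map, goal_map, map_pick]; rfl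

theorem toY_map (k i j : ℕ) (u w : α) :
    (F.map φ).toY k i j (φ u) (φ w) = φ (F.toY k i j u w) := by
  simp only [toY, toAlong, toAcross, along_map, goal_map, map_pick]; rfl

include hF

theorem along_mem {i j : ℕ} (hi : i < F.n) : F.along i j ∈ S :=
  pick_mem (fun _ => hF.sx i hi) (fun _ => hF.sy i hi)

theorem across_mem {i j : ℕ} (hi : i < F.n) : F.across i j ∈ S :=
  pick_mem (fun _ => hF.sy i hi) (fun _ => hF.sx i hi)

theorem goal_mem (j : ℕ) : F.goal j ∈ S :=
  pick_mem (fun _ => hF.rim 2 (by omega)) fun _ => pick_mem (fun _ => hF.rim 3 (by omega)) fun _ =>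
    pick_mem (fun _ => hF.rim 0 (by omega)) (fun _ => hF.rim 1 (by omega))

theorem leg_mem {k i j : ℕ} {u w : α} (hi : i < F.n) (hu : u ∈ S) (hw : w ∈ S) :
    F.fromX k i j u w ∈ S ∧ F.toX k i j u w ∈ S ∧ F.fromY k i j u w ∈ S ∧ F.toY k i j u w ∈ S := by
  have a := along_mem hF (j := j) hi
  have b := across_mem hF (j := j) hi
  have c := goal_mem hF j
  refine ⟨?_, ?_, ?_, ?_⟩ <;>
  · refine pick_mem (fun _ => pick_mem ?_ ?_) (fun _ => pick_mem ?_ ?_) <;> intro <;> assumption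

theorem vertex_mem {o k : ℕ} (ho : o < F.nobs) (hk : k < F.len o) :
    F.ox (F.next o k) ∈ S ∧ F.oy (F.next o k) ∈ S := by
  unfold next
  by_cases h : k + 1 = F.len o
  · rw [pick_pos h]; exact ⟨hF.ox o ho 0 (by omega), hF.oy o ho 0 (by omega)⟩
  · rw [pick_neg h]; exact ⟨hF.ox o ho _ (by omega), hF.oy o ho _ (by omega)⟩

include hφ

theorem legsMeet_map {m i j m' i' j' : ℕ} {u w u' w' : α} (hi : i < F.n) (hi' : i' < F.n)
    (hu : u ∈ S) (hw : w ∈ S) (hu' : u' ∈ S) (hw' : w' ∈ S) :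
    (F.map φ).LegsMeet m i j (φ u) (φ w) m' i' j' (φ u') (φ w') ↔
      F.LegsMeet m i j u w m' i' j' u' w' := by
  obtain ⟨a, b, c, d⟩ := leg_mem hF (k := m) (j := j) hi hu hw
  obtain ⟨a', b', c', d'⟩ := leg_mem hF (k := m') (j := j') hi' hu' hw'
  simp only [LegsMeet, fromX_map, toX_map, fromY_map, toY_map, meets_map hφ a b a' b',
    meets_map hφ c d c' d']

/-- All ends of legs are coordinates of the frame or one of `u`, `w`, hence in `S`, and legality
only compares them with each other and with the rim, the intervals and the obstacles. -/
theorem valid_map {po : Prop} {i j : ℕ} {u w : α} (hi : i < F.n) (hj : j < F.n)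
    (hu : u ∈ S) (hw : w ∈ S) :
    (F.map φ).Valid po i j (φ u) (φ w) ↔ F.Valid po i j u w := by
  have h1 : (F.map φ).Fits po i j (φ u) (φ w) ↔ F.Fits po i j u w := by
    have r : ∀ (p : Prop) k l, k < 4 → l < 4 →
        pick p ((F.map φ).rim k) ((F.map φ).rim l) = φ (pick p (F.rim k) (F.rim l)) ∧
          pick p (F.rim k) (F.rim l) ∈ S := fun p k l hk hl =>
      ⟨map_pick φ _ _ _, pick_mem (fun _ => hF.rim k hk) (fun _ => hF.rim l hl)⟩
    have e : (F.map φ).Upright j = F.Upright j := rfl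
    simp only [Fits, along_map, across_map, e, (r _ 0 2 (by omega) (by omega)).1,
      (r _ 1 3 (by omega) (by omega)).1, (r _ 2 0 (by omega) (by omega)).1,
      (r _ 3 1 (by omega) (by omega)).1,
      lt_map hφ (r (F.Upright j) 0 2 (by omega) (by omega)).2 hu,
      lt_map hφ hu (r (F.Upright j) 1 3 (by omega) (by omega)).2,
      lt_map hφ (r (F.Upright j) 2 0 (by omega) (by omega)).2 hw,
      lt_map hφ hw (r (F.Upright j) 3 1 (by omega) (by omega)).2,
      eq_map hφ hu (along_mem hF hi), eq_map hφ hw (across_mem hF hi)]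
    have l1 : (F.map φ).lo j ≤ φ u ↔ F.lo j ≤ u := hφ _ (hF.lo j hj) _ hu
    have l2 : φ u ≤ (F.map φ).hi j ↔ u ≤ F.hi j := hφ _ hu _ (hF.hi j hj)
    rw [l1, l2]; rfl
  have h2 : (F.map φ).Clear i j (φ u) (φ w) ↔ F.Clear i j u w := by
    have e : ∀ m o k, o < F.nobs → k < F.len o →
        ((F.map φ).Hits m i j (φ u) (φ w) o k ↔ F.Hits m i j u w o k) := by
      intro m o k ho hk
      obtain ⟨a, b, c, d⟩ := leg_mem hF (k := m) (j := j) hi hu hw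
      simp only [Hits, fromX_map, toX_map, fromY_map, toY_map, start_map, next_map]
      exact and_congr (meets_map hφ a b (hF.ox o ho k hk) (vertex_mem hF ho hk).1)
        (meets_map hφ c d (hF.oy o ho k hk) (vertex_mem hF ho hk).2)
    refine forall₂_congr fun o _ => forall₂_congr fun k _ => ?_
    refine forall₂_congr fun ho hk => ?_
    rw [e 0 o k ho hk, e 1 o k ho hk, e 2 o k ho hk]
  rw [Valid, Valid, h1, h2]

theorem bends_map {i j : ℕ} {u w : α} (hi : i < F.n) (hu : u ∈ S) (hw : w ∈ S) :
    (F.map φ).bends i j (φ u) (φ w) = F.bends i j u w := by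
  simp only [bends, along_map, across_map, eq_map hφ hu (along_mem hF hi),
    eq_map hφ hw (across_mem hF hi)]

end Map

end Frame

end BoundaryLabeling

end

/-! ### Routes with natural coordinates and their continuations outside the rectangle -/

noncomputable section

namespace BoundaryLabeling

open Machine (pick pick_pos pick_neg)
open BoundaryLabeling.Lattice

theorem mem_uIcc_nat {a b x : ℕ} : x ∈ Set.uIcc a b ↔ min a b ≤ x ∧ x ≤ max a b := by
  rw [Set.mem_uIcc]; omega

theorem Lattice.conn_box (a b c d : ℕ) :
    Conn {v : ℕ × ℕ | v.1 ∈ Set.uIcc a b ∧ v.2 ∈ Set.uIcc c d} := by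
  refine conn_of_base (min a b, min c d) ?_
  suffices h : ∀ k (u : ℕ × ℕ), u.1 + u.2 ≤ k →
      u ∈ {v : ℕ × ℕ | v.1 ∈ Set.uIcc a b ∧ v.2 ∈ Set.uIcc c d} →
      Joined {v : ℕ × ℕ | v.1 ∈ Set.uIcc a b ∧ v.2 ∈ Set.uIcc c d} (min a b, min c d) u from
    fun u hu => h _ u le_rfl hu
  intro k
  induction k with
  | zero =>
    rintro ⟨x, y⟩ h ⟨h1, h2⟩
    simp only [mem_uIcc_nat] at h h1 h2
    have e1 : x = min a b := by omega
    have e2 : y = min c d := by omega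
    rw [e1, e2]
  | succ k ih =>
    rintro ⟨x, y⟩ h hu
    have ⟨h1, h2⟩ := hu
    simp only [mem_uIcc_nat] at h h1 h2
    by_cases hx : min a b < x
    · have hm : ((x - 1, y) : ℕ × ℕ) ∈ {v : ℕ × ℕ | v.1 ∈ Set.uIcc a b ∧ v.2 ∈ Set.uIcc c d} :=
        ⟨by simp only [mem_uIcc_nat]; omega, by simp only [mem_uIcc_nat]; omega⟩
      refine (ih _ (by simp only; omega) hm).tail ⟨?_, hm, hu⟩
      simp only [Adj, and_true]; omega
    · by_cases hy : min c d < y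
      · have hm : ((x, y - 1) : ℕ × ℕ) ∈ {v : ℕ × ℕ | v.1 ∈ Set.uIcc a b ∧ v.2 ∈ Set.uIcc c d} :=
          ⟨by simp only [mem_uIcc_nat]; omega,
            by simp only [mem_uIcc_nat]; omega⟩
        refine (ih _ (by simp only; omega) hm).tail ⟨?_, hm, hu⟩
        simp only [Adj, true_and]; omega
      · have e1 : x = min a b := by omega
        have e2 : y = min c d := by omega
        rw [e1, e2]

/-- Routes numbered by natural numbers, in a frame with coordinates at most `Q`. -/
structure Coding where
  F : Frame ℕ
  Q : ℕ
  po : Prop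
  site : ℕ → ℕ
  label : ℕ → ℕ
  port : ℕ → ℕ
  mid : ℕ → ℕ

namespace Coding

variable (K : Coding)

/-- The side of the label of a route. -/
def sd (c : ℕ) : ℕ := K.F.side (K.label c)

/-- The route number `c` is legal. -/
def Valid (c : ℕ) : Prop := K.F.Valid K.po (K.site c) (K.label c) (K.port c) (K.mid c)

/-- The routes are continued outside the rectangle to points below it, in such a way that the order
of these points is the order of the ports around the rectangle. -/
def pos (c : ℕ) : ℕ :=
  pick (K.sd c = 0) (K.Q + 2 + K.port c) (pick (K.sd c = 1) (K.Q + K.Q + K.Q + K.Q + 5 - K.port c)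
    (pick (K.sd c = 2) (K.Q + 1 - K.port c) (K.Q + K.Q + 3 + K.port c)))

/-- The height of the continuation of a route to the top side. -/
def height (c : ℕ) : ℕ := K.Q + K.Q + 3 - K.port c

/-- A route and its continuation consist of six segments. -/
def x₁ (k c : ℕ) : ℕ :=
  pick (k ≤ 2) (K.Q + 2 + K.F.fromX k (K.site c) (K.label c) (K.port c) (K.mid c))
    (pick (K.sd c = 0) (K.Q + 2 + K.port c) (pick (K.sd c = 1)
      (pick (k ≤ 4) (K.Q + 2 + K.port c) (K.pos c))
      (pick (k = 3) (K.Q + 2 + K.F.goal (K.label c)) (K.pos c))))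

def x₂ (k c : ℕ) : ℕ :=
  pick (k ≤ 2) (K.Q + 2 + K.F.toX k (K.site c) (K.label c) (K.port c) (K.mid c))
    (pick (K.sd c = 0) (K.Q + 2 + K.port c) (pick (K.sd c = 1)
      (pick (k = 3) (K.Q + 2 + K.port c) (K.pos c)) (K.pos c)))

def y₁ (k c : ℕ) : ℕ :=
  pick (k ≤ 2) (1 + K.F.fromY k (K.site c) (K.label c) (K.port c) (K.mid c))
    (pick (K.sd c = 0) (pick (k = 3) (1 + K.F.goal (K.label c)) 0) (pick (K.sd c = 1)
      (pick (k = 3) (1 + K.F.goal (K.label c)) (K.height c))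
      (pick (k ≤ 4) (1 + K.port c) 0)))

def y₂ (k c : ℕ) : ℕ :=
  pick (k ≤ 2) (1 + K.F.toY k (K.site c) (K.label c) (K.port c) (K.mid c))
    (pick (K.sd c = 0) 0 (pick (K.sd c = 1) (pick (k ≤ 4) (K.height c) 0)
      (pick (k = 3) (1 + K.port c) 0)))

/-- The segment number `k`. -/
def box (k c : ℕ) : Set (ℕ × ℕ) :=
  {v | v.1 ∈ Set.uIcc (K.x₁ k c) (K.x₂ k c) ∧ v.2 ∈ Set.uIcc (K.y₁ k c) (K.y₂ k c)}

/-- The points of a route and of its continuation. -/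
def str (c : ℕ) : Set (ℕ × ℕ) := {v | ∃ k < 6, v ∈ K.box k c}

/-- The continued routes intersect. -/
def Touch (c d : ℕ) : Prop :=
  ∃ k < 6, ∃ l < 6, Meets (K.x₁ k c) (K.x₂ k c) (K.x₁ l d) (K.x₂ l d) ∧
    Meets (K.y₁ k c) (K.y₂ k c) (K.y₁ l d) (K.y₂ l d)

/-- The continued route contains a point `(x, t)` with `t` between `y` and `y'`. -/
def HitsColumn (c x y y' : ℕ) : Prop :=
  ∃ k < 6, Meets x x (K.x₁ k c) (K.x₂ k c) ∧ Meets y y' (K.y₁ k c) (K.y₂ k c)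

theorem disjoint_iff {c d : ℕ} : Disjoint (K.str c) (K.str d) ↔ ¬ K.Touch c d := by
  rw [Set.disjoint_left]
  constructor
  · rintro h ⟨k, hk, l, hl, h1, h2⟩
    obtain ⟨x, a, b⟩ := meets_iff.1 h1
    obtain ⟨y, a', b'⟩ := meets_iff.1 h2
    exact h (a := (x, y)) ⟨k, hk, a, a'⟩ ⟨l, hl, b, b'⟩
  · rintro h v ⟨k, hk, a, a'⟩ ⟨l, hl, b, b'⟩
    exact h ⟨k, hk, l, hl, meets_iff.2 ⟨_, a, b⟩, meets_iff.2 ⟨_, a', b'⟩⟩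

theorem hitsColumn_iff {c x y y' : ℕ} (h : y ≤ y') :
    ¬ K.HitsColumn c x y y' ↔ ∀ t, y ≤ t → t ≤ y' → (x, t) ∉ K.str c := by
  constructor
  · rintro hn t h1 h2 ⟨k, hk, a, b⟩
    exact hn ⟨k, hk, meets_iff.2 ⟨x, Set.left_mem_uIcc, a⟩,
      meets_iff.2 ⟨t, Set.mem_uIcc.2 (Or.inl ⟨h1, h2⟩), b⟩⟩
  · rintro hn ⟨k, hk, h1, h2⟩
    obtain ⟨a, a1, a2⟩ := meets_iff.1 h1
    obtain ⟨t, t1, t2⟩ := meets_iff.1 h2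
    rw [Set.uIcc_self, Set.mem_singleton_iff] at a1
    rw [Set.uIcc_of_le h] at t1
    exact hn t t1.1 t1.2 ⟨k, hk, a1 ▸ a2, t2⟩

/-- Consecutive segments share an end; this makes the continued route connected. -/
theorem chain (k c : ℕ) (hk : k < 5) :
    K.x₁ (k + 1) c = K.x₂ k c ∧ K.y₁ (k + 1) c = K.y₂ k c := by
  have hU : K.F.Upright (K.label c) ↔ K.sd c ≤ 1 := Iff.rfl
  have hs : K.F.side (K.label c) = K.sd c := rfl
  have key : ∀ p q r : Prop, (K.sd c ≤ 1 ↔ p) → (K.sd c = 0 ↔ q) → (K.sd c = 1 ↔ r) →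
      (p ∧ q ∧ ¬ r) ∨ (p ∧ ¬ q ∧ r) ∨ (¬ p ∧ ¬ q ∧ ¬ r) := by
    intro p q r hp hq hr
    rw [← hp, ← hq, ← hr]
    omega
  simp only [x₁, x₂, y₁, y₂, Frame.fromX, Frame.toX, Frame.fromY, Frame.toY, Frame.fromAlong,
    Frame.toAlong, Frame.fromAcross, Frame.toAcross, hU, pos, height]
  rcases key _ _ _ Iff.rfl Iff.rfl Iff.rfl with ⟨h1, h2, h3⟩ | ⟨h1, h2, h3⟩ | ⟨h1, h2, h3⟩ <;>
  · simp only [pick_pos, pick_neg, h1, h2, h3, not_false_eq_true]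
    interval_cases k <;> simp [pick]

theorem conn_str (c : ℕ) : Conn (K.str c) := by
  have h : ∀ k < 6, Conn {v | ∃ l ≤ k, v ∈ K.box l c} := by
    intro k
    induction k with
    | zero =>
      intro _
      have : {v | ∃ l ≤ 0, v ∈ K.box l c} = K.box 0 c := by
        ext v; constructor
        · rintro ⟨l, hl, h⟩; rwa [Nat.le_zero.1 hl] at h
        · intro h; exact ⟨0, le_rfl, h⟩
      rw [this]; exact conn_box _ _ _ _
    | succ k ih =>
      intro hk
      have e : {v | ∃ l ≤ k + 1, v ∈ K.box l c} = {v | ∃ l ≤ k, v ∈ K.box l c} ∪ K.box (k + 1) c := by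
        ext v; constructor
        · rintro ⟨l, hl, h⟩
          rcases (by omega : l ≤ k ∨ l = k + 1) with h' | rfl
          · exact Or.inl ⟨l, h', h⟩
          · exact Or.inr h
        · rintro (⟨l, hl, h⟩ | h)
          · exact ⟨l, by omega, h⟩
          · exact ⟨k + 1, le_rfl, h⟩
      rw [e]
      obtain ⟨e1, e2⟩ := K.chain k c (by omega)
      refine (ih (by omega)).union (conn_box _ _ _ _) (x := (K.x₂ k c, K.y₂ k c))
        (y := (K.x₂ k c, K.y₂ k c)) ⟨k, le_rfl, Set.right_mem_uIcc, Set.right_mem_uIcc⟩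
        ⟨?_, ?_⟩ (Or.inr rfl)
      · simp only [e1, Set.left_mem_uIcc]
      · simp only [e2, Set.left_mem_uIcc]
  have e : K.str c = {v | ∃ l ≤ 5, v ∈ K.box l c} := by
    ext v; constructor
    · rintro ⟨l, hl, h⟩; exact ⟨l, by omega, h⟩
    · rintro ⟨l, hl, h⟩; exact ⟨l, by omega, h⟩
  rw [e]; exact h 5 (by omega)

/-- The frame has coordinates at most `Q`, the sites lie inside its rim, and the intervals of the
labels do not overlap. -/
structure IsProper : Prop where
  within : K.F.Within (Set.Iic K.Q)
  port_le : ∀ c, K.port c ≤ K.Q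
  mid_le : ∀ c, K.mid c ≤ K.Q
  side_le : ∀ j < K.F.n, K.F.side j ≤ 3
  site_x : ∀ i < K.F.n, K.F.rim 0 < K.F.sx i ∧ K.F.sx i < K.F.rim 1
  site_y : ∀ i < K.F.n, K.F.rim 2 < K.F.sy i ∧ K.F.sy i < K.F.rim 3
  intervals : ∀ j < K.F.n, ∀ k < K.F.n, j ≠ k → K.F.side j = K.F.side k →
    K.F.hi j ≤ K.F.lo k ∨ K.F.hi k ≤ K.F.lo j

/-- The point of the side of the rectangle at which a route ends. -/
def portPoint (c : ℕ) : ℕ × ℕ :=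
  pick (K.sd c ≤ 1) (K.Q + 2 + K.port c, 1 + K.F.goal (K.label c))
    (K.Q + 2 + K.F.goal (K.label c), 1 + K.port c)

def Inside (v : ℕ × ℕ) : Prop :=
  K.Q + 2 + K.F.rim 0 < v.1 ∧ v.1 < K.Q + 2 + K.F.rim 1 ∧ 1 + K.F.rim 2 < v.2 ∧
    v.2 < 1 + K.F.rim 3

def Outside (v : ℕ × ℕ) : Prop :=
  v.1 < K.Q + 2 + K.F.rim 0 ∨ K.Q + 2 + K.F.rim 1 < v.1 ∨ v.2 < 1 + K.F.rim 2 ∨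
    1 + K.F.rim 3 < v.2

variable {K} (hK : K.IsProper)

include hK

/-- Site, port and middle coordinate lie strictly inside the rim; only the coordinate across the
side at the end of the last leg lies on it. -/
theorem leg_cases {c k : ℕ} (hc : K.Valid c) (hk : k ≤ 2) {v : ℕ × ℕ} (hv : v ∈ K.box k c) :
    K.Inside v ∨ v = K.portPoint c := by
  obtain ⟨⟨hi, hj, -, -, hu, hu', hw, hw', -⟩, -⟩ := hc
  have sx := hK.site_x _ hi
  have sy := hK.site_y _ hi
  have hs : K.sd c = K.F.side (K.label c) := rfl
  have hU : K.F.Upright (K.label c) ↔ K.sd c ≤ 1 := Iff.rfl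
  obtain ⟨x, y⟩ := v
  obtain ⟨h1, h2⟩ := hv
  simp only [x₁, x₂, y₁, y₂, pick_pos hk, Frame.fromX, Frame.toX, Frame.fromY, Frame.toY,
    Frame.fromAlong, Frame.toAlong, Frame.fromAcross, Frame.toAcross, Frame.along,
    Frame.across, hU] at h1 h2
  simp only [Inside, portPoint]
  by_cases hb : K.sd c ≤ 1
  · simp only [pick_pos hb, pick_pos (hU.2 hb)] at *
    have g : K.F.goal (K.label c) = K.F.rim 2 ∨ K.F.goal (K.label c) = K.F.rim 3 := by
      rcases (by omega : K.F.side (K.label c) = 0 ∨ K.F.side (K.label c) = 1) with h | h <;>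
      simp [Frame.goal, h, pick]
    interval_cases k <;> simp [pick, Set.mem_uIcc, Prod.ext_iff] at h1 h2 ⊢ <;> omega
  · simp only [pick_neg hb, pick_neg (fun h => hb (hU.1 h))] at *
    have g : K.F.goal (K.label c) = K.F.rim 0 ∨ K.F.goal (K.label c) = K.F.rim 1 := by
      simp only [Frame.goal]
      rw [pick_neg (by omega), pick_neg (by omega)]
      by_cases h : K.F.side (K.label c) = 2 <;> simp [pick, h]
    interval_cases k <;> simp [pick, Set.mem_uIcc, Prod.ext_iff] at h1 h2 ⊢ <;> omega

/-- The points of the continuation of a route, by the side of its label. -/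
theorem continuation_cases {c k : ℕ} (hc : K.Valid c) (hk : 2 < k) (hk' : k < 6) {v : ℕ × ℕ}
    (hv : v ∈ K.box k c) :
    (K.sd c = 0 ∧ v.1 = K.Q + 2 + K.port c ∧ v.2 ≤ 1 + K.F.rim 2) ∨
    (K.sd c = 1 ∧ ((v.1 = K.Q + 2 + K.port c ∧ 1 + K.F.rim 3 ≤ v.2 ∧ v.2 ≤ 2 * K.Q + 3 - K.port c) ∨
      (K.Q + 2 + K.port c ≤ v.1 ∧ v.1 ≤ 4 * K.Q + 5 - K.port c ∧ v.2 = 2 * K.Q + 3 - K.port c) ∨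
      (v.1 = 4 * K.Q + 5 - K.port c ∧ v.2 ≤ 2 * K.Q + 3 - K.port c))) ∨
    (K.sd c = 2 ∧ ((K.Q + 1 - K.port c ≤ v.1 ∧ v.1 ≤ K.Q + 2 + K.F.rim 0 ∧ v.2 = 1 + K.port c) ∨
      (v.1 = K.Q + 1 - K.port c ∧ v.2 ≤ 1 + K.port c))) ∨
    (K.sd c = 3 ∧ ((K.Q + 2 + K.F.rim 1 ≤ v.1 ∧ v.1 ≤ 2 * K.Q + 3 + K.port c ∧
      v.2 = 1 + K.port c) ∨ (v.1 = 2 * K.Q + 3 + K.port c ∧ v.2 ≤ 1 + K.port c))) := by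
  obtain ⟨⟨hi, hj, -⟩, -⟩ := hc
  have p := hK.port_le c
  have r0 : K.F.rim 0 ≤ K.Q := hK.within.rim 0 (by omega)
  have r1 : K.F.rim 1 ≤ K.Q := hK.within.rim 1 (by omega)
  have r2 : K.F.rim 2 ≤ K.Q := hK.within.rim 2 (by omega)
  have r3 : K.F.rim 3 ≤ K.Q := hK.within.rim 3 (by omega)
  have hs : K.F.side (K.label c) = K.sd c := rfl
  have hs3 : K.sd c ≤ 3 := hK.side_le _ hj
  obtain ⟨x, y⟩ := v
  obtain ⟨h1, h2⟩ := hv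
  simp only [mem_uIcc_nat, x₁, x₂, y₁, y₂, pick_neg (not_le.2 hk), pos, height, Frame.goal,
    hs] at h1 h2
  simp only
  rcases (by omega : K.sd c = 0 ∨ K.sd c = 1 ∨ K.sd c = 2 ∨ K.sd c = 3) with h | h | h | h <;>
  rcases (by omega : k = 3 ∨ k = 4 ∨ k = 5) with rfl | rfl | rfl <;>
  · simp [pick, h] at h1 h2 ⊢
    omega

/-- Routes with different ports on the same side have disjoint continuations. -/
theorem continuation_disjoint {c d k l : ℕ} (hc : K.Valid c) (hd : K.Valid d) (hk : 2 < k)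
    (hk' : k < 6) (hl : 2 < l) (hl' : l < 6) (hp : K.sd c = K.sd d → K.port c ≠ K.port d)
    {v : ℕ × ℕ} (hv : v ∈ K.box k c) (hv' : v ∈ K.box l d) : False := by
  have p := hK.port_le c
  have p' := hK.port_le d
  have r0 : K.F.rim 0 ≤ K.Q := hK.within.rim 0 (by omega)
  have r1 : K.F.rim 1 ≤ K.Q := hK.within.rim 1 (by omega)
  have r2 : K.F.rim 2 ≤ K.Q := hK.within.rim 2 (by omega)
  have r3 : K.F.rim 3 ≤ K.Q := hK.within.rim 3 (by omega)
  have fit : ∀ c, K.Valid c → (K.sd c ≤ 1 → K.F.rim 0 < K.port c ∧ K.port c < K.F.rim 1) ∧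
      (1 < K.sd c → K.F.rim 2 < K.port c ∧ K.port c < K.F.rim 3) ∧ K.F.rim 2 < K.F.rim 3 ∧
        K.F.rim 0 < K.F.rim 1 := by
    rintro c ⟨⟨hi, hj, -, -, hu, hu', -⟩, -⟩
    have hU : K.F.Upright (K.label c) ↔ K.sd c ≤ 1 := Iff.rfl
    refine ⟨fun h => ?_, fun h => ?_, (hK.site_y _ hi).1.trans (hK.site_y _ hi).2,
      (hK.site_x _ hi).1.trans (hK.site_x _ hi).2⟩
    · rw [pick_pos (hU.2 h)] at hu hu'; exact ⟨hu, hu'⟩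
    · rw [pick_neg (fun h' => absurd (hU.1 h') (by omega))] at hu hu'; exact ⟨hu, hu'⟩
  have f := fit c hc
  have f' := fit d hd
  have a := continuation_cases hK hc hk hk' hv
  have a' := continuation_cases hK hd hl hl' hv'
  rcases a with ⟨s, a⟩ | ⟨s, a⟩ | ⟨s, a⟩ | ⟨s, a⟩ <;>
  rcases a' with ⟨s', a'⟩ | ⟨s', a'⟩ | ⟨s', a'⟩ | ⟨s', a'⟩ <;>
  · simp only [s, s', true_imp_iff] at f f' hp
    omega

omit hK in
theorem portPoint_mem {c : ℕ} : K.portPoint c ∈ K.box 2 c := by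
  have hU : K.F.Upright (K.label c) ↔ K.sd c ≤ 1 := Iff.rfl
  by_cases hb : K.sd c ≤ 1 <;>
  simp [portPoint, box, mem_uIcc_nat, x₁, x₂, y₁, y₂, Frame.fromX, Frame.toX, Frame.fromY,
    Frame.toY, Frame.fromAlong, Frame.toAlong, Frame.fromAcross, Frame.toAcross, hU, hb, pick]

/-- A point of a continuation is the port or lies outside the rectangle. -/
theorem continuation_outside {c k : ℕ} (hc : K.Valid c) (hk : 2 < k) (hk' : k < 6) {v : ℕ × ℕ}
    (hv : v ∈ K.box k c) : ¬ K.Inside v ∧ (K.Outside v ∨ v = K.portPoint c) := by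
  have a := continuation_cases hK hc hk hk' hv
  obtain ⟨⟨hi, hj, -, -, hu, hu', -⟩, -⟩ := hc
  have sx := hK.site_x _ hi
  have sy := hK.site_y _ hi
  have p := hK.port_le c
  have r0 : K.F.rim 0 ≤ K.Q := hK.within.rim 0 (by omega)
  have r1 : K.F.rim 1 ≤ K.Q := hK.within.rim 1 (by omega)
  have r2 : K.F.rim 2 ≤ K.Q := hK.within.rim 2 (by omega)
  have r3 : K.F.rim 3 ≤ K.Q := hK.within.rim 3 (by omega)
  have hU : K.F.Upright (K.label c) ↔ K.sd c ≤ 1 := Iff.rfl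
  have hs : K.F.side (K.label c) = K.sd c := rfl
  obtain ⟨x, y⟩ := v
  simp only [Inside, Outside, portPoint, Frame.goal, hs, hU] at *
  rcases a with ⟨s, a⟩ | ⟨s, a⟩ | ⟨s, a⟩ | ⟨s, a⟩ <;>
  · simp [s, pick, Prod.ext_iff] at hu hu' a ⊢
    omega

theorem not_outside_portPoint {c : ℕ} (hc : K.Valid c) : ¬ K.Outside (K.portPoint c) := by
  obtain ⟨⟨hi, hj, -, -, hu, hu', -⟩, -⟩ := hc
  have sx := hK.site_x _ hi
  have sy := hK.site_y _ hi
  have hU : K.F.Upright (K.label c) ↔ K.sd c ≤ 1 := Iff.rfl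
  have hs : K.F.side (K.label c) = K.sd c := rfl
  have hs3 : K.sd c ≤ 3 := hK.side_le _ hj
  simp only [Outside, portPoint, Frame.goal, hs, hU] at *
  rcases (by omega : K.sd c = 0 ∨ K.sd c = 1 ∨ K.sd c = 2 ∨ K.sd c = 3) with s | s | s | s <;>
  · simp [s, pick] at hu hu' ⊢
    omega

/-- Routes whose legs are disjoint have disjoint continuations. -/
theorem not_touch {c d : ℕ} (hc : K.Valid c) (hd : K.Valid d)
    (h : ∀ k < 3, ∀ l < 3, ¬ K.F.LegsMeet k (K.site c) (K.label c) (K.port c) (K.mid c)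
      l (K.site d) (K.label d) (K.port d) (K.mid d)) : ¬ K.Touch c d := by
  have legs : ∀ k < 3, ∀ l < 3, ∀ v, v ∈ K.box k c → v ∈ K.box l d → False := by
    rintro k hk l hl v ⟨a, b⟩ ⟨a', b'⟩
    refine h k hk l hl ⟨?_, ?_⟩
    · have := meets_iff.2 ⟨_, a, a'⟩
      simp only [x₁, x₂, pick_pos (Nat.le_of_lt_succ hk), pick_pos (Nat.le_of_lt_succ hl),
        Meets, Nat.add_le_add_iff_left] at this
      exact this
    · have := meets_iff.2 ⟨_, b, b'⟩
      simp only [y₁, y₂, pick_pos (Nat.le_of_lt_succ hk), pick_pos (Nat.le_of_lt_succ hl),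
        Meets, Nat.add_le_add_iff_left] at this
      exact this
  -- The last legs contain the port points, so disjoint legs have different ports. Continuations are
  -- nested curves indexed by the ports, so nothing new can meet outside; inside, a leg meets a
  -- continuation only in a common port.
  have port : K.portPoint c ≠ K.portPoint d := fun e =>
    legs 2 (by omega) 2 (by omega) _ portPoint_mem (e ▸ portPoint_mem)
  have hp : K.sd c = K.sd d → K.port c ≠ K.port d := by
    intro e e'
    apply port
    have : K.F.goal (K.label c) = K.F.goal (K.label d) := by
      simp only [Frame.goal, show K.F.side (K.label c) = K.F.side (K.label d) from e]
    simp only [portPoint, e, e', this]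
  rw [← disjoint_iff, Set.disjoint_left]
  rintro v ⟨k, hk, hv⟩ ⟨l, hl, hv'⟩
  have mixed : ∀ c d k l, K.Valid c → K.Valid d → k < 3 → 2 < l → l < 6 → v ∈ K.box k c →
      v ∈ K.box l d → K.portPoint c = K.portPoint d := by
    intro c d k l hc hd hk hl hl' hv hv'
    obtain ⟨h1, h2⟩ := continuation_outside hK hd hl hl' hv'
    rcases leg_cases hK hc (Nat.le_of_lt_succ hk) hv with h | rfl
    · exact absurd h h1
    · exact h2.resolve_left (not_outside_portPoint hK hc)
  by_cases hk3 : k < 3 <;> by_cases hl3 : l < 3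
  · exact legs k hk3 l hl3 v hv hv'
  · exact port (mixed c d k l hc hd hk3 (by omega) hl hv hv')
  · exact port (mixed d c l k hd hc hl3 (by omega) hk hv' hv).symm
  · exact continuation_disjoint hK hc hd (by omega) hk (by omega) hl hp hv hv'

omit hK in
/-- Routes whose continuations are disjoint have disjoint legs. -/
theorem not_legsMeet {c d k l : ℕ} (h : ¬ K.Touch c d) (hk : k < 3) (hl : l < 3) :
    ¬ K.F.LegsMeet k (K.site c) (K.label c) (K.port c) (K.mid c)
      l (K.site d) (K.label d) (K.port d) (K.mid d) := by
  rintro ⟨h1, h2⟩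
  refine h ⟨k, by omega, l, by omega, ?_, ?_⟩
  · simp only [x₁, x₂, pick_pos (Nat.le_of_lt_succ hk), pick_pos (Nat.le_of_lt_succ hl),
      Meets, Nat.add_le_add_iff_left]
    exact h1
  · simp only [y₁, y₂, pick_pos (Nat.le_of_lt_succ hk), pick_pos (Nat.le_of_lt_succ hl),
      Meets, Nat.add_le_add_iff_left]
    exact h2

/-- If a route ends between two routes to the same label, then it goes to that label, too. -/
theorem label_eq_of_between {c d e : ℕ} (hc : K.Valid c) (hd : K.Valid d) (he : K.Valid e)
    (h : K.label c = K.label e) (h1 : K.pos c < K.pos d) (h2 : K.pos d < K.pos e) :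
    K.label d = K.label c := by
  have pc := hK.port_le c
  have pd := hK.port_le d
  have pe := hK.port_le e
  obtain ⟨⟨-, jc, lc, uc, -⟩, -⟩ := hc
  obtain ⟨⟨-, jd, ld, ud, -⟩, -⟩ := hd
  obtain ⟨⟨-, -, le, ue, -⟩, -⟩ := he
  have sc : K.sd c ≤ 3 := hK.side_le _ jc
  have sd : K.sd d ≤ 3 := hK.side_le _ jd
  have hs : K.sd e = K.sd c := by rw [Coding.sd, Coding.sd, h]
  by_contra hne
  -- Feet are ordered like the ports around the rectangle. Intervals may share an end, but the
  -- strict inequalities `h1` and `h2` leave no room for an interval of another label between two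
  -- ports of one label.
  have int := hK.intervals _ jc _ jd (Ne.symm hne)
  rw [← h] at le ue
  have hs' : K.F.side (K.label c) = K.F.side (K.label d) ↔ K.sd c = K.sd d := Iff.rfl
  rw [hs'] at int
  simp only [pos, hs] at h1 h2
  rcases (by omega : K.sd c = 0 ∨ K.sd c = 1 ∨ K.sd c = 2 ∨ K.sd c = 3) with s | s | s | s <;>
  rcases (by omega : K.sd d = 0 ∨ K.sd d = 1 ∨ K.sd d = 2 ∨ K.sd d = 3) with s' | s' | s' | s' <;>
  · simp [s, s', pick] at h1 h2 int
    try omega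

/-- The feet of the left, bottom, right and top sides occupy consecutive ranges, the largest being
`4 * Q + 5`, and the highest continuation has height `2 * Q + 3`; hence the size of the lattice
rectangle. -/
theorem isStringSystem {V : Set ℕ} (hV : ∀ c ∈ V, K.Valid c) :
    IsStringSystem (4 * K.Q + 6) (2 * K.Q + 4) K.str K.pos V where
  conn c _ := K.conn_str c
  pos_mem c hc := by
    refine ⟨5, by omega, ?_⟩
    simp only [box, Set.mem_ofPred_eq, mem_uIcc_nat, x₁, x₂, y₁, y₂, height]
    have sc : K.sd c ≤ 3 := hK.side_le _ (hV c hc).1.2.1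
    rcases (by omega : K.sd c = 0 ∨ K.sd c = 1 ∨ K.sd c = 2 ∨ K.sd c = 3) with s | s | s | s <;>
    simp [s, pick, pos]
  pos_eq c hc x := by
    rintro ⟨k, hk, hx⟩
    have p := hK.port_le c
    have r2 : K.F.rim 2 ≤ K.Q := hK.within.rim 2 (by omega)
    by_cases h2 : k ≤ 2
    · have := hx.2
      simp only [y₁, y₂, pick_pos h2, mem_uIcc_nat] at this
      omega
    · have hs : K.F.side (K.label c) = K.sd c := rfl
      obtain ⟨h1, h2'⟩ := hx
      have sc : K.sd c ≤ 3 := hK.side_le _ (hV c hc).1.2.1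
      simp only [mem_uIcc_nat, x₁, x₂, y₁, y₂, pick_neg h2, pos, height] at h1 h2' ⊢
      rcases (by omega : K.sd c = 0 ∨ K.sd c = 1 ∨ K.sd c = 2 ∨ K.sd c = 3) with s | s | s | s <;>
      rcases (by omega : k = 3 ∨ k = 4 ∨ k = 5) with rfl | rfl | rfl <;>
      · simp [s, pick] at h1 h2' ⊢
        try omega
  inside c hc v := by
    rintro ⟨k, hk, hv⟩
    have p := hK.port_le c
    by_cases h2 : k ≤ 2
    · obtain ⟨a, b, a', b'⟩ := Frame.leg_mem hK.within (k := k) (j := K.label c) (hV c hc).1.1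
        (hK.port_le c) (hK.mid_le c)
      obtain ⟨h3, h4⟩ := hv
      simp only [mem_uIcc_nat, x₁, x₂, y₁, y₂, pick_pos h2, Set.mem_Iic] at *
      omega
    · have r0 : K.F.rim 0 ≤ K.Q := hK.within.rim 0 (by omega)
      have r1 : K.F.rim 1 ≤ K.Q := hK.within.rim 1 (by omega)
      have r2 : K.F.rim 2 ≤ K.Q := hK.within.rim 2 (by omega)
      have := continuation_cases hK (hV c hc) (by omega) hk hv
      omega

end Coding

end BoundaryLabeling

end

noncomputable section

namespace BoundaryLabeling

open Machine (pick pick_pos pick_neg)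
open BoundaryLabeling.Lattice

/-! ### Pairing with bounded sums -/

/-- `b * b` for `b ≤ N`. -/
def sq (N b : ℕ) : ℕ := ∑ t ∈ Finset.range N, pick (t < b) b 0

/-- The pairing function, for arguments below `N`. -/
def pr (N a b : ℕ) : ℕ := pick (a < b) (sq N b + a) (sq N a + a + b)

/-- Expressions have neither multiplication nor division, so the components of a pair are found by
searching all pairs below `N`; at most one term of the double sum is relevant. -/
def fs (N c : ℕ) : ℕ := ∑ a ∈ Finset.range N, ∑ b ∈ Finset.range N, pick (pr N a b = c) a 0

def sn (N c : ℕ) : ℕ := ∑ a ∈ Finset.range N, ∑ b ∈ Finset.range N, pick (pr N a b = c) b 0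

theorem sq_eq {N b : ℕ} (h : b ≤ N) : sq N b = b * b := by
  obtain ⟨d, rfl⟩ := Nat.exists_eq_add_of_le h
  rw [sq]
  induction d with
  | zero =>
    have e : ∑ t ∈ Finset.range b, pick (t < b) b 0 = ∑ t ∈ Finset.range b, b :=
      Finset.sum_congr rfl fun x hx => pick_pos (Finset.mem_range.1 hx) _ _
    rw [Nat.add_zero, e, Finset.sum_const, Finset.card_range, smul_eq_mul]
  | succ d ih =>
    rw [← Nat.add_assoc, Finset.sum_range_succ, ih (by omega), pick_neg (by omega), Nat.add_zero]

theorem pr_eq {N a b : ℕ} (ha : a ≤ N) (hb : b ≤ N) : pr N a b = Nat.pair a b := by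
  rw [pr, sq_eq ha, sq_eq hb, Nat.pair]
  by_cases h : a < b <;> simp [pick, h]

theorem sum_pick_eq (N k v : ℕ) (h : k < N) :
    ∑ a ∈ Finset.range N, pick (a = k) v 0 = v := by
  rw [Finset.sum_eq_single k]
  · exact pick_pos rfl _ _
  · intro b _ hb; exact pick_neg hb _ _
  · intro h'; exact absurd (Finset.mem_range.2 h) h'

theorem decode_eq {N c : ℕ} (hc : c < N) (g : ℕ → ℕ → ℕ) :
    ∑ a ∈ Finset.range N, ∑ b ∈ Finset.range N, pick (pr N a b = c) (g a b) 0 =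
      g (Nat.unpair c).1 (Nat.unpair c).2 := by
  have h1 : (Nat.unpair c).1 < N := (Nat.unpair_left_le c).trans_lt hc
  have h2 : (Nat.unpair c).2 < N := (Nat.unpair_right_le c).trans_lt hc
  rw [Finset.sum_eq_single (Nat.unpair c).1, Finset.sum_eq_single (Nat.unpair c).2]
  · refine pick_pos ?_ _ _
    rw [pr_eq h1.le h2.le, Nat.pair_unpair]
  · intro b hb hne
    refine pick_neg (fun h => hne ?_) _ _
    rw [pr_eq h1.le (Finset.mem_range.1 hb).le] at h
    rw [← h, Nat.unpair_pair]
  · intro h; exact absurd (Finset.mem_range.2 h2) h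
  · intro a ha hne
    refine Finset.sum_eq_zero fun b hb => pick_neg (fun h => hne ?_) _ _
    rw [pr_eq (Finset.mem_range.1 ha).le (Finset.mem_range.1 hb).le] at h
    rw [← h, Nat.unpair_pair]
  · intro h; exact absurd (Finset.mem_range.2 h1) h

theorem fs_eq {N c : ℕ} (hc : c < N) : fs N c = (Nat.unpair c).1 := decode_eq hc fun a _ => a

theorem sn_eq {N c : ℕ} (hc : c < N) : sn N c = (Nat.unpair c).2 := decode_eq hc fun _ b => b

theorem fs_lt {N c : ℕ} (hc : c < N) : fs N c < N := by
  rw [fs_eq hc]; exact (Nat.unpair_left_le c).trans_lt hc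

theorem sn_lt {N c : ℕ} (hc : c < N) : sn N c < N := by
  rw [sn_eq hc]; exact (Nat.unpair_right_le c).trans_lt hc

theorem fs_pair {N a b : ℕ} (h : Nat.pair a b < N) : fs N (Nat.pair a b) = a := by
  rw [fs_eq h, Nat.unpair_pair]

theorem sn_pair {N a b : ℕ} (h : Nat.pair a b < N) : sn N (Nat.pair a b) = b := by
  rw [sn_eq h, Nat.unpair_pair]

theorem pair_lt {a b B : ℕ} (ha : a < B) (hb : b < B) : Nat.pair a b < B ^ 2 := by
  refine (Nat.pair_lt_max_add_one_sq a b).trans_le (Nat.pow_le_pow_left ?_ 2)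
  omega

/-! ### The dynamic program -/

namespace Coding

variable (K : Coding) (N : ℕ)

/-- The routes cannot occur together. -/
def Conf (c d : ℕ) : Prop := K.Valid c ∧ (K.label c = K.label d ∨ K.Touch c d)

/-- The code of a column segment. -/
def Blocks (v c : ℕ) : Prop := K.HitsColumn c (fs N v) (fs N (sn N v)) (sn N (sn N v))

/-- The routes of the subproblem with the code `σ`. -/
def Allow (σ c : ℕ) : Prop :=
  c < N ∧ K.Valid c ∧ fs N (fs N (sn N σ)) < K.pos c ∧ K.pos c < sn N (fs N (sn N σ)) ∧
    ¬ K.Conf (fs N (fs N σ)) c ∧ ¬ K.Conf (sn N (fs N σ)) c ∧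
    ¬ K.Blocks N (fs N (sn N (sn N σ))) c ∧ ¬ K.Blocks N (sn N (sn N (sn N σ))) c

/-- The routes allowed by `σ'` are allowed by `σ` and compatible with `d`. -/
def Refines (σ d σ' : ℕ) : Prop := ∀ c < N, K.Allow N σ' c → K.Allow N σ c ∧ ¬ K.Conf d c

/-- `τ` consists of a subproblem, a route, and another subproblem, which together are part of the
subproblem `σ`. -/
def Trans (σ τ : ℕ) : Prop :=
  K.Allow N σ (fs N (sn N τ)) ∧ K.Refines N σ (fs N (sn N τ)) (fs N τ) ∧
    K.Refines N σ (fs N (sn N τ)) (sn N (sn N τ)) ∧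
    ∀ c < N, ∀ d < N, K.Allow N (fs N τ) c → K.Allow N (sn N (sn N τ)) d → ¬ K.Conf c d

/-- The number of bends of a route. -/
def bends (c : ℕ) : ℕ := K.F.bends (K.site c) (K.label c) (K.port c) (K.mid c)

/-- Selected routes are stored as `c + 1`; `0` means that no route is selected. -/
def weight (x : ℕ) : ℕ := pick (x = 0) 0 (K.F.n + K.F.n + 1 - K.bends (x - 1))

def merged (T : ℕ → ℕ) (τ i : ℕ) : ℕ :=
  pick (K.site (fs N (sn N τ)) = i) (fs N (sn N τ) + 1)
    (pick (T (pr N (fs N τ) i) = 0) (T (pr N (sn N (sn N τ)) i)) (T (pr N (fs N τ) i)))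

/-- The total weight of a selection. -/
def total (f : ℕ → ℕ) : ℕ := ∑ i ∈ Finset.range N, pick (i < K.F.n) (K.weight (f i)) 0

def Best (T : ℕ → ℕ) (σ τ : ℕ) : Prop :=
  K.Trans N σ τ ∧ ∀ τ' < N, K.Trans N σ τ' →
    K.total N (fun i => K.merged N T τ' i) ≤ K.total N (fun i => K.merged N T τ i)

/-- A definable form of the maximum: only the least best transition contributes to the sum. Without
any transition the value is 0, the empty selection. -/
def entry (T : ℕ → ℕ) (σ i : ℕ) : ℕ :=
  ∑ τ ∈ Finset.range N, pick (K.Best N T σ τ ∧ ∀ τ' < N, K.Best N T σ τ' → τ ≤ τ')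
    (K.merged N T τ i) 0

/-- The selections after `k` rounds. -/
def table : ℕ → ℕ → ℕ
  | 0, _ => 0
  | k + 1, x => if x < N then K.entry N (table k) (fs N x) (sn N x) else 0

theorem entry_spec (T : ℕ → ℕ) (σ : ℕ) :
    (∃ τ < N, K.Best N T σ τ ∧ ∀ i, K.entry N T σ i = K.merged N T τ i) ∨
      ((¬ ∃ τ < N, K.Trans N σ τ) ∧ ∀ i, K.entry N T σ i = 0) := by
  classical
  by_cases h : ∃ τ < N, K.Best N T σ τ
  · left
    refine ⟨Nat.find h, (Nat.find_spec h).1, (Nat.find_spec h).2, fun i => ?_⟩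
    have hmin : ∀ τ' < N, K.Best N T σ τ' → Nat.find h ≤ τ' := fun τ' h1 h2 =>
      Nat.find_min' h ⟨h1, h2⟩
    rw [entry, Finset.sum_eq_single (Nat.find h)]
    · exact pick_pos ⟨(Nat.find_spec h).2, hmin⟩ _ _
    · rintro τ hτ hne
      refine pick_neg (fun h' => hne ?_) _ _
      exact le_antisymm (h'.2 _ (Nat.find_spec h).1 (Nat.find_spec h).2)
        (hmin τ (Finset.mem_range.1 hτ) h'.1)
    · intro h'; exact absurd (Finset.mem_range.2 (Nat.find_spec h).1) h'
  · right
    refine ⟨fun hT => h ?_, fun i => Finset.sum_eq_zero fun τ hτ => pick_neg (fun h' =>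
      h ⟨τ, Finset.mem_range.1 hτ, h'.1⟩) _ _⟩
    obtain ⟨τ, hτ, hm⟩ := Finset.exists_max_image ((Finset.range N).filter (K.Trans N σ))
      (fun τ => K.total N (fun i => K.merged N T τ i)) (by
        obtain ⟨τ, h1, h2⟩ := hT
        exact ⟨τ, Finset.mem_filter.2 ⟨Finset.mem_range.2 h1, h2⟩⟩)
    simp only [Finset.mem_filter, Finset.mem_range] at hτ hm
    exact ⟨τ, hτ.1, hτ.2, fun τ' h1 h2 => hm τ' ⟨h1, h2⟩⟩

/-- The selections stored in `T` are compatible selections of allowed routes. -/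
def Sound (T : ℕ → ℕ) : Prop :=
  ∀ σ < N, ∀ i < N, T (pr N σ i) ≠ 0 →
    (K.site (T (pr N σ i) - 1) = i ∧ K.Allow N σ (T (pr N σ i) - 1)) ∧
    ∀ i' < N, T (pr N σ i') ≠ 0 → i ≠ i' → ¬ K.Conf (T (pr N σ i) - 1) (T (pr N σ i') - 1)

variable {K N}

theorem Touch.symm {c d : ℕ} (h : K.Touch c d) : K.Touch d c := by
  obtain ⟨k, hk, l, hl, h1, h2⟩ := h
  exact ⟨l, hl, k, hk, h1.symm, h2.symm⟩

/-- `Conf` asks only its first argument to be valid, so that an invalid number can stand for "no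
route"; such a number conflicts with nothing. Between valid routes the relation is symmetric. -/
theorem not_conf_symm {c d : ℕ} (hc : K.Valid c) (h : ¬ K.Conf c d) : ¬ K.Conf d c := by
  rintro ⟨-, h' | h'⟩
  · exact h ⟨hc, Or.inl h'.symm⟩
  · exact h ⟨hc, Or.inr h'.symm⟩

/-- Both routes start at the common site. Thus compatible routes belong to different sites, and a
selection is a function of the site. -/
theorem touch_of_site_eq {c d : ℕ} (h : K.site c = K.site d) : K.Touch c d := by
  refine ⟨0, by omega, 0, by omega, meets_iff.2 ⟨K.Q + 2 + K.F.sx (K.site c), ?_, ?_⟩,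
    meets_iff.2 ⟨1 + K.F.sy (K.site c), ?_, ?_⟩⟩
  · have : K.x₁ 0 c = K.Q + 2 + K.F.sx (K.site c) := by
      by_cases hb : K.F.Upright (K.label c) <;>
      simp [x₁, Frame.fromX, Frame.fromAlong, Frame.fromAcross, Frame.along, Frame.across, pick, hb]
    rw [← this]; exact Set.left_mem_uIcc
  · have : K.x₁ 0 d = K.Q + 2 + K.F.sx (K.site d) := by
      by_cases hb : K.F.Upright (K.label d) <;>
      simp [x₁, Frame.fromX, Frame.fromAlong, Frame.fromAcross, Frame.along, Frame.across, pick, hb]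
    rw [h, ← this]; exact Set.left_mem_uIcc
  · have : K.y₁ 0 c = 1 + K.F.sy (K.site c) := by
      by_cases hb : K.F.Upright (K.label c) <;>
      simp [y₁, Frame.fromY, Frame.fromAlong, Frame.fromAcross, Frame.along, Frame.across, pick, hb]
    rw [← this]; exact Set.left_mem_uIcc
  · have : K.y₁ 0 d = 1 + K.F.sy (K.site d) := by
      by_cases hb : K.F.Upright (K.label d) <;>
      simp [y₁, Frame.fromY, Frame.fromAlong, Frame.fromAcross, Frame.along, Frame.across, pick, hb]
    rw [h, ← this]; exact Set.left_mem_uIcc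

/-- The selection made from `τ` is a compatible selection of routes that `σ` allows. -/
theorem merged_spec {T : ℕ → ℕ} (hT : K.Sound N T) {σ τ : ℕ} (hτ : τ < N)
    (h : K.Trans N σ τ) {i : ℕ} (hi : i < N) (h0 : K.merged N T τ i ≠ 0) :
    (K.site (K.merged N T τ i - 1) = i ∧ K.Allow N σ (K.merged N T τ i - 1)) ∧
    ∀ i' < N, K.merged N T τ i' ≠ 0 → i ≠ i' →
      ¬ K.Conf (K.merged N T τ i - 1) (K.merged N T τ i' - 1) := by
  obtain ⟨h1, h2, h3, h4⟩ := h
  have cases : ∀ i < N, K.merged N T τ i ≠ 0 →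
      (K.site (fs N (sn N τ)) = i ∧ K.merged N T τ i - 1 = fs N (sn N τ)) ∨
      (T (pr N (fs N τ) i) ≠ 0 ∧ K.merged N T τ i = T (pr N (fs N τ) i)) ∨
      (T (pr N (sn N (sn N τ)) i) ≠ 0 ∧ K.merged N T τ i = T (pr N (sn N (sn N τ)) i)) := by
    intro i hi h0
    unfold merged at h0 ⊢
    by_cases a : K.site (fs N (sn N τ)) = i
    · rw [pick_pos a]; exact Or.inl ⟨a, rfl⟩
    · rw [pick_neg a] at h0 ⊢
      by_cases b : T (pr N (fs N τ) i) = 0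
      · rw [pick_pos b] at h0 ⊢; exact Or.inr (Or.inr ⟨h0, rfl⟩)
      · rw [pick_neg b]; exact Or.inr (Or.inl ⟨b, rfl⟩)
  have l1 : fs N τ < N := fs_lt hτ
  have l2 : sn N (sn N τ) < N := sn_lt (sn_lt hτ)
  refine ⟨?_, fun i' hi' h0' hne => ?_⟩
  · rcases cases i hi h0 with ⟨a, b⟩ | ⟨a, b⟩ | ⟨a, b⟩
    · rw [b]; exact ⟨a, h1⟩
    · rw [b]
      obtain ⟨⟨c, d⟩, -⟩ := hT _ l1 i hi a
      exact ⟨c, (h2 _ d.1 d).1⟩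
    · rw [b]
      obtain ⟨⟨c, d⟩, -⟩ := hT _ l2 i hi a
      exact ⟨c, (h3 _ d.1 d).1⟩
  · rcases cases i hi h0 with ⟨a, b⟩ | ⟨a, b⟩ | ⟨a, b⟩ <;>
    rcases cases i' hi' h0' with ⟨a', b'⟩ | ⟨a', b'⟩ | ⟨a', b'⟩ <;> rw [b, b']
    · exact absurd (a.symm.trans a') hne
    · obtain ⟨⟨c, d⟩, -⟩ := hT _ l1 i' hi' a'
      exact (h2 _ d.1 d).2
    · obtain ⟨⟨c, d⟩, -⟩ := hT _ l2 i' hi' a'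
      exact (h3 _ d.1 d).2
    · obtain ⟨⟨c, d⟩, -⟩ := hT _ l1 i hi a
      exact not_conf_symm h1.2.1 (h2 _ d.1 d).2
    · exact (hT _ l1 i hi a).2 i' hi' a' hne
    · obtain ⟨⟨c, d⟩, -⟩ := hT _ l1 i hi a
      obtain ⟨⟨c', d'⟩, -⟩ := hT _ l2 i' hi' a'
      exact h4 _ d.1 _ d'.1 d d'
    · obtain ⟨⟨c, d⟩, -⟩ := hT _ l2 i hi a
      exact not_conf_symm h1.2.1 (h3 _ d.1 d).2
    · obtain ⟨⟨c, d⟩, -⟩ := hT _ l2 i hi a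
      obtain ⟨⟨c', d'⟩, -⟩ := hT _ l1 i' hi' a'
      exact not_conf_symm d'.2.1 (h4 _ d'.1 _ d.1 d' d)
    · exact (hT _ l2 i hi a).2 i' hi' a' hne

/-- A cell whose index does not fit below `N` stays 0, which means that no route is selected;
soundness is not affected. -/
theorem table_cases (k : ℕ) {σ i : ℕ} (hσ : σ < N) (hi : i < N) :
    K.table N (k + 1) (pr N σ i) = K.entry N (K.table N k) σ i ∨
      (N ≤ Nat.pair σ i ∧ K.table N (k + 1) (pr N σ i) = 0) := by
  rw [pr_eq hσ.le hi.le]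
  by_cases h : Nat.pair σ i < N
  · left
    rw [table, if_pos h, fs_pair h, sn_pair h]
  · right
    rw [table, if_neg h]
    exact ⟨not_lt.1 h, rfl⟩

/-- No geometry is needed: `Trans` itself demands that the allowed routes of the two parts and the
middle route are allowed by `σ` and compatible with each other. -/
theorem sound_table (k : ℕ) : K.Sound N (K.table N k) := by
  induction k with
  | zero => intro σ _ i _ h; exact absurd rfl h
  | succ k ih =>
    intro σ hσ i hi h0
    have e : ∀ i < N, K.table N (k + 1) (pr N σ i) ≠ 0 →
        K.table N (k + 1) (pr N σ i) = K.entry N (K.table N k) σ i := fun i hi h =>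
      (table_cases k hσ hi).resolve_right fun h' => h h'.2
    rcases K.entry_spec N (K.table N k) σ with ⟨τ, hτ, hb, he⟩ | ⟨-, he⟩
    · have m := merged_spec ih hτ hb.1 hi (by rwa [← he, ← e i hi h0])
      rw [e i hi h0, he]
      refine ⟨m.1, fun i' hi' h0' hne => ?_⟩
      rw [e i' hi' h0', he]
      exact m.2 i' hi' (by rwa [← he, ← e i' hi' h0']) hne
    · exact absurd ((e i hi h0).trans (he i)) h0

/-- Routes from the two parts and the middle route are compatible, hence have different sites. At
every site at most one of the three contributes, so `merged` drops nothing. -/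
theorem Sound.total_merged {T : ℕ → ℕ} (hT : K.Sound N T) {σ τ : ℕ} (hτ : τ < N)
    (h : K.Trans N σ τ) (hn : K.F.n ≤ N) :
    K.weight (fs N (sn N τ) + 1) + K.total N (fun i => T (pr N (fs N τ) i)) +
      K.total N (fun i => T (pr N (sn N (sn N τ)) i)) ≤
    K.total N (fun i => K.merged N T τ i) := by
  obtain ⟨h1, h2, h3, h4⟩ := h
  have l1 : fs N τ < N := fs_lt hτ
  have l2 : sn N (sn N τ) < N := sn_lt (sn_lt hτ)
  have hm : K.site (fs N (sn N τ)) < K.F.n := h1.2.1.1.1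
  rw [← sum_pick_eq N (K.site (fs N (sn N τ))) (K.weight (fs N (sn N τ) + 1)) (by omega),
    total, total, total, ← Finset.sum_add_distrib, ← Finset.sum_add_distrib]
  refine Finset.sum_le_sum fun i hi => ?_
  rw [Finset.mem_range] at hi
  by_cases hin : i < K.F.n
  · simp only [pick_pos hin]
    have w0 : K.weight 0 = 0 := pick_pos rfl _ _
    by_cases a : i = K.site (fs N (sn N τ))
    · have z1 : T (pr N (fs N τ) i) = 0 := by
        by_contra hne
        obtain ⟨⟨c, d⟩, -⟩ := hT _ l1 i hi hne
        exact (h2 _ d.1 d).2 ⟨h1.2.1, Or.inr (touch_of_site_eq (by rw [c, a]))⟩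
      have z2 : T (pr N (sn N (sn N τ)) i) = 0 := by
        by_contra hne
        obtain ⟨⟨c, d⟩, -⟩ := hT _ l2 i hi hne
        exact (h3 _ d.1 d).2 ⟨h1.2.1, Or.inr (touch_of_site_eq (by rw [c, a]))⟩
      rw [z1, z2, w0, pick_pos a, merged, pick_pos a.symm]
      omega
    · rw [pick_neg a, merged, pick_neg (Ne.symm a)]
      by_cases z1 : T (pr N (fs N τ) i) = 0
      · rw [z1, w0, pick_pos rfl]; omega
      · have z2 : T (pr N (sn N (sn N τ)) i) = 0 := by
          by_contra hne
          obtain ⟨⟨c, d⟩, -⟩ := hT _ l1 i hi z1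
          obtain ⟨⟨c', d'⟩, -⟩ := hT _ l2 i hi hne
          exact h4 _ d.1 _ d'.1 d d' ⟨d.2.1, Or.inr (touch_of_site_eq (by rw [c, c']))⟩
        rw [z2, w0, pick_neg z1]; omega
  · simp only [pick_neg hin]
    rw [pick_neg (by omega)]

end Coding

end BoundaryLabeling

end

/-! ### Completeness of the dynamic program -/

noncomputable section

namespace BoundaryLabeling

open Machine (pick pick_pos pick_neg)
open BoundaryLabeling.Lattice

namespace Coding

variable {K : Coding} {N : ℕ}

set_option linter.unusedSectionVars false

/-- The numbers of legal routes. -/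
def Legal (K : Coding) (N : ℕ) : Set ℕ := {c | c < N ∧ K.Valid c}

/-- The owner of a lattice point, with respect to the routes in `S`. -/
abbrev own (K : Coding) (S : Set ℕ) (z : ℕ × ℕ) : ℕ :=
  owner (4 * K.Q + 6) (2 * K.Q + 4) K.str K.pos S z

/-- `S` is a set of legal routes that can occur together. -/
structure IsIndependent (K : Coding) (N : ℕ) (S : Set ℕ) : Prop where
  subset : S ⊆ K.Legal N
  label : ∀ c ∈ S, ∀ d ∈ S, c ≠ d → K.label c ≠ K.label d
  disjoint : ∀ c ∈ S, ∀ d ∈ S, c ≠ d → Disjoint (K.str c) (K.str d)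

/-- The code `σ` describes the subproblem between `z` and `z'`. -/
def Describes (K : Coding) (N : ℕ) (S : Set ℕ) (z z' : ℕ × ℕ) (σ : ℕ) : Prop :=
  ∀ c, K.Allow N σ c ↔ c ∈ between (4 * K.Q + 6) (2 * K.Q + 4) K.str K.pos S (K.Legal N) z z' ∧
    ∀ e ∈ S, (K.pos e = K.own S z ∨ K.pos e = K.own S z') → K.label e ≠ K.label c

section

variable (hK : K.IsProper) {S : Set ℕ} (hS : K.IsIndependent N S)

include hK

theorem strings : IsStringSystem (4 * K.Q + 6) (2 * K.Q + 4) K.str K.pos (K.Legal N) :=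
  isStringSystem hK fun _ h => h.2

include hS

/-- A point whose owner is the foot of `e` has its root in the string of `e`: feet are injective on
`S`, and the artificial owners 0 and `4 * Q + 6` are no feet. -/
theorem str_subset_stem {z : ℕ × ℕ} {e : ℕ} (he : e ∈ S) (h : K.pos e = K.own S z) :
    rootOf (support K.str S) (4 * K.Q + 6) (2 * K.Q + 4) z ∈ K.str e := by
  have hV := strings (N := N) hK
  have b := pos_bounds hV hS.subset he
  by_cases hs : rootOf (support K.str S) (4 * K.Q + 6) (2 * K.Q + 4) z ∈ support K.str S
  · obtain ⟨c, hc, hr⟩ := hs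
    have := owner_eq_pos (pos := K.pos) hS.disjoint hc hr
    have e' : e = c := pos_injOn hV hS.subset hS.disjoint he hc (h.trans this)
    exact e' ▸ hr
  · have hne : ¬ ∃ c ∈ S, rootOf (support K.str S) (4 * K.Q + 6) (2 * K.Q + 4) z ∈ K.str c := hs
    rw [own, owner, dif_neg hne] at h
    rcases root_cases (m := 4 * K.Q + 6) (n := 2 * K.Q + 4) (str := K.str) (S := S) z
      with h' | h' | h'
    · exact absurd h' hs
    · rw [h'] at h; simp only at h; omega
    · rw [h'] at h; simp only at h; omega

/-- This separates the two conditions that a code records in different ways: conflict with the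
owner, and contact with the path, which `exists_barrier` turns into numbers. -/
theorem disjoint_stem_iff {z : ℕ × ℕ} {c : ℕ} :
    Disjoint (K.str c) (stem (4 * K.Q + 6) (2 * K.Q + 4) K.str S z) ↔
      (∀ e ∈ S, K.pos e = K.own S z → ¬ K.Touch e c) ∧
        Disjoint (K.str c) (path (support K.str S) (4 * K.Q + 6) (2 * K.Q + 4) z) := by
  rw [stem, Set.disjoint_union_right]
  refine and_congr_left fun _ => ?_
  constructor
  · intro h e he hp
    rw [← disjoint_iff, disjoint_comm]
    refine Set.disjoint_of_subset_right (fun w hw => ?_) h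
    exact ⟨e, he, str_subset_stem hK hS he hp, hw⟩
  · intro h
    rw [Set.disjoint_left]
    rintro w hw ⟨e, he, hr, hw'⟩
    have := h e he (owner_eq_pos hS.disjoint he hr).symm
    rw [← disjoint_iff] at this
    exact Set.disjoint_left.1 this hw' hw

/-- The code of the owner of a lattice point, and what it says about conflicts. -/
theorem exists_owner_code {L : ℕ} (hcode : ∀ c ∈ S, c < L ^ 4)
    (hbad : ∃ b < L ^ 4, ¬ K.Valid b) (z : ℕ × ℕ) : ∃ e < L ^ 4, ∀ c,
    ¬ K.Conf e c ↔ ∀ e' ∈ S, K.pos e' = K.own S z → K.label e' ≠ K.label c ∧ ¬ K.Touch e' c := by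
  by_cases h : ∃ e ∈ S, K.pos e = K.own S z
  · obtain ⟨e, he, hp⟩ := h
    refine ⟨e, hcode e he, fun c => ?_⟩
    have hv : K.Valid e := (hS.subset he).2
    constructor
    · intro hc e' he' hp'
      have : e' = e := pos_injOn (strings hK) hS.subset hS.disjoint he' he (hp'.trans hp.symm)
      subst this
      exact ⟨fun h => hc ⟨hv, Or.inl h⟩, fun h => hc ⟨hv, Or.inr h⟩⟩
    · rintro h ⟨-, h'⟩
      obtain ⟨h1, h2⟩ := h e he hp
      tauto
  -- An artificial owner is coded by an invalid route, which conflicts with nothing.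
  · obtain ⟨b, hb, hb'⟩ := hbad
    exact ⟨b, hb, fun c => ⟨fun _ e' he' hp' => (h ⟨e', he', hp'⟩).elim, fun _ h' => hb' h'.1⟩⟩

/-- A code contains two owners, a range of feet and two column segments. With numbers below `L` and
routes below `L ^ 4`, nested pairing stays below `L ^ 32`. -/
theorem exists_describes {L : ℕ} (hL : 4 * K.Q + 8 ≤ L) (hN : L ^ 32 ≤ N)
    (hcode : ∀ c ∈ S, c < L ^ 4) (hbad : ∃ b < L ^ 4, ¬ K.Valid b) {z z' : ℕ × ℕ}
    (hz : z.1 ≤ 4 * K.Q + 6 ∧ z.2 ≤ 2 * K.Q + 4) (hz' : z'.1 ≤ 4 * K.Q + 6 ∧ z'.2 ≤ 2 * K.Q + 4)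
    (hm : K.own S z' ≤ 4 * K.Q + 6) : ∃ σ < L ^ 32, K.Describes N S z z' σ := by
  have hV := strings (N := N) hK
  obtain ⟨e, he, hec⟩ := exists_owner_code hK hS hcode hbad z
  obtain ⟨f, hf, hfc⟩ := exists_owner_code hK hS hcode hbad z'
  obtain ⟨x, y₀, y, p, b1, b2, b3, b4, b5, b6⟩ :=
    exists_barrier hV hS.subset hS.disjoint (by omega) hz.1 hz.2
  obtain ⟨x', y₀', y', p', b1', b2', b3', b4', b5', b6'⟩ :=
    exists_barrier hV hS.subset hS.disjoint (by omega) hz'.1 hz'.2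
  change K.own S z ≤ p at b5
  change ∀ c ∈ K.Legal N, K.pos c ≠ K.own S z → (_ ↔ _ ∧ ¬ (K.own S z < K.pos c ∧ K.pos c ≤ p)) at b6
  change ∀ c ∈ K.Legal N, K.pos c ≠ K.own S z' →
    (_ ↔ _ ∧ ¬ (K.own S z' < K.pos c ∧ K.pos c ≤ p')) at b6'
  have up : ∀ {a i j : ℕ}, a < L ^ i → i ≤ j → a < L ^ j := fun h hij =>
    h.trans_le (Nat.pow_le_pow_right (by omega) hij)
  have pl : ∀ {a b i : ℕ}, a < L ^ i → b < L ^ i → Nat.pair a b < L ^ (i * 2) := fun ha hb => by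
    rw [pow_mul]; exact pair_lt ha hb
  have one : ∀ {a}, a < L → a < L ^ 1 := fun h => by rwa [pow_one]
  have cx : ∀ {x y₀ y : ℕ}, x ≤ 4 * K.Q + 6 → y₀ ≤ y → y ≤ 2 * K.Q + 4 →
      Nat.pair y₀ y < L ^ 2 ∧ Nat.pair x (Nat.pair y₀ y) < L ^ 4 := by
    intro x y₀ y h1 h2 h3
    have := pl (one (a := y₀) (by omega)) (one (a := y) (by omega))
    exact ⟨this, pl (up (one (by omega)) (by omega)) this⟩
  have c1 := cx b1 b2 b3
  have c1' := cx b1' b2' b3'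
  have c2 := pl he hf
  -- The left limit is `p` and not the owner of `z`, because feet up to `p` lie under the path of
  -- `z`. The corresponding condition for `p'` holds automatically for feet to the left of the owner
  -- of `z'`.
  have c3 : Nat.pair p (K.own S z') < L ^ 2 := pl (one (by omega)) (one (by omega))
  have c4 := pl c1.2 c1'.2
  have c5 := pl (up c3 (j := 8) (by omega)) c4
  have c6 := pl (up c2 (j := 16) (by omega)) c5
  refine ⟨_, c6, fun c => ?_⟩
  have lt : ∀ {a i}, a < L ^ i → i ≤ 32 → a < N := fun h hi => (up h hi).trans_le hN
  simp only [Allow, Blocks, fs_pair (lt c6 (by omega)), sn_pair (lt c6 (by omega)),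
    fs_pair (lt c5 (by omega)), sn_pair (lt c5 (by omega)), fs_pair (lt c4 (by omega)),
    sn_pair (lt c4 (by omega)), fs_pair (lt c3 (by omega)), sn_pair (lt c3 (by omega)),
    fs_pair (lt c2 (by omega)), sn_pair (lt c2 (by omega)), fs_pair (lt c1.2 (by omega)),
    sn_pair (lt c1.2 (by omega)), fs_pair (lt c1'.2 (by omega)), sn_pair (lt c1'.2 (by omega)),
    fs_pair (lt c1.1 (by omega)), sn_pair (lt c1.1 (by omega)), fs_pair (lt c1'.1 (by omega)),
    sn_pair (lt c1'.1 (by omega)), hec, hfc, hitsColumn_iff _ b2, hitsColumn_iff _ b2']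
  have unfold_between : c ∈ between (4 * K.Q + 6) (2 * K.Q + 4) K.str K.pos S (K.Legal N) z z' ↔
      c ∈ K.Legal N ∧ K.own S z < K.pos c ∧ K.pos c < K.own S z' ∧
        Disjoint (K.str c) (stem (4 * K.Q + 6) (2 * K.Q + 4) K.str S z) ∧
        Disjoint (K.str c) (stem (4 * K.Q + 6) (2 * K.Q + 4) K.str S z') := Iff.rfl
  rw [unfold_between, disjoint_stem_iff hK hS, disjoint_stem_iff hK hS]
  constructor
  · rintro ⟨h1, h2, h3, h4, h5, h6, h7, h8⟩
    have hc : c ∈ K.Legal N := ⟨h1, h2⟩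
    refine ⟨⟨hc, by omega, h4, ⟨fun e he hp => (h5 e he hp).2, (b6 c hc (by omega)).2 ⟨h7, by omega⟩⟩,
      fun e he hp => (h6 e he hp).2, (b6' c hc (by omega)).2 ⟨h8, by omega⟩⟩, fun e he hp => ?_⟩
    rcases hp with hp | hp
    · exact (h5 e he hp).1
    · exact (h6 e he hp).1
  · rintro ⟨⟨hc, h3, h4, ⟨h5, h7⟩, h6, h8⟩, h9⟩
    have k7 := (b6 c hc (by omega)).1 h7
    have k8 := (b6' c hc (by omega)).1 h8
    exact ⟨hc.1, hc.2, by omega, h4, fun e he hp => ⟨h9 e he (Or.inl hp), h5 e he hp⟩,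
      fun e he hp => ⟨h9 e he (Or.inr hp), h6 e he hp⟩, k7.1, k8.1⟩

/-- Members of `S` avoid all stems of other owners, so for them lying between the owners is only a
matter of the feet. -/
theorem mem_between_of_mem {z z' : ℕ × ℕ} {c : ℕ} (hc : c ∈ S) (h1 : K.own S z < K.pos c)
    (h2 : K.pos c < K.own S z') :
    c ∈ between (4 * K.Q + 6) (2 * K.Q + 4) K.str K.pos S (K.Legal N) z z' := by
  have st : ∀ w, K.own S w ≠ K.pos c →
      Disjoint (K.str c) (stem (4 * K.Q + 6) (2 * K.Q + 4) K.str S w) := by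
    intro w hw
    rw [Set.disjoint_left]
    intro v hv hv'
    exact hw ((owner_of_mem_stem hS.disjoint hv').symm.trans (owner_of_mem hS.disjoint hc hv))
  exact ⟨hS.subset hc, h1, h2, st z (by omega), st z' (by omega)⟩

theorem not_touch_of_mem_between {z z' : ℕ × ℕ} {c e : ℕ} (he : e ∈ S)
    (hc : c ∈ between (4 * K.Q + 6) (2 * K.Q + 4) K.str K.pos S (K.Legal N) z z')
    (hp : K.pos e = K.own S z ∨ K.pos e = K.own S z') : ¬ K.Touch e c := by
  obtain ⟨-, -, -, h1, h2⟩ := hc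
  rcases hp with hp | hp
  · exact ((disjoint_stem_iff hK hS).1 h1).1 e he hp
  · exact ((disjoint_stem_iff hK hS).1 h2).1 e he hp

/-- The decomposition of a subproblem at a triangle. -/
theorem trans_of_describes {z z' u v w : ℕ × ℕ} (hzz : Adj z z') (huv : Adj u v) (hvw : Adj v w)
    {d : ℕ} (hd : d ∈ S) (hu : K.own S u = K.own S z) (hv : K.own S v = K.pos d)
    (hw : K.own S w = K.own S z') (h1 : K.own S z < K.pos d) (h2 : K.pos d < K.own S z')
    {σ σ₁ σ₂ τ : ℕ} (dσ : K.Describes N S z z' σ) (dσ₁ : K.Describes N S u v σ₁)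
    (dσ₂ : K.Describes N S v w σ₂) (e₁ : fs N τ = σ₁) (e₂ : fs N (sn N τ) = d)
    (e₃ : sn N (sn N τ) = σ₂) : K.Trans N σ τ := by
  have hV := strings (N := N) hK
  have hdv : K.Valid d := (hS.subset hd).2
  rw [Trans, e₁, e₂, e₃]
  have ne : ∀ c, K.pos c ≠ K.pos d → c ∈ S → K.label c ≠ K.label d := fun c h hc =>
    hS.label c hc d hd fun e => h (by rw [e])
  have bt : ∀ {σ z z' c}, K.Describes N S z z' σ → K.Allow N σ c →
      c ∈ between (4 * K.Q + 6) (2 * K.Q + 4) K.str K.pos S (K.Legal N) z z' := fun h h' =>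
    ((h _).1 h').1
  have l₁ : ∀ {c}, K.Allow N σ₁ c → K.label d ≠ K.label c := fun hc =>
    ((dσ₁ _).1 hc).2 d hd (Or.inr hv.symm)
  have l₂ : ∀ {c}, K.Allow N σ₂ c → K.label d ≠ K.label c := fun hc =>
    ((dσ₂ _).1 hc).2 d hd (Or.inl hv.symm)
  have p₁ : ∀ {c}, K.Allow N σ₁ c → K.pos c < K.pos d := fun hc => hv ▸ (bt dσ₁ hc).2.2.1
  have p₂ : ∀ {c}, K.Allow N σ₂ c → K.pos d < K.pos c := fun hc => hv ▸ (bt dσ₂ hc).2.1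
  refine ⟨(dσ d).2 ⟨mem_between_of_mem hK hS hd h1 h2, fun e he hp => ne e (by omega) he⟩,
    fun c hcN hc => ⟨(dσ c).2 ⟨?_, ?_⟩, ?_⟩, fun c hcN hc => ⟨(dσ c).2 ⟨?_, ?_⟩, ?_⟩, ?_⟩
  · exact between_mono_left hV hS.subset hS.disjoint hzz huv hu
      (by simp only [own] at hu hv h1 h2; omega) (by simp only [own] at hu hv h1 h2; omega) (bt dσ₁ hc)
  · rintro e he (hp | hp)
    · exact ((dσ₁ c).1 hc).2 e he (Or.inl (hp.trans hu.symm))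
    -- A route in the left part with the label of the right owner would enclose `d` between two
    -- routes to that label, so `d` would have this label as well.
    · intro hl
      exact l₁ hc (label_eq_of_between hK hc.2.1 hdv (hS.subset he).2 hl.symm (p₁ hc) (by omega))
  · rintro ⟨-, h' | h'⟩
    · exact l₁ hc h'
    · exact not_touch_of_mem_between hK hS hd (bt dσ₁ hc) (Or.inr hv.symm) h'
  · exact between_mono_right hV hS.subset hS.disjoint hzz hvw hw
      (by simp only [own] at hw hv h1 h2; omega) (by simp only [own] at hw hv h1 h2; omega) (bt dσ₂ hc)
  · rintro e he (hp | hp)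
    · intro hl
      exact l₂ hc ((label_eq_of_between hK (hS.subset he).2 hdv hc.2.1 hl (by omega)
        (p₂ hc)).trans hl)
    · exact ((dσ₂ c).1 hc).2 e he (Or.inr (hp.trans hw.symm))
  · rintro ⟨-, h' | h'⟩
    · exact l₂ hc h'
    · exact not_touch_of_mem_between hK hS hd (bt dσ₂ hc) (Or.inl hv.symm) h'
  · rintro c - c' - hc hc' ⟨-, h' | h'⟩
    -- Likewise two routes with a common label in different parts would force their label on `d`.
    · exact l₁ hc (label_eq_of_between hK hc.2.1 hdv hc'.2.1 h' (p₁ hc) (p₂ hc'))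
    · refine (disjoint_iff K).1 ?_ h'
      exact between_disjoint hV hS.subset hS.disjoint huv hvw
        (by simp only [own] at hu hw hv h1 h2; omega) (by simp only [own] at hu hw hv h1 h2; omega) (bt dσ₁ hc) (bt dσ₂ hc')

end

variable (hK : K.IsProper) {S : Finset ℕ} (hS : K.IsIndependent N ↑S) {L : ℕ} (hL : 4 * K.Q + 8 ≤ L)
  (hn : K.F.n ≤ L) (hN : L ^ 128 ≤ N) (hcode : ∀ c ∈ S, c < L ^ 4)
  (hbad : ∃ b < L ^ 4, ¬ K.Valid b)

include hK hS hL hn hN hcode hbad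

/-- The routes of `S` that lie between the owners of `z` and `z'` weigh no more than the selection
for the subproblem between `z` and `z'`. -/
theorem weight_le_total (k : ℕ) : ∀ (z z' : ℕ × ℕ) (σ : ℕ), Adj z z' →
    (K.own S z = 0 ∨ ∃ c ∈ S, K.own S z = K.pos c) → K.own S z' ≤ 4 * K.Q + 6 →
    σ < L ^ 32 → K.Describes N S z z' σ →
    (S.filter fun c => K.own S z < K.pos c ∧ K.pos c < K.own S z').card ≤ k →
    ∑ c ∈ S.filter (fun c => K.own S z < K.pos c ∧ K.pos c < K.own S z'), K.weight (c + 1) ≤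
      K.total N (fun i => K.table N k (pr N σ i)) := by
  have hV := strings (N := N) hK
  have up : ∀ {a i j : ℕ}, a < L ^ i → i ≤ j → a < L ^ j := fun h hij =>
    h.trans_le (Nat.pow_le_pow_right (by omega) hij)
  have pl : ∀ {a b i : ℕ}, a < L ^ i → b < L ^ i → Nat.pair a b < L ^ (i * 2) := fun ha hb => by
    rw [pow_mul]; exact pair_lt ha hb
  have lt : ∀ {a i}, a < L ^ i → i ≤ 128 → a < N := fun h hi => (up h hi).trans_le hN
  have hL1 : L ≤ N := (Nat.le_self_pow (by omega) L).trans hN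
  induction k with
  | zero =>
    intro z z' σ _ _ _ _ _ hc
    rw [Finset.card_eq_zero.1 (Nat.le_zero.1 hc), Finset.sum_empty]
    exact Nat.zero_le _
  | succ k ih =>
    intro z z' σ hzz hz hz' hσ hd hc
    rcases (S.filter fun c => K.own S z < K.pos c ∧ K.pos c < K.own S z').eq_empty_or_nonempty
      with he | ⟨c, hc'⟩
    · rw [he, Finset.sum_empty]
      exact Nat.zero_le _
    · rw [Finset.mem_filter] at hc'
      obtain ⟨d, hdS, u, v, w, ⟨bu, bv, bw, huv, hvw, -⟩, eu, ev, ew, l1, l2⟩ :=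
        exists_split hV hS.subset hS.disjoint (by omega) hzz hz hz' hc'.1 hc'.2.1 hc'.2.2
      change K.own S u = K.own S z at eu
      change K.own S v = K.pos d at ev
      change K.own S w = K.own S z' at ew
      change K.own S z < K.pos d at l1
      change K.pos d < K.own S z' at l2
      have hdS' : d ∈ S := hdS
      obtain ⟨σ₁, b₁, d₁⟩ := exists_describes hK hS (N := N) hL
        ((Nat.pow_le_pow_right (by omega) (by omega)).trans hN) hcode hbad
        (z := u) (z' := v) (by omega) (by omega) (by omega)
      obtain ⟨σ₂, b₂, d₂⟩ := exists_describes hK hS (N := N) hL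
        ((Nat.pow_le_pow_right (by omega) (by omega)).trans hN) hcode hbad
        (z := v) (z' := w) (by omega) (by omega) (by omega)
      -- The middle route with one part stays below `L ^ 64`, and the complete transition below `L ^
      -- 128`; this is the reason for the hypothesis on `N`.
      have c₁ := pl (up (hcode d hdS') (by omega)) b₂
      have c₂ := pl (up b₁ (j := 64) (by omega)) c₁
      have τN := lt c₂ (by omega)
      have e₁ := fs_pair τN
      have e₂ := sn_pair τN
      have e₃ := fs_pair (lt c₁ (by omega))
      have e₄ := sn_pair (lt c₁ (by omega))
      have htr : K.Trans N σ (Nat.pair σ₁ (Nat.pair d σ₂)) :=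
        trans_of_describes hK hS hzz huv hvw hdS eu ev ew l1 l2 hd d₁ d₂ e₁ (by rw [e₂, e₃])
          (by rw [e₂, e₄])
      have hσN := lt hσ (by omega)
      have tab : ∀ i < K.F.n, K.table N (k + 1) (pr N σ i) = K.entry N (K.table N k) σ i := by
        intro i hi
        refine (table_cases k hσN (by omega)).resolve_right fun h => ?_
        have hi' : i < L ^ 32 := lt_of_lt_of_le (by omega) (Nat.le_self_pow (by omega) L)
        exact absurd (lt (pl hσ hi') (by omega)) (not_lt.2 h.1)
      have key := (sound_table k).total_merged τN htr (by omega)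
      rw [e₂, e₁, e₃, e₄] at key
      -- The transition at the triangle is one of those tried, so the best one is at least as heavy.
      have mono : K.total N (fun i => K.merged N (K.table N k) (Nat.pair σ₁ (Nat.pair d σ₂)) i) ≤
          K.total N (fun i => K.table N (k + 1) (pr N σ i)) := by
        rcases K.entry_spec N (K.table N k) σ with ⟨τ', hτ', hb, he⟩ | ⟨hno, -⟩
        · refine (hb.2 _ τN htr).trans (Finset.sum_le_sum fun i _ => ?_)
          by_cases hi : i < K.F.n
          · exact le_of_eq (by simp only [pick_pos hi, tab i hi, he])
          · rw [pick_neg hi, pick_neg hi]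
        · exact absurd ⟨_, τN, htr⟩ hno
      -- The feet of `S` between `z` and `z'` are that of `d` and those on either side of it; both
      -- sides lack `d`, so the induction on their number applies.
      have sub : S.filter (fun c => K.own S z < K.pos c ∧ K.pos c < K.own S z') ⊆
          {d} ∪ (S.filter (fun c => K.own S u < K.pos c ∧ K.pos c < K.own S v) ∪
            S.filter (fun c => K.own S v < K.pos c ∧ K.pos c < K.own S w)) := by
        intro x hx
        simp only [Finset.mem_union, Finset.mem_singleton, Finset.mem_filter] at hx ⊢
        by_cases hxd : x = d
        · exact Or.inl hxd
        · have : K.pos x ≠ K.pos d := fun h =>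
            hxd (pos_injOn hV hS.subset hS.disjoint hx.1 hdS h)
          rcases lt_or_gt_of_ne this with h | h
          · exact Or.inr (Or.inl ⟨hx.1, by omega, by omega⟩)
          · exact Or.inr (Or.inr ⟨hx.1, by omega, by omega⟩)
      have card₁ : (S.filter (fun c => K.own S u < K.pos c ∧ K.pos c < K.own S v)).card ≤ k := by
        refine Nat.le_of_lt_succ (lt_of_lt_of_le (Finset.card_lt_card ?_) hc)
        refine (Finset.ssubset_iff_of_subset fun x hx => ?_).2 ⟨d, ?_, ?_⟩
        · simp only [Finset.mem_filter] at hx ⊢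
          exact ⟨hx.1, by omega, by omega⟩
        · exact Finset.mem_filter.2 ⟨hdS', l1, l2⟩
        · simp only [Finset.mem_filter]; omega
      have card₂ : (S.filter (fun c => K.own S v < K.pos c ∧ K.pos c < K.own S w)).card ≤ k := by
        refine Nat.le_of_lt_succ (lt_of_lt_of_le (Finset.card_lt_card ?_) hc)
        refine (Finset.ssubset_iff_of_subset fun x hx => ?_).2 ⟨d, ?_, ?_⟩
        · simp only [Finset.mem_filter] at hx ⊢
          exact ⟨hx.1, by omega, by omega⟩
        · exact Finset.mem_filter.2 ⟨hdS', l1, l2⟩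
        · simp only [Finset.mem_filter]; omega
      have i₁ := ih u v σ₁ huv (by rwa [eu]) (by omega) b₁ d₁ card₁
      have i₂ := ih v w σ₂ hvw (Or.inr ⟨d, hdS', ev⟩) (by omega) b₂ d₂ card₂
      have s₁ := Finset.sum_le_sum_of_subset (f := fun c => K.weight (c + 1)) sub
      have s₂ := Finset.sum_union_inter (f := fun c => K.weight (c + 1)) (s₁ := {d})
        (s₂ := S.filter (fun c => K.own S u < K.pos c ∧ K.pos c < K.own S v) ∪
            S.filter (fun c => K.own S v < K.pos c ∧ K.pos c < K.own S w))
      have s₃ := Finset.sum_union_inter (f := fun c => K.weight (c + 1))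
        (s₁ := S.filter (fun c => K.own S u < K.pos c ∧ K.pos c < K.own S v))
        (s₂ := S.filter (fun c => K.own S v < K.pos c ∧ K.pos c < K.own S w))
      rw [Finset.sum_singleton] at s₂
      omega

/-- Some subproblem has a selection that weighs at least as much as `S`. -/
theorem exists_weight_le_total {k : ℕ} (hk : S.card ≤ k) :
    ∃ σ < N, ∑ c ∈ S, K.weight (c + 1) ≤ K.total N (fun i => K.table N k (pr N σ i)) := by
  have hV := strings (N := N) hK
  -- The two topmost points of the right column are adjacent, and their owners 0 and `4 * Q + 6`
  -- enclose all feet: their edge describes the whole problem.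
  have o1 : K.own S (4 * K.Q + 6, 2 * K.Q + 4) = 0 := owner_top hV hS.subset (by omega) _
  have o2 : K.own S (4 * K.Q + 6, 2 * K.Q + 3) = 4 * K.Q + 6 :=
    owner_right hV hS.subset (by omega)
  obtain ⟨σ, b, d⟩ := exists_describes hK hS (N := N) hL
    ((Nat.pow_le_pow_right (by omega) (by omega)).trans hN) hcode hbad
    (z := (4 * K.Q + 6, 2 * K.Q + 4)) (z' := (4 * K.Q + 6, 2 * K.Q + 3)) ⟨le_rfl, le_rfl⟩
    ⟨le_rfl, by simp only; omega⟩ o2.le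
  refine ⟨σ, b.trans_le ((Nat.pow_le_pow_right (by omega) (by omega)).trans hN), ?_⟩
  have e : S.filter (fun c => K.own S (4 * K.Q + 6, 2 * K.Q + 4) < K.pos c ∧
      K.pos c < K.own S (4 * K.Q + 6, 2 * K.Q + 3)) = S := by
    rw [o1, o2]
    refine Finset.filter_true_of_mem fun c hc => pos_bounds hV hS.subset hc
  have := weight_le_total hK hS hL hn hN hcode hbad k (4 * K.Q + 6, 2 * K.Q + 4)
    (4 * K.Q + 6, 2 * K.Q + 3) σ (by unfold Adj; simp) (Or.inl o1) o2.le b d (by rwa [e])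
  rwa [e] at this

end Coding

end BoundaryLabeling

end

noncomputable section

namespace BoundaryLabeling

open Machine (pick pick_pos pick_neg)

/-! ### Chains and boxes -/

/-- The point set of an axis-aligned box. -/
def planeBox (p q : Point) : Set Point :=
  {x | x.1 ∈ Set.uIcc p.1 q.1 ∧ x.2 ∈ Set.uIcc p.2 q.2}

theorem segment_eq_planeBox {p q : Point} (h : p.1 = q.1 ∨ p.2 = q.2) :
    segment ℝ p q = planeBox p q := by
  obtain ⟨a, b⟩ := p
  obtain ⟨c, d⟩ := q
  rcases h with h | h
  · simp only at h
    subst h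
    rw [← Prod.image_mk_segment_right, segment_eq_uIcc]
    ext ⟨x, y⟩
    simp only [planeBox, Set.uIcc_self, Set.mem_image, Set.mem_ofPred_eq, Prod.mk.injEq,
      Set.mem_singleton_iff]
    constructor
    · rintro ⟨_, h, rfl, rfl⟩; exact ⟨rfl, h⟩
    · rintro ⟨rfl, h⟩; exact ⟨_, h, rfl, rfl⟩
  · simp only at h
    subst h
    rw [← Prod.image_mk_segment_left, segment_eq_uIcc]
    ext ⟨x, y⟩
    simp only [planeBox, Set.uIcc_self, Set.mem_image, Set.mem_ofPred_eq, Prod.mk.injEq,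
      Set.mem_singleton_iff]
    constructor
    · rintro ⟨_, h, rfl, rfl⟩; exact ⟨h, rfl⟩
    · rintro ⟨h, rfl⟩; exact ⟨_, h, rfl, rfl⟩

theorem mem_trace_of_mem {l : List Point} {p : Point} (h : p ∈ l) : p ∈ trace l := by
  induction l with
  | nil => exact absurd h List.not_mem_nil
  | cons a l ih =>
    cases l with
    | nil => simpa [trace] using h
    | cons b l =>
      rcases List.mem_cons.1 h with rfl | h
      · exact Or.inl (left_mem_segment ℝ _ _)
      · exact Or.inr (ih h)

theorem mem_trace_iff {l : List Point} (hl : 2 ≤ l.length) {p : Point} :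
    p ∈ trace l ↔ ∃ (k : ℕ) (h : k + 1 < l.length), p ∈ segment ℝ l[k] l[k + 1] := by
  induction l with
  | nil => simp at hl
  | cons a l ih =>
    cases l with
    | nil => simp at hl
    | cons b l =>
      have step : p ∈ trace (a :: b :: l) ↔ p ∈ segment ℝ a b ∨ p ∈ trace (b :: l) := Iff.rfl
      rw [step]
      cases l with
      | nil =>
        constructor
        · rintro (h | h)
          · exact ⟨0, by simp, h⟩
          · have : p = b := h
            subst this; exact ⟨0, by simp, right_mem_segment ℝ _ _⟩
        · rintro ⟨k, hk, h⟩
          simp only [List.length_cons, List.length_nil] at hk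
          obtain rfl : k = 0 := by omega
          exact Or.inl h
      | cons c l =>
        rw [ih (by simp)]
        constructor
        · rintro (h | ⟨k, hk, h⟩)
          · exact ⟨0, by simp, h⟩
          · exact ⟨k + 1, by simp at hk ⊢; omega, h⟩
        · rintro ⟨k, hk, h⟩
          cases k with
          | zero => exact Or.inl h
          | succ k => exact Or.inr ⟨k, by simp at hk ⊢; omega, h⟩

theorem isPreconnected_trace (l : List Point) : IsPreconnected (trace l) := by
  induction l with
  | nil => exact isPreconnected_empty
  | cons a l ih =>
    cases l with
    | nil => exact isPreconnected_singleton
    | cons b l =>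
      exact (convex_segment a b).isPreconnected.union b (right_mem_segment ℝ _ _)
        (mem_trace_of_mem List.mem_cons_self) ih

theorem trace_subset {l : List Point} {C : Set Point} (hC : Convex ℝ C) (h : ∀ p ∈ l, p ∈ C) :
    trace l ⊆ C := by
  induction l with
  | nil => exact Set.empty_subset _
  | cons a l ih =>
    cases l with
    | nil => rintro p rfl; exact h _ List.mem_cons_self
    | cons b l =>
      have hb := ih fun p hp => h p (List.mem_cons_of_mem _ hp)
      exact Set.union_subset (hC.segment_subset (h _ List.mem_cons_self)
        (h _ (by simp))) hb

/-- The boundary of a polygon belongs to its region. -/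
theorem trace_subset_region (P : List Point) : trace (closedChain P) ⊆ region P := by
  intro p hp
  have : connectedComponentIn (trace (closedChain P))ᶜ p = ∅ :=
    connectedComponentIn_eq_empty fun h => h hp
  rw [region, Set.mem_ofPred_eq, this]
  exact Bornology.isBounded_empty

/-- A point that is joined to infinity off the boundary of a polygon is not in its region. -/
theorem disjoint_region {P : List Point} {X Y : Set Point} (hX : IsPreconnected X)
    (hY : IsPreconnected Y) {q : Point} (hqX : q ∈ X) (hqY : q ∈ Y)
    (dX : Disjoint X (trace (closedChain P))) (dY : Disjoint Y (trace (closedChain P)))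
    (hub : ¬ Bornology.IsBounded Y) : Disjoint X (region P) := by
  rw [Set.disjoint_left]
  intro p hp hr
  have hr' : Bornology.IsBounded (connectedComponentIn (trace (closedChain P))ᶜ p) := hr
  -- `X ∪ Y` is connected and avoids the boundary, so the component of a point of `X` contains the
  -- unbounded set `Y`.
  refine hub (hr'.subset (Set.Subset.trans (Set.subset_union_right (s := X)) ?_))
  refine (hX.union q hqX hqY hY).subset_connectedComponentIn (Or.inl hp) ?_
  exact Set.union_subset (Set.subset_compl_iff_disjoint_right.2 dX)
    (Set.subset_compl_iff_disjoint_right.2 dY)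

namespace Rect

theorem convex_closed (R : Rect) : Convex ℝ R.closed := (convex_Icc _ _).prod (convex_Icc _ _)

/-- From every point of a side that belongs to it there is a ray that leaves the rectangle. -/
theorem exists_ray (R : Rect) (s : Side) (u : ℝ) : ∃ Y : Set Point, IsPreconnected Y ∧
    R.sidePoint s u ∈ Y ∧ ¬ Bornology.IsBounded Y ∧ ∀ p ∈ Y, p ∈ R.closed →
      p = R.sidePoint s u := by
  -- A map that does not shrink distances takes unbounded sets to unbounded sets.
  have ub : ∀ (f : ℝ → Point) (S : Set ℝ), (∀ t t', |t - t'| ≤ dist (f t) (f t')) →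
      ¬ Bornology.IsBounded S → ¬ Bornology.IsBounded (f '' S) := by
    intro f S hf hS hb
    apply hS
    rw [Metric.isBounded_iff] at hb ⊢
    obtain ⟨C, hC⟩ := hb
    exact ⟨C, fun t ht t' ht' => (hf t t').trans
      (hC (Set.mem_image_of_mem f ht) (Set.mem_image_of_mem f ht'))⟩
  have up : ∀ a : ℝ, ¬ Bornology.IsBounded (Set.Ici a) := fun a h =>
    not_bddAbove_Ici a h.bddAbove
  have dn : ∀ a : ℝ, ¬ Bornology.IsBounded (Set.Iic a) := fun a h =>
    not_bddBelow_Iic a h.bddBelow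
  have cv : ∀ t : ℝ, Continuous fun x : ℝ => ((t, x) : Point) := fun t => by fun_prop
  have ch : ∀ t : ℝ, Continuous fun x : ℝ => ((x, t) : Point) := fun t => by fun_prop
  cases s with
  | bottom =>
    refine ⟨(fun t => (u, t)) '' Set.Iic R.ymin, isPreconnected_Iic.image _ (cv u).continuousOn,
      ⟨_, Set.self_mem_Iic, rfl⟩, ub _ _ (fun t t' => ?_) (dn _), ?_⟩
    · simp [Prod.dist_eq, Real.dist_eq]
    · rintro _ ⟨t, ht, rfl⟩ ⟨-, h⟩
      have : t = R.ymin := le_antisymm ht h.1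
      simp only [sidePoint, this]
  | top =>
    refine ⟨(fun t => (u, t)) '' Set.Ici R.ymax, isPreconnected_Ici.image _ (cv u).continuousOn,
      ⟨_, Set.self_mem_Ici, rfl⟩, ub _ _ (fun t t' => ?_) (up _), ?_⟩
    · simp [Prod.dist_eq, Real.dist_eq]
    · rintro _ ⟨t, ht, rfl⟩ ⟨-, h⟩
      have : t = R.ymax := le_antisymm h.2 ht
      simp only [sidePoint, this]
  | left =>
    refine ⟨(fun t => (t, u)) '' Set.Iic R.xmin, isPreconnected_Iic.image _ (ch u).continuousOn,
      ⟨_, Set.self_mem_Iic, rfl⟩, ub _ _ (fun t t' => ?_) (dn _), ?_⟩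
    · simp [Prod.dist_eq, Real.dist_eq]
    · rintro _ ⟨t, ht, rfl⟩ ⟨h, -⟩
      have : t = R.xmin := le_antisymm ht h.1
      simp only [sidePoint, this]
  | right =>
    refine ⟨(fun t => (t, u)) '' Set.Ici R.xmax, isPreconnected_Ici.image _ (ch u).continuousOn,
      ⟨_, Set.self_mem_Ici, rfl⟩, ub _ _ (fun t t' => ?_) (up _), ?_⟩
    · simp [Prod.dist_eq, Real.dist_eq]
    · rintro _ ⟨t, ht, rfl⟩ ⟨h, -⟩
      have : t = R.xmax := le_antisymm h.2 ht
      simp only [sidePoint, this]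

end Rect

/-- A chain that ends on the boundary of a rectangle meets the region of a polygon inside the
rectangle only if it meets its boundary. -/
theorem disjoint_region_iff {R : Rect} {P : List Point} (hP : ∀ p ∈ P, p ∈ R.closed)
    {l : List Point} {s : Side} {u : ℝ} (hq : R.sidePoint s u ∈ trace l) :
    Disjoint (trace l) (region P) ↔ Disjoint (trace l) (trace (closedChain P)) := by
  refine ⟨fun h => h.mono_right (trace_subset_region P), fun h => ?_⟩
  -- The ray starting at the port meets the rectangle, and hence the polygon, at most in the port
  -- itself, which the chain already keeps off the boundary of the polygon.
  obtain ⟨Y, h1, h2, h3, h4⟩ := R.exists_ray s u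
  refine disjoint_region (isPreconnected_trace l) h1 hq h2 h ?_ h3
  rw [Set.disjoint_left]
  intro p hp hp'
  have : p ∈ R.closed := by
    refine trace_subset R.convex_closed (fun p hp => ?_) hp'
    rcases List.mem_append.1 hp with h | h
    · exact hP p h
    · exact hP p (List.mem_of_mem_take h)
  rw [h4 p hp this] at hp'
  exact Set.disjoint_left.1 h hq hp'

theorem mem_trace_closedChain {P : List Point} (hP : IsOrthogonalPolygon P) {p : Point} :
    p ∈ trace (closedChain P) ↔ ∃ (k : ℕ) (h : k < P.length),
      p ∈ planeBox P[k] (if h' : k + 1 = P.length then P[0]'(by omega) else P[k + 1]'(by omega)) := by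
  obtain ⟨h4, hc⟩ := hP
  have hlen : (closedChain P).length = P.length + 1 := by
    simp only [closedChain, List.length_append, List.length_take]; omega
  rw [mem_trace_iff (by omega)]
  have e : ∀ (k : ℕ) (h : k < P.length),
      (closedChain P)[k]'(by omega) = P[k] ∧ (closedChain P)[k + 1]'(by omega) =
        if h' : k + 1 = P.length then P[0]'(by omega) else P[k + 1]'(by omega) := by
    intro k h
    refine ⟨List.getElem_append_left h, ?_⟩
    split_ifs with h'
    · simp only [closedChain]
      rw [List.getElem_append_right (by omega)]
      simp [h']
    · exact List.getElem_append_left (by omega)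
  have s : ∀ (k : ℕ) (h : k < P.length), segment ℝ ((closedChain P)[k]'(by omega))
      ((closedChain P)[k + 1]'(by omega)) = planeBox P[k]
        (if h' : k + 1 = P.length then P[0]'(by omega) else P[k + 1]'(by omega)) := by
    intro k h
    rw [segment_eq_planeBox (List.isChain_iff_getElem.1 hc k (by omega)), (e k h).1, (e k h).2]
  constructor
  · rintro ⟨k, hk, h⟩
    exact ⟨k, by omega, by rwa [← s k (by omega)]⟩
  · rintro ⟨k, hk, h⟩
    exact ⟨k, by omega, by rwa [s k hk]⟩

end BoundaryLabeling

end

noncomputable section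

namespace BoundaryLabeling

open Machine (pick pick_pos pick_neg)

/-! ### Routes as leaders -/

/-- The coordinates of an instance. -/
def Problem.frame (I : Problem) (N : ℕ) : Frame ℝ where
  n := I.n
  nobs := I.obstacles.length
  N := N
  side := I.input.nat 1
  len := I.input.nat 2
  rim := I.input.real 0
  sx := I.input.real 1
  sy := I.input.real 2
  lo := I.input.real 3
  hi := I.input.real 4
  ox := I.input.real 5
  oy := I.input.real 6

namespace Frame

variable (F : Frame ℝ)

/-- The point with coordinate `a` along and coordinate `b` across the side of the label `j`. -/
def pt (j : ℕ) (a b : ℝ) : Point := pick (F.Upright j) (a, b) (b, a)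

/-- The vertices of a route. -/
def route (i j : ℕ) (u w : ℝ) : List Point :=
  pick (u = F.along i j) [F.pt j (F.along i j) (F.across i j), F.pt j u (F.goal j)]
    (pick (w = F.across i j)
      [F.pt j (F.along i j) (F.across i j), F.pt j u w, F.pt j u (F.goal j)]
      [F.pt j (F.along i j) (F.across i j), F.pt j (F.along i j) w, F.pt j u w,
        F.pt j u (F.goal j)])

/-- The leg number `k` of a route. -/
def leg (k i j : ℕ) (u w : ℝ) : Set Point :=
  planeBox (F.fromX k i j u w, F.fromY k i j u w) (F.toX k i j u w, F.toY k i j u w)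

variable {F}

theorem pt_inj {j : ℕ} {a b a' b' : ℝ} : F.pt j a b = F.pt j a' b' ↔ a = a' ∧ b = b' := by
  by_cases h : F.Upright j <;> simp [pt, pick, h, and_comm]

theorem segment_pt {j : ℕ} {a b a' b' : ℝ} (h : a = a' ∨ b = b') :
    segment ℝ (F.pt j a b) (F.pt j a' b') = planeBox (F.pt j a b) (F.pt j a' b') := by
  refine segment_eq_planeBox ?_
  by_cases hU : F.Upright j <;> simp only [pt, pick_pos, pick_neg, hU, not_false_eq_true] <;> tauto

theorem leg_eq (k i j : ℕ) (u w : ℝ) : F.leg k i j u w =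
    planeBox (F.pt j (F.fromAlong k i j u) (F.fromAcross k i j w))
      (F.pt j (F.toAlong k i j u) (F.toAcross k j w)) := by
  by_cases hU : F.Upright j <;>
  simp only [pt, leg, fromX, fromY, toX, toY, pick_pos, pick_neg, hU, not_false_eq_true]

theorem leg_segments (i j : ℕ) (u w : ℝ) :
    F.leg 0 i j u w = segment ℝ (F.pt j (F.along i j) (F.across i j)) (F.pt j (F.along i j) w) ∧
    F.leg 1 i j u w = segment ℝ (F.pt j (F.along i j) w) (F.pt j u w) ∧
    F.leg 2 i j u w = segment ℝ (F.pt j u w) (F.pt j u (F.goal j)) := by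
  rw [segment_pt (Or.inl rfl), segment_pt (Or.inr rfl), segment_pt (Or.inl rfl), leg_eq, leg_eq,
    leg_eq]
  simp [fromAlong, fromAcross, toAlong, toAcross, pick]

/-- With fewer than two bends some of the three legs degenerate to points of other legs, so the
union of the legs is the trace in all cases. This allows leaders with any number of bends to be
treated uniformly. -/
theorem mem_trace_route {i j : ℕ} {u w : ℝ} (h : u = F.along i j → w = F.across i j) {p : Point} :
    p ∈ trace (F.route i j u w) ↔ ∃ k < 3, p ∈ F.leg k i j u w := by
  obtain ⟨h0, h1, h2⟩ := F.leg_segments i j u w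
  have e : (∃ k < 3, p ∈ F.leg k i j u w) ↔ p ∈ F.leg 0 i j u w ∨ p ∈ F.leg 1 i j u w ∨
      p ∈ F.leg 2 i j u w := by
    constructor
    · rintro ⟨k, hk, h⟩
      rcases (by omega : k = 0 ∨ k = 1 ∨ k = 2) with rfl | rfl | rfl <;> tauto
    · rintro (h | h | h)
      exacts [⟨0, by omega, h⟩, ⟨1, by omega, h⟩, ⟨2, by omega, h⟩]
  rw [e, h0, h1, h2]
  have r : ∀ q r : Point, p = r → p ∈ segment ℝ q r := by
    rintro q r rfl; exact right_mem_segment ℝ _ _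
  have l : ∀ q r : Point, p = q → p ∈ segment ℝ q r := by
    rintro q r rfl; exact left_mem_segment ℝ _ _
  by_cases hu : u = F.along i j
  · have hw := h hu
    rw [route, pick_pos hu, hw, hu, segment_same]
    simp only [trace, Set.mem_union, Set.mem_singleton_iff]
    have := r (F.pt j (F.along i j) (F.across i j)) (F.pt j (F.along i j) (F.goal j))
    have := l (F.pt j (F.along i j) (F.across i j)) (F.pt j (F.along i j) (F.goal j))
    tauto
  · by_cases hw : w = F.across i j
    · rw [route, pick_neg hu, pick_pos hw, hw, segment_same]
      simp only [trace, Set.mem_union, Set.mem_singleton_iff]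
      have := l (F.pt j (F.along i j) (F.across i j)) (F.pt j u (F.across i j))
      have := r (F.pt j u (F.across i j)) (F.pt j u (F.goal j))
      tauto
    · rw [route, pick_neg hu, pick_neg hw]
      simp only [trace, Set.mem_union, Set.mem_singleton_iff]
      have := r (F.pt j u w) (F.pt j u (F.goal j))
      tauto

theorem disjoint_trace_route {i j i' j' : ℕ} {u w u' w' : ℝ}
    (h : u = F.along i j → w = F.across i j) (h' : u' = F.along i' j' → w' = F.across i' j') :
    Disjoint (trace (F.route i j u w)) (trace (F.route i' j' u' w')) ↔
      ∀ k < 3, ∀ l < 3, ¬ F.LegsMeet k i j u w l i' j' u' w' := by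
  rw [Set.disjoint_left]
  constructor
  · rintro hd k hk l hl ⟨h1, h2⟩
    obtain ⟨x, a, b⟩ := meets_iff.1 h1
    obtain ⟨y, a', b'⟩ := meets_iff.1 h2
    exact hd (a := (x, y)) ((mem_trace_route h).2 ⟨k, hk, a, a'⟩)
      ((mem_trace_route h').2 ⟨l, hl, b, b'⟩)
  · intro hn p hp hp'
    obtain ⟨k, hk, a, a'⟩ := (mem_trace_route h).1 hp
    obtain ⟨l, hl, b, b'⟩ := (mem_trace_route h').1 hp'
    exact hn k hk l hl ⟨meets_iff.2 ⟨_, a, b⟩, meets_iff.2 ⟨_, a', b'⟩⟩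

theorem route_length (i j : ℕ) (u w : ℝ) :
    (F.route i j u w).length = F.bends i j u w + 2 := by
  by_cases h : u = F.along i j <;> by_cases h' : w = F.across i j <;>
  simp [route, Frame.bends, pick, h, h']

theorem route_head (i j : ℕ) (u w : ℝ) :
    (F.route i j u w).head? = some (F.pt j (F.along i j) (F.across i j)) := by
  by_cases h : u = F.along i j <;> by_cases h' : w = F.across i j <;>
  simp [route, pick, h, h']

theorem route_getLast (i j : ℕ) (u w : ℝ) :
    (F.route i j u w).getLast? = some (F.pt j u (F.goal j)) := by
  by_cases h : u = F.along i j <;> by_cases h' : w = F.across i j <;>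
  simp [route, pick, h, h']

theorem horizontal_pt {j : ℕ} {a b a' b' : ℝ} : Horizontal (F.pt j a b) (F.pt j a' b') ↔
    pick (F.Upright j) (b = b' ∧ a ≠ a') (a = a' ∧ b ≠ b') := by
  by_cases h : F.Upright j <;> simp [Horizontal, pt, pick, h]

theorem vertical_pt {j : ℕ} {a b a' b' : ℝ} : Vertical (F.pt j a b) (F.pt j a' b') ↔
    pick (F.Upright j) (a = a' ∧ b ≠ b') (b = b' ∧ a ≠ a') := by
  by_cases h : F.Upright j <;> simp [Vertical, pt, pick, h]

theorem isOrthogonalPath_route {i j : ℕ} {u w : ℝ} (hw : w ≠ F.goal j) (hs : F.across i j ≠ F.goal j) : IsOrthogonalPath (F.route i j u w) := by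
  by_cases hu : u = F.along i j
  · rw [route, pick_pos hu]
    simp only [IsOrthogonalPath, horizontal_pt, vertical_pt]
    by_cases hU : F.Upright j <;> simp [pick, hU, hu, hs]
  · by_cases hw' : w = F.across i j
    · rw [route, pick_neg hu, pick_pos hw']
      simp only [IsOrthogonalPath, horizontal_pt, vertical_pt]
      by_cases hU : F.Upright j <;> simp [pick, hU, Ne.symm hu, hs, hw']
    · rw [route, pick_neg hu, pick_neg hw']
      simp only [IsOrthogonalPath, horizontal_pt, vertical_pt]
      by_cases hU : F.Upright j <;> simp [pick, hU, Ne.symm hu, hw, Ne.symm hw']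

/-- Orthogonal paths with at most two bends that end with a segment across the side of the label
`j` are routes. -/
theorem exists_route {i j : ℕ} {l : List Point} {u : ℝ} (hl : IsOrthogonalPath l)
    (hb : BoundaryLabeling.bends l ≤ 2)
    (hhead : l.head? = some (F.pt j (F.along i j) (F.across i j)))
    (hlast : l.getLast? = some (F.pt j u (F.goal j)))
    (hin : ∀ a b, F.pt j a b ∈ trace l → F.pt j a b ≠ F.pt j u (F.goal j) → b ≠ F.goal j) :
    ∃ w, (u = F.along i j → w = F.across i j) ∧ l = F.route i j u w ∧
      F.pt j u w ∈ trace l ∧ w ≠ F.goal j := by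
  have sur : ∀ p : Point, ∃ a b, p = F.pt j a b := by
    rintro ⟨x, y⟩
    by_cases hU : F.Upright j
    · exact ⟨x, y, by simp [pt, pick, hU]⟩
    · exact ⟨y, x, by simp [pt, pick, hU]⟩
  have mem : ∀ p ∈ l, p ∈ trace l := fun p => mem_trace_of_mem
  match l, hl with
  | [p, q], hl =>
    simp only [List.head?_cons, Option.some.injEq] at hhead
    simp only [List.getLast?_cons_cons, List.getLast?_singleton, Option.some.injEq] at hlast
    subst hhead hlast
    simp only [IsOrthogonalPath, horizontal_pt, vertical_pt] at hl
    -- By `hin`, the vertex before the port does not lie on the line through the side, so the last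
    -- segment runs across the side. As directions alternate, the shape of the path is then
    -- determined; the longer paths are treated in the same way.
    have key : F.along i j = u ∧ F.across i j ≠ F.goal j := by
      have := hin (F.along i j) (F.across i j) (mem _ (by simp))
      rw [ne_eq, pt_inj] at this
      by_cases hU : F.Upright j <;> simp only [pick, hU, if_true, if_false] at hl <;> tauto
    refine ⟨F.across i j, fun _ => rfl, ?_, ?_, key.2⟩
    · rw [route, pick_pos key.1.symm]
    · have := mem (F.pt j (F.along i j) (F.across i j)) (by simp)
      simpa only [key.1] using this
  | [p, m, q], hl =>
    simp only [List.head?_cons, Option.some.injEq] at hhead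
    simp only [List.getLast?_cons_cons, List.getLast?_singleton, Option.some.injEq] at hlast
    obtain ⟨a, b, rfl⟩ := sur m
    subst hhead hlast
    simp only [IsOrthogonalPath, horizontal_pt, vertical_pt] at hl
    have key : a = u ∧ b = F.across i j ∧ F.along i j ≠ u ∧ b ≠ F.goal j := by
      have := hin a b (mem _ (by simp))
      rw [ne_eq, pt_inj] at this
      by_cases hU : F.Upright j <;> simp only [pick, hU, if_true, if_false] at hl
      · rcases hl with ⟨⟨⟨h1, h2⟩, h3, h4⟩ | ⟨⟨h1, h2⟩, h3, h4⟩, -⟩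
        · exact ⟨h3, h1.symm, h3 ▸ h2, h4⟩
        · exact absurd h3 (this fun h => h4 h.1)
      · rcases hl with ⟨⟨⟨h1, h2⟩, h3, h4⟩ | ⟨⟨h1, h2⟩, h3, h4⟩, -⟩
        · exact absurd h3 (this fun h => h4 h.1)
        · exact ⟨h3, h1.symm, h3 ▸ h2, h4⟩
    obtain ⟨rfl, rfl, k3, k4⟩ := key
    refine ⟨_, fun _ => rfl, ?_, mem _ (by simp), k4⟩
    rw [route, pick_neg k3.symm, pick_pos rfl]
  | [p, m, m', q], hl =>
    simp only [List.head?_cons, Option.some.injEq] at hhead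
    simp only [List.getLast?_cons_cons, List.getLast?_singleton, Option.some.injEq] at hlast
    obtain ⟨a, b, rfl⟩ := sur m
    obtain ⟨a', b', rfl⟩ := sur m'
    subst hhead hlast
    simp only [IsOrthogonalPath, horizontal_pt, vertical_pt] at hl
    have key : a' = u ∧ b' = b ∧ a = F.along i j ∧ F.along i j ≠ u ∧ b ≠ F.across i j ∧
        b' ≠ F.goal j := by
      have := hin a' b' (mem _ (by simp))
      rw [ne_eq, pt_inj] at this
      by_cases hU : F.Upright j <;> simp only [pick, hU, if_true, if_false] at hl <;> grind
    obtain ⟨rfl, rfl, rfl, k3, k4, k5⟩ := key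
    refine ⟨_, fun h => absurd h.symm k3, ?_, mem _ (by simp), k5⟩
    rw [route, pick_neg k3.symm, pick_neg k4]
  | _ :: _ :: _ :: _ :: _ :: _, _ => simp [BoundaryLabeling.bends] at hb

end Frame

end BoundaryLabeling

end

/-! ### Leaders of an instance are the legal routes of its frame -/

noncomputable section

namespace BoundaryLabeling

open Machine (pick pick_pos pick_neg)

namespace Problem

variable (I : Problem) (N : ℕ)

theorem frame_side (j : Fin I.n) : (I.frame N).side j = (I.side j).code := by
  simp [frame, input]

theorem frame_len {o : ℕ} (h : o < I.obstacles.length) :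
    (I.frame N).len o = I.obstacles[o].length := by
  simp [frame, input, h]

theorem frame_rim : (I.frame N).rim 0 = I.rect.xmin ∧ (I.frame N).rim 1 = I.rect.xmax ∧
    (I.frame N).rim 2 = I.rect.ymin ∧ (I.frame N).rim 3 = I.rect.ymax := by
  simp [frame, input]

theorem frame_site (i : Fin I.n) :
    (I.frame N).sx i = (I.site i).1 ∧ (I.frame N).sy i = (I.site i).2 := by
  simp [frame, input]

theorem frame_ends (j : Fin I.n) : (I.frame N).lo j = I.lo j ∧ (I.frame N).hi j = I.hi j := by
  simp [frame, input]

theorem upright_iff (j : Fin I.n) :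
    (I.frame N).Upright j ↔ I.side j = .bottom ∨ I.side j = .top := by
  rw [Frame.Upright, frame_side]
  cases I.side j <;> simp [Side.code]

theorem goal_eq (j : Fin I.n) : (I.frame N).goal j = match I.side j with
    | .bottom => I.rect.ymin
    | .top => I.rect.ymax
    | .left => I.rect.xmin
    | .right => I.rect.xmax := by
  obtain ⟨h0, h1, h2, h3⟩ := I.frame_rim N
  rw [Frame.goal, frame_side, h0, h1, h2, h3]
  cases I.side j <;> simp [Side.code, pick]

theorem sidePoint_eq (j : Fin I.n) (u : ℝ) :
    I.rect.sidePoint (I.side j) u = (I.frame N).pt j u ((I.frame N).goal j) := by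
  have h := I.upright_iff N j
  rw [goal_eq, Frame.pt]
  cases hs : I.side j <;> simp [hs] at h <;> simp [Rect.sidePoint, pick, h]

theorem site_eq (i : Fin I.n) (j : ℕ) :
    (I.frame N).pt j ((I.frame N).along i j) ((I.frame N).across i j) = I.site i := by
  obtain ⟨h1, h2⟩ := I.frame_site N i
  by_cases hU : (I.frame N).Upright j <;>
  simp [Frame.pt, Frame.along, Frame.across, pick, hU, h1, h2]

theorem mem_inside_iff (j : ℕ) (a b : ℝ) : (I.frame N).pt j a b ∈ I.rect.inside ↔
    (pick ((I.frame N).Upright j) ((I.frame N).rim 0) ((I.frame N).rim 2) < a ∧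
      a < pick ((I.frame N).Upright j) ((I.frame N).rim 1) ((I.frame N).rim 3)) ∧
    (pick ((I.frame N).Upright j) ((I.frame N).rim 2) ((I.frame N).rim 0) < b ∧
      b < pick ((I.frame N).Upright j) ((I.frame N).rim 3) ((I.frame N).rim 1)) := by
  obtain ⟨h0, h1, h2, h3⟩ := I.frame_rim N
  by_cases hU : (I.frame N).Upright j <;>
  simp only [Rect.inside, Frame.pt, pick_pos, pick_neg, hU, h0, h1, h2, h3, Set.mem_prod, Set.mem_Ioo,
    not_false_eq_true] <;>
  tauto

theorem goal_cases (j : Fin I.n) :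
    (I.frame N).goal j = pick ((I.frame N).Upright j) ((I.frame N).rim 2) ((I.frame N).rim 0) ∨
    (I.frame N).goal j = pick ((I.frame N).Upright j) ((I.frame N).rim 3) ((I.frame N).rim 1) := by
  obtain ⟨h0, h1, h2, h3⟩ := I.frame_rim N
  have h := I.upright_iff N j
  rw [goal_eq, h0, h1, h2, h3]
  cases hs : I.side j <;> simp [hs] at h <;> simp [pick, h]

theorem start_succ {o : ℕ} (h : o < N) :
    (I.frame N).start (o + 1) = (I.frame N).start o + (I.frame N).len o := by
  have e : (I.frame N).len o =
      ∑ o' ∈ Finset.range (I.frame N).N, pick (o' = o) ((I.frame N).len o) 0 :=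
    (sum_pick_eq N o _ h).symm
  rw [e, Frame.start, Frame.start, ← Finset.sum_add_distrib]
  refine Finset.sum_congr rfl fun o' _ => ?_
  rcases lt_trichotomy o' o with h | rfl | h
  · rw [pick_pos (by omega), pick_pos h, pick_neg (by omega), Nat.add_zero]
  · rw [pick_pos (by omega), pick_neg (by omega), pick_pos rfl, Nat.zero_add]
  · rw [pick_neg (by omega), pick_neg (by omega), pick_neg (by omega)]

variable {N} (hN : I.obstacles.length ≤ N) (hN' : ∀ P ∈ I.obstacles, P.length ≤ N)

include hN

theorem start_eq {o : ℕ} (h : o ≤ I.obstacles.length) :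
    (I.frame N).start o = (I.obstacles.take o).flatten.length := by
  induction o with
  | zero => exact Finset.sum_eq_zero fun o' _ => pick_neg (by omega) _ _
  | succ o ih =>
    rw [start_succ I N (by omega), ih (by omega), frame_len I N (by omega),
      List.take_succ_eq_append_getElem (by omega), List.flatten_append, List.length_append]
    simp

/-- All obstacles lie in one flattened array; obstacle `o` begins after the vertices of its
predecessors. -/
theorem frame_vertex {o k : ℕ} (ho : o < I.obstacles.length) (hk : k < I.obstacles[o].length) :
    (I.frame N).ox ((I.frame N).start o + k) = I.obstacles[o][k].1 ∧
      (I.frame N).oy ((I.frame N).start o + k) = I.obstacles[o][k].2 := by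
  have e : I.obstacles.flatten[(I.frame N).start o + k]? = some I.obstacles[o][k] := by
    rw [start_eq I hN ho.le]
    conv_lhs => rw [← List.take_append_drop o I.obstacles]
    rw [List.flatten_append, List.getElem?_append_right (by simp),
      List.take_append_drop, Nat.add_sub_cancel_left, List.drop_eq_getElem_cons ho,
      List.flatten_cons, List.getElem?_append_left hk, List.getElem?_eq_getElem hk]
  constructor
  · change (I.obstacles.flatten.map Prod.fst).getD _ 0 = _
    rw [List.getD_eq_getElem?_getD, List.getElem?_map, e]; rfl
  · change (I.obstacles.flatten.map Prod.snd).getD _ 0 = _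
    rw [List.getD_eq_getElem?_getD, List.getElem?_map, e]; rfl

include hN'

/-- Legs and polygon edges are axis-aligned boxes, and two boxes intersect if and only if their
projections do. The bounds `hN` and `hN'` make the quantifiers up to `N` cover all edges. -/
theorem clear_iff {i j : ℕ} {u w : ℝ}
    (h : u = (I.frame N).along i j → w = (I.frame N).across i j) :
    (I.frame N).Clear i j u w ↔
      ∀ P ∈ I.obstacles, Disjoint (trace ((I.frame N).route i j u w)) (trace (closedChain P)) := by
  have hit : ∀ m o k (ho : o < I.obstacles.length) (hk : k < I.obstacles[o].length),
      (I.frame N).Hits m i j u w o k ↔ ∃ p ∈ (I.frame N).leg m i j u w,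
        p ∈ planeBox I.obstacles[o][k] (if h' : k + 1 = I.obstacles[o].length then
          I.obstacles[o][0]'(by omega) else I.obstacles[o][k + 1]'(by omega)) := by
    intro m o k ho hk
    have v : (I.frame N).ox ((I.frame N).next o k) = (if h' : k + 1 = I.obstacles[o].length then
          I.obstacles[o][0]'(by omega) else I.obstacles[o][k + 1]'(by omega)).1 ∧
        (I.frame N).oy ((I.frame N).next o k) = (if h' : k + 1 = I.obstacles[o].length then
          I.obstacles[o][0]'(by omega) else I.obstacles[o][k + 1]'(by omega)).2 := by
      rw [Frame.next, frame_len I N ho]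
      split_ifs with h'
      · rw [pick_pos h']; exact frame_vertex I hN ho _
      · rw [pick_neg h']; exact frame_vertex I hN ho _
    rw [Frame.Hits, (frame_vertex I hN ho hk).1, (frame_vertex I hN ho hk).2, v.1, v.2]
    constructor
    · rintro ⟨h1, h2⟩
      obtain ⟨x, a, b⟩ := meets_iff.1 h1
      obtain ⟨y, a', b'⟩ := meets_iff.1 h2
      exact ⟨(x, y), ⟨a, a'⟩, b, b'⟩
    · rintro ⟨p, ⟨a, a'⟩, b, b'⟩
      exact ⟨meets_iff.2 ⟨_, a, b⟩, meets_iff.2 ⟨_, a', b'⟩⟩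
  constructor
  · intro hc P hP
    obtain ⟨o, ho, rfl⟩ := List.getElem_of_mem hP
    rw [Set.disjoint_left]
    intro p hp hp'
    obtain ⟨m, hm, hp⟩ := (Frame.mem_trace_route h).1 hp
    obtain ⟨k, hk, hp'⟩ := (mem_trace_closedChain (I.obstacle_polygon _ hP)).1 hp'
    have hkN := hN' _ hP
    obtain ⟨c0, c1, c2⟩ := hc o (by change o < N; omega) k (by change k < N; omega) ho
      (by rwa [frame_len I N ho])
    have hh := (hit m o k ho hk).2 ⟨p, hp, hp'⟩
    rcases (by omega : m = 0 ∨ m = 1 ∨ m = 2) with rfl | rfl | rfl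
    · exact c0 hh
    · exact c1 hh
    · exact c2 hh
  · intro hd o _ k _ ho hk
    change o < I.obstacles.length at ho
    rw [frame_len I N ho] at hk
    have : ∀ m < 3, ¬ (I.frame N).Hits m i j u w o k := by
      intro m hm hh
      obtain ⟨p, hp, hp'⟩ := (hit m o k ho hk).1 hh
      exact Set.disjoint_left.1 (hd _ (List.getElem_mem ho))
        ((Frame.mem_trace_route h).2 ⟨m, hm, hp⟩)
        ((mem_trace_closedChain (I.obstacle_polygon _ (List.getElem_mem ho))).2 ⟨k, hk, hp'⟩)
    exact ⟨this 0 (by omega), this 1 (by omega), this 2 (by omega)⟩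

/-- Legal routes are leaders. -/
theorem isLeader_route {t : LeaderStyle} {i j : Fin I.n} {u w : ℝ}
    (h : (I.frame N).Valid (t = .po) i j u w) : I.IsLeader t i j ((I.frame N).route i j u w) := by
  obtain ⟨⟨-, -, h1, h2, h3, h4, h5, h6, h7, h8⟩, hc⟩ := h
  have hs := I.site_mem i
  rw [← site_eq I N i j, mem_inside_iff] at hs
  have hg := I.goal_cases N j
  have hw : w ≠ (I.frame N).goal j := by
    rintro e; rcases hg with g | g <;> rw [e, g] at h5 h6
    · exact lt_irrefl _ h5
    · exact lt_irrefl _ h6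
  have hs' : (I.frame N).across i j ≠ (I.frame N).goal j := by
    rintro e; rcases hg with g | g <;> rw [e, g] at hs
    · exact lt_irrefl _ hs.2.1
    · exact lt_irrefl _ hs.2.2
  refine ⟨Frame.isOrthogonalPath_route hw hs', ?_, ?_, ⟨u, ?_, ?_, ?_⟩, fun P hP => ?_⟩
  · rw [BoundaryLabeling.bends, Frame.route_length, Nat.add_sub_cancel, Frame.bends]
    cases t with
    | po => rw [h8 rfl, pick_pos rfl (1 : ℕ)]; by_cases e : u = (I.frame N).along i j <;>
              simp [pick, e, LeaderStyle.maxBends]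
    | opo => by_cases e : u = (I.frame N).along i j <;> by_cases e' : w = (I.frame N).across i j <;>
              simp [pick, e, e', LeaderStyle.maxBends]
  · rw [Frame.route_head, site_eq]
  · rw [← (I.frame_ends N j).1, ← (I.frame_ends N j).2]; exact ⟨h1, h2⟩
  · rw [Frame.route_getLast, sidePoint_eq I N]
  · intro p hp hne
    rw [sidePoint_eq I N] at hne
    obtain ⟨k, hk, hp⟩ := (Frame.mem_trace_route h7).1 hp
    have sur : ∃ a b, p = (I.frame N).pt j a b := by
      obtain ⟨x, y⟩ := p
      by_cases hU : (I.frame N).Upright j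
      · exact ⟨x, y, by simp [Frame.pt, pick, hU]⟩
      · exact ⟨y, x, by simp [Frame.pt, pick, hU]⟩
    obtain ⟨a, b, rfl⟩ := sur
    rw [mem_inside_iff]
    rw [ne_eq, Frame.pt_inj] at hne
    have box : ∀ a b c d a' b', (I.frame N).pt j a b ∈ planeBox ((I.frame N).pt j c d)
        ((I.frame N).pt j a' b') ↔ a ∈ Set.uIcc c a' ∧ b ∈ Set.uIcc d b' := by
      intro a b c d a' b'
      by_cases hU : (I.frame N).Upright j <;> simp [Frame.pt, pick, hU, planeBox, and_comm]
    rw [Frame.leg_eq, box] at hp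
    obtain ⟨p1, p2⟩ := hp
    rcases (by omega : k = 0 ∨ k = 1 ∨ k = 2) with rfl | rfl | rfl <;>
    simp [Frame.fromAlong, Frame.toAlong, Frame.fromAcross, Frame.toAcross, pick_pos,
      pick_neg, Set.mem_uIcc] at p1 p2
    · grind
    · grind
    · grind
  · rw [disjoint_region_iff (s := I.side j) (u := u) (I.obstacle_mem P hP)]
    · exact (clear_iff I hN hN' h7).1 hc P hP
    · rw [sidePoint_eq I N]
      exact mem_trace_of_mem (List.mem_of_getLast? (Frame.route_getLast _ _ _ _))

/-- Leaders are legal routes. -/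
theorem exists_valid_of_isLeader {t : LeaderStyle} {i j : Fin I.n} {l : List Point}
    (h : I.IsLeader t i j l) :
    ∃ u w, (I.frame N).Valid (t = .po) i j u w ∧ l = (I.frame N).route i j u w := by
  obtain ⟨hp, hb, hh, ⟨u, hu, hlast, hin⟩, hobs⟩ := h
  rw [← site_eq I N i j] at hh
  have hg := I.goal_cases N j
  have hq : I.rect.sidePoint (I.side j) u ∈ trace l :=
    mem_trace_of_mem (List.mem_of_getLast? hlast)
  rw [sidePoint_eq I N] at hlast hin
  have hne : ∀ a b, (I.frame N).pt j a b ∈ I.rect.inside → b ≠ (I.frame N).goal j := by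
    rintro a b h rfl
    rw [mem_inside_iff] at h
    rcases hg with g | g <;> rw [g] at h
    · exact lt_irrefl _ h.2.1
    · exact lt_irrefl _ h.2.2
  have hb2 : BoundaryLabeling.bends l ≤ 2 := hb.trans (by cases t <;> simp [LeaderStyle.maxBends])
  obtain ⟨w, h7, rfl, hmem, hw⟩ := Frame.exists_route hp hb2 hh hlast
    fun a b hab hab' => hne a b (hin _ hab hab')
  -- The point `(u, w)` of the route is not the port and so lies in the open rectangle; this yields
  -- all strict inequalities of `Fits`.
  have hins := hin _ hmem (by rw [ne_eq, Frame.pt_inj]; exact fun h => hw h.2)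
  rw [mem_inside_iff] at hins
  refine ⟨u, w, ⟨⟨i.2, j.2, ?_, ?_, hins.1.1, hins.1.2, hins.2.1, hins.2.2, h7, ?_⟩, ?_⟩, rfl⟩
  · rw [(I.frame_ends N j).1]; exact hu.1
  · rw [(I.frame_ends N j).2]; exact hu.2
  · rintro rfl
    by_contra hwb
    have hua : u ≠ (I.frame N).along i j := fun e => hwb (h7 e)
    rw [BoundaryLabeling.bends, Frame.route_length, Nat.add_sub_cancel, Frame.bends,
      pick_neg hua, pick_neg hwb] at hb
    simp [LeaderStyle.maxBends] at hb
  · rw [clear_iff I hN hN' h7]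
    intro P hP
    rw [← disjoint_region_iff (I.obstacle_mem P hP) hq]
    exact hobs P hP

end Problem

end BoundaryLabeling

end

noncomputable section

namespace BoundaryLabeling

open Machine (pick pick_pos pick_neg)

/-! ### The data of the machine -/

namespace Machine

/-- The frame stored in a memory. -/
def realFrame (s : State) : Frame ℝ where
  n := s.nat 0 0
  nobs := s.nat 0 1
  N := bound s
  side := s.nat 1
  len := s.nat 2
  rim := s.real 0
  sx := s.real 1
  sy := s.real 2
  lo := s.real 3
  hi := s.real 4
  ox := s.real 5
  oy := s.real 6

/-- The number of cells of the array `real 10` with contents below `x`. -/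
def rank (s : State) (x : ℝ) : ℕ :=
  ∑ j ∈ Finset.range (bound s), pick (j < s.nat params 1 ∧ s.real 10 j < x) 1 0

/-- The routes whose coordinates are found in the array `real 10`. -/
def coding (po : Prop) (s : State) : Coding where
  F := (realFrame s).map (rank s)
  Q := s.nat params 1
  po := po
  -- A code that refers to a place beyond the available coordinates gets the nonexistent site `n`
  -- and is thereby invalid.
  site c := pick (fs (bound s) (sn (bound s) c) < s.nat params 1 ∧
    sn (bound s) (sn (bound s) c) < s.nat params 1) (fs (bound s) (fs (bound s) c)) (s.nat 0 0)
  label c := sn (bound s) (fs (bound s) c)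
  port c := rank s (s.real 10 (fs (bound s) (sn (bound s) c)))
  mid c := rank s (s.real 10 (sn (bound s) (sn (bound s) c)))

/-- Definable functions, as a class. -/
class Dn (f : State → (ℕ → ℕ) → ℕ) : Prop where
  out : Definable f

/-- Definable relations, as a class. -/
class Dr (p : State → (ℕ → ℕ) → Prop) : Prop where
  out : DefinableRel p

/-! ### Definability of the dynamic program, by instance search -/

section Instances

variable (po : Prop) {f g h k l l' : State → (ℕ → ℕ) → ℕ} {p q : State → (ℕ → ℕ) → Prop}

instance (c : ℕ) : Dn fun _ _ => c := ⟨.const c⟩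

instance (c : ℕ) : Dn fun _ ρ => ρ c := ⟨.var c⟩

instance [hf : Dn f] [hg : Dn g] : Dn fun s ρ => f s ρ + g s ρ := ⟨.add hf.out hg.out⟩

instance [hf : Dn f] [hg : Dn g] : Dn fun s ρ => f s ρ - g s ρ := ⟨.sub hf.out hg.out⟩

instance [hp : Dr p] [hf : Dn f] [hg : Dn g] : Dn fun s ρ => pick (p s ρ) (f s ρ) (g s ρ) :=
  ⟨.pick hp.out hf.out hg.out⟩

instance (F : State → (ℕ → ℕ) → ℕ → ℕ) [hf : Dn fun s ρ => F s (fun k => ρ (k + 1)) (ρ 0)] :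
    Dn fun s ρ => ∑ i ∈ Finset.range (bound s), F s ρ i := ⟨.sum hf.out⟩

instance (P : Prop) : Dr fun _ _ => P := ⟨.pick_const P⟩

instance [hf : Dn f] [hg : Dn g] : Dr fun s ρ => f s ρ ≤ g s ρ := ⟨.le hf.out hg.out⟩

instance [hf : Dn f] [hg : Dn g] : Dr fun s ρ => f s ρ < g s ρ := ⟨.lt hf.out hg.out⟩

instance [hf : Dn f] [hg : Dn g] : Dr fun s ρ => f s ρ = g s ρ := ⟨.eq hf.out hg.out⟩

instance (a b : ℕ) [hf : Dn f] [hg : Dn g] :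
    Dr fun s ρ => s.real a (f s ρ) < s.real b (g s ρ) := ⟨.realLt a b hf.out hg.out⟩

instance [hp : Dr p] [hq : Dr q] : Dr fun s ρ => p s ρ ∧ q s ρ := ⟨.and hp.out hq.out⟩

instance [hp : Dr p] [hq : Dr q] : Dr fun s ρ => p s ρ ∨ q s ρ := ⟨.or hp.out hq.out⟩

instance [hp : Dr p] [hq : Dr q] : Dr fun s ρ => p s ρ → q s ρ := ⟨.imp hp.out hq.out⟩

instance (P : State → (ℕ → ℕ) → ℕ → Prop) [hP : Dr fun s ρ => P s (fun k => ρ (k + 1)) (ρ 0)] :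
    Dr fun s ρ => ∀ i < bound s, P s ρ i := ⟨.all hP.out⟩

instance (c : ℕ) (P : State → (ℕ → ℕ) → ℕ → Prop)
    [hP : Dr fun s ρ => P s (fun k => ρ (k + 1)) (ρ 0)] : Dr fun s ρ => ∃ i < c, P s ρ i :=
  ⟨.exConst c hP.out⟩

instance [hf : Dn f] : Dn fun s ρ => s.nat 0 (f s ρ) := ⟨.cell (by decide) hf.out⟩

instance [hf : Dn f] : Dn fun s ρ => s.nat 1 (f s ρ) := ⟨.cell (by decide) hf.out⟩

instance [hf : Dn f] : Dn fun s ρ => s.nat 2 (f s ρ) := ⟨.cell (by decide) hf.out⟩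

instance [hf : Dn f] : Dn fun s ρ => s.nat params (f s ρ) := ⟨.cell (by decide) hf.out⟩

instance [hf : Dn f] : Dn fun s ρ => sq (bound s) (f s ρ) :=
  -- The argument is bound to a variable before it is used inside the sum; otherwise `f` would stand
  -- under the binder of the sum.
  ⟨.app₁ (F := fun s => sq (bound s)) (show Dn _ by unfold sq; infer_instance).out hf.out⟩

instance [Dn f] [Dn g] : Dn fun s ρ => pr (bound s) (f s ρ) (g s ρ) := by
  unfold pr; infer_instance

instance [hf : Dn f] : Dn fun s ρ => fs (bound s) (f s ρ) :=
  ⟨.app₁ (F := fun s => fs (bound s)) (show Dn _ by unfold fs; infer_instance).out hf.out⟩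

instance [hf : Dn f] : Dn fun s ρ => sn (bound s) (f s ρ) :=
  ⟨.app₁ (F := fun s => sn (bound s)) (show Dn _ by unfold sn; infer_instance).out hf.out⟩

instance (b : ℕ) [hf : Dn f] : Dn fun s ρ => rank s (s.real b (f s ρ)) :=
  ⟨.app₁ (F := fun s i => rank s (s.real b i)) (show Dn _ by unfold rank; infer_instance).out
    hf.out⟩

instance [Dn f] : Dn fun s ρ => (coding po s).site (f s ρ) := by
  unfold coding; infer_instance

instance [Dn f] : Dn fun s ρ => (coding po s).label (f s ρ) := by
  unfold coding; infer_instance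

instance [Dn f] : Dn fun s ρ => (coding po s).port (f s ρ) := by
  unfold coding; infer_instance

instance [Dn f] : Dn fun s ρ => (coding po s).mid (f s ρ) := by
  unfold coding; infer_instance

instance : Dn fun s _ => (coding po s).Q := by unfold coding; infer_instance

instance : Dr fun s _ => (coding po s).po := by unfold coding; infer_instance

instance : Dn fun s _ => (coding po s).F.n := by
  unfold coding Frame.map realFrame; infer_instance

instance : Dn fun s _ => (coding po s).F.nobs := by
  unfold coding Frame.map realFrame; infer_instance

instance [Dn f] : Dn fun s ρ => (coding po s).F.side (f s ρ) := by
  unfold coding Frame.map realFrame; infer_instance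

instance [Dn f] : Dn fun s ρ => (coding po s).F.len (f s ρ) := by
  unfold coding Frame.map realFrame; infer_instance

instance [Dn f] : Dn fun s ρ => (coding po s).F.rim (f s ρ) := by
  unfold coding Frame.map realFrame; infer_instance

instance [Dn f] : Dn fun s ρ => (coding po s).F.sx (f s ρ) := by
  unfold coding Frame.map realFrame; infer_instance

instance [Dn f] : Dn fun s ρ => (coding po s).F.sy (f s ρ) := by
  unfold coding Frame.map realFrame; infer_instance

instance [Dn f] : Dn fun s ρ => (coding po s).F.lo (f s ρ) := by
  unfold coding Frame.map realFrame; infer_instance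

instance [Dn f] : Dn fun s ρ => (coding po s).F.hi (f s ρ) := by
  unfold coding Frame.map realFrame; infer_instance

instance [Dn f] : Dn fun s ρ => (coding po s).F.ox (f s ρ) := by
  unfold coding Frame.map realFrame; infer_instance

instance [Dn f] : Dn fun s ρ => (coding po s).F.oy (f s ρ) := by
  unfold coding Frame.map realFrame; infer_instance

/-- Rewriting with this equation gives sums and quantifiers the range `bound s`, which the instances
recognize. -/
theorem coding_N (s : State) : (coding po s).F.N = bound s := rfl

instance [hf : Dn f] : Dn fun s ρ => (coding po s).F.start (f s ρ) :=
  ⟨.app₁ (F := fun s => (coding po s).F.start)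
    (show Dn _ by simp only [Frame.start, coding_N]; infer_instance).out hf.out⟩

instance [Dn f] [Dn g] : Dn fun s ρ => (coding po s).F.next (f s ρ) (g s ρ) := by
  unfold Frame.next; infer_instance

instance [Dn f] : Dr fun s ρ => (coding po s).F.Upright (f s ρ) := by
  unfold Frame.Upright; infer_instance

instance [Dn f] : Dn fun s ρ => (coding po s).F.goal (f s ρ) := by
  unfold Frame.goal; infer_instance

instance [Dn f] [Dn g] : Dn fun s ρ => (coding po s).F.along (f s ρ) (g s ρ) := by
  unfold Frame.along; infer_instance

instance [Dn f] [Dn g] : Dn fun s ρ => (coding po s).F.across (f s ρ) (g s ρ) := by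
  unfold Frame.across; infer_instance

instance [Dn f] [Dn g] [Dn h] [Dn k] :
    Dr fun s ρ => Meets (f s ρ) (g s ρ) (h s ρ) (k s ρ) := by
  unfold Meets; infer_instance

instance [Dn f] [Dn g] [Dn h] [Dn k] :
    Dn fun s ρ => (coding po s).F.fromAlong (f s ρ) (g s ρ) (h s ρ) (k s ρ) := by
  unfold Frame.fromAlong; infer_instance

instance [Dn f] [Dn g] [Dn h] [Dn k] :
    Dn fun s ρ => (coding po s).F.toAlong (f s ρ) (g s ρ) (h s ρ) (k s ρ) := by
  unfold Frame.toAlong; infer_instance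

instance [Dn f] [Dn g] [Dn h] [Dn k] :
    Dn fun s ρ => (coding po s).F.fromAcross (f s ρ) (g s ρ) (h s ρ) (k s ρ) := by
  unfold Frame.fromAcross; infer_instance

instance [Dn f] [Dn g] [Dn h] :
    Dn fun s ρ => (coding po s).F.toAcross (f s ρ) (g s ρ) (h s ρ) := by
  unfold Frame.toAcross; infer_instance

instance [Dn f] [Dn g] [Dn h] [Dn k] [Dn l] :
    Dn fun s ρ => (coding po s).F.fromX (f s ρ) (g s ρ) (h s ρ) (k s ρ) (l s ρ) := by
  unfold Frame.fromX; infer_instance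

instance [Dn f] [Dn g] [Dn h] [Dn k] [Dn l] :
    Dn fun s ρ => (coding po s).F.toX (f s ρ) (g s ρ) (h s ρ) (k s ρ) (l s ρ) := by
  unfold Frame.toX; infer_instance

instance [Dn f] [Dn g] [Dn h] [Dn k] [Dn l] :
    Dn fun s ρ => (coding po s).F.fromY (f s ρ) (g s ρ) (h s ρ) (k s ρ) (l s ρ) := by
  unfold Frame.fromY; infer_instance

instance [Dn f] [Dn g] [Dn h] [Dn k] [Dn l] :
    Dn fun s ρ => (coding po s).F.toY (f s ρ) (g s ρ) (h s ρ) (k s ρ) (l s ρ) := by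
  unfold Frame.toY; infer_instance

instance [Dn f] [Dn g] [Dn h] [Dn k] : Dr fun s ρ =>
    (coding po s).F.Fits (coding po s).po (f s ρ) (g s ρ) (h s ρ) (k s ρ) := by
  unfold Frame.Fits; infer_instance

instance [Dn f] [Dn g] [Dn h] [Dn k] [Dn l] [Dn l'] (m : ℕ) : Dr fun s ρ =>
    (coding po s).F.Hits m (f s ρ) (g s ρ) (h s ρ) (k s ρ) (l s ρ) (l' s ρ) := by
  unfold Frame.Hits; infer_instance

instance [hf : Dn f] : Dr fun s ρ => (coding po s).Valid (f s ρ) :=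
  ⟨.app₁ (F := fun s => (coding po s).Valid) (show Dr _ by
    simp only [Coding.Valid, Frame.Valid, Frame.Clear, coding_N]
    infer_instance).out hf.out⟩

instance [Dn f] : Dn fun s ρ => (coding po s).bends (f s ρ) := by
  unfold Coding.bends Frame.bends; infer_instance

instance [Dn f] : Dn fun s ρ => (coding po s).sd (f s ρ) := by
  unfold Coding.sd; infer_instance

instance [Dn f] : Dn fun s ρ => (coding po s).pos (f s ρ) := by
  unfold Coding.pos; infer_instance

instance [Dn f] : Dn fun s ρ => (coding po s).height (f s ρ) := by
  unfold Coding.height; infer_instance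

instance [Dn f] [Dn g] : Dn fun s ρ => (coding po s).x₁ (f s ρ) (g s ρ) := by
  unfold Coding.x₁; infer_instance

instance [Dn f] [Dn g] : Dn fun s ρ => (coding po s).x₂ (f s ρ) (g s ρ) := by
  unfold Coding.x₂; infer_instance

instance [Dn f] [Dn g] : Dn fun s ρ => (coding po s).y₁ (f s ρ) (g s ρ) := by
  unfold Coding.y₁; infer_instance

instance [Dn f] [Dn g] : Dn fun s ρ => (coding po s).y₂ (f s ρ) (g s ρ) := by
  unfold Coding.y₂; infer_instance

instance [hf : Dn f] [hg : Dn g] : Dr fun s ρ => (coding po s).Touch (f s ρ) (g s ρ) :=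
  ⟨.app₂ (F := fun s => (coding po s).Touch)
    (show Dr _ by unfold Coding.Touch; infer_instance).out hf.out hg.out⟩

instance [Dn f] [Dn g] : Dr fun s ρ => (coding po s).Conf (f s ρ) (g s ρ) := by
  unfold Coding.Conf; infer_instance

instance [hf : Dn f] [hg : Dn g] :
    Dr fun s ρ => (coding po s).Blocks (bound s) (f s ρ) (g s ρ) :=
  ⟨.app₂ (F := fun s => (coding po s).Blocks (bound s))
    (show Dr _ by unfold Coding.Blocks Coding.HitsColumn; infer_instance).out hf.out hg.out⟩

instance [Dn f] [Dn g] : Dr fun s ρ => (coding po s).Allow (bound s) (f s ρ) (g s ρ) := by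
  unfold Coding.Allow; infer_instance

instance [hf : Dn f] [hg : Dn g] [hh : Dn h] :
    Dr fun s ρ => (coding po s).Refines (bound s) (f s ρ) (g s ρ) (h s ρ) :=
  ⟨.app₃ (F := fun s => (coding po s).Refines (bound s))
    (show Dr _ by unfold Coding.Refines; infer_instance).out hf.out hg.out hh.out⟩

instance [hf : Dn f] [hg : Dn g] :
    Dr fun s ρ => (coding po s).Trans (bound s) (f s ρ) (g s ρ) :=
  ⟨.app₂ (F := fun s => (coding po s).Trans (bound s))
    (show Dr _ by unfold Coding.Trans; infer_instance).out hf.out hg.out⟩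

instance [Dn f] : Dn fun s ρ => (coding po s).weight (f s ρ) := by
  unfold Coding.weight; infer_instance

instance [hf : Dn f] : Dn fun s ρ => s.nat 12 (f s ρ) := ⟨.cell (by decide) hf.out⟩

instance [hf : Dn f] : Dn fun s ρ => s.nat 13 (f s ρ) := ⟨.cell (by decide) hf.out⟩

instance [hf : Dn f] : Dn fun s ρ => s.nat 15 (f s ρ) := ⟨.cell (by decide) hf.out⟩

instance [Dn f] [Dn g] :
    Dn fun s ρ => (coding po s).merged (bound s) (s.nat 13) (f s ρ) (g s ρ) := by
  unfold Coding.merged; infer_instance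

instance [hf : Dn f] :
    Dn fun s ρ => (coding po s).total (bound s) fun i =>
      (coding po s).merged (bound s) (s.nat 13) (f s ρ) i :=
  ⟨.app₁ (F := fun s τ => (coding po s).total (bound s) fun i =>
      (coding po s).merged (bound s) (s.nat 13) τ i)
    (show Dn _ by unfold Coding.total; infer_instance).out hf.out⟩

instance [hf : Dn f] :
    Dn fun s ρ => (coding po s).total (bound s) fun i => s.nat 13 (pr (bound s) (f s ρ) i) :=
  ⟨.app₁ (F := fun s σ => (coding po s).total (bound s) fun i => s.nat 13 (pr (bound s) σ i))
    (show Dn _ by unfold Coding.total; infer_instance).out hf.out⟩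

instance [hf : Dn f] [hg : Dn g] :
    Dr fun s ρ => (coding po s).Best (bound s) (s.nat 13) (f s ρ) (g s ρ) :=
  ⟨.app₂ (F := fun s => (coding po s).Best (bound s) (s.nat 13))
    (show Dr _ by unfold Coding.Best; infer_instance).out hf.out hg.out⟩

instance [hf : Dn f] [hg : Dn g] :
    Dn fun s ρ => (coding po s).entry (bound s) (s.nat 13) (f s ρ) (g s ρ) :=
  ⟨.app₂ (F := fun s => (coding po s).entry (bound s) (s.nat 13))
    (show Dn _ by unfold Coding.entry; infer_instance).out hf.out hg.out⟩

end Instances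

end Machine

end BoundaryLabeling

end

noncomputable section

namespace BoundaryLabeling

open Machine (pick pick_pos pick_neg)

namespace Machine

/-! ### Correctness of programs -/

/-- Started in a memory that satisfies `P`, the program halts in a memory that satisfies `P'`; the
number of steps is polynomial in the final bound, and the bound does not decrease. The properties
depend on a parameter, and the polynomial does not. -/
def Does {ι : Type*} (P : ι → State → Prop) (c : Program) (P' : ι → State → Prop) : Prop :=
  ∃ p : Polynomial ℕ, ∀ x s, P x s →
    ∃ s', Runs c s (p.eval (bound s')) s' ∧ bound s ≤ bound s' ∧ P' x s'

theorem eval_mono (p : Polynomial ℕ) {a b : ℕ} (h : a ≤ b) : p.eval a ≤ p.eval b := by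
  rw [Polynomial.eval_eq_sum, Polynomial.eval_eq_sum]
  exact Finset.sum_le_sum fun i _ => Nat.mul_le_mul_left _ (Nat.pow_le_pow_left h i)

section Does

variable {ι : Type*} {P P' P'' : ι → State → Prop} {c d : Program}

/-- Time is measured by the final bound. Since bounds never decrease, the estimate for the first
program remains true at the end. -/
theorem Does.seq (h : Does P c P') (h' : Does P' d P'') : Does P (.seq c d) P'' := by
  obtain ⟨p, hp⟩ := h
  obtain ⟨q, hq⟩ := h'
  refine ⟨p + q, fun x s hs => ?_⟩
  obtain ⟨s1, r1, b1, h1⟩ := hp x s hs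
  obtain ⟨s2, r2, b2, h2⟩ := hq x s1 h1
  refine ⟨s2, (r1.seq r2).mono ?_, b1.trans b2, h2⟩
  rw [Polynomial.eval_add]
  exact Nat.add_le_add_right (eval_mono p b2) _

/-- An expression that computes a definable function. -/
def expr (f : State → (ℕ → ℕ) → ℕ) [hf : Dn f] : BoundedExpr := hf.out.choose

theorem eval_expr (f : State → (ℕ → ℕ) → ℕ) [hf : Dn f] (s : State) (ρ : ℕ → ℕ) :
    (expr f).eval s ρ = f s ρ := hf.out.choose_spec s ρ

theorem does_assign {a : ℕ} (k : ℕ) (f : State → ℕ) [Dn fun s _ => f s] (ha : a ≠ scratch)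
    (h : ∀ x s s', P x s → AgreeOff a s s' → s'.nat a = Function.update (s.nat a) k (f s) →
      bound s ≤ bound s' ∧ P' x s') : Does P (assign a k (expr fun s _ => f s)) P' := by
  refine ⟨(expr fun s _ => f s).steps + 10, fun x s hs => ?_⟩
  obtain ⟨s', r, h1, h2⟩ := runs_assign k (expr fun s _ => f s) s ha
  rw [eval_expr] at h2
  obtain ⟨h3, h4⟩ := h x s s' hs h1 h2
  refine ⟨s', r.mono ?_, h3, h4⟩
  rw [Polynomial.eval_add, Polynomial.eval_ofNat]
  exact Nat.add_le_add_right (eval_mono _ h3) _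

theorem AgreeOff.bound_eq {a : ℕ} {s s' : State} (h : AgreeOff a s s') (ha : a ≠ params) :
    bound s' = bound s := by simp only [bound, h.2 params (by decide) ha.symm]

theorem AgreeNat.bound_eq {s s' : State} (h : AgreeNat s s') :
    bound s' = bound s := by simp only [bound, h params (by decide)]

theorem does_fillNat {a : ℕ} (f : State → ℕ → ℕ) [Dn fun s ρ => f s (ρ 0)] (ha : a ≠ scratch)
    (ha' : a ≠ params) (hf : ∀ s s', AgreeOff a s s' → ∀ i, f s' i = f s i)
    (h : ∀ x s s', P x s → AgreeOff a s s' →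
      (∀ i, s'.nat a i = if i < bound s then f s i else s.nat a i) → P' x s') :
    Does P (fillNat a (expr fun s ρ => f s (ρ 0))) P' := by
  refine ⟨Polynomial.X * ((expr fun s ρ => f s (ρ 0)).steps + 30) + 20, fun x s hs => ?_⟩
  obtain ⟨s', r, h1, h2⟩ := runs_fillNat (expr fun s ρ => f s (ρ 0)) s ha ha' (f s)
    (fun s' h i _ => by rw [eval_expr, hf s s' h])
  have hb := h1.bound_eq ha'
  exact ⟨s', hb ▸ r, hb.ge, h x s s' hs h1 h2⟩

theorem does_fillReal (a b c : ℕ) (g d e f : State → ℕ → ℕ) [Dn fun s ρ => g s (ρ 0)]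
    [Dn fun s ρ => d s (ρ 0)] [Dn fun s ρ => e s (ρ 0)] [Dn fun s ρ => f s (ρ 0)]
    (hg : ∀ s s', AgreeNat s s' → ∀ i, g s' i = g s i)
    (hd : ∀ s s', AgreeNat s s' → ∀ i, d s' i = d s i)
    (he : ∀ s s', AgreeNat s s' → ∀ i, e s' i = e s i)
    (hf : ∀ s s', AgreeNat s s' → ∀ i, f s' i = f s i)
    (h : ∀ x s s', P x s → AgreeNat s s' →
      s'.real = realFill a b c (g s) (d s) (e s) (f s) s.real (bound s) → P' x s') :
    Does P (fillReal a b c (expr fun s ρ => g s (ρ 0)) (expr fun s ρ => d s (ρ 0))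
      (expr fun s ρ => e s (ρ 0)) (expr fun s ρ => f s (ρ 0))) P' := by
  refine ⟨Polynomial.X * ((expr fun s ρ => g s (ρ 0)).steps + (expr fun s ρ => d s (ρ 0)).steps +
    (expr fun s ρ => e s (ρ 0)).steps + (expr fun s ρ => f s (ρ 0)).steps + 60) + 20,
    fun x s hs => ?_⟩
  obtain ⟨s', r, h1, h2⟩ := runs_fillReal a b c (expr fun s ρ => g s (ρ 0))
    (expr fun s ρ => d s (ρ 0)) (expr fun s ρ => e s (ρ 0)) (expr fun s ρ => f s (ρ 0)) s
    (g s) (d s) (e s) (f s) (fun s' h i _ => by rw [eval_expr, hg s s' h])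
    (fun s' h i _ => by rw [eval_expr, hd s s' h]) (fun s' h i _ => by rw [eval_expr, he s s' h])
    (fun s' h i _ => by rw [eval_expr, hf s s' h])
  have hb := h1.bound_eq
  exact ⟨s', hb ▸ r, hb.ge, h x s s' hs h1 h2⟩

/-- The round and the initial memory are part of the parameter of the body's specification, so one
polynomial serves all rounds. The body keeps the bound, so the total is the bound times this
polynomial, up to overhead. -/
theorem does_loop {a : ℕ} (k : ℕ) (ha : a ≠ params) {R : ℕ → ι → State → Prop}
    (hc : Does (fun (x : ι × ℕ × State) s => bound s = bound x.2.2 ∧ s.nat a k = x.2.1 ∧ R x.2.1 x.1 s)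
      c (fun x s => bound s = bound x.2.2 ∧ s.nat a k = x.2.1 ∧ R (x.2.1 + 1) x.1 s))
    (hR : ∀ i x s v, R i x s → R i x (s.setNat a k v))
    (h0 : ∀ x s, P x s → R 0 x s) (h1 : ∀ x s, R (bound s) x s → P' x s) :
    Does P (loop a k c) P' := by
  obtain ⟨p, hp⟩ := hc
  refine ⟨Polynomial.X * (p + 20) + 20, fun x s hs => ?_⟩
  obtain ⟨s', r, h2, h3⟩ := runs_loop (a := a) (k := k) (c := c) (N := bound s)
    (B := p.eval (bound s)) (fun i s' => R i x s') ha
    (by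
      intro i hi s1 hR1 hk hN
      obtain ⟨s2, r2, -, h4, h5, h6⟩ := hp (x, i, s) s1 ⟨hN, hk, hR1⟩
      exact ⟨s2, h4 ▸ r2, h5, h4, hR _ _ _ _ h6⟩) (s := s) rfl (hR _ _ _ _ (h0 x s hs))
  refine ⟨s', r.mono ?_, h3.ge, h1 x s' (h3 ▸ h2)⟩
  rw [h3]
  simp only [Polynomial.eval_add, Polynomial.eval_mul, Polynomial.eval_X, Polynomial.eval_ofNat]
  exact le_rfl

end Does

/-! ### The contents of filled arrays -/

section RealFill

variable {a b c : ℕ} {g d e f : ℕ → ℕ} {r : ℕ → ℕ → ℝ}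

theorem realFill_other {a' : ℕ} (h : a' ≠ a) (k : ℕ) : realFill a b c g d e f r k a' = r a' := by
  induction k with
  | zero => rfl
  | succ k ih =>
    simp only [realFill]
    split_ifs
    · exact ih
    · rw [Function.update_of_ne h, ih]

theorem realFill_miss {k x : ℕ} (h : ∀ i < k, 0 < g i → d i ≠ x) :
    realFill a b c g d e f r k a x = r a x := by
  induction k with
  | zero => rfl
  | succ k ih =>
    simp only [realFill]
    split_ifs with hg
    · exact ih fun i hi => h i (by omega)
    · rw [Function.update_self, Function.update_of_ne (h k (by omega) (by omega)).symm]
      exact ih fun i hi => h i (by omega)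

/-- The source arrays are never written, and the cell `d i` is written in one round only, so the
value of this round is final. -/
theorem realFill_hit (hb : b ≠ a) (hc : c ≠ a) {k i : ℕ} (hi : i < k) (hg : 0 < g i)
    (h : ∀ j < k, 0 < g j → d j = d i → j = i) :
    realFill a b c g d e f r k a (d i) = (r b (e i) + r c (f i)) / 2 := by
  induction k with
  | zero => omega
  | succ k ih =>
    simp only [realFill]
    by_cases hik : i = k
    · subst hik
      rw [if_neg (by omega), Function.update_self, Function.update_self, realFill_other hb,
        realFill_other hc]
    · have ih' := ih (by omega) fun j hj => h j (by omega)
      split_ifs with hg'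
      · exact ih'
      · rw [Function.update_self, Function.update_of_ne, ih']
        intro e
        exact hik (h k (by omega) (by omega) e.symm).symm

/-- Filling an array cell by cell from earlier cells. -/
theorem realFill_rec (hb : b ≠ a) (hd : ∀ i, d i = i) {k i : ℕ} (hi : i < k)
    (hf : 0 < g i → f i < i) :
    realFill a b a g d e f r k a i = if g i ≤ 0 then r a i else
      (r b (e i) + realFill a b a g d e f r k a (f i)) / 2 := by
  have stable : ∀ k k' j, j < k → k ≤ k' →
      realFill a b a g d e f r k' a j = realFill a b a g d e f r k a j := by
    intro k k' j hj hk
    induction k', hk using Nat.le_induction with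
    | base => rfl
    | succ k' hk ih =>
      rw [← ih]
      simp only [realFill]
      split_ifs
      · rfl
      · rw [Function.update_self, Function.update_of_ne (by rw [hd]; omega)]
  have miss : realFill a b a g d e f r i a i = r a i :=
    realFill_miss fun j hj _ => by rw [hd]; omega
  rw [stable (i + 1) k i (by omega) (by omega)]
  simp only [realFill]
  split_ifs with h
  · exact miss
  · have := hf (by omega)
    rw [Function.update_self, hd, Function.update_self, realFill_other hb,
      stable i k (f i) this (by omega)]

end RealFill

end Machine

end BoundaryLabeling

end

/-! ### Preparation of the memory: bounds and candidate coordinates -/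

noncomputable section

namespace BoundaryLabeling

open Machine (pick pick_pos pick_neg)

namespace Problem

variable (I : Problem)

/-- Bounds for the number of input cells that are used, for the number of coordinates, and for the
numbers that occur. -/
def inputBound : ℕ := I.n + I.obstacles.length + I.obstacles.flatten.length + 5

/-- A candidate coordinate is given by two collected input numbers and an exponent, each below `7 *
inputBound`; the nested pair of the three is below the fourth power. -/
def coordBound : ℕ := (7 * I.inputBound) ^ 4

/-- Large enough to serve as `L` in `exists_weight_le_total`, which needs `4 * Q + 8 ≤ L` with `Q`
the number of candidate coordinates. -/
def digitBound : ℕ := 10 * I.coordBound + 20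

/-- The exponent is the one that makes room for the codes of all transitions needed. -/
def codeBound : ℕ := I.digitBound ^ 128

end Problem

namespace Machine

/-- The memory contains the input. -/
def Keeps (I : Problem) (s : State) : Prop :=
  (∀ a < 3, s.nat a = I.input.nat a) ∧ ∀ b < 7, s.real b = I.input.real b

/-- The array `real 11` contains the coordinates of the input. -/
def Collected (b' : ℕ) (I : Problem) (s : State) : Prop :=
  ∀ b < b', ∀ r < I.inputBound, s.real 11 (7 * r + b) = I.input.real b r

/-- The array `real 10` contains, at `Nat.pair (Nat.pair p q) k`, the point that is obtained from
the coordinate number `q` by `k` times halving the distance to the coordinate number `p`. -/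
def Spread (s : State) : Prop :=
  (∀ p q, Nat.pair (Nat.pair p q) 0 < bound s →
    s.real 10 (Nat.pair (Nat.pair p q) 0) = s.real 11 q) ∧
  ∀ p q k, Nat.pair (Nat.pair p q) (k + 1) < bound s →
    s.real 10 (Nat.pair (Nat.pair p q) (k + 1)) =
      (s.real 11 p + s.real 10 (Nat.pair (Nat.pair p q) k)) / 2

/-- The memory before the last three phases of the preparation. -/
def Stage (N q : Problem → ℕ) (b : ℕ) (I : Problem) (s : State) : Prop :=
  Keeps I s ∧ (∀ i, s.nat 13 i = 0) ∧ bound s = N I ∧ s.nat params 1 = q I ∧ Collected b I s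

theorem Stage.of_agreeOff {N q N' q' : Problem → ℕ} {b : ℕ} {I : Problem} {s s' : State}
    (h : Stage N q b I s) (hs : AgreeOff params s s') (hN : bound s' = N' I)
    (hq : s'.nat params 1 = q' I) : Stage N' q' b I s' := by
  obtain ⟨⟨h1, h2⟩, h3, -, -, h6⟩ := h
  refine ⟨⟨fun a ha => ?_, fun b hb => ?_⟩, fun i => ?_, hN, hq, ?_⟩
  · rw [hs.2 a (by simp only [scratch]; omega) (by simp only [params]; omega), h1 a ha]
  · rw [hs.1, h2 b hb]
  · rw [hs.2 13 (by decide) (by decide), h3]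
  · rw [Collected, hs.1]; exact h6

/-- Changing the bound. -/
theorem does_bound {N N' q : Problem → ℕ} {b : ℕ} (f : State → ℕ) [Dn fun s _ => f s]
    (hf : ∀ I s, Stage N q b I s → f s = N' I) (hN : ∀ I, N I ≤ N' I) :
    Does (Stage N q b) (assign params 0 (expr fun s _ => f s)) (Stage N' q b) := by
  refine does_assign 0 f (by decide) fun I s s' h hs hu => ?_
  have e : bound s' = N' I := by
    simp only [bound, hu, Function.update_self]; exact hf I s h
  refine ⟨?_, h.of_agreeOff hs e ?_⟩
  · rw [e, h.2.2.1]; exact hN I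
  · rw [hu, Function.update_of_ne (by decide)]; exact h.2.2.2.1

/-- In the input memory the bound is 0 and all sums are empty, so the first bound is computed
without any sum. It is just large enough to add up the lengths of the obstacles in the next step. -/
theorem does_input : Does (fun I s => s = I.input)
    (assign params 0 (expr fun s _ => s.nat 0 0 + s.nat 0 1))
    (Stage (fun I => I.n + I.obstacles.length) (fun _ => 0) 0) := by
  refine does_assign 0 (fun s => s.nat 0 0 + s.nat 0 1) (by decide) fun I s s' h hs hu => ?_
  subst h
  have hz : Stage (fun _ => 0) (fun _ => 0) 0 I I.input :=
    ⟨⟨fun _ _ => rfl, fun _ _ => rfl⟩, fun _ => rfl, rfl, rfl, fun b hb => absurd hb (by omega)⟩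
  refine ⟨?_, hz.of_agreeOff hs ?_ ?_⟩
  · exact Nat.zero_le _
  · simp only [bound, hu, Function.update_self]; simp [Problem.input]
  · rw [hu, Function.update_of_ne (by decide)]; rfl

theorem sum_len (I : Problem) {N : ℕ} (hN : I.obstacles.length ≤ N) :
    ∑ i ∈ Finset.range N, I.input.nat 2 i = I.obstacles.flatten.length := by
  have h1 := I.start_eq hN (o := I.obstacles.length) le_rfl
  rw [List.take_length] at h1
  rw [← h1, Frame.start]
  refine Finset.sum_congr rfl fun o _ => ?_
  by_cases h : o < I.obstacles.length
  · rw [pick_pos h]; rfl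
  · rw [pick_neg h]
    simp [Problem.input, h]

theorem does_inputBound : Does (Stage (fun I => I.n + I.obstacles.length) (fun _ => 0) 0)
    (assign params 0 (expr fun s _ => s.nat 0 0 + s.nat 0 1 +
      (∑ i ∈ Finset.range (bound s), s.nat 2 i) + (5 : ℕ)))
    (Stage Problem.inputBound (fun _ => 0) 0) := by
  refine does_bound (fun s => s.nat 0 0 + s.nat 0 1 + (∑ i ∈ Finset.range (bound s), s.nat 2 i) + 5)
    (fun I s h => ?_) fun I => by simp only [Problem.inputBound]; omega
  obtain ⟨⟨h1, -⟩, -, h3, -⟩ := h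
  rw [h1 0 (by omega), h1 2 (by omega), h3, sum_len I (Nat.le_add_left _ _)]
  rfl

/-- Copying the input array `b`. -/
def collect (b : ℕ) : Program :=
  fillReal 11 b b (expr fun _ _ => 1)
    (expr fun _ ρ => ρ 0 + ρ 0 + ρ 0 + ρ 0 + ρ 0 + ρ 0 + ρ 0 + b) (expr fun _ ρ => ρ 0)
    (expr fun _ ρ => ρ 0)

theorem does_collect {b : ℕ} (hb : b < 7) : Does (Stage Problem.inputBound (fun _ => 0) b)
    (collect b) (Stage Problem.inputBound (fun _ => 0) (b + 1)) := by
  refine does_fillReal 11 b b (fun _ _ => 1) (fun _ i => i + i + i + i + i + i + i + b)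
    (fun _ i => i) (fun _ i => i) (fun _ _ _ _ => rfl) (fun _ _ _ _ => rfl) (fun _ _ _ _ => rfl)
    (fun _ _ _ _ => rfl) fun I s s' h hs hr => ?_
  obtain ⟨⟨h1, h2⟩, h3, h4, h5, h6⟩ := h
  refine ⟨⟨fun a ha => ?_, fun b' hb' => ?_⟩, fun i => ?_, ?_, ?_, fun b' hb' r hr' => ?_⟩
  · rw [hs a (by simp only [scratch]; omega), h1 a ha]
  · rw [hr, realFill_other (by omega), h2 b' hb']
  · rw [hs 13 (by decide), h3]
  · rw [hs.bound_eq, h4]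
  · rw [hs params (by decide), h5]
  · rw [hr]
    by_cases e : b' = b
    · subst e
      have := realFill_hit (a := 11) (b := b') (c := b') (g := fun _ => 1)
        (d := fun i => i + i + i + i + i + i + i + b') (e := fun i => i) (f := fun i => i)
        (r := s.real) (k := bound s) (i := r) (by omega) (by omega) (by omega) one_pos
        (fun j _ _ h => by omega)
      rw [show 7 * r + b' = r + r + r + r + r + r + r + b' by omega, this, h2 b' hb]
      ring
    · rw [realFill_miss (fun i _ _ => by omega)]
      exact h6 b' (by omega) r hr'

/-- A fourth power, written as a fourfold sum of ones since there is no multiplication. -/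
theorem does_coords : Does (Stage (fun I => 7 * I.inputBound) (fun _ => 0) 7)
    (assign params 1 (expr fun s _ => ∑ _i ∈ Finset.range (bound s),
      ∑ _j ∈ Finset.range (bound s), ∑ _k ∈ Finset.range (bound s),
        ∑ _l ∈ Finset.range (bound s), 1))
    (Stage (fun I => 7 * I.inputBound) Problem.coordBound 7) := by
  refine does_assign 1 (fun s => ∑ _i ∈ Finset.range (bound s),
      ∑ _j ∈ Finset.range (bound s), ∑ _k ∈ Finset.range (bound s),
        ∑ _l ∈ Finset.range (bound s), 1) (by decide) fun I s s' h hs hu => ?_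
  have e : bound s' = bound s := by
    simp only [bound, hu]; rw [Function.update_of_ne (by decide)]
  refine ⟨e.ge, h.of_agreeOff hs (e.trans h.2.2.1) ?_⟩
  rw [hu, Function.update_self]
  simp only [Finset.sum_const, Finset.card_range, smul_eq_mul, mul_one, h.2.2.1,
    Problem.coordBound]
  ring

/-- Seven squarings give the exponent `2 ^ 7 = 128`. Intermediate bounds are never larger than the
final one, so the time remains polynomial. -/
theorem does_square (k : ℕ) : Does (Stage (fun I => I.digitBound ^ 2 ^ k) Problem.coordBound 7)
    (assign params 0 (expr fun s _ => ∑ _i ∈ Finset.range (bound s), bound s))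
    (Stage (fun I => I.digitBound ^ 2 ^ (k + 1)) Problem.coordBound 7) := by
  refine does_bound (fun s => ∑ _i ∈ Finset.range (bound s), bound s) (fun I s h => ?_)
    fun I => Nat.pow_le_pow_right (by simp only [Problem.digitBound]; omega)
      (Nat.pow_le_pow_right (by omega) (by omega))
  rw [Finset.sum_const, Finset.card_range, smul_eq_mul, h.2.2.1, pow_succ 2, pow_mul, pow_two]

/-- The memory after the preparation. -/
def Ready (I : Problem) (s : State) : Prop :=
  Stage Problem.codeBound Problem.coordBound 7 I s ∧ Spread s

/-- Initializes every cell `((p, q), k)` with the number `q`; the following pass overwrites those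
with `k > 0`. -/
theorem does_copy : Does (Stage Problem.codeBound Problem.coordBound 7)
    (fillReal 10 11 11 (expr fun _ _ => 1) (expr fun _ ρ => ρ 0)
      (expr fun s ρ => sn (bound s) (fs (bound s) (ρ 0)))
      (expr fun s ρ => sn (bound s) (fs (bound s) (ρ 0))))
    (fun I s => Stage Problem.codeBound Problem.coordBound 7 I s ∧
      ∀ i < bound s, s.real 10 i = s.real 11 (sn (bound s) (fs (bound s) i))) := by
  have inv : ∀ s s', AgreeNat s s' → ∀ i,
      sn (bound s') (fs (bound s') i) = sn (bound s) (fs (bound s) i) := by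
    intro s s' h i; rw [h.bound_eq]
  refine does_fillReal 10 11 11 (fun _ _ => 1) (fun _ i => i)
    (fun s i => sn (bound s) (fs (bound s) i)) (fun s i => sn (bound s) (fs (bound s) i))
    (fun _ _ _ _ => rfl) (fun _ _ _ _ => rfl) inv inv fun I s s' h hs hr => ?_
  obtain ⟨⟨h1, h2⟩, h3, h4, h5, h6⟩ := h
  have e11 : s'.real 11 = s.real 11 := by rw [hr, realFill_other (by omega)]
  refine ⟨⟨⟨fun a ha => ?_, fun b' hb' => ?_⟩, fun i => ?_, ?_, ?_, fun b' hb' r hr' => ?_⟩,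
    fun i hi => ?_⟩
  · rw [hs a (by simp only [scratch]; omega), h1 a ha]
  · rw [hr, realFill_other (by omega), h2 b' hb']
  · rw [hs 13 (by decide), h3]
  · rw [hs.bound_eq, h4]
  · rw [hs params (by decide), h5]
  · rw [e11]; exact h6 b' hb' r hr'
  · rw [hs.bound_eq] at hi ⊢
    have := realFill_hit (a := 10) (b := 11) (c := 11) (g := fun _ => 1) (d := fun i => i)
      (e := fun i => sn (bound s) (fs (bound s) i)) (f := fun i => sn (bound s) (fs (bound s) i))
      (r := s.real) (k := bound s) (i := i) (by omega) (by omega) hi one_pos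
      (fun j _ _ h => h)
    rw [e11, hr, this]
    ring

theorem does_halve : Does (fun I s => Stage Problem.codeBound Problem.coordBound 7 I s ∧
      ∀ i < bound s, s.real 10 i = s.real 11 (sn (bound s) (fs (bound s) i)))
    (fillReal 10 11 10 (expr fun s ρ => sn (bound s) (ρ 0)) (expr fun _ ρ => ρ 0)
      (expr fun s ρ => fs (bound s) (fs (bound s) (ρ 0)))
      (expr fun s ρ => pr (bound s) (fs (bound s) (ρ 0)) (sn (bound s) (ρ 0) - (1 : ℕ))))
    Ready := by
  refine does_fillReal 10 11 10 (fun s i => sn (bound s) i) (fun _ i => i)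
    (fun s i => fs (bound s) (fs (bound s) i))
    (fun s i => pr (bound s) (fs (bound s) i) (sn (bound s) i - (1 : ℕ)))
    (fun s s' h i => by rw [h.bound_eq]) (fun _ _ _ _ => rfl) (fun s s' h i => by rw [h.bound_eq])
    (fun s s' h i => by rw [h.bound_eq]) fun I s s' ⟨h, hz⟩ hs hr => ?_
  obtain ⟨⟨h1, h2⟩, h3, h4, h5, h6⟩ := h
  have e11 : s'.real 11 = s.real 11 := by rw [hr, realFill_other (by omega)]
  have key : ∀ i < bound s, s'.real 10 i = if sn (bound s) i ≤ 0 then s.real 10 i else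
      (s.real 11 (fs (bound s) (fs (bound s) i)) +
        s'.real 10 (pr (bound s) (fs (bound s) i) (sn (bound s) i - 1))) / 2 := by
    intro i hi
    rw [hr]
    refine realFill_rec (by omega) (fun _ => rfl) hi fun hpos => ?_
    have l1 := fs_lt hi
    have l2 := sn_lt hi
    rw [pr_eq l1.le (by omega)]
    conv_rhs => rw [← Nat.pair_unpair i, ← fs_eq hi, ← sn_eq hi]
    -- Pairing is increasing in the exponent, so the cell for the preceding exponent comes earlier
    -- and has its final value already.
    exact Nat.pair_lt_pair_right _ (by omega)
  refine ⟨⟨⟨fun a ha => ?_, fun b' hb' => ?_⟩, fun i => ?_, ?_, ?_, fun b' hb' r hr' => ?_⟩,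
    fun p q hi => ?_, fun p q k hi => ?_⟩
  · rw [hs a (by simp only [scratch]; omega), h1 a ha]
  · rw [hr, realFill_other (by omega), h2 b' hb']
  · rw [hs 13 (by decide), h3]
  · rw [hs.bound_eq, h4]
  · rw [hs params (by decide), h5]
  · rw [e11]; exact h6 b' hb' r hr'
  · rw [hs.bound_eq] at hi
    rw [key _ hi, sn_pair hi, if_pos le_rfl, hz _ hi, fs_pair hi,
      sn_pair ((Nat.left_le_pair _ _).trans_lt hi), e11]
  · rw [hs.bound_eq] at hi
    have hi' := (Nat.left_le_pair _ _).trans_lt hi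
    have hk := (Nat.right_le_pair _ _).trans_lt hi
    rw [key _ hi, sn_pair hi, if_neg (by omega), fs_pair hi, fs_pair hi', Nat.add_sub_cancel,
      pr_eq hi'.le (by omega), e11]

/-- The preparation. -/
def setup : Program :=
  .seq (assign params 0 (expr fun s _ => s.nat 0 0 + s.nat 0 1))
  (.seq (assign params 0 (expr fun s _ => s.nat 0 0 + s.nat 0 1 +
      (∑ i ∈ Finset.range (bound s), s.nat 2 i) + (5 : ℕ)))
  (.seq (collect 0) (.seq (collect 1) (.seq (collect 2) (.seq (collect 3) (.seq (collect 4)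
  (.seq (collect 5) (.seq (collect 6)
  (.seq (assign params 0 (expr fun s _ =>
    bound s + bound s + bound s + bound s + bound s + bound s + bound s))
  (.seq (assign params 1 (expr fun s _ => ∑ _i ∈ Finset.range (bound s),
      ∑ _j ∈ Finset.range (bound s), ∑ _k ∈ Finset.range (bound s),
        ∑ _l ∈ Finset.range (bound s), 1))
  (.seq (assign params 0 (expr fun s _ => s.nat params 1 + s.nat params 1 + s.nat params 1 +
    s.nat params 1 + s.nat params 1 + s.nat params 1 + s.nat params 1 + s.nat params 1 +
    s.nat params 1 + s.nat params 1 + (20 : ℕ)))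
  (.seq (assign params 0 (expr fun s _ => ∑ _i ∈ Finset.range (bound s), bound s))
  (.seq (assign params 0 (expr fun s _ => ∑ _i ∈ Finset.range (bound s), bound s))
  (.seq (assign params 0 (expr fun s _ => ∑ _i ∈ Finset.range (bound s), bound s))
  (.seq (assign params 0 (expr fun s _ => ∑ _i ∈ Finset.range (bound s), bound s))
  (.seq (assign params 0 (expr fun s _ => ∑ _i ∈ Finset.range (bound s), bound s))
  (.seq (assign params 0 (expr fun s _ => ∑ _i ∈ Finset.range (bound s), bound s))
  (.seq (assign params 0 (expr fun s _ => ∑ _i ∈ Finset.range (bound s), bound s))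
  (.seq (fillReal 10 11 11 (expr fun _ _ => 1) (expr fun _ ρ => ρ 0)
      (expr fun s ρ => sn (bound s) (fs (bound s) (ρ 0)))
      (expr fun s ρ => sn (bound s) (fs (bound s) (ρ 0))))
    (fillReal 10 11 10 (expr fun s ρ => sn (bound s) (ρ 0)) (expr fun _ ρ => ρ 0)
      (expr fun s ρ => fs (bound s) (fs (bound s) (ρ 0)))
      (expr fun s ρ => pr (bound s) (fs (bound s) (ρ 0)) (sn (bound s) (ρ 0) - (1 : ℕ)))))))))))))))))))))))

theorem does_setup : Does (fun I s => s = I.input) setup Ready := by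
  refine does_input.seq (does_inputBound.seq ((does_collect (by omega)).seq
    ((does_collect (by omega)).seq ((does_collect (by omega)).seq ((does_collect (by omega)).seq
    ((does_collect (by omega)).seq ((does_collect (by omega)).seq ((does_collect (by omega)).seq
    (Does.seq (P' := Stage (fun I => 7 * I.inputBound) (fun _ => 0) 7) ?_ (does_coords.seq
    (Does.seq (P' := Stage (fun I => I.digitBound ^ 2 ^ 0) Problem.coordBound 7) ?_
    ((does_square 0).seq ((does_square 1).seq ((does_square 2).seq ((does_square 3).seq
    ((does_square 4).seq ((does_square 5).seq ((does_square 6).seq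
    (does_copy.seq does_halve)))))))))))))))))))
  · refine does_bound (fun s => bound s + bound s + bound s + bound s + bound s + bound s + bound s)
      (fun I s h => ?_) fun I => ?_
    · rw [h.2.2.1]; omega
    · omega
  · refine does_bound (fun s => s.nat params 1 + s.nat params 1 + s.nat params 1 +
      s.nat params 1 + s.nat params 1 + s.nat params 1 + s.nat params 1 + s.nat params 1 +
      s.nat params 1 + s.nat params 1 + (20 : ℕ)) (fun I s h => ?_) fun I => ?_
    · rw [h.2.2.2.1]; simp only [Problem.digitBound, pow_zero, pow_one]; omega
    · have : 7 * I.inputBound ≤ I.coordBound := Nat.le_self_pow (by omega) _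
      simp only [Problem.digitBound, pow_zero, pow_one]; omega

end Machine

end BoundaryLabeling

end

noncomputable section

namespace BoundaryLabeling

open Machine (pick pick_pos pick_neg)

namespace Machine

/-! ### The dynamic program on the machine -/

/-- The memory contains the input and the coordinates of the routes. -/
def Base (I : Problem) (s : State) : Prop :=
  Keeps I s ∧ bound s = I.codeBound ∧ s.nat params 1 = I.coordBound ∧ Collected 7 I s ∧ Spread s

/-- Arrays with data that are needed until the end. -/
def IsData (a : ℕ) : Prop := a < 3 ∨ a = params ∨ a = 13 ∨ a = 15

section Congr

variable (po : Prop) {I : Problem} {s s' : State}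

theorem coding_congr (hp : s'.nat params = s.nat params) (hn : ∀ a < 3, s'.nat a = s.nat a)
    (hr : ∀ b < 7, s'.real b = s.real b) (h10 : s'.real 10 = s.real 10) :
    coding po s' = coding po s := by
  have e : bound s' = bound s := by simp only [bound, hp]
  have er : rank s' = rank s := by
    funext x; simp only [rank, e, hp, h10]
  simp only [coding, realFrame, er, e, hp, hn 0 (by omega), hn 1 (by omega), hn 2 (by omega),
    hr 0 (by omega), hr 1 (by omega), hr 2 (by omega), hr 3 (by omega), hr 4 (by omega),
    hr 5 (by omega), hr 6 (by omega), h10]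

theorem Base.congr (h : Base I s) (hp : s'.nat params = s.nat params)
    (hn : ∀ a < 3, s'.nat a = s.nat a) (hr : ∀ b < 7, s'.real b = s.real b)
    (h10 : s'.real 10 = s.real 10) (h11 : s'.real 11 = s.real 11) : Base I s' := by
  have e : bound s' = bound s := by simp only [bound, hp]
  obtain ⟨⟨h1, h2⟩, h3, h4, h5, h6⟩ := h
  refine ⟨⟨fun a ha => (hn a ha).trans (h1 a ha), fun b hb => (hr b hb).trans (h2 b hb)⟩,
    e.trans h3, hp ▸ h4, ?_, ?_⟩
  · rw [Collected, h11]; exact h5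
  · rw [Spread, e, h10, h11]; exact h6

variable {a : ℕ}

theorem AgreeOff.coding_eq (h : AgreeOff a s s') (ha : ¬ (a < 3 ∨ a = params)) :
    coding po s' = coding po s :=
  coding_congr po (h.2 _ (by decide) (by tauto))
    (fun b hb => h.2 b (by simp only [scratch]; omega) (by omega)) (fun _ _ => by rw [h.1])
    (by rw [h.1])

theorem Base.of_agreeOff (hb : Base I s) (h : AgreeOff a s s') (ha : ¬ (a < 3 ∨ a = params)) :
    Base I s' :=
  hb.congr (h.2 _ (by decide) (by tauto))
    (fun b hb => h.2 b (by simp only [scratch]; omega) (by omega)) (fun _ _ => by rw [h.1])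
    (by rw [h.1]) (by rw [h.1])

end Congr

variable (po : Prop)

/-- The array `nat 13` contains the table of selections after `k` rounds. -/
def Table (k : ℕ) (I : Problem) (s : State) : Prop :=
  Base I s ∧ s.nat 13 = (coding po s).table (bound s) k

theorem Table.of_agreeOff {k a : ℕ} {I : Problem} {s s' : State} (ht : Table po k I s)
    (h : AgreeOff a s s') (ha : ¬ (a < 3 ∨ a = params)) (h13 : a ≠ 13) : Table po k I s' := by
  refine ⟨ht.1.of_agreeOff h ha, ?_⟩
  rw [h.2 13 (by decide) h13.symm, h.coding_eq po ha, h.bound_eq (by tauto), ht.2]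

instance (f : State → (ℕ → ℕ) → ℕ) [hf : Dn f] : Dn fun s ρ => s.nat 4 (f s ρ) :=
  ⟨.cell (by decide) hf.out⟩

instance (f : State → (ℕ → ℕ) → ℕ) [hf : Dn f] : Dn fun s ρ => s.nat 5 (f s ρ) :=
  ⟨.cell (by decide) hf.out⟩

/-- One round of the dynamic program. -/
def round : Program :=
  -- The new table is built in a separate array, because each entry reads the whole old table.
  .seq (fillNat 12 (expr fun s ρ =>
      (coding po s).entry (bound s) (s.nat 13) (fs (bound s) (ρ 0)) (sn (bound s) (ρ 0))))
    (fillNat 13 (expr fun s ρ => s.nat 12 (ρ 0)))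

theorem does_round : Does (fun (x : Problem × ℕ × State) s =>
      bound s = bound x.2.2 ∧ s.nat 14 0 = x.2.1 ∧ Table po x.2.1 x.1 s) (round po)
    (fun x s => bound s = bound x.2.2 ∧ s.nat 14 0 = x.2.1 ∧ Table po (x.2.1 + 1) x.1 s) := by
  refine Does.seq (P' := fun x s => bound s = bound x.2.2 ∧ s.nat 14 0 = x.2.1 ∧
    Table po x.2.1 x.1 s ∧ ∀ i < bound s, s.nat 12 i = (coding po s).entry (bound s) (s.nat 13)
      (fs (bound s) i) (sn (bound s) i)) ?_ ?_
  · refine does_fillNat (fun s i =>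
      (coding po s).entry (bound s) (s.nat 13) (fs (bound s) i) (sn (bound s) i)) (by decide)
      (by decide) (fun s s' h i => ?_) fun x s s' ⟨h1, h2, h3⟩ h hv => ?_
    · rw [h.coding_eq po (by decide), h.bound_eq (by decide), h.2 13 (by decide) (by decide)]
    · rw [h.coding_eq po (by decide), h.bound_eq (by decide), h.2 13 (by decide) (by decide),
        h.2 14 (by decide) (by decide)]
      refine ⟨h1, h2, h3.of_agreeOff po h (by decide) (by decide), fun i hi => ?_⟩
      rw [hv, if_pos hi]
  · refine does_fillNat (fun s i => s.nat 12 i) (by decide) (by decide) (fun s s' h i => ?_)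
      fun x s s' ⟨h1, h2, h3, h4⟩ h hv => ?_
    · rw [h.2 12 (by decide) (by decide)]
    · rw [h.bound_eq (by decide), h.2 14 (by decide) (by decide)]
      refine ⟨h1, h2, h3.1.of_agreeOff h (by decide), funext fun i => ?_⟩
      rw [hv, h.coding_eq po (by decide), h.bound_eq (by decide), Coding.table]
      by_cases hi : i < bound s
      · rw [if_pos hi, if_pos hi, h4 i hi, h3.2]
      · rw [if_neg hi, if_neg hi, h3.2]
        -- Cells beyond the bound are not written; they are 0 initially, as in every table.
        cases x.2.1 with
        | zero => rfl
        | succ k => rw [Coding.table, if_neg hi]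

/-- The loop makes as many rounds as the bound, which exceeds the number of sites and therefore the
depth of any decomposition. -/
theorem does_rounds : Does Ready (loop 14 0 (round po))
    (fun I s => Table po (bound s) I s) := by
  refine does_loop 0 (by decide) (R := Table po) (does_round po) (fun i x s v h => ?_)
    (fun I s h => ?_) fun I s h => h
  · exact h.of_agreeOff po (a := 14) ⟨rfl, fun b _ hb => Function.update_of_ne hb _ _⟩
      (by decide) (by decide)
  · obtain ⟨⟨h1, h2, h3, h4, h5⟩, h6⟩ := h
    exact ⟨⟨h1, h3, h4, h5, h6⟩, funext h2⟩

/-- The weight of the selection for the subproblem `σ`. -/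
def gain (s : State) (σ : ℕ) : ℕ :=
  (coding po s).total (bound s) fun i => s.nat 13 (pr (bound s) σ i)

/-- The selection for the subproblem `σ` has the largest weight. -/
def Top (s : State) (σ : ℕ) : Prop := ∀ σ' < bound s, gain po s σ' ≤ gain po s σ

/-- The first subproblem with the largest weight. -/
def best (s : State) : ℕ :=
  ∑ σ ∈ Finset.range (bound s), pick (Top po s σ ∧ ∀ σ' < bound s, Top po s σ' → σ ≤ σ') σ 0

instance (f : State → (ℕ → ℕ) → ℕ) [Dn f] : Dn fun s ρ => gain po s (f s ρ) := by
  unfold gain; infer_instance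

instance (f : State → (ℕ → ℕ) → ℕ) [hf : Dn f] : Dr fun s ρ => Top po s (f s ρ) :=
  ⟨.app₁ (F := Top po) (show Dr _ by unfold Top; infer_instance).out hf.out⟩

instance : Dn fun s _ => best po s := by unfold best; infer_instance

theorem best_spec (s : State) (h : 0 < bound s) : best po s < bound s ∧ Top po s (best po s) := by
  classical
  have hex : ∃ σ, σ < bound s ∧ Top po s σ := by
    obtain ⟨σ, h1, h2⟩ := Finset.exists_max_image (Finset.range (bound s)) (gain po s)
      ⟨0, Finset.mem_range.2 h⟩
    exact ⟨σ, Finset.mem_range.1 h1, fun σ' h' => h2 σ' (Finset.mem_range.2 h')⟩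
  have e : best po s = Nat.find hex := by
    have hs := Nat.find_spec hex
    rw [best, Finset.sum_eq_single (Nat.find hex)]
    · exact pick_pos ⟨hs.2, fun σ' h1 h2 => Nat.find_min' hex ⟨h1, h2⟩⟩ _ _
    · intro σ hσ hne
      refine pick_neg ?_ _ _
      rintro ⟨h1, h2⟩
      have := Nat.find_min' hex ⟨Finset.mem_range.1 hσ, h1⟩
      have := h2 _ hs.1 hs.2
      omega
    · intro hn; exact absurd (Finset.mem_range.2 hs.1) hn
  rw [e]; exact Nat.find_spec hex

/-- The memory after the computation of an optimal selection. -/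
def Chosen (I : Problem) (s : State) : Prop :=
  Table po (bound s) I s ∧ s.nat 15 0 < bound s ∧ Top po s (s.nat 15 0)

theorem codeBound_pos (I : Problem) : 0 < I.codeBound :=
  pow_pos (by simp only [Problem.digitBound]; omega) _

theorem AgreeOff.top_iff {a : ℕ} {s s' : State} (h : AgreeOff a s s')
    (ha : ¬ (a < 3 ∨ a = params)) (h13 : a ≠ 13) (σ : ℕ) : Top po s' σ ↔ Top po s σ := by
  simp only [Top, gain, h.coding_eq po ha, h.bound_eq (by tauto), h.2 13 (by decide) h13.symm]

theorem does_choose : Does (fun I s => Table po (bound s) I s)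
    (assign 15 0 (expr fun s _ => best po s)) (Chosen po) := by
  refine does_assign 0 (best po) (by decide) fun I s s' ht h hu => ?_
  have hb := h.bound_eq (by decide)
  have ⟨h1, h2⟩ := best_spec po s (ht.1.2.1 ▸ codeBound_pos I)
  refine ⟨hb.ge, ?_, ?_, ?_⟩
  · rw [hb]; exact ht.of_agreeOff po h (by decide) (by decide)
  · rw [hu, Function.update_self, hb]; exact h1
  · rw [hu, Function.update_self, h.top_iff po (by decide) (by decide)]; exact h2

theorem Chosen.of_agreeOff {a : ℕ} {I : Problem} {s s' : State} (hc : Chosen po I s)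
    (h : AgreeOff a s s') (ha : ¬ IsData a) : Chosen po I s' := by
  have h1 : ¬ (a < 3 ∨ a = params) := fun h => ha (by unfold IsData; tauto)
  have h13 : a ≠ 13 := fun h => ha (by unfold IsData; tauto)
  have h15 : a ≠ 15 := fun h => ha (by unfold IsData; tauto)
  have hb := h.bound_eq (by tauto)
  refine ⟨?_, ?_, ?_⟩
  · rw [hb]; exact hc.1.of_agreeOff po h h1 h13
  · rw [hb, h.2 15 (by decide) h15.symm]; exact hc.2.1
  · rw [h.2 15 (by decide) h15.symm, h.top_iff po h1 h13]; exact hc.2.2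

/-! ### The output -/

/-- The selected route of the site `i`, plus one. -/
def choice (s : State) (i : ℕ) : ℕ := s.nat 13 (pr (bound s) (s.nat 15 0) i)

/-- All sites have been connected. -/
def Success (s : State) : Prop := ∀ i < bound s, i < s.nat 0 0 → ¬ choice s i = 0

/-- The place of the `r`-th number of the input array `b`. -/
def place (s : State) (b r : ℕ) : ℕ :=
  pr (bound s) (pr (bound s) 0 (r + r + r + r + r + r + r + b)) 0

/-- The route of the site `i` ends on the bottom or on the top side. -/
def Up (s : State) (i : ℕ) : Prop := s.nat 1 (s.nat 4 i) ≤ 1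

/-- Coordinates are addressed and not computed: each vertex coordinate of a leader is an input
number or one of the two candidate coordinates of its route. With four vertices the vertex 1 still
has the coordinate of the site along the side. -/
def cellAlong (s : State) (i k : ℕ) : ℕ :=
  pick (k = 0 ∨ k = 1 ∧ s.nat 5 i = 4) (pick (Up s i) (place s 1 i) (place s 2 i))
    (fs (bound s) (sn (bound s) (choice s i - (1 : ℕ))))

def cellAcross (s : State) (i k : ℕ) : ℕ :=
  pick (k = 0) (pick (Up s i) (place s 2 i) (place s 1 i)) (pick (k + (1 : ℕ) = s.nat 5 i)
    (place s 0 (pick (s.nat 1 (s.nat 4 i) = 0) 2 (pick (s.nat 1 (s.nat 4 i) = 1) 3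
      (pick (s.nat 1 (s.nat 4 i) = 2) 0 1))))
    (sn (bound s) (sn (bound s) (choice s i - (1 : ℕ)))))

/-- The place of the first coordinate of the vertex `k` of the route of the site `i`. -/
def cellX (s : State) (i k : ℕ) : ℕ := pick (Up s i) (cellAlong s i k) (cellAcross s i k)

def cellY (s : State) (i k : ℕ) : ℕ := pick (Up s i) (cellAcross s i k) (cellAlong s i k)

section Instances

variable (f g : State → (ℕ → ℕ) → ℕ)

instance [Dn f] : Dn fun s ρ => choice s (f s ρ) := by unfold choice; infer_instance

instance : Dr fun s _ => Success s := by unfold Success; infer_instance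

instance [Dn f] [Dn g] : Dn fun s ρ => place s (f s ρ) (g s ρ) := by unfold place; infer_instance

instance [Dn f] : Dr fun s ρ => Up s (f s ρ) := by unfold Up; infer_instance

instance [Dn f] [Dn g] : Dn fun s ρ => cellAlong s (f s ρ) (g s ρ) := by
  unfold cellAlong; infer_instance

instance [Dn f] [Dn g] : Dn fun s ρ => cellAcross s (f s ρ) (g s ρ) := by
  unfold cellAcross; infer_instance

instance [Dn f] [Dn g] : Dn fun s ρ => cellX s (f s ρ) (g s ρ) := by
  unfold cellX; infer_instance

instance [Dn f] [Dn g] : Dn fun s ρ => cellY s (f s ρ) (g s ρ) := by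
  unfold cellY; infer_instance

end Instances

/-- The numbers that are written to the output. -/
def Reported (I : Problem) (s : State) : Prop :=
  Chosen po I s ∧ s.nat 3 0 = pick (Success s) 1 0 ∧
    ∀ i < bound s, s.nat 4 i = (coding po s).label (choice s i - 1) ∧
      s.nat 5 i = (coding po s).bends (choice s i - 1) + 2

theorem AgreeOff.choice_eq {a : ℕ} {s s' : State} (h : AgreeOff a s s') (ha : ¬ IsData a) (i : ℕ) :
    choice s' i = choice s i := by
  have h1 : a ≠ params := fun h => ha (by unfold IsData; tauto)
  have h13 : a ≠ 13 := fun h => ha (by unfold IsData; tauto)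
  have h15 : a ≠ 15 := fun h => ha (by unfold IsData; tauto)
  simp only [choice, h.bound_eq h1, h.2 13 (by decide) h13.symm, h.2 15 (by decide) h15.symm]

/-- Reporting the answer, the labels, and the numbers of vertices. -/
def report : Program :=
  .seq (assign 3 0 (expr fun s _ => pick (Success s) 1 0))
  (.seq (fillNat 4 (expr fun s ρ => (coding po s).label (choice s (ρ 0) - (1 : ℕ))))
    (fillNat 5 (expr fun s ρ => (coding po s).bends (choice s (ρ 0) - (1 : ℕ)) + (2 : ℕ))))

theorem AgreeOff.success_iff {a : ℕ} {s s' : State} (h : AgreeOff a s s') (ha : ¬ IsData a) :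
    Success s' ↔ Success s := by
  have h1 : a ≠ params := fun h => ha (by unfold IsData; tauto)
  have h0 : a ≠ 0 := fun h => ha (by unfold IsData; omega)
  simp only [Success, h.choice_eq ha, h.bound_eq h1, h.2 0 (by decide) h0.symm]

theorem does_report : Does (Chosen po) (report po) (Reported po) := by
  have d3 : ¬ IsData 3 := by simp [IsData, params]
  have d4 : ¬ IsData 4 := by simp [IsData, params]
  have d5 : ¬ IsData 5 := by simp [IsData, params]
  refine Does.seq (P' := fun I s => Chosen po I s ∧ s.nat 3 0 = pick (Success s) 1 0) ?_
    (Does.seq (P' := fun I s => Chosen po I s ∧ s.nat 3 0 = pick (Success s) 1 0 ∧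
      ∀ i < bound s, s.nat 4 i = (coding po s).label (choice s i - 1)) ?_ ?_)
  · refine does_assign 0 (fun s => pick (Success s) 1 0) (by decide) fun I s s' hc h hu => ?_
    refine ⟨(h.bound_eq (by decide)).ge, hc.of_agreeOff po h d3, ?_⟩
    rw [hu, Function.update_self, propext (h.success_iff d3)]
  · refine does_fillNat (fun s i => (coding po s).label (choice s i - 1)) (by decide) (by decide)
      (fun s s' h i => ?_) fun I s s' ⟨hc, h3⟩ h hv => ?_
    · rw [h.coding_eq po (by decide), h.choice_eq d4]
    · refine ⟨hc.of_agreeOff po h d4, ?_, fun i hi => ?_⟩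
      · rw [propext (h.success_iff d4), h.2 3 (by decide) (by decide), h3]
      · rw [h.bound_eq (by decide)] at hi
        rw [hv, if_pos hi, h.coding_eq po (by decide), h.choice_eq d4]
  · refine does_fillNat (fun s i => (coding po s).bends (choice s i - 1) + 2) (by decide)
      (by decide) (fun s s' h i => ?_) fun I s s' ⟨hc, h3, h4⟩ h hv => ?_
    · rw [h.coding_eq po (by decide), h.choice_eq d5]
    · refine ⟨hc.of_agreeOff po h d5, ?_, fun i hi => ?_⟩
      · rw [propext (h.success_iff d5), h.2 3 (by decide) (by decide), h3]
      · rw [h.bound_eq (by decide)] at hi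
        rw [hv, if_pos hi, h.coding_eq po (by decide), h.choice_eq d5,
          h.2 4 (by decide) (by decide)]
        exact ⟨h4 i hi, rfl⟩

/-- Writing a coordinate of the vertices of the leaders. -/
def draw (a : ℕ) (C : State → ℕ → ℕ → ℕ)
    [Dn fun s ρ => C s (fs (bound s) (ρ 0)) (sn (bound s) (ρ 0))] : Program :=
  fillReal a 10 10 (expr fun s ρ => pick (fs (bound s) (ρ 0) < s.nat 0 0 ∧
      sn (bound s) (ρ 0) < 4) 1 0)
    (expr fun s ρ => fs (bound s) (ρ 0) + fs (bound s) (ρ 0) + fs (bound s) (ρ 0) +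
      fs (bound s) (ρ 0) + sn (bound s) (ρ 0))
    (expr fun s ρ => C s (fs (bound s) (ρ 0)) (sn (bound s) (ρ 0)))
    (expr fun s ρ => C s (fs (bound s) (ρ 0)) (sn (bound s) (ρ 0)))

/-- The array `a` contains the coordinates of the vertices of the leaders. -/
def Drawn (a : ℕ) (C : State → ℕ → ℕ → ℕ) (s : State) : Prop :=
  ∀ i < s.nat 0 0, ∀ k < 4, Nat.pair i k < bound s → s.real a (4 * i + k) = s.real 10 (C s i k)

theorem Chosen.of_agreeNat {I : Problem} {s s' : State} (hc : Chosen po I s) (h : AgreeNat s s')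
    (hr : ∀ b < 7, s'.real b = s.real b) (h10 : s'.real 10 = s.real 10)
    (h11 : s'.real 11 = s.real 11) : Chosen po I s' ∧ coding po s' = coding po s := by
  have e : coding po s' = coding po s := coding_congr po (h _ (by decide))
    (fun a ha => h a (by simp only [scratch]; omega)) hr h10
  have hB := hc.1.1.congr (h _ (by decide)) (fun a ha => h a (by simp only [scratch]; omega)) hr
    h10 h11
  simp only [Chosen, Table, Top, gain, e, h.bound_eq, h 13 (by decide), h 15 (by decide)]
  exact ⟨⟨⟨hB, hc.1.2⟩, hc.2⟩, trivial⟩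

theorem Reported.of_agreeNat {I : Problem} {s s' : State} (hc : Reported po I s)
    (h : AgreeNat s s') (hr : ∀ b < 7, s'.real b = s.real b) (h10 : s'.real 10 = s.real 10)
    (h11 : s'.real 11 = s.real 11) : Reported po I s' := by
  obtain ⟨h1, e⟩ := hc.1.of_agreeNat po h hr h10 h11
  refine ⟨h1, ?_⟩
  simp only [Success, choice, e, h.bound_eq, h 0 (by decide), h 3 (by decide), h 4 (by decide),
    h 5 (by decide), h 13 (by decide), h 15 (by decide)]
  exact hc.2

theorem does_draw {P : State → Prop} (a : ℕ) (ha : 7 ≤ a) (h10 : a ≠ 10) (h11 : a ≠ 11)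
    (C : State → ℕ → ℕ → ℕ)
    [Dn fun s ρ => C s (fs (bound s) (ρ 0)) (sn (bound s) (ρ 0))]
    (hC : ∀ s s', AgreeNat s s' → C s' = C s)
    (hP : ∀ s s', P s → AgreeNat s s' → (∀ b ≠ a, s'.real b = s.real b) → P s') :
    Does (fun I s => Reported po I s ∧ P s) (draw a C)
      (fun I s => (Reported po I s ∧ P s) ∧ Drawn a C s) := by
  refine does_fillReal a 10 10 (fun s x => pick (fs (bound s) x < s.nat 0 0 ∧ sn (bound s) x < 4)
    1 0) (fun s x => fs (bound s) x + fs (bound s) x + fs (bound s) x + fs (bound s) x +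
      sn (bound s) x) (fun s x => C s (fs (bound s) x) (sn (bound s) x))
    (fun s x => C s (fs (bound s) x) (sn (bound s) x))
    (fun s s' h i => by rw [h.bound_eq, h 0 (by decide)]) (fun s s' h i => by rw [h.bound_eq])
    (fun s s' h i => by rw [h.bound_eq, hC s s' h])
    (fun s s' h i => by rw [h.bound_eq, hC s s' h]) fun I s s' ⟨hR, hp⟩ h hr => ?_
  have other : ∀ b ≠ a, s'.real b = s.real b := fun b hb => by rw [hr, realFill_other hb]
  refine ⟨⟨hR.of_agreeNat po h (fun b hb => other b (by omega)) (other 10 h10.symm)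
    (other 11 h11.symm), hP s s' hp h other⟩, fun i hi k hk hx => ?_⟩
  rw [h 0 (by decide)] at hi
  rw [h.bound_eq] at hx
  have key := realFill_hit (a := a) (b := 10) (c := 10)
    (g := fun x => pick (fs (bound s) x < s.nat 0 0 ∧ sn (bound s) x < 4) 1 0)
    (d := fun x => fs (bound s) x + fs (bound s) x + fs (bound s) x + fs (bound s) x +
      sn (bound s) x) (e := fun x => C s (fs (bound s) x) (sn (bound s) x))
    (f := fun x => C s (fs (bound s) x) (sn (bound s) x)) (r := s.real) h10.symm h10.symm hx
    (by rw [fs_pair hx, sn_pair hx, pick_pos ⟨hi, hk⟩]; exact one_pos)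
    (by
      -- The guard keeps the vertex number below 4, so `4 * i + k` determines both `i` and `k` and
      -- no cell is written twice.
      intro j hj hg hd
      rw [fs_pair hx, sn_pair hx] at hd
      have h4 : sn (bound s) j < 4 := by
        by_contra hn
        rw [pick_neg (fun h => hn h.2)] at hg
        exact lt_irrefl _ hg
      have e1 : fs (bound s) j = i := by omega
      have e2 : sn (bound s) j = k := by omega
      rw [fs_eq hj] at e1
      rw [sn_eq hj] at e2
      rw [← Nat.pair_unpair j, e1, e2])
  rw [fs_pair hx, sn_pair hx] at key
  rw [show 4 * i + k = i + i + i + i + k by omega, hr, key, hC s s' h, ← hr, other 10 h10.symm]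
  ring

theorem cell_congr {s s' : State} (h : AgreeNat s s') : cellX s' = cellX s ∧ cellY s' = cellY s := by
  constructor <;> funext i k <;>
  simp only [cellX, cellY, cellAlong, cellAcross, place, Up, choice, h.bound_eq, h 1 (by decide),
    h 4 (by decide), h 5 (by decide), h 13 (by decide), h 15 (by decide)]

/-- The memory at the end. -/
def Finished (I : Problem) (s : State) : Prop :=
  Reported po I s ∧ Drawn 7 cellX s ∧ Drawn 8 cellY s

/-- The algorithm. -/
def algorithm : Program :=
  .seq setup (.seq (loop 14 0 (round po)) (.seq (assign 15 0 (expr fun s _ => best po s))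
    (.seq (report po) (.seq (draw 7 cellX) (draw 8 cellY)))))

theorem does_algorithm : Does (fun I s => s = I.input) (algorithm po) (Finished po) := by
  refine does_setup.seq ((does_rounds po).seq ((does_choose po).seq ((does_report po).seq ?_)))
  have d7 := does_draw (P := fun _ => True) po 7 le_rfl (by decide) (by decide) cellX
    (fun s s' h => (cell_congr h).1) fun _ _ _ _ _ => trivial
  have d8 := does_draw (P := Drawn 7 cellX) po 8 (by decide) (by decide) (by decide) cellY
    (fun s s' h => (cell_congr h).2) fun s s' h h1 h2 => by
      simp only [Drawn, (cell_congr h1).1, h1.bound_eq, h1 0 (by decide), h2 7 (by decide),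
        h2 10 (by decide)]
      exact h
  obtain ⟨p, hp⟩ := d7
  obtain ⟨q, hq⟩ := d8
  refine Does.seq (P' := fun I s => Reported po I s ∧ Drawn 7 cellX s) ⟨p, fun I s h => ?_⟩
    ⟨q, fun I s h => ?_⟩
  · obtain ⟨s', h1, h2, h3⟩ := hp I s ⟨h, trivial⟩
    exact ⟨s', h1, h2, h3.1.1, h3.2⟩
  · obtain ⟨s', h1, h2, h3⟩ := hq I s h
    exact ⟨s', h1, h2, h3.1.1, h3.1.2, h3.2⟩

end Machine

end BoundaryLabeling

end

noncomputable section

namespace BoundaryLabeling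

open Machine (pick pick_pos pick_neg)

namespace Machine

/-! ### The coordinates on the machine -/

/-- The numbers that can occur as coordinates of routes. -/
def values (s : State) : Set ℝ := {x | ∃ j < s.nat params 1, s.real 10 j = x}

/-- The numbers in the input. -/
def inputValues (I : Problem) : Set ℝ := {x | ∃ b < 7, ∃ r, I.input.real b r = x}

open Classical in
theorem rank_eq_card {s : State} (hQ : s.nat params 1 ≤ bound s) (x : ℝ) :
    rank s x = ((Finset.range (s.nat params 1)).filter fun j => s.real 10 j < x).card := by
  rw [rank, Finset.card_filter, ← Finset.sum_subset (Finset.range_mono hQ)]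
  · refine Finset.sum_congr rfl fun j hj => ?_
    simp only [pick, Finset.mem_range.1 hj, true_and]
  · intro j _ hj
    exact pick_neg (fun h => hj (Finset.mem_range.2 h.1)) _ _

theorem rank_le {s : State} (hQ : s.nat params 1 ≤ bound s) (x : ℝ) :
    rank s x ≤ s.nat params 1 := by
  rw [rank_eq_card hQ]
  exact (Finset.card_filter_le _ _).trans (Finset.card_range _).le

/-- A number of the list is counted in the rank of every larger number but not in its own, so ranks
are strictly increasing on the list; repetitions do no harm. -/
theorem rank_le_rank {s : State} (hQ : s.nat params 1 ≤ bound s) :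
    ∀ a ∈ values s, ∀ b ∈ values s, rank s a ≤ rank s b ↔ a ≤ b := by
  classical
  have hlt : ∀ a ∈ values s, ∀ b, a < b → rank s a < rank s b := by
    rintro _ ⟨j, hj, rfl⟩ b hb
    rw [rank_eq_card hQ, rank_eq_card hQ]
    refine Finset.card_lt_card ((Finset.ssubset_iff_of_subset fun i hi => ?_).2 ⟨j, ?_, ?_⟩)
    · rw [Finset.mem_filter] at hi ⊢; exact ⟨hi.1, hi.2.trans hb⟩
    · exact Finset.mem_filter.2 ⟨Finset.mem_range.2 hj, hb⟩
    · rw [Finset.mem_filter]; exact fun h => lt_irrefl _ h.2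
  intro a ha b hb
  constructor
  · intro h
    by_contra hn
    exact absurd (hlt b hb a (not_le.1 hn)) (not_lt.2 h)
  · intro h
    rcases h.eq_or_lt with rfl | h
    · exact le_rfl
    · exact (hlt a ha b h).le

variable {I : Problem} {s : State}

theorem coordBound_le (I : Problem) : I.coordBound ≤ I.codeBound :=
  (show I.coordBound ≤ I.digitBound by simp only [Problem.digitBound]; omega).trans
    (Nat.le_self_pow (by decide) _)

theorem inputBound_le (I : Problem) : 7 * I.inputBound ≤ I.coordBound :=
  Nat.le_self_pow (by decide) _

theorem Base.le_bound (h : Base I s) : s.nat params 1 ≤ bound s := by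
  rw [h.2.2.1, h.2.1]; exact coordBound_le I

theorem Base.le_rank (h : Base I s) :
    ∀ a ∈ values s, ∀ b ∈ values s, rank s a ≤ rank s b ↔ a ≤ b := rank_le_rank h.le_bound

theorem Base.realFrame_eq (h : Base I s) : realFrame s = I.frame (bound s) := by
  obtain ⟨⟨h1, h2⟩, -⟩ := h
  simp only [realFrame, Problem.frame, h1 0 (by decide), h1 1 (by decide), h1 2 (by decide),
    h2 0 (by decide), h2 1 (by decide), h2 2 (by decide), h2 3 (by decide), h2 4 (by decide),
    h2 5 (by decide), h2 6 (by decide)]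
  rfl

theorem place_lt {M p q k : ℕ} (hp : p < M) (hq : q < M) (hk : k < M) :
    Nat.pair (Nat.pair p q) k < M ^ 4 := by
  have h1 := pair_lt hp hq
  have h2 : k < M ^ 2 := hk.trans_le (Nat.le_self_pow (by decide) _)
  exact (pair_lt h1 h2).trans_eq (by ring)

theorem Base.place_lt (h : Base I s) {p q k : ℕ} (hp : p < 7 * I.inputBound)
    (hq : q < 7 * I.inputBound) (hk : k < 7 * I.inputBound) :
    Nat.pair (Nat.pair p q) k < s.nat params 1 := by
  rw [h.2.2.1]; exact Machine.place_lt hp hq hk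

/-- Halving the distance to `p` repeatedly gives a closed form, valid as long as the cell lies
within the filled range. -/
theorem Base.spread_eq (h : Base I s) {p q : ℕ} (hp : p < 7 * I.inputBound)
    (hq : q < 7 * I.inputBound) : ∀ k < 7 * I.inputBound,
    s.real 10 (Nat.pair (Nat.pair p q) k) =
      s.real 11 p + (s.real 11 q - s.real 11 p) / 2 ^ k
  | 0, hk => by
    rw [h.2.2.2.2.1 _ _ ((h.place_lt hp hq hk).trans_le h.le_bound), pow_zero, div_one]; ring
  | k + 1, hk => by
    rw [h.2.2.2.2.2 _ _ _ ((h.place_lt hp hq hk).trans_le h.le_bound),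
      h.spread_eq hp hq k (by omega), pow_succ]
    field_simp
    ring

theorem input_real_zero (I : Problem) {b r : ℕ} (hr : I.inputBound ≤ r) : I.input.real b r = 0 := by
  have h1 : ¬ r < I.n := by simp only [Problem.inputBound] at hr; omega
  have h2 : I.obstacles.flatten.length ≤ r := by simp only [Problem.inputBound] at hr; omega
  have h4 : 4 ≤ r := by simp only [Problem.inputBound] at hr; omega
  have h0 : ∀ l : List ℝ, l.length ≤ r → l.getD r 0 = 0 := fun l hl => by
    rw [List.getD_eq_getElem?_getD, List.getElem?_eq_none hl]; rfl
  rcases b with _ | _ | _ | _ | _ | _ | _ | b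
  · exact h0 _ h4
  · exact dif_neg h1
  · exact dif_neg h1
  · exact dif_neg h1
  · exact dif_neg h1
  · exact h0 _ ((List.length_map _).trans_le h2)
  · exact h0 _ ((List.length_map _).trans_le h2)
  · rfl

theorem Base.real_place (h : Base I s) {b r : ℕ} (hb : b < 7) (hr : r < I.inputBound) :
    s.real 10 (Nat.pair (Nat.pair 0 (7 * r + b)) 0) = I.input.real b r := by
  rw [h.spread_eq (by omega) (by omega) 0 (by omega), pow_zero, div_one,
    ← h.2.2.2.1 b hb r hr]
  ring

/-- The numbers in the input have been collected. -/
theorem Base.exists_index (h : Base I s) {x : ℝ} (hx : x ∈ inputValues I) :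
    ∃ q < 7 * I.inputBound, s.real 11 q = x := by
  obtain ⟨b, hb, r, rfl⟩ := hx
  by_cases hr : r < I.inputBound
  · exact ⟨7 * r + b, by omega, h.2.2.2.1 b hb r hr⟩
  · have h4 : 4 < I.inputBound := by simp only [Problem.inputBound]; omega
    -- Cells beyond the data contain 0, and so does the fifth cell of the rectangle's array, which
    -- has been collected.
    refine ⟨7 * 4 + 0, by omega, ?_⟩
    rw [h.2.2.2.1 0 (by omega) 4 h4, input_real_zero I (not_lt.1 hr)]
    rfl

theorem Base.input_subset (h : Base I s) : inputValues I ⊆ values s := by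
  intro x hx
  obtain ⟨q, hq, rfl⟩ := h.exists_index hx
  refine ⟨_, h.place_lt hq hq (by omega : 0 < 7 * I.inputBound), ?_⟩
  rw [h.spread_eq hq hq 0 (by omega)]
  ring

theorem within_inputValues (I : Problem) (N : ℕ) : (I.frame N).Within (inputValues I) where
  rim i _ := ⟨0, by decide, i, rfl⟩
  sx i _ := ⟨1, by decide, i, rfl⟩
  sy i _ := ⟨2, by decide, i, rfl⟩
  lo i _ := ⟨3, by decide, i, rfl⟩
  hi i _ := ⟨4, by decide, i, rfl⟩
  ox _ _ _ _ := ⟨5, by decide, _, rfl⟩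
  oy _ _ _ _ := ⟨6, by decide, _, rfl⟩

theorem _root_.BoundaryLabeling.Frame.Within.mono {α : Type*} {F : Frame α} {S S' : Set α}
    (h : F.Within S) (hS : S ⊆ S') : F.Within S' where
  rim i hi := hS (h.rim i hi)
  sx i hi := hS (h.sx i hi)
  sy i hi := hS (h.sy i hi)
  lo i hi := hS (h.lo i hi)
  hi i hi := hS (h.hi i hi)
  ox o ho k hk := hS (h.ox o ho k hk)
  oy o ho k hk := hS (h.oy o ho k hk)

theorem Base.within (h : Base I s) : (I.frame (bound s)).Within (values s) :=
  (within_inputValues I _).mono h.input_subset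

variable (po : Prop)

theorem Base.coding_F (h : Base I s) : (coding po s).F = (I.frame (bound s)).map (rank s) := by
  rw [← h.realFrame_eq]; rfl

/-- The inequalities of the instance pass to ranks, since all input numbers occur among the
candidate coordinates. -/
theorem Base.isProper (h : Base I s) : (coding po s).IsProper := by
  have hle := rank_le h.le_bound
  have lt : ∀ {a b}, a ∈ inputValues I → b ∈ inputValues I → a < b → rank s a < rank s b :=
    fun ha hb hab => not_le.1 fun hn =>
      not_le.2 hab ((h.le_rank _ (h.input_subset hb) _ (h.input_subset ha)).1 hn)
  have hw := within_inputValues I (bound s)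
  obtain ⟨r0, r1, r2, r3⟩ := I.frame_rim (bound s)
  refine ⟨?_, fun c => hle _, fun c => hle _, ?_, ?_, ?_, ?_⟩
  · exact ⟨fun _ _ => hle _, fun _ _ => hle _, fun _ _ => hle _, fun _ _ => hle _,
      fun _ _ => hle _, fun _ _ _ _ => hle _, fun _ _ _ _ => hle _⟩
  · rw [h.coding_F]
    intro j hj
    have := I.frame_side (bound s) ⟨j, hj⟩
    simp only [Frame.map] at hj ⊢
    rw [this]
    cases I.side ⟨j, hj⟩ <;> simp [Side.code]
  · rw [h.coding_F]
    intro i hi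
    have hs := (I.site_mem ⟨i, hi⟩).1
    have e := (I.frame_site (bound s) ⟨i, hi⟩).1
    refine ⟨lt (hw.rim 0 (by decide)) (hw.sx i hi) ?_, lt (hw.sx i hi) (hw.rim 1 (by decide)) ?_⟩
    · rw [r0, e]; exact hs.1
    · rw [r1, e]; exact hs.2
  · rw [h.coding_F]
    intro i hi
    have hs := (I.site_mem ⟨i, hi⟩).2
    have e := (I.frame_site (bound s) ⟨i, hi⟩).2
    refine ⟨lt (hw.rim 2 (by decide)) (hw.sy i hi) ?_, lt (hw.sy i hi) (hw.rim 3 (by decide)) ?_⟩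
    · rw [r2, e]; exact hs.1
    · rw [r3, e]; exact hs.2
  · rw [h.coding_F]
    intro j hj k hk hne hside
    have hside' : I.side ⟨j, hj⟩ = I.side ⟨k, hk⟩ := by
      have h1 := I.frame_side (bound s) ⟨j, hj⟩
      have h2 := I.frame_side (bound s) ⟨k, hk⟩
      simp only [Frame.map] at hside
      rw [hside, h2] at h1
      revert h1
      cases I.side ⟨j, hj⟩ <;> cases I.side ⟨k, hk⟩ <;> simp [Side.code]
    have key := I.intervals_disjoint ⟨j, hj⟩ ⟨k, hk⟩ (fun e => hne (congrArg Fin.val e)) hside'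
    rw [← (I.frame_ends (bound s) ⟨j, hj⟩).1, ← (I.frame_ends (bound s) ⟨j, hj⟩).2,
      ← (I.frame_ends (bound s) ⟨k, hk⟩).1, ← (I.frame_ends (bound s) ⟨k, hk⟩).2] at key
    exact key.imp
      (h.le_rank _ (h.input_subset (hw.hi j hj)) _ (h.input_subset (hw.lo k hk))).2
      (h.le_rank _ (h.input_subset (hw.hi k hk)) _ (h.input_subset (hw.lo j hj))).2

/-- The places of the coordinates of a route, and the coordinates. -/
def portPlace (s : State) (c : ℕ) : ℕ := fs (bound s) (sn (bound s) c)

def midPlace (s : State) (c : ℕ) : ℕ := sn (bound s) (sn (bound s) c)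

def portValue (s : State) (c : ℕ) : ℝ := s.real 10 (portPlace s c)

def midValue (s : State) (c : ℕ) : ℝ := s.real 10 (midPlace s c)

theorem Base.valid_iff (h : Base I s) {c : ℕ} (hi : (coding po s).site c < I.n)
    (hj : (coding po s).label c < I.n) (hu : portPlace s c < s.nat params 1)
    (hw : midPlace s c < s.nat params 1) :
    (coding po s).Valid c ↔ (I.frame (bound s)).Valid po ((coding po s).site c)
      ((coding po s).label c) (portValue s c) (midValue s c) := by
  rw [Coding.Valid, h.coding_F]
  exact Frame.valid_map h.within h.le_rank hi hj ⟨_, hu, rfl⟩ ⟨_, hw, rfl⟩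

/-- The ends of the range of legal routes. -/
theorem Base.valid_spec (h : Base I s) {c : ℕ} (hv : (coding po s).Valid c) :
    (coding po s).site c < I.n ∧ (coding po s).label c < I.n ∧
      portPlace s c < s.nat params 1 ∧ midPlace s c < s.nat params 1 := by
  have hi : (coding po s).site c < I.n := by
    have := hv.1.1; rwa [h.coding_F] at this
  have hj : (coding po s).label c < I.n := by
    have := hv.1.2.1; rwa [h.coding_F] at this
  refine ⟨hi, hj, ?_⟩
  by_contra hn
  have e : (coding po s).site c = s.nat 0 0 := pick_neg hn _ _
  rw [e, h.1.1 0 (by decide)] at hi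
  exact lt_irrefl _ hi

theorem Base.bends_eq (h : Base I s) {c : ℕ} (hv : (coding po s).Valid c) :
    (coding po s).bends c = (I.frame (bound s)).bends ((coding po s).site c)
      ((coding po s).label c) (portValue s c) (midValue s c) := by
  obtain ⟨hi, -, hu, hw⟩ := h.valid_spec po hv
  rw [Coding.bends, h.coding_F]
  exact Frame.bends_map h.within h.le_rank hi ⟨_, hu, rfl⟩ ⟨_, hw, rfl⟩

theorem Base.legsMeet_iff (h : Base I s) {c d : ℕ} (hc : (coding po s).Valid c)
    (hd : (coding po s).Valid d) (k l : ℕ) :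
    (coding po s).F.LegsMeet k ((coding po s).site c) ((coding po s).label c)
      ((coding po s).port c) ((coding po s).mid c) l ((coding po s).site d)
      ((coding po s).label d) ((coding po s).port d) ((coding po s).mid d) ↔
    (I.frame (bound s)).LegsMeet k ((coding po s).site c) ((coding po s).label c) (portValue s c)
      (midValue s c) l ((coding po s).site d) ((coding po s).label d) (portValue s d)
      (midValue s d) := by
  obtain ⟨hi, -, hu, hw⟩ := h.valid_spec po hc
  obtain ⟨hi', -, hu', hw'⟩ := h.valid_spec po hd
  rw [h.coding_F]
  exact Frame.legsMeet_map h.within h.le_rank hi hi' ⟨_, hu, rfl⟩ ⟨_, hw, rfl⟩ ⟨_, hu', rfl⟩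
    ⟨_, hw', rfl⟩

/-- The vertices of the route `c`. -/
def path (s : State) (I : Problem) (c : ℕ) : List Point :=
  (I.frame (bound s)).route ((coding po s).site c) ((coding po s).label c) (portValue s c)
    (midValue s c)

/-- The combinatorial relation computed on ranks and outside the rectangle is the geometric one:
continuations add no contacts, and ranks preserve the contacts of legs. -/
theorem Base.touch_iff (h : Base I s) {c d : ℕ} (hc : (coding po s).Valid c)
    (hd : (coding po s).Valid d) :
    ¬ (coding po s).Touch c d ↔ Disjoint (trace (path po s I c)) (trace (path po s I d)) := by
  obtain ⟨hi, hj, hu, hw⟩ := h.valid_spec po hc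
  obtain ⟨hi', hj', hu', hw'⟩ := h.valid_spec po hd
  have v := ((h.valid_iff po hi hj hu hw).1 hc).1.2.2.2.2.2.2.2.2.1
  have v' := ((h.valid_iff po hi' hj' hu' hw').1 hd).1.2.2.2.2.2.2.2.2.1
  rw [path, path, Frame.disjoint_trace_route v v']
  constructor
  · intro ht k hk l hl
    rw [← h.legsMeet_iff po hc hd]
    exact Coding.not_legsMeet ht hk hl
  · intro hl
    refine Coding.not_touch (h.isProper po) hc hd fun k hk l hl' => ?_
    rw [h.legsMeet_iff po hc hd]
    exact hl k hk l hl'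

end Machine

end BoundaryLabeling

end

/-! ### Moving arbitrary coordinates to candidate coordinates -/

noncomputable section

namespace BoundaryLabeling

open Machine (pick pick_pos pick_neg)

/-- The points of `B` can be moved to points that arise from points of `P` by bisection, such that
the order is preserved. -/
theorem exists_bisection (P B : Finset ℝ) (hB : ∀ v ∈ B, (∃ p ∈ P, p < v) ∧ ∃ q ∈ P, v < q) :
    ∃ φ : ℝ → ℝ, (∀ v ∈ P, φ v = v) ∧
      (∀ v ∈ B, v ∉ P → ∃ p ∈ P, ∃ q ∈ P, ∃ k ≤ B.card, φ v = p + (q - p) / 2 ^ k) ∧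
      ∀ a b, (a ∈ P ∨ a ∈ B) → (b ∈ P ∨ b ∈ B) → a < b → φ a < φ b := by
  classical
  have hlow : ∀ v, ∃ p, v ∈ B → p ∈ P ∧ p < v ∧ ∀ p' ∈ P, p' < v → p' ≤ p := by
    intro v
    by_cases hv : v ∈ B
    · obtain ⟨p, h1, h2⟩ := (hB v hv).1
      obtain ⟨m, h3, h4⟩ := Finset.exists_max_image (P.filter (· < v)) id
        ⟨p, Finset.mem_filter.2 ⟨h1, h2⟩⟩
      rw [Finset.mem_filter] at h3
      exact ⟨m, fun _ => ⟨h3.1, h3.2, fun p' h5 h6 => h4 p' (Finset.mem_filter.2 ⟨h5, h6⟩)⟩⟩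
    · exact ⟨0, fun h => absurd h hv⟩
  have hupp : ∀ v, ∃ q, v ∈ B → q ∈ P ∧ v < q ∧ ∀ q' ∈ P, v < q' → q ≤ q' := by
    intro v
    by_cases hv : v ∈ B
    · obtain ⟨p, h1, h2⟩ := (hB v hv).2
      obtain ⟨m, h3, h4⟩ := Finset.exists_min_image (P.filter (v < ·)) id
        ⟨p, Finset.mem_filter.2 ⟨h1, h2⟩⟩
      rw [Finset.mem_filter] at h3
      exact ⟨m, fun _ => ⟨h3.1, h3.2, fun p' h5 h6 => h4 p' (Finset.mem_filter.2 ⟨h5, h6⟩)⟩⟩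
    · exact ⟨0, fun h => absurd h hv⟩
  choose lo hlo using hlow
  choose up hup using hupp
  -- The exponent counts the elements of `B` not below `v`: larger elements get smaller exponents
  -- and hence larger images within the same gap, and no exponent exceeds the size of `B`.
  set K : ℝ → ℕ := fun v => (B.filter (v ≤ ·)).card with hK
  have Kpos : ∀ v ∈ B, 1 ≤ K v := fun v hv =>
    Finset.card_pos.2 ⟨v, Finset.mem_filter.2 ⟨hv, le_rfl⟩⟩
  have Klt : ∀ v ∈ B, ∀ v', v < v' → K v' < K v := by
    intro v hv v' h
    refine Finset.card_lt_card ((Finset.ssubset_iff_of_subset fun x hx => ?_).2 ⟨v, ?_, ?_⟩)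
    · rw [Finset.mem_filter] at hx ⊢; exact ⟨hx.1, h.le.trans hx.2⟩
    · exact Finset.mem_filter.2 ⟨hv, le_rfl⟩
    · rw [Finset.mem_filter]; exact fun hx => not_le.2 h hx.2
  set φ : ℝ → ℝ := fun v => if v ∈ P then v else lo v + (up v - lo v) / 2 ^ K v with hφ
  have bounds : ∀ v ∈ B, v ∉ P → lo v < φ v ∧ φ v < up v := by
    intro v hv hn
    have h1 := (hlo v hv).2.1.trans (hup v hv).2.1
    have h2 : (1 : ℝ) < 2 ^ K v := one_lt_pow₀ one_lt_two (by have := Kpos v hv; omega)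
    have h3 : (up v - lo v) / 2 ^ K v < up v - lo v := div_lt_self (by linarith) h2
    have h4 : 0 < (up v - lo v) / 2 ^ K v := div_pos (by linarith) (by positivity)
    simp only [hφ, if_neg hn]
    constructor <;> linarith
  refine ⟨φ, fun v hv => if_pos hv, fun v hv hn =>
    ⟨lo v, (hlo v hv).1, up v, (hup v hv).1, K v, Finset.card_filter_le _ _, if_neg hn⟩, ?_⟩
  intro a b ha hb hab
  by_cases haP : a ∈ P
  · have ea : φ a = a := if_pos haP
    by_cases hbP : b ∈ P
    · have eb : φ b = b := if_pos hbP
      rw [ea, eb]; exact hab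
    · have hb := hb.resolve_left hbP
      rw [ea]
      exact ((hlo b hb).2.2 a haP hab).trans_lt (bounds b hb hbP).1
  · have ha := ha.resolve_left haP
    by_cases hbP : b ∈ P
    · have eb : φ b = b := if_pos hbP
      rw [eb]
      exact (bounds a ha haP).2.trans_le ((hup a ha).2.2 b hbP hab)
    · have hb := hb.resolve_left hbP
      -- If a point of `P` separates `a` and `b`, their images stay on different sides of it.
      -- Otherwise both lie in the same gap of `P` and the exponents decide.
      by_cases hsep : ∃ p ∈ P, a < p ∧ p < b
      · obtain ⟨p, h1, h2, h3⟩ := hsep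
        exact (bounds a ha haP).2.trans_le (((hup a ha).2.2 p h1 h2).trans
          (((hlo b hb).2.2 p h1 h3).trans (bounds b hb hbP).1.le))
      · push Not at hsep
        have e1 : lo a = lo b := by
          refine le_antisymm ((hlo b hb).2.2 _ (hlo a ha).1 ((hlo a ha).2.1.trans hab)) ?_
          refine (hlo a ha).2.2 _ (hlo b hb).1 (lt_of_not_ge fun h => ?_)
          have hne : a ≠ lo b := fun h => haP (h ▸ (hlo b hb).1)
          exact not_lt.2 (hsep _ (hlo b hb).1 (lt_of_le_of_ne h hne)) (hlo b hb).2.1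
        have e2 : up a = up b := by
          refine le_antisymm ((hup a ha).2.2 _ (hup b hb).1 (hab.trans (hup b hb).2.1)) ?_
          refine (hup b hb).2.2 _ (hup a ha).1 ?_
          have hne : up a ≠ b := fun h => hbP (h ▸ (hup a ha).1)
          exact lt_of_le_of_ne (hsep _ (hup a ha).1 (hup a ha).2.1) hne.symm
        have h1 := (hlo b hb).2.1.trans (hup b hb).2.1
        simp only [hφ, if_neg haP, if_neg hbP, e1, e2]
        have : (up b - lo b) / 2 ^ K a < (up b - lo b) / 2 ^ K b :=
          div_lt_div_of_pos_left (by linarith) (by positivity)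
            (pow_lt_pow_right₀ one_lt_two (Klt a ha b hab))
        linarith

namespace Machine

variable {I : Problem} {s : State}

/-- The move fixes all input numbers, so transport along it changes only the routes and not the
instance. -/
theorem frame_map_eq {φ : ℝ → ℝ} (hφ : ∀ x ∈ inputValues I, φ x = x) (N : ℕ) :
    (I.frame N).map φ = I.frame N := by
  have e : ∀ b < 7, (fun r => φ (I.input.real b r)) = I.input.real b := fun b hb =>
    funext fun r => hφ _ ⟨b, hb, r, rfl⟩
  simp only [Frame.map, Problem.frame, e 0 (by decide), e 1 (by decide), e 2 (by decide),
    e 3 (by decide), e 4 (by decide), e 5 (by decide), e 6 (by decide)]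

/-- The coordinates of finitely many routes can be moved to the available coordinates. -/
theorem Base.exists_snap (h : Base I s) (B : Finset ℝ) (hcard : B.card < 7 * I.inputBound)
    (hB : ∀ v ∈ B, (∃ p ∈ inputValues I, p < v) ∧ ∃ q ∈ inputValues I, v < q) :
    ∃ φ : ℝ → ℝ, (∀ x ∈ inputValues I, φ x = x) ∧ (∀ v ∈ B, φ v ∈ values s) ∧
      ∀ a ∈ inputValues I ∪ ↑B, ∀ b ∈ inputValues I ∪ ↑B, φ a ≤ φ b ↔ a ≤ b := by
  classical
  set P : Finset ℝ := (Finset.range (7 * I.inputBound)).image (s.real 11) with hP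
  have sub : ∀ x ∈ inputValues I, x ∈ P := by
    intro x hx
    obtain ⟨q, hq, rfl⟩ := h.exists_index hx
    exact Finset.mem_image_of_mem _ (Finset.mem_range.2 hq)
  obtain ⟨φ, h1, h2, h3⟩ := exists_bisection P B fun v hv =>
    ⟨(hB v hv).1.imp fun p hp => ⟨sub p hp.1, hp.2⟩, (hB v hv).2.imp fun p hp => ⟨sub p hp.1, hp.2⟩⟩
  refine ⟨φ, fun x hx => h1 x (sub x hx), fun v hv => ?_, fun a ha b hb => ?_⟩
  · by_cases hv' : v ∈ P
    · rw [h1 v hv']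
      obtain ⟨q, hq, rfl⟩ := Finset.mem_image.1 hv'
      rw [Finset.mem_range] at hq
      refine ⟨_, h.place_lt hq hq (by omega : 0 < 7 * I.inputBound), ?_⟩
      rw [h.spread_eq hq hq 0 (by omega)]
      ring
    · obtain ⟨p, hp, q, hq, k, hk, e⟩ := h2 v hv hv'
      obtain ⟨p, hp', rfl⟩ := Finset.mem_image.1 hp
      obtain ⟨q, hq', rfl⟩ := Finset.mem_image.1 hq
      rw [Finset.mem_range] at hp' hq'
      exact ⟨_, h.place_lt hp' hq' (hk.trans_lt hcard), by rw [h.spread_eq hp' hq' k (by omega), e]⟩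
  · have ha' : a ∈ P ∨ a ∈ B := ha.imp (sub a) id
    have hb' : b ∈ P ∨ b ∈ B := hb.imp (sub b) id
    constructor
    · intro hle
      by_contra hn
      exact absurd (h3 b a hb' ha' (not_le.1 hn)) (not_lt.2 hle)
    · intro hle
      rcases hle.eq_or_lt with rfl | hlt
      · exact le_rfl
      · exact (h3 a b ha' hb' hlt).le

/-- The code of a route. -/
def code (i j a b : ℕ) : ℕ := Nat.pair (Nat.pair i j) (Nat.pair a b)

theorem code_lt {i j a b L : ℕ} (hi : i < L) (hj : j < L) (ha : a < L) (hb : b < L) :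
    code i j a b < L ^ 4 := by
  exact (pair_lt (pair_lt hi hj) (pair_lt ha hb)).trans_eq (by ring)

variable (po : Prop)

theorem code_spec {i j a b : ℕ} (h : code i j a b < bound s) :
    fs (bound s) (fs (bound s) (code i j a b)) = i ∧ (coding po s).label (code i j a b) = j ∧
      portPlace s (code i j a b) = a ∧ midPlace s (code i j a b) = b := by
  have h1 : Nat.pair i j < bound s := (Nat.left_le_pair _ _).trans_lt h
  have h2 : Nat.pair a b < bound s := (Nat.right_le_pair _ _).trans_lt h
  have e1 : fs (bound s) (code i j a b) = Nat.pair i j := fs_pair h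
  have e2 : sn (bound s) (code i j a b) = Nat.pair a b := sn_pair h
  refine ⟨by rw [e1, fs_pair h1], ?_, ?_, ?_⟩
  · change sn (bound s) (fs (bound s) _) = j
    rw [e1, sn_pair h1]
  · rw [portPlace, e2, fs_pair h2]
  · rw [midPlace, e2, sn_pair h2]

theorem pow_le_codeBound (I : Problem) : I.digitBound ^ 4 ≤ I.codeBound :=
  Nat.pow_le_pow_right (by simp only [Problem.digitBound]; omega) (by decide)


end Machine

end BoundaryLabeling

end

/-! ### Every feasible labeling is matched by a selection in the table -/

noncomputable section

namespace BoundaryLabeling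

open Machine (pick pick_pos pick_neg)

namespace Frame

theorem route_getElem {F : Frame ℝ} (i j : ℕ) (u w : ℝ) {k : ℕ}
    (hk : k < (F.route i j u w).length) : (F.route i j u w)[k] =
      F.pt j (pick (k = 0 ∨ k = 1 ∧ F.bends i j u w + 2 = 4) (F.along i j) u)
        (pick (k = 0) (F.across i j) (pick (k + 1 = F.bends i j u w + 2) (F.goal j) w)) := by
  have hk' := hk
  rw [route_length] at hk'
  by_cases hu : u = F.along i j
  · have hb : F.bends i j u w = 0 := pick_pos hu _ _
    rw [hb] at hk' ⊢
    simp only [route, pick_pos hu]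
    rcases (by omega : k = 0 ∨ k = 1) with rfl | rfl <;> simp [pick]
  · by_cases hw : w = F.across i j
    · have hb : F.bends i j u w = 1 := by rw [bends, pick_neg hu, pick_pos hw]
      rw [hb] at hk' ⊢
      simp only [route, pick_neg hu, pick_pos hw]
      rcases (by omega : k = 0 ∨ k = 1 ∨ k = 2) with rfl | rfl | rfl <;> simp [pick]
    · have hb : F.bends i j u w = 2 := by rw [bends, pick_neg hu, pick_neg hw]
      rw [hb] at hk' ⊢
      simp only [route, pick_neg hu, pick_neg hw]
      rcases (by omega : k = 0 ∨ k = 1 ∨ k = 2 ∨ k = 3) with rfl | rfl | rfl | rfl <;> simp [pick]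

end Frame

namespace Machine

variable {I : Problem} {s : State} {t : LeaderStyle}

theorem inputBound_le_bound (h : Base I s) : I.inputBound ≤ bound s := by
  have := inputBound_le I
  have := coordBound_le I
  rw [h.2.1]; omega

theorem Base.n_le (h : Base I s) : I.n ≤ bound s :=
  le_trans (by simp only [Problem.inputBound]; omega) (inputBound_le_bound h)

theorem Base.obstacles_le (h : Base I s) : I.obstacles.length ≤ bound s :=
  le_trans (by simp only [Problem.inputBound]; omega) (inputBound_le_bound h)

theorem Base.obstacle_le (h : Base I s) : ∀ P ∈ I.obstacles, P.length ≤ bound s := by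
  intro P hP
  have h1 := (List.sublist_flatten_of_mem hP).length_le
  exact le_trans (by simp only [Problem.inputBound]; omega) (inputBound_le_bound h)

theorem Base.coding_n (h : Base I s) (po : Prop) : (coding po s).F.n = I.n := by
  rw [h.coding_F]; rfl

theorem site_code (po : Prop) {i j a b : ℕ} (hc : code i j a b < bound s)
    (ha : a < s.nat params 1) (hb : b < s.nat params 1) :
    (coding po s).site (code i j a b) = i := by
  obtain ⟨h1, -, h3, h4⟩ := code_spec po hc
  have : portPlace s (code i j a b) < s.nat params 1 ∧
    midPlace s (code i j a b) < s.nat params 1 := by rw [h3, h4]; exact ⟨ha, hb⟩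
  exact (pick_pos this _ _).trans h1

theorem Base.total_eq (h : Base I s) (po : Prop) (f : ℕ → ℕ) :
    (coding po s).total (bound s) f = ∑ i : Fin I.n, (coding po s).weight (f i) := by
  rw [Coding.total, h.coding_n,
    Fin.sum_univ_eq_sum_range (fun i => (coding po s).weight (f i)) I.n,
    ← Finset.sum_subset (Finset.range_mono h.n_le)]
  · exact Finset.sum_congr rfl fun i hi => pick_pos (Finset.mem_range.1 hi) _ _
  · intro i _ hi
    exact pick_neg (fun hn => hi (Finset.mem_range.2 hn)) _ _

/-- Some subproblem has a selection that weighs at least as much as a given feasible labeling. -/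
theorem Base.exists_le_total (h : Base I s) {L : I.Labeling} (hL : I.IsFeasible t L) :
    ∃ σ < bound s, ∑ i, (I.n + I.n + 1 - bends (L.leader i)) ≤
      (coding (t = .po) s).total (bound s)
        fun i => (coding (t = .po) s).table (bound s) (bound s) (pr (bound s) σ i) := by
  classical
  obtain ⟨hinj, hlead, hdis⟩ := hL
  -- Each leader is a route with port coordinate `u i` and middle coordinate `w i`; these at most `2
  -- * n` numbers are moved to candidate coordinates.
  choose u w hv hr using fun i =>
    I.exists_valid_of_isLeader h.obstacles_le h.obstacle_le (hlead i)
  set F := I.frame (bound s) with hF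
  set K := coding (t = .po) s with hK
  set B : Finset ℝ := Finset.univ.image u ∪ Finset.univ.image w with hB
  have huB : ∀ i, u i ∈ B := fun i =>
    Finset.mem_union_left _ (Finset.mem_image_of_mem _ (Finset.mem_univ i))
  have hwB : ∀ i, w i ∈ B := fun i =>
    Finset.mem_union_right _ (Finset.mem_image_of_mem _ (Finset.mem_univ i))
  have hwin := within_inputValues I (bound s)
  have hcard : B.card < 7 * I.inputBound := by
    have h1 : B.card ≤ _ := Finset.card_union_le _ _
    have h2 := Finset.card_image_le (s := (Finset.univ : Finset (Fin I.n))) (f := u)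
    have h3 := Finset.card_image_le (s := (Finset.univ : Finset (Fin I.n))) (f := w)
    rw [Finset.card_univ, Fintype.card_fin] at h2 h3
    simp only [Problem.inputBound]; omega
  -- The rim supplies input numbers below and above each coordinate, so each one lies in a bounded
  -- gap.
  obtain ⟨φ, hφ1, hφ2, hφ3⟩ := h.exists_snap B hcard (by
    have rim : ∀ (p : Prop) (k l : ℕ), k < 4 → l < 4 → pick p (F.rim k) (F.rim l) ∈ inputValues I :=
      fun p k l hk hl => Frame.pick_mem (fun _ => hwin.rim k hk) (fun _ => hwin.rim l hl)
    intro v hv'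
    rcases Finset.mem_union.1 hv' with hv' | hv' <;> obtain ⟨i, -, rfl⟩ := Finset.mem_image.1 hv'
    · exact ⟨⟨_, rim _ _ _ (by decide) (by decide), (hv i).1.2.2.2.2.1⟩,
        ⟨_, rim _ _ _ (by decide) (by decide), (hv i).1.2.2.2.2.2.1⟩⟩
    · exact ⟨⟨_, rim _ _ _ (by decide) (by decide), (hv i).1.2.2.2.2.2.2.1⟩,
        ⟨_, rim _ _ _ (by decide) (by decide), (hv i).1.2.2.2.2.2.2.2.1⟩⟩)
  have hmap : F.map φ = F := frame_map_eq hφ1 _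
  have hW : F.Within (inputValues I ∪ ↑B) := hwin.mono Set.subset_union_left
  have uS : ∀ i, u i ∈ inputValues I ∪ ↑B := fun i => Or.inr (huB i)
  have wS : ∀ i, w i ∈ inputValues I ∪ ↑B := fun i => Or.inr (hwB i)
  choose a ha ha' using fun i => hφ2 _ (huB i)
  choose b hb hb' using fun i => hφ2 _ (hwB i)
  set c : Fin I.n → ℕ := fun i => code i (L.label i) (a i) (b i) with hc
  have hQ : s.nat params 1 < I.digitBound := by
    rw [h.2.2.1]; simp only [Problem.digitBound]; omega
  have hn : I.n ≤ I.digitBound := by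
    have := inputBound_le I
    simp only [Problem.digitBound, Problem.inputBound] at *; omega
  have hlt : ∀ i, c i < I.digitBound ^ 4 := fun i =>
    code_lt (i.2.trans_le hn) ((L.label i).2.trans_le hn) ((ha i).trans hQ) ((hb i).trans hQ)
  have hlt' : ∀ i, c i < bound s := fun i => by
    rw [h.2.1]; exact (hlt i).trans_le (pow_le_codeBound I)
  have hsite : ∀ i, K.site (c i) = i := fun i => site_code _ (hlt' i) (ha i) (hb i)
  have hspec := fun i => code_spec (t = .po) (hlt' i)
  have hlabel : ∀ i, K.label (c i) = L.label i := fun i => (hspec i).2.1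
  have hport : ∀ i, portValue s (c i) = φ (u i) := fun i => by
    rw [portValue, (hspec i).2.2.1, ha']
  have hmid : ∀ i, midValue s (c i) = φ (w i) := fun i => by
    rw [midValue, (hspec i).2.2.2, hb']
  have hvalid : ∀ i, K.Valid (c i) := by
    intro i
    refine (h.valid_iff _ ((hsite i).trans_lt i.2) ((hlabel i).trans_lt (L.label i).2)
      ((hspec i).2.2.1.trans_lt (ha i)) ((hspec i).2.2.2.trans_lt (hb i))).2 ?_
    have := (Frame.valid_map hW hφ3 (po := t = .po) (i := i) (j := L.label i) i.2 (L.label i).2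
      (uS i) (wS i)).2 (hv i)
    rw [hmap] at this
    rw [hport, hmid]
    change F.Valid _ (K.site (c i)) (K.label (c i)) _ _
    rw [hsite, hlabel]
    exact this
  have hbends : ∀ i, K.bends (c i) = bends (L.leader i) := by
    intro i
    have := Frame.bends_map hW hφ3 (i := i) (j := L.label i) i.2 (uS i) (wS i)
    rw [hmap] at this
    rw [h.bends_eq _ (hvalid i), hport, hmid, hr i, bends, Frame.route_length, Nat.add_sub_cancel,
      ← this]
    change F.bends (K.site (c i)) (K.label (c i)) _ _ = _
    rw [hsite, hlabel]
  have htouch : ∀ i i', i ≠ i' → ¬ K.Touch (c i) (c i') := by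
    intro i i' hne
    refine Coding.not_touch (h.isProper _) (hvalid i) (hvalid i') fun k hk l hl => ?_
    rw [h.legsMeet_iff _ (hvalid i) (hvalid i'), hport, hport, hmid, hmid]
    change ¬ F.LegsMeet k (K.site (c i)) (K.label (c i)) _ _ l (K.site (c i')) (K.label (c i')) _ _
    rw [hsite, hlabel, hsite, hlabel]
    have e := Frame.legsMeet_map hW hφ3 (m := k) (i := i) (j := L.label i) (m' := l) (i' := i')
      (j' := L.label i') i.2 i'.2 (uS i) (wS i) (uS i') (wS i')
    rw [hmap] at e
    rw [e]
    have hd := hdis i i' hne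
    rw [hr i, hr i'] at hd
    exact (Frame.disjoint_trace_route (hv i).1.2.2.2.2.2.2.2.2.1
      (hv i').1.2.2.2.2.2.2.2.2.1).1 hd k hk l hl
  have cinj : Function.Injective c := fun i i' e => Fin.ext (by rw [← hsite i, ← hsite i', e])
  have ind : K.IsIndependent (bound s) ↑(Finset.univ.image c) := by
    refine ⟨?_, ?_, ?_⟩
    -- The moved routes form an independent set of codes. Moving changes neither legality nor bends
    -- nor disjointness, so the weight is that of the given labeling.
    · intro x hx
      obtain ⟨i, -, rfl⟩ := Finset.mem_image.1 (Finset.mem_coe.1 hx)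
      exact ⟨hlt' i, hvalid i⟩
    · intro x hx y hy hne
      obtain ⟨i, -, rfl⟩ := Finset.mem_image.1 (Finset.mem_coe.1 hx)
      obtain ⟨i', -, rfl⟩ := Finset.mem_image.1 (Finset.mem_coe.1 hy)
      rw [hlabel, hlabel]
      exact fun e => hne (congrArg c (hinj (Fin.ext e)))
    · intro x hx y hy hne
      obtain ⟨i, -, rfl⟩ := Finset.mem_image.1 (Finset.mem_coe.1 hx)
      obtain ⟨i', -, rfl⟩ := Finset.mem_image.1 (Finset.mem_coe.1 hy)
      rw [K.disjoint_iff]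
      exact htouch i i' fun e => hne (congrArg c e)
  obtain ⟨σ, hσ, hle⟩ := Coding.exists_weight_le_total (h.isProper (t = .po)) ind
    (L := I.digitBound) (k := bound s)
    (by
      change 4 * s.nat params 1 + 8 ≤ _
      rw [h.2.2.1]; simp only [Problem.digitBound]; omega)
    (by rw [h.coding_n]; exact hn) (by rw [h.2.1]; exact le_rfl)
    (fun x hx => by
      obtain ⟨i, -, rfl⟩ := Finset.mem_image.1 hx
      exact hlt i)
    -- The invalid code refers to the first place beyond the list of candidate coordinates.
    ⟨code 0 0 (s.nat params 1) 0, code_lt (by omega) (by omega) hQ (by omega), fun hbad => by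
      have hl : code 0 0 (s.nat params 1) 0 < bound s := by
        rw [h.2.1]
        exact (code_lt (by omega) (by omega) hQ (by omega)).trans_le (pow_le_codeBound I)
      have := (h.valid_spec _ hbad).2.2.1
      rw [(code_spec (t = .po) hl).2.2.1] at this
      exact lt_irrefl _ this⟩
    (by
      refine Finset.card_image_le.trans ?_
      rw [Finset.card_univ, Fintype.card_fin]
      exact h.n_le)
  refine ⟨σ, hσ, le_trans (le_of_eq ?_) hle⟩
  rw [Finset.sum_image fun i _ i' _ e => cinj e]
  refine Finset.sum_congr rfl fun i _ => ?_
  change _ = K.weight (c i + 1)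
  rw [Coding.weight, pick_neg (Nat.succ_ne_zero _), Nat.add_sub_cancel, hbends, h.coding_n]

end Machine

end BoundaryLabeling

end

/-! ### Optimality of the result, correctness of the output, and running time -/

noncomputable section

namespace BoundaryLabeling

open Machine (pick pick_pos pick_neg)

theorem Problem.IsFeasible.bends_le {I : Problem} {t : LeaderStyle} {L : I.Labeling}
    (h : I.IsFeasible t L) (i : Fin I.n) : bends (L.leader i) ≤ 2 :=
  (h.2.1 i).2.1.trans (by cases t <;> decide)

namespace Machine

variable {I : Problem} {s : State} {t : LeaderStyle}

/-- The selection finally chosen is the heaviest over all subproblem codes, in particular at least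
as heavy as the one matching `L`. -/
theorem Chosen.le_gain (h : Chosen (t = .po) I s) {L : I.Labeling} (hL : I.IsFeasible t L) :
    ∑ i, (I.n + I.n + 1 - bends (L.leader i)) ≤
      ∑ i : Fin I.n, (coding (t = .po) s).weight (choice s i) := by
  obtain ⟨σ, hσ, hle⟩ := h.1.1.exists_le_total hL
  rw [← h.1.2] at hle
  have := hle.trans (h.2.2 σ hσ)
  rwa [gain, h.1.1.total_eq] at this

theorem Chosen.choice_spec {po : Prop} (h : Chosen po I s) {i : ℕ} (hi : i < I.n)
    (h0 : choice s i ≠ 0) :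
    (coding po s).site (choice s i - 1) = i ∧ (coding po s).Valid (choice s i - 1) ∧
      ∀ j < I.n, choice s j ≠ 0 → i ≠ j →
        ¬ (coding po s).Conf (choice s i - 1) (choice s j - 1) := by
  have hs : (coding po s).Sound (bound s) (s.nat 13) := by
    rw [h.1.2]; exact Coding.sound_table _
  have hn := h.1.1.n_le
  obtain ⟨⟨h1, h2⟩, h3⟩ := hs _ h.2.1 i (hi.trans_le hn) h0
  exact ⟨h1, h2.2.1, fun j hj => h3 j (hj.trans_le hn)⟩

theorem Chosen.weight_le {po : Prop} (h : Chosen po I s) (x : ℕ) :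
    (coding po s).weight x ≤ I.n + I.n + 1 := by
  rw [Coding.weight, h.1.1.coding_n]
  by_cases hx : x = 0
  · rw [pick_pos hx]; omega
  · rw [pick_neg hx]; omega

/-- If there is a feasible labeling, then all sites have been connected. -/
theorem Chosen.success (h : Chosen (t = .po) I s) {L : I.Labeling} (hL : I.IsFeasible t L) :
    Success s := by
  classical
  intro i _ hi h0
  rw [h.1.1.1.1 0 (by decide)] at hi
  change i < I.n at hi
  have hle := h.le_gain hL
  -- With at most two bends per leader a feasible labeling weighs at least `n * (2 * n - 1)`, one
  -- more than the largest weight `(n - 1) * (2 * n + 1)` of a selection that misses a site.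
  have h1 : ∑ _i : Fin I.n, (I.n + I.n - 1) ≤ ∑ i, (I.n + I.n + 1 - bends (L.leader i)) :=
    Finset.sum_le_sum fun i _ => by have := hL.bends_le i; omega
  have h2 : ∑ i : Fin I.n, (coding (t = .po) s).weight (choice s i) ≤
      ∑ _i ∈ (Finset.univ : Finset (Fin I.n)).erase ⟨i, hi⟩, (I.n + I.n + 1) := by
    rw [← Finset.add_sum_erase _ _ (Finset.mem_univ (⟨i, hi⟩ : Fin I.n))]
    have : (coding (t = .po) s).weight (choice s i) = 0 := by rw [h0]; exact pick_pos rfl _ _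
    rw [this, Nat.zero_add]
    exact Finset.sum_le_sum fun i _ => h.weight_le _
  rw [Finset.sum_const, Finset.card_univ, Fintype.card_fin, smul_eq_mul] at h1
  rw [Finset.sum_const, Finset.card_erase_of_mem (Finset.mem_univ _), Finset.card_univ,
    Fintype.card_fin, smul_eq_mul] at h2
  obtain ⟨m, hm⟩ : ∃ m, I.n = m + 1 := ⟨I.n - 1, by omega⟩
  have h3 := h1.trans (hle.trans h2)
  rw [hm, show m + 1 + (m + 1) - 1 = 2 * m + 1 by omega, show m + 1 - 1 = m by omega] at h3
  nlinarith

/-- The labeling that has been found. -/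
theorem Chosen.exists_labeling (h : Chosen (t = .po) I s) (hs : Success s) :
    ∃ L : I.Labeling, I.IsOptimal t L ∧ ∀ i : Fin I.n,
      (L.label i : ℕ) = (coding (t = .po) s).label (choice s i - 1) ∧
      L.leader i = (I.frame (bound s)).route i ((coding (t = .po) s).label (choice s i - 1))
        (portValue s (choice s i - 1)) (midValue s (choice s i - 1)) ∧
      bends (L.leader i) = (coding (t = .po) s).bends (choice s i - 1) := by
  have hB := h.1.1
  set K := coding (t = .po) s with hK
  have h0 : ∀ i : Fin I.n, choice s i ≠ 0 := fun i =>
    hs i (i.2.trans_le hB.n_le) (by rw [hB.1.1 0 (by decide)]; exact i.2)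
  have hspec := fun i : Fin I.n => h.choice_spec i.2 (h0 i)
  have hlab : ∀ i : Fin I.n, K.label (choice s i - 1) < I.n := fun i =>
    (hB.valid_spec _ (hspec i).2.1).2.1
  have hpath : ∀ i : Fin I.n, path (t = .po) s I (choice s i - 1) =
      (I.frame (bound s)).route i (K.label (choice s i - 1))
        (portValue s (choice s i - 1)) (midValue s (choice s i - 1)) := fun i => by
    rw [path, (hspec i).1]
  have hbends : ∀ i : Fin I.n, bends (path (t = .po) s I (choice s i - 1)) =
      K.bends (choice s i - 1) := fun i => by
    rw [hB.bends_eq _ (hspec i).2.1, bends, path, Frame.route_length, Nat.add_sub_cancel]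
  let L : I.Labeling :=
    ⟨fun i => ⟨K.label (choice s i - 1), hlab i⟩, fun i => path (t = .po) s I (choice s i - 1)⟩
  have hL : I.IsFeasible t L := by
    refine ⟨fun i j e => ?_, fun i => ?_, fun i j hne => ?_⟩
    · by_contra hne
      exact (hspec i).2.2 j j.2 (h0 j) (fun e => hne (Fin.ext e))
        ⟨(hspec i).2.1, Or.inl (congrArg Fin.val e)⟩
    · have hv := (hspec i).2.1
      obtain ⟨h1, h2, h3, h4⟩ := hB.valid_spec _ hv
      have hv' := (hB.valid_iff _ h1 h2 h3 h4).1 hv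
      rw [(hspec i).1] at hv'
      change I.IsLeader t i _ (path (t = .po) s I (choice s i - 1))
      rw [hpath]
      exact I.isLeader_route hB.obstacles_le hB.obstacle_le (j := ⟨_, h2⟩) hv'
    · refine (hB.touch_iff _ (hspec i).2.1 (hspec j).2.1).1 fun ht => ?_
      exact (hspec i).2.2 j j.2 (h0 j) (fun e => hne (Fin.ext e)) ⟨(hspec i).2.1, Or.inr ht⟩
  refine ⟨L, ⟨hL, fun L' hL' => ?_⟩, fun i => ⟨rfl, hpath i, hbends i⟩⟩
  have hle := h.le_gain hL'
  have e : ∀ i : Fin I.n, K.weight (choice s i) = I.n + I.n + 1 - bends (L.leader i) := by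
    intro i
    rw [Coding.weight, pick_neg (h0 i), hB.coding_n, ← hbends i]
  -- For complete labelings weight plus number of bends is constant, so the heaviest has the fewest
  -- bends. The bound on bends ensures that the truncated subtraction is exact.
  have comp : ∀ L'' : I.Labeling, I.IsFeasible t L'' →
      ∑ i, (I.n + I.n + 1 - bends (L''.leader i)) + I.totalBends L'' =
        ∑ _i : Fin I.n, (I.n + I.n + 1) := by
    intro L'' h''
    rw [Problem.totalBends, ← Finset.sum_add_distrib]
    refine Finset.sum_congr rfl fun i _ => ?_
    have := h''.bends_le i
    have := i.2
    omega
  have h1 := comp L hL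
  have h2 := comp L' hL'
  rw [Finset.sum_congr rfl fun i _ => e i] at hle
  omega

theorem Base.place_eq (h : Base I s) {b r : ℕ} (hb : b < 7) (hr : r < I.inputBound) :
    s.real 10 (place s b r) = I.input.real b r := by
  have hN := inputBound_le_bound h
  have h1 := inputBound_le I
  have h2 := h.place_lt (p := 0) (q := 7 * r + b) (k := 0) (by omega) (by omega) (by omega)
  have h3 := (Nat.left_le_pair (Nat.pair 0 (7 * r + b)) 0).trans h2.le
  have h4 := (Nat.right_le_pair 0 (7 * r + b)).trans h3
  have h5 := h.le_bound
  rw [place, show r + r + r + r + r + r + r + b = 7 * r + b by omega,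
    pr_eq (Nat.zero_le _) (h4.trans h5), pr_eq (h3.trans h5) (Nat.zero_le _), h.real_place hb hr]

theorem real_pick (b : ℕ) (p : Prop) (x y : ℕ) :
    s.real b (pick p x y) = pick p (s.real b x) (s.real b y) :=
  (Frame.map_pick (s.real b) p x y).symm

/-- The output describes the labeling that has been found. -/
theorem Finished.holds (h : Finished (t = .po) I s) {L : I.Labeling}
    (hL : ∀ i : Fin I.n,
      (L.label i : ℕ) = (coding (t = .po) s).label (choice s i - 1) ∧
      L.leader i = (I.frame (bound s)).route i ((coding (t = .po) s).label (choice s i - 1))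
        (portValue s (choice s i - 1)) (midValue s (choice s i - 1)) ∧
      bends (L.leader i) = (coding (t = .po) s).bends (choice s i - 1)) : I.Holds s L := by
  obtain ⟨⟨hc, -, hn⟩, h7, h8⟩ := h
  have hB := hc.1.1
  intro i
  obtain ⟨h1, h2, h3⟩ := hL i
  obtain ⟨h4, h5⟩ := hn i (i.2.trans_le hB.n_le)
  have hlen : (L.leader i).length = s.nat 5 i := by
    rw [h5, ← h3, bends, h2, Frame.route_length, Nat.add_sub_cancel]
  refine ⟨h4.trans h1.symm, hlen.symm, fun k hk => ?_⟩
  set F := I.frame (bound s) with hF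
  set j := (coding (t = .po) s).label (choice s i - 1) with hj
  set u := portValue s (choice s i - 1) with hu
  set w := midValue s (choice s i - 1) with hw
  have hb : F.bends i j u w + 2 = s.nat 5 i := by rw [← Frame.route_length, ← h2, hlen]
  have hk' : k < (F.route i j u w).length := h2 ▸ hk
  have e : (L.leader i)[k] = (F.route i j u w)[k] := by simp only [h2]
  have hk4 : k < 4 := by
    rw [Frame.route_length, Frame.bends] at hk'
    by_cases c1 : u = F.along i j
    · rw [pick_pos c1] at hk'; omega
    · by_cases c2 : w = F.across i j
      · rw [pick_neg c1, pick_pos c2] at hk'; omega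
      · rw [pick_neg c1, pick_neg c2] at hk'; omega
  have hi : (i : ℕ) < I.inputBound := i.2.trans_le (by simp only [Problem.inputBound]; omega)
  have h4I : 4 < I.inputBound := by simp only [Problem.inputBound]; omega
  have hpair : Nat.pair i k < bound s := by
    refine (Nat.left_le_pair _ 0).trans_lt (lt_of_lt_of_le ?_ hB.le_bound)
    exact hB.place_lt (by omega) (by omega) (by omega)
  have hi0 : (i : ℕ) < s.nat 0 0 := by rw [hB.1.1 0 (by decide)]; exact i.2
  have hU : Up s i ↔ F.Upright j := by
    rw [Up, Frame.Upright, h4, hB.1.1 1 (by decide)]; rfl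
  have al : s.real 10 (cellAlong s i k) =
      pick (k = 0 ∨ k = 1 ∧ F.bends i j u w + 2 = 4) (F.along i j) u := by
    rw [cellAlong, real_pick, real_pick, hB.place_eq (by decide) hi, hB.place_eq (by decide) hi,
      propext hU, hb]
    rfl
  have ac : s.real 10 (cellAcross s i k) = pick (k = 0) (F.across i j)
      (pick (k + 1 = F.bends i j u w + 2) (F.goal j) w) := by
    rw [cellAcross, real_pick, real_pick, real_pick, hB.place_eq (by decide) hi,
      hB.place_eq (by decide) hi, propext hU, hb, h4, hB.1.1 1 (by decide)]
    have g : s.real 10 (place s 0 (pick (I.input.nat 1 j = 0) 2 (pick (I.input.nat 1 j = 1) 3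
        (pick (I.input.nat 1 j = 2) 0 1)))) = F.goal j := by
      have hr : pick (I.input.nat 1 j = 0) 2 (pick (I.input.nat 1 j = 1) 3
        (pick (I.input.nat 1 j = 2) 0 1)) < 4 := by
        simp only [pick]; split_ifs <;> decide
      rw [hB.place_eq (by decide) (hr.trans h4I), Frame.goal]
      simp only [Frame.map_pick]
      rfl
    rw [g]
    rfl
  rw [e, Frame.route_getElem _ _ _ _ hk', ← al, ← ac, h7 i hi0 k hk4 hpair, h8 i hi0 k hk4 hpair,
    cellX, cellY, real_pick, real_pick, propext hU, Frame.pt]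
  by_cases c : F.Upright j
  · simp only [pick_pos c]
  · simp only [pick_neg c]

/-- The size counts vertices and not obstacles, but an obstacle has at least four vertices; so the
number of obstacles, and every bound built on it, is polynomial in the size. -/
theorem codeBound_le (I : Problem) : I.codeBound ≤
    ((10 * (7 * (2 * .X + 5)) ^ 4 + 20) ^ 128 : Polynomial ℕ).eval I.size := by
  have h1 : I.obstacles.length ≤ I.obstacles.flatten.length := by
    rw [List.length_flatten]
    have := List.length_le_sum_of_one_le (I.obstacles.map List.length) (fun k hk => by
      obtain ⟨P, hP, rfl⟩ := List.mem_map.1 hk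
      have := (I.obstacle_polygon P hP).1
      omega)
    rwa [List.length_map] at this
  have h2 : I.inputBound ≤ 2 * I.size + 5 := by
    simp only [Problem.inputBound, Problem.size]; omega
  have h3 : I.digitBound ≤ 10 * (7 * (2 * I.size + 5)) ^ 4 + 20 := by
    have := Nat.pow_le_pow_left (Nat.mul_le_mul_left 7 h2) 4
    simp only [Problem.digitBound, Problem.coordBound]
    omega
  refine (Nat.pow_le_pow_left h3 128).trans (le_of_eq ?_)
  simp only [Polynomial.eval_pow, Polynomial.eval_add, Polynomial.eval_mul, Polynomial.eval_X,
    Polynomial.eval_ofNat]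

end Machine

end BoundaryLabeling

end

theorem theorem4 (t : BoundaryLabeling.LeaderStyle) :
    ∃ (A : BoundaryLabeling.Program) (f : Polynomial ℕ),
      ∀ I : BoundaryLabeling.Problem,
        ∃ (T : ℕ) (s : BoundaryLabeling.State),
          BoundaryLabeling.Exec A I.input T s ∧ T ≤ f.eval I.size ∧
          ((BoundaryLabeling.Problem.answer s = 1 ∧
              ∃ L : I.Labeling, I.IsOptimal t L ∧ I.Holds s L) ∨
            (BoundaryLabeling.Problem.answer s = 0 ∧
              ¬ ∃ L : I.Labeling, I.IsFeasible t L)) := by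
  obtain ⟨p, hp⟩ := BoundaryLabeling.Machine.does_algorithm (t = .po)
  refine ⟨BoundaryLabeling.Machine.algorithm (t = .po),
    p.comp ((10 * (7 * (2 * .X + 5)) ^ 4 + 20) ^ 128), fun I => ?_⟩
  obtain ⟨s, ⟨T, hT, hx⟩, -, hs⟩ := hp I I.input rfl
  refine ⟨T, s, hx, hT.trans ?_, ?_⟩
  -- The time is polynomial in the final bound, which is `codeBound`, and this in turn is polynomial
  -- in the size.
  · rw [Polynomial.eval_comp, hs.1.1.1.1.2.1]
    exact BoundaryLabeling.Machine.eval_mono p (BoundaryLabeling.Machine.codeBound_le I)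
  · have hc := hs.1.1
    have ha : BoundaryLabeling.Problem.answer s = _ := hs.1.2.1
    by_cases h : BoundaryLabeling.Machine.Success s
    · obtain ⟨L, hL, hL'⟩ := hc.exists_labeling h
      exact Or.inl ⟨ha.trans (BoundaryLabeling.Machine.pick_pos h _ _), L, hL, hs.holds hL'⟩
    · refine Or.inr ⟨ha.trans (BoundaryLabeling.Machine.pick_neg h _ _), ?_⟩
      rintro ⟨L, hL⟩
      exact h (hc.success hL)
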